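/- Let $N\ge 2$ and write $\langle v\rangle=\sqrt{1+|v|^2}$. For $q\in\mathbb{R}$ let $\|f\|_{L^1_q}=\int_{\mathbb{R}^N}|f(v)|\langle v\rangle^q\,dv$. For $r\ge 0$ let $\|u\|_{H^r}=\|(1+|2\pi\xi|^2)^{r/2}\hat u(\xi)\|_{L^2_\xi}$, where $\hat u(\xi)=\int_{\mathbb{R}^N} u(v)e^{-2i\pi v\cdot\xi}\,dv$. For $s\ge 0$ and $q\in\mathbb{R}$, with $k=\lfloor s\rfloor$, let $H^s_q=H^s_q(\mathbb{R}^N)$ be the weighted Sobolev space of real-valued functions with norm $$\|f\|_{H^s_q}=\Big(\sum_{|\alpha|\le k}\big\|\langle\cdot\rangle^q\,\partial^\alpha f\big\|_{H^{s-k}}^2\Big)^{1/2},$$ where $\partial^\alpha f$ are weak derivatives; for integer $s$ this is $\big(\sum_{|\alpha|\le s}\int|\partial^\alpha f(v)|^2\langle v\rangle^{2q}\,dv\big)^{1/2}$. Let $\Phi\in C^\infty_0(\mathbb{R}^N\setminus\{0\})$ and $b\in C^\infty_0(-1,1)$ be real-valued, let $B(u,\sigma)=\Phi(u)\,b(\hat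 u\cdot\sigma)$ with $\hat u=u/|u|$, let $e\in(0,1]$ and $\beta=\frac{1+e}{2e}$. The associated inelastic gain operator is $$Q^+(g,f)(v)=\frac1{e^2}\int_{\mathbb{R}^N\times\mathbb{S}^{N-1}} f('v)\,g('v_*)\,B(v-v_*,\sigma)\,d\sigma\,dv_*,$$ where, with $u=v-v_*$ and $'u=(1-\beta)u+\beta|u|\sigma$, the pre-collisional velocities are $'v=\frac{v+v_*}{2}+\frac{'u}{2}$ and $'v_*=\frac{v+v_*}{2}-\frac{'u}{2}$. Then for every $s\ge 0$ there is a constant $C>0$, depending only on $s$, $N$, $\Phi$, $b$ and $e$, such that for all $\eta\ge 0$, all $g\in H^s_\eta$ and all $f\in L^1_{2\eta}$, the integral defining $Q^+(g,f)(v)$ converges absolutely for almost every $v\in\mathbb{R}^N$, $Q^+(g,f)\in H^{s+(N-1)/2}_\eta$, and $$\|Q^+(g,f)\|_{H^{s+(N-1)/2}_\eta}\le C\,\|g\|_{H^s_\eta}\,\|f\|_{L^1_{2\eta}}.$$ -/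

import Mathlib

open MeasureTheory
open scoped ENNReal NNReal ContDiff FourierTransform

namespace InelasticBoltzmann

/-- The velocity space `ℝ^N` with its Euclidean norm. -/
abbrev Vel (N : ℕ) : Type := EuclideanSpace ℝ (Fin N)

/-- The unit sphere `𝕊^{N-1}`; it carries the surface measure `(volume : Measure (Vel N)).toSphere`. -/
abbrev Sph (N : ℕ) : Type := Metric.sphere (0 : Vel N) 1

/-! ### Function spaces -/

/-- The weight `⟨v⟩ = √(1 + |v|²)`. -/
noncomputable def bracket {N : ℕ} (v : Vel N) : ℝ := Real.sqrt (1 + ‖v‖ ^ 2)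

/-- The function `⟨v⟩^q h(v)`. -/
noncomputable def weighted {N : ℕ} (q : ℝ) (h : Vel N → ℝ) : Vel N → ℝ :=
  fun v => bracket v ^ q * h v

/-- Multi-indices `α ∈ ℕ^N` of order `|α| ≤ k`. -/
def multiIndices (N k : ℕ) : Finset (Fin N → ℕ) :=
  (Fintype.piFinset fun _ : Fin N => Finset.range (k + 1)).filter fun α => ∑ i, α i ≤ k

/-- The classical partial derivative `∂φ/∂v_i`. -/
noncomputable def partialDeriv {N : ℕ} (i : Fin N) (φ : Vel N → ℝ) : Vel N → ℝ :=
  fun v => fderiv ℝ φ v (EuclideanSpace.single i 1)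

/-- The classical partial derivative `∂^α φ`. -/
noncomputable def multiDeriv {N : ℕ} (α : Fin N → ℕ) (φ : Vel N → ℝ) : Vel N → ℝ :=
  (List.finRange N).foldr (fun i ψ => (partialDeriv i)^[α i] ψ) φ

/-- `h` is the weak (distributional) derivative `∂^α f`. -/
def IsWeakDeriv {N : ℕ} (α : Fin N → ℕ) (f h : Vel N → ℝ) : Prop :=
  LocallyIntegrable f volume ∧ LocallyIntegrable h volume ∧
    ∀ φ : Vel N → ℝ, ContDiff ℝ ∞ φ → HasCompactSupport φ →
      ∫ v, f v * multiDeriv α φ v = (-1) ^ (∑ i, α i) * ∫ v, h v * φ v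

/-- The unweighted Sobolev norm of order `r`, for `u ∈ L²`, through the Fourier transform:
`‖(1 + |2πξ|²)^{r/2} û(ξ)‖_{L²}`, where `û(ξ) = ∫ u(v) e^{-2iπ v·ξ} dv` is extended to `L²`.
It is `∞` if `u` is not in `L²`. -/
noncomputable def fourierSobolevNorm {N : ℕ} (r : ℝ) (u : Vel N → ℝ) : ℝ≥0∞ :=
  ⨅ hu : MemLp (fun v => (u v : ℂ)) 2 (volume : Measure (Vel N)),
    eLpNorm (fun ξ : Vel N => ((1 + (2 * Real.pi * ‖ξ‖) ^ 2) ^ (r / 2) : ℝ) •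
      (𝓕 (hu.toLp _) : Lp ℂ 2 (volume : Measure (Vel N))) ξ) 2 volume

/-- The norm of the weighted Sobolev space `H^s_q(ℝ^N)`, `s ≥ 0`: with `k = ⌊s⌋`,
`(∑_{|α| ≤ k} ‖⟨v⟩^q ∂^α f‖²_{H^{s-k}})^{1/2}`. For integer `s` this is
`(∑_{|α| ≤ s} ‖∂^α f‖²_{L²_q})^{1/2}`. The infimum is over the families `D` of weak derivatives
of `f` up to order `k`, which are unique up to null sets; so the value is `∞` if one of them does
not exist, and `f ∈ H^s_q` means that the value is finite. -/
noncomputable def sobolevNorm {N : ℕ} (s q : ℝ) (f : Vel N → ℝ) : ℝ≥0∞ :=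
  ⨅ (D : (Fin N → ℕ) → Vel N → ℝ) (_ : ∀ α ∈ multiIndices N ⌊s⌋₊, IsWeakDeriv α f (D α)),
    (∑ α ∈ multiIndices N ⌊s⌋₊,
      fourierSobolevNorm (s - ⌊s⌋₊) (weighted q (D α)) ^ 2) ^ (1 / 2 : ℝ)

/-- `f ∈ H^s_q(ℝ^N)`. -/
def MemSobolevSpace {N : ℕ} (s q : ℝ) (f : Vel N → ℝ) : Prop := sobolevNorm s q f < ⊤

/-- `f ∈ L¹_q(ℝ^N)`. -/
def MemL1 {N : ℕ} (q : ℝ) (f : Vel N → ℝ) : Prop := MemLp (weighted q f) 1 volume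

/-- The norm `‖f‖_{L¹_q} = ∫ |f(v)| ⟨v⟩^q dv`. -/
noncomputable def l1Norm {N : ℕ} (q : ℝ) (f : Vel N → ℝ) : ℝ≥0∞ :=
  eLpNorm (weighted q f) 1 volume

/-! ### The inelastic gain operator -/

/-- `β = (1 + e)/(2e)`, for the restitution coefficient `e`. -/
noncomputable def betaCoeff (e : ℝ) : ℝ := (1 + e) / (2 * e)

/-- The pre-collisional relative velocity `'u = (1 - β) u + β |u| σ`. -/
noncomputable def preRel {N : ℕ} (e : ℝ) (u : Vel N) (σ : Sph N) : Vel N :=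
  (1 - betaCoeff e) • u + (betaCoeff e * ‖u‖) • (σ : Vel N)

/-- The pre-collisional velocity `'v = (v + v_*)/2 + 'u/2`, with `u = v - v_*`. -/
noncomputable def preVel {N : ℕ} (e : ℝ) (v vs : Vel N) (σ : Sph N) : Vel N :=
  (1 / 2 : ℝ) • (v + vs) + (1 / 2 : ℝ) • preRel e (v - vs) σ

/-- The pre-collisional velocity `'v_* = (v + v_*)/2 - 'u/2`, with `u = v - v_*`. -/
noncomputable def preVelStar {N : ℕ} (e : ℝ) (v vs : Vel N) (σ : Sph N) : Vel N :=
  (1 / 2 : ℝ) • (v + vs) - (1 / 2 : ℝ) • preRel e (v - vs) σ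

/-- The collision kernel `B(u, σ) = Φ(u) b(û · σ)`, `û = u/|u|`. -/
noncomputable def collisionKernel {N : ℕ} (Φ : Vel N → ℝ) (b : ℝ → ℝ) (u : Vel N) (σ : Sph N) :
    ℝ :=
  Φ u * b (inner ℝ (‖u‖⁻¹ • u) (σ : Vel N))

/-- The integrand `e⁻² f('v) g('v_*) B(v - v_*, σ)` of the gain operator at `v`, as a function of
`(v_*, σ)`. -/
noncomputable def gainIntegrand {N : ℕ} (e : ℝ) (Φ : Vel N → ℝ) (b : ℝ → ℝ) (g f : Vel N → ℝ)
    (v : Vel N) (p : Vel N × Sph N) : ℝ :=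
  f (preVel e v p.1 p.2) * g (preVelStar e v p.1 p.2) / e ^ 2 *
    collisionKernel Φ b (v - p.1) p.2

/-- The gain operator
`Q⁺(g,f)(v) = ∫_{ℝ^N × 𝕊^{N-1}} e⁻² f('v) g('v_*) B(v - v_*, σ) dσ dv_*`. -/
noncomputable def gain {N : ℕ} (e : ℝ) (Φ : Vel N → ℝ) (b : ℝ → ℝ) (g f : Vel N → ℝ) :
    Vel N → ℝ :=
  fun v => ∫ p, gainIntegrand e Φ b g f v p
    ∂((volume : Measure (Vel N)).prod (volume : Measure (Vel N)).toSphere)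

end InelasticBoltzmann

/-! Write `w = 'v`, `u = v - v_*`, `x = v - 'v`, `y = 'v_* - 'v`, `G = ⟨·⟩^η g`. The map `(v, v_*,
σ) ↦ (w, u, σ)` preserves the measure, so the pairing of `⟨v⟩^η Q⁺(g,f)` with a test function `φ`
equals `∫ f(w) ⟨w⟩^{2η} I_w dw`, where `I_w` is the integral over `(u, σ)` of `e⁻² B exp(η ψ_w(x,y))
G(w+y) φ(w+x)` and `ψ_w = log⟨w+x⟩ - log⟨w+y⟩ - 2 log⟨w⟩`. By duality it suffices to show, uniformly
in `w` and `η`, that `|I_w| ≤ C (1+η)^{-J} ‖G‖_{H^s} ‖φ‖_{H^{-s-(N-1)/2}}`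
(`IsCollAmp.exists_enorm_pairing_le`).

Geometry. The relation `x·y = κ|x|²` holds with `κ = 2 - 1/β ≥ 1`, so for fixed `x` the point `y`
runs over a hyperplane orthogonal to `x`. The Carleman representation (`lintegral_carleman`)
rewrites `du dσ` accordingly. Its density is smooth on the support of `B`, where `x` and `u` stay
away from `0`. Hyperplane integrals are written as integrals over `p` in the whole space, with a
normalized Gaussian in the direction of `x`; after a factor `e^{-π|y|²}` is split off from the
amplitude, this becomes a full Gaussian in `p`.

Smoothing. When the remaining amplitude depends on `x` alone, the pairing tests against `φ` the
function `x ↦ ∫ Ĝ(ξ) c(x) exp(2πiκ x·ξ - π|P_x ξ|²) dξ`, with `P_x` the projection onto `x⊥`. On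
each ray this is a one-dimensional Fourier transform, to which Plancherel applies. Averaging
`exp(-a|P_ϑ ξ|²)` over directions `ϑ` yields `O(⟨ξ⟩^{-(N-1)})`, because only directions nearly
parallel to `ξ` contribute; after a square root this is the gain of `(N-1)/2` derivatives
(`eLpNorm_planeOp_term_le`). Each `x`-derivative costs one power of `ξ`, since factors `P_x ξ` are
absorbed by the Gaussian, and interpolation covers real orders (`hnorm_planeOp_le`). A general
amplitude in `(x,y)` is a superposition of characters, which are moved onto `φ` and `G`; the
polynomial loss is paid by the decay of its Fourier transform (`enorm_integral_amp_pairKernel_le`).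

Uniformity in the weight. On the support of the amplitude `ψ_w ≤ -c < 0` for all `w`
(`exists_amplitude`). For `w` away from `0` this comes from `|v|² ≤ |'v|² + |'v_*|²` and the second
power of `⟨w⟩^η`; for `w` near `0` it comes from `|y| > |x|`. The factor `e^{-cη}` then dominates
the powers of `1+η` produced by differentiating `exp(ηψ_w)`, and also those produced when `H^s_η` is
compared with the Fourier norm of `⟨·⟩^η g` (`hnorm_cweighted_le_sobolevNorm`,
`sobolevNorm_le_hnorm_cweighted`). -/

set_option linter.unusedSectionVars false

namespace InelasticBoltzmann

/-! ### Fourier transform on L², Sobolev norms and their duality -/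

section Toolbox

variable {E : Type*} [NormedAddCommGroup E] [InnerProductSpace ℝ E] [FiniteDimensional ℝ E]
  [MeasurableSpace E] [BorelSpace E]

open scoped SchwartzMap

/-- The weight `1 + |2πξ|²`. -/
noncomputable def jb (ξ : E) : ℝ := 1 + (2 * Real.pi * ‖ξ‖) ^ 2

lemma one_le_jb (ξ : E) : 1 ≤ jb ξ := by unfold jb; nlinarith [sq_nonneg (2 * Real.pi * ‖ξ‖)]

lemma jb_pos (ξ : E) : 0 < jb ξ := lt_of_lt_of_le one_pos (one_le_jb ξ)

lemma jb_rpow_pos (r : ℝ) (ξ : E) : 0 < jb ξ ^ r := Real.rpow_pos_of_pos (jb_pos ξ) r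

@[fun_prop]
lemma continuous_jb : Continuous (jb : E → ℝ) := by unfold jb; fun_prop

@[fun_prop]
lemma continuous_jb_rpow (r : ℝ) : Continuous (fun ξ : E => jb ξ ^ r) :=
  continuous_jb.rpow_const fun ξ => Or.inl (jb_pos ξ).ne'

lemma jb_hasTemperateGrowth (r : ℝ) : (fun ξ : E => jb ξ ^ r).HasTemperateGrowth := by
  have h := (Function.hasTemperateGrowth_one_add_norm_sq_rpow E r).comp
    ((2 * Real.pi) • ContinuousLinearMap.id ℝ E).hasTemperateGrowth
  have h2 : (fun ξ : E => jb ξ ^ r) = (fun ξ : E => (1 + ‖ξ‖ ^ 2) ^ r) ∘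
      ⇑((2 * Real.pi) • ContinuousLinearMap.id ℝ E) := by
    ext ξ
    simp [jb, norm_smul, abs_of_pos Real.pi_pos]
  rw [h2]; exact h

/-- The `L²` Fourier transform, as a function; zero outside `L²`. -/
noncomputable def l2hat (u : E → ℂ) : E → ℂ :=
  open Classical in
  if hu : MemLp u 2 (volume : Measure E) then ⇑(𝓕 (hu.toLp u) : Lp ℂ 2 (volume : Measure E)) else 0

/-- The Sobolev norm of order `r` of an `L²` function. -/
noncomputable def hnorm (r : ℝ) (u : E → ℂ) : ℝ≥0∞ :=
  eLpNorm (fun ξ : E => (jb ξ ^ (r / 2) : ℝ) • l2hat u ξ) 2 volume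

lemma l2hat_memLp (u : E → ℂ) : MemLp (l2hat u) 2 (volume : Measure E) := by
  unfold l2hat
  split_ifs with h
  · exact Lp.memLp _
  · exact MemLp.zero

lemma l2hat_eq {u : E → ℂ} (hu : MemLp u 2 (volume : Measure E)) :
    l2hat u = ⇑(𝓕 (hu.toLp u) : Lp ℂ 2 (volume : Measure E)) := by
  unfold l2hat; rw [dif_pos hu]

lemma eLpNorm_l2hat {u : E → ℂ} (hu : MemLp u 2 (volume : Measure E)) :
    eLpNorm (l2hat u) 2 volume = eLpNorm u 2 volume := by
  rw [l2hat_eq hu, ← Lp.enorm_def, ← ofReal_norm, Lp.norm_fourier_eq, ofReal_norm,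
    Lp.enorm_def, eLpNorm_congr_ae hu.coeFn_toLp]

lemma l2hat_congr {u v : E → ℂ} (h : u =ᵐ[volume] v) : l2hat u = l2hat v := by
  by_cases hu : MemLp u 2 (volume : Measure E)
  · have hv : MemLp v 2 (volume : Measure E) := (memLp_congr_ae h).1 hu
    rw [l2hat_eq hu, l2hat_eq hv, (MemLp.toLp_eq_toLp_iff hu hv).2 h]
  · have hv : ¬ MemLp v 2 (volume : Measure E) := fun hv => hu ((memLp_congr_ae h).2 hv)
    unfold l2hat; rw [dif_neg hu, dif_neg hv]

lemma l2hat_add {u v : E → ℂ} (hu : MemLp u 2 (volume : Measure E))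
    (hv : MemLp v 2 (volume : Measure E)) :
    l2hat (u + v) =ᵐ[volume] l2hat u + l2hat v := by
  rw [l2hat_eq hu, l2hat_eq hv, l2hat_eq (hu.add hv), MemLp.toLp_add, FourierTransform.fourier_add]
  exact Lp.coeFn_add _ _

lemma l2hat_const_smul {u : E → ℂ} (hu : MemLp u 2 (volume : Measure E)) (c : ℂ) :
    l2hat (c • u) =ᵐ[volume] c • l2hat u := by
  rw [l2hat_eq hu, l2hat_eq (hu.const_smul c), MemLp.toLp_const_smul, FourierTransform.fourier_smul]
  exact Lp.coeFn_smul _ _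

/-- The Fourier transform is moved onto a Schwartz function; identities between L² transforms are
reduced to this. -/
lemma integral_l2hat_mul {u : E → ℂ} (hu : MemLp u 2 (volume : Measure E)) (ψ : 𝓢(E, ℂ)) :
    ∫ ξ, l2hat u ξ * ψ ξ = ∫ x, u x * 𝓕 ψ x := by
  have h := congrArg (fun T => T ψ) (Lp.fourier_toTemperedDistribution_eq (hu.toLp u))
  simp only [TemperedDistribution.fourier_apply, Lp.toTemperedDistribution_apply] at h
  rw [l2hat_eq hu]
  calc _ = ∫ ξ, ψ ξ • (𝓕 (hu.toLp u) : Lp ℂ 2 (volume : Measure E)) ξ := by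
        simp [mul_comm]
    _ = _ := by
        rw [← h]
        refine integral_congr_ae ?_
        filter_upwards [hu.coeFn_toLp] with x hx
        rw [hx, smul_eq_mul, mul_comm]

lemma l2hat_schwartz (φ : 𝓢(E, ℂ)) : l2hat φ =ᵐ[volume] ⇑(𝓕 φ : 𝓢(E, ℂ)) := by
  have hφ : MemLp (⇑φ) 2 (volume : Measure E) := φ.memLp 2
  rw [l2hat_eq hφ]
  have : hφ.toLp (⇑φ) = φ.toLp 2 := rfl
  rw [this, SchwartzMap.toLp_fourier_eq]
  exact SchwartzMap.coeFn_toLp _ _ _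

lemma fourierSobolevNorm_eq {N : ℕ} (r : ℝ) {u : Vel N → ℝ}
    (hu : MemLp (fun v => (u v : ℂ)) 2 (volume : Measure (Vel N))) :
    fourierSobolevNorm r u = hnorm r (fun v => (u v : ℂ)) := by
  unfold fourierSobolevNorm hnorm
  rw [iInf_pos hu, l2hat_eq hu]
  rfl

lemma memLp_of_fourierSobolevNorm_lt_top {N : ℕ} {r : ℝ} {u : Vel N → ℝ}
    (hu : fourierSobolevNorm r u < ⊤) : MemLp (fun v => (u v : ℂ)) 2 (volume : Measure (Vel N)) := by
  by_contra h
  unfold fourierSobolevNorm at hu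
  rw [iInf_neg h] at hu
  exact lt_irrefl _ hu

lemma ae_eq_of_integral_schwartz {u v : E → ℂ} (hu : LocallyIntegrable u volume)
    (hv : LocallyIntegrable v volume) (h : ∀ ψ : 𝓢(E, ℂ), ∫ x, u x * ψ x = ∫ x, v x * ψ x) :
    u =ᵐ[volume] v := by
  refine ae_eq_of_integral_contDiff_smul_eq hu hv fun g hg hgc => ?_
  have hc : HasCompactSupport (fun x => (g x : ℂ)) := hgc.comp_left (g := Complex.ofReal) (by simp)
  have hs : ContDiff ℝ ∞ (fun x => (g x : ℂ)) := Complex.ofRealCLM.contDiff.comp hg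
  have := h (hc.toSchwartzMap hs)
  simpa [mul_comm] using this

/-- A function that acts on Schwartz functions as an `L²`-bounded functional is in `L²`. -/
lemma eLpNorm_le_of_schwartz_dual {u : E → ℂ} (hu : LocallyIntegrable u volume)
    (hi : ∀ ψ : 𝓢(E, ℂ), Integrable (fun x => u x * ψ x) volume) {K : ℝ≥0∞} (hK : K ≠ ⊤)
    (h : ∀ ψ : 𝓢(E, ℂ), ‖∫ x, u x * ψ x‖ₑ ≤ K * eLpNorm ψ 2 volume) :
    eLpNorm u 2 volume ≤ K := by
  let T : 𝓢(E, ℂ) →ₗ[ℂ] ℂ :=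
    { toFun := fun ψ => ∫ x, u x * ψ x
      map_add' := fun a b => by
        rw [← integral_add (hi a) (hi b)]; simp [mul_add]
      map_smul' := fun c a => by
        rw [RingHom.id_apply, smul_eq_mul, ← integral_const_mul]
        congr 1; ext x; simp; ring }
  let e : 𝓢(E, ℂ) →ₗ[ℂ] Lp ℂ 2 (volume : Measure E) :=
    (SchwartzMap.toLpCLM ℂ (E := E) ℂ 2 volume).toLinearMap
  have hdense : DenseRange e := SchwartzMap.denseRange_toLpCLM ENNReal.ofNat_ne_top
  have hnorm : ∀ ψ, ‖T ψ‖ ≤ K.toReal * ‖e ψ‖ := fun ψ => by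
    have h1 := h ψ
    have h2 : eLpNorm ψ 2 volume = ‖e ψ‖ₑ := by
      rw [Lp.enorm_def]
      exact (eLpNorm_congr_ae (SchwartzMap.coeFn_toLp _ _ _)).symm
    rw [h2] at h1
    have := ENNReal.toReal_mono (ENNReal.mul_ne_top hK (by simp)) h1
    rw [ENNReal.toReal_mul, toReal_enorm, toReal_enorm] at this
    exact this
  -- By density the functional extends to all of L² with the same bound. Its Riesz representative
  -- `k` is the conjugate of `u`, so that `‖u‖ = ‖k‖ ≤ K`.
  let T' := T.extendOfNorm e
  have hT' : ∀ f, ‖T' f‖ ≤ K.toReal * ‖f‖ :=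
    LinearMap.norm_extendOfNorm_apply_le hdense _ hnorm
  let k := (InnerProductSpace.toDual ℂ (Lp ℂ 2 (volume : Measure E))).symm T'
  have hk : ‖k‖ ≤ K.toReal := by
    rw [LinearIsometryEquiv.norm_map]
    exact ContinuousLinearMap.opNorm_le_bound _ ENNReal.toReal_nonneg hT'
  have hku : u =ᵐ[volume] fun x => (starRingEnd ℂ) (k x) := by
    have hkm : MemLp (fun x => (starRingEnd ℂ) (k x)) 2 (volume : Measure E) :=
      (Lp.memLp k).star
    refine ae_eq_of_integral_schwartz hu (hkm.locallyIntegrable (by norm_num)) fun ψ => ?_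
    have h1 : T' (e ψ) = T ψ := LinearMap.extendOfNorm_eq hdense ⟨_, hnorm⟩ ψ
    have h2 : inner ℂ k (e ψ) = T' (e ψ) := InnerProductSpace.toDual_symm_apply
    rw [h1, L2.inner_def] at h2
    change T ψ = _
    rw [← h2]
    refine integral_congr_ae ?_
    filter_upwards [SchwartzMap.coeFn_toLp ψ 2 (volume : Measure E)] with x hx
    change inner ℂ (k x) (ψ.toLp 2 volume x) = _
    rw [hx]; simp [mul_comm]
  rw [eLpNorm_congr_ae hku]
  have : eLpNorm (fun x => (starRingEnd ℂ) (k x)) 2 volume = eLpNorm k 2 volume :=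
    eLpNorm_congr_norm_ae (Filter.Eventually.of_forall fun x => by simp)
  rw [this, ← Lp.enorm_def, ← ofReal_norm]
  exact ENNReal.ofReal_le_of_le_toReal hk

lemma enorm_integral_mul_le {u v : E → ℂ} (hu : AEStronglyMeasurable u volume)
    (hv : AEStronglyMeasurable v volume) :
    ‖∫ x, u x * v x‖ₑ ≤ eLpNorm u 2 volume * eLpNorm v 2 volume := by
  refine (enorm_integral_le_lintegral_enorm _).trans ?_
  have := eLpNorm_smul_le_mul_eLpNorm (p := 2) (q := 2) (r := 1) (μ := volume) hv hu
  rw [eLpNorm_one_eq_lintegral_enorm] at this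
  simpa using this

lemma integrable_mul_of_memLp {u v : E → ℂ} (hu : MemLp u 2 (volume : Measure E))
    (hv : MemLp v 2 (volume : Measure E)) : Integrable (fun x => u x * v x) volume :=
  hu.integrable_mul hv

/-- The dual Sobolev norm of order `-r` of a Schwartz function. -/
noncomputable def dualNorm (r : ℝ) (φ : 𝓢(E, ℂ)) : ℝ≥0∞ :=
  eLpNorm (fun ξ : E => (jb ξ ^ (-r / 2) : ℝ) • 𝓕⁻ φ ξ) 2 volume

lemma enorm_integral_le_hnorm_mul_dualNorm (r : ℝ) {u : E → ℂ}
    (hu : MemLp u 2 (volume : Measure E)) (φ : 𝓢(E, ℂ)) :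
    ‖∫ x, u x * φ x‖ₑ ≤ hnorm r u * dualNorm r φ := by
  have h1 : ∫ x, u x * φ x = ∫ ξ, l2hat u ξ * (𝓕⁻ φ) ξ := by
    rw [integral_l2hat_mul hu, FourierTransform.fourier_fourierInv_eq]
  have h2 : ∀ ξ, l2hat u ξ * (𝓕⁻ φ) ξ =
      ((jb ξ ^ (r / 2) : ℝ) • l2hat u ξ) * ((jb ξ ^ (-r / 2) : ℝ) • (𝓕⁻ φ) ξ) := fun ξ => by
    rw [smul_mul_smul_comm, ← Real.rpow_add (jb_pos ξ)]
    have : r / 2 + -r / 2 = 0 := by ring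
    rw [this]; simp
  rw [h1, integral_congr_ae (Filter.Eventually.of_forall h2)]
  exact enorm_integral_mul_le
    ((continuous_jb_rpow _).aestronglyMeasurable.smul (l2hat_memLp u).1)
    ((continuous_jb_rpow _).aestronglyMeasurable.smul (𝓕⁻ φ).continuous.aestronglyMeasurable)

/-- Multiplication of a Schwartz function by a power of the weight. -/
noncomputable def jbMul (r : ℝ) (φ : 𝓢(E, ℂ)) : 𝓢(E, ℂ) :=
  SchwartzMap.smulLeftCLM ℂ (fun ξ : E => jb ξ ^ r) φ

lemma jbMul_apply (r : ℝ) (φ : 𝓢(E, ℂ)) (ξ : E) : jbMul r φ ξ = (jb ξ ^ r : ℝ) • φ ξ :=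
  SchwartzMap.smulLeftCLM_apply_apply (jb_hasTemperateGrowth r) φ ξ

/-- Converse of the duality inequality: the test functions `φ = 𝓕 (jb^{r/2} ψ)` turn the hypothesis
into an L² bound for `jb^{r/2} û` as a functional of `ψ`. -/
lemma hnorm_le_of_dual {r : ℝ} {u : E → ℂ} (hu : MemLp u 2 (volume : Measure E)) {K : ℝ≥0∞}
    (hK : K ≠ ⊤) (h : ∀ φ : 𝓢(E, ℂ), ‖∫ x, u x * φ x‖ₑ ≤ K * dualNorm r φ) :
    hnorm r u ≤ K := by
  have hmul : ∀ ψ : 𝓢(E, ℂ), ∀ ξ, ((jb ξ ^ (r / 2) : ℝ) • l2hat u ξ) * ψ ξ =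
      l2hat u ξ * jbMul (r / 2) ψ ξ := fun ψ ξ => by
    rw [jbMul_apply, smul_mul_assoc, mul_smul_comm]
  refine eLpNorm_le_of_schwartz_dual ?_ (fun ψ => ?_) hK fun ψ => ?_
  · have := ((l2hat_memLp u).locallyIntegrable (by norm_num)).continuous_smul
        (continuous_jb_rpow (E := E) (r / 2))
    exact this
  · simp only [hmul]
    exact integrable_mul_of_memLp (l2hat_memLp u) ((jbMul (r / 2) ψ).memLp 2)
  · simp only [hmul]
    rw [integral_l2hat_mul hu]
    refine (h _).trans_eq ?_
    unfold dualNorm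
    rw [FourierTransform.fourierInv_fourier_eq]
    congr 2
    ext ξ
    rw [jbMul_apply, smul_smul, ← Real.rpow_add (jb_pos ξ)]
    have : -r / 2 + r / 2 = 0 := by ring
    rw [this]; simp

end Toolbox

/-! ### Quadratic real interpolation between weighted L² spaces -/

section Interpolation

/-- The integrand `t^{-2θ-1} (tw)²/(1+(tw)²)` of the quadratic interpolation method. -/
noncomputable def interpKernel (θ w t : ℝ) : ℝ :=
  t ^ (-2 * θ - 1) * ((t * w) ^ 2 / (1 + (t * w) ^ 2))

lemma interpKernel_nonneg (θ w : ℝ) {t : ℝ} (ht : 0 < t) : 0 ≤ interpKernel θ w t := by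
  unfold interpKernel
  have := Real.rpow_pos_of_pos ht (-2 * θ - 1)
  positivity

lemma measurable_interpKernel (θ : ℝ) :
    Measurable (fun p : ℝ × ℝ => interpKernel θ p.1 p.2) := by
  unfold interpKernel; fun_prop

/-- The normalization constant of the quadratic interpolation method. -/
noncomputable def interpConst (θ : ℝ) : ℝ≥0∞ :=
  ∫⁻ t in Set.Ioi (0 : ℝ), ENNReal.ofReal (interpKernel θ 1 t)

lemma interpConst_ne_zero (θ : ℝ) : interpConst θ ≠ 0 := by
  unfold interpConst
  have hm : Measurable (interpKernel θ 1) :=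
    (measurable_interpKernel θ).comp (measurable_const.prodMk measurable_id)
  rw [Ne, lintegral_eq_zero_iff hm.ennreal_ofReal]
  intro h
  have h2 : ∀ᵐ t ∂(volume.restrict (Set.Ioi (0 : ℝ))), False := by
    filter_upwards [h, ae_restrict_mem measurableSet_Ioi] with t ht ht0
    have ht0 : (0 : ℝ) < t := ht0
    have : 0 < interpKernel θ 1 t := by
      unfold interpKernel
      have := Real.rpow_pos_of_pos ht0 (-2 * θ - 1)
      positivity
    have h3 := ENNReal.ofReal_eq_zero.1 ht
    linarith
  rw [ae_iff] at h2
  simp at h2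

/-- The integrand is at most `t^{1-2θ}` near `0` and at most `t^{-2θ-1}` near infinity;
integrability at the two ends is exactly `θ < 1` and `θ > 0`. -/
lemma interpConst_ne_top {θ : ℝ} (h0 : 0 < θ) (h1 : θ < 1) : interpConst θ ≠ ⊤ := by
  have hu : Set.Ioi (0 : ℝ) = Set.Ioc 0 1 ∪ Set.Ioi 1 := (Set.Ioc_union_Ioi_eq_Ioi zero_le_one).symm
  have hA : IntegrableOn (fun t : ℝ => t ^ (1 - 2 * θ)) (Set.Ioc 0 1) := by
    have := (intervalIntegral.intervalIntegrable_rpow' (a := 0) (b := 1)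
      (r := 1 - 2 * θ) (by linarith))
    rwa [intervalIntegrable_iff_integrableOn_Ioc_of_le zero_le_one] at this
  have hB : IntegrableOn (fun t : ℝ => t ^ (-2 * θ - 1)) (Set.Ioi 1) :=
    integrableOn_Ioi_rpow_of_lt (by linarith) zero_lt_one
  have hmeas : Measurable (interpKernel θ 1) :=
    (measurable_interpKernel θ).comp (measurable_const.prodMk measurable_id)
  have hint : IntegrableOn (interpKernel θ 1) (Set.Ioi 0) := by
    rw [hu]
    refine IntegrableOn.union (hA.mono' hmeas.aestronglyMeasurable ?_)
      (hB.mono' hmeas.aestronglyMeasurable ?_)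
    · filter_upwards [ae_restrict_mem measurableSet_Ioc] with t ht
      have ht0 : 0 < t := ht.1
      rw [Real.norm_of_nonneg (interpKernel_nonneg θ 1 ht0)]
      have e1 : t ^ (1 - 2 * θ) = t ^ (-2 * θ - 1) * t ^ 2 := by
        rw [← Real.rpow_natCast t 2, ← Real.rpow_add ht0]; congr 1; push_cast; ring
      rw [e1]; unfold interpKernel
      gcongr
      rw [mul_one]
      exact div_le_self (by positivity) (by nlinarith [sq_nonneg t])
    · filter_upwards [ae_restrict_mem measurableSet_Ioi] with t ht
      have ht0 : 0 < t := lt_trans zero_lt_one ht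
      rw [Real.norm_of_nonneg (interpKernel_nonneg θ 1 ht0)]
      unfold interpKernel
      refine mul_le_of_le_one_right (Real.rpow_nonneg ht0.le _) ?_
      rw [div_le_one (by positivity)]; linarith
  unfold interpConst
  exact (hint.lintegral_lt_top).ne

/-- Scaling `t ↦ wt`. The power `w^{2θ}` is thereby an average of the quadratic K-functional weights
`(tw)²/(1+(tw)²)`. -/
lemma lintegral_interpKernel (θ : ℝ) {w : ℝ} (hw : 0 < w) :
    ∫⁻ t in Set.Ioi (0 : ℝ), ENNReal.ofReal (interpKernel θ w t) =
      ENNReal.ofReal (w ^ (2 * θ)) * interpConst θ := by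
  have himg : (fun t : ℝ => w * t) '' Set.Ioi 0 = Set.Ioi 0 := by
    rw [Set.image_mul_left_Ioi hw, mul_zero]
  have h := lintegral_image_eq_lintegral_abs_deriv_mul (measurableSet_Ioi (a := (0 : ℝ)))
    (f := fun t => w * t) (f' := fun _ => w)
    (fun x _ => by simpa using ((hasDerivAt_id x).const_mul w).hasDerivWithinAt)
    ((mul_right_injective₀ hw.ne').injOn) (fun t => ENNReal.ofReal (interpKernel θ 1 t))
  rw [himg] at h
  unfold interpConst
  rw [h, ← lintegral_const_mul' _ _ ENNReal.ofReal_ne_top]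
  refine setLIntegral_congr_fun measurableSet_Ioi fun t ht => ?_
  have ht : (0 : ℝ) < t := ht
  rw [← ENNReal.ofReal_mul (abs_nonneg _), ← ENNReal.ofReal_mul (by positivity)]
  congr 1
  unfold interpKernel
  rw [abs_of_pos hw, Real.mul_rpow hw.le ht.le, mul_one, mul_comm w t]
  have : w ^ (2 * θ) * (w * w ^ (-2 * θ - 1)) = 1 := by
    rw [mul_left_comm, ← Real.rpow_add hw]
    have : 2 * θ + (-2 * θ - 1) = -1 := by ring
    rw [this, Real.rpow_neg_one, mul_inv_cancel₀ hw.ne']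
  linear_combination (- t ^ (-2 * θ - 1) * ((t * w) ^ 2 / (1 + (t * w) ^ 2))) * this

/-- After clearing the denominator the difference is at least `(‖a‖ - s‖b‖)²`. -/
lemma norm_add_sq_mul_le (a b : ℂ) {s : ℝ} (hs : 0 < s) :
    ‖a + b‖ ^ 2 * (s / (1 + s)) ≤ ‖a‖ ^ 2 + s * ‖b‖ ^ 2 := by
  have h := norm_add_le a b
  have h2 : ‖a + b‖ ^ 2 ≤ (‖a‖ + ‖b‖) ^ 2 := by gcongr
  rw [← mul_div_assoc, div_le_iff₀ (by linarith)]
  nlinarith [sq_nonneg (‖a‖ - s * ‖b‖), mul_le_mul_of_nonneg_right h2 hs.le]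

lemma eLpNorm_two_sq {α F : Type*} [MeasurableSpace α] {μ : Measure α} [NormedAddCommGroup F]
    (u : α → F) : eLpNorm u 2 μ ^ 2 = ∫⁻ x, ‖u x‖ₑ ^ 2 ∂μ := by
  have := eLpNorm_nnreal_pow_eq_lintegral (f := u) (μ := μ) (p := 2) (by norm_num)
  simpa using this

lemma enorm_sq_eq_ofReal {F : Type*} [NormedAddCommGroup F] (z : F) :
    ‖z‖ₑ ^ 2 = ENNReal.ofReal (‖z‖ ^ 2) := by
  rw [ENNReal.ofReal_pow (norm_nonneg _), ofReal_norm]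

/-- Quadratic real interpolation between weighted `L²` spaces. -/
theorem eLpNorm_interpolation {α β : Type*} [MeasurableSpace α] [MeasurableSpace β]
    {μ : Measure α} {ν : Measure β} [SFinite μ] [SFinite ν] {θ : ℝ} (h0 : 0 < θ) (h1 : θ < 1)
    {W V : α → ℝ} {W' : β → ℝ} (hW : Measurable W) (hV : Measurable V) (hW' : Measurable W')
    (hW0 : ∀ x, 0 < W x) (hW0' : ∀ x, 0 < W' x)
    {h : α → ℂ} {U : β → ℂ} (hh : AEStronglyMeasurable h μ) (hU : AEStronglyMeasurable U ν)
    {C : ℝ≥0∞} (hC : C ≠ ⊤)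
    (H : ∀ t : ℝ, 0 < t → ∃ U₀ U₁ : β → ℂ, AEStronglyMeasurable U₀ ν ∧ AEStronglyMeasurable U₁ ν ∧
      U =ᵐ[ν] U₀ + U₁ ∧
      eLpNorm U₀ 2 ν ≤ C * eLpNorm (fun x =>
        (V x * ((t * W x) ^ 2 / (1 + (t * W x) ^ 2))) • h x) 2 μ ∧
      eLpNorm (fun y => W' y • U₁ y) 2 ν ≤ C * eLpNorm (fun x =>
        (V x * W x * (1 / (1 + (t * W x) ^ 2))) • h x) 2 μ) :
    eLpNorm (fun y => W' y ^ θ • U y) 2 ν ≤ C * eLpNorm (fun x => (V x * W x ^ θ) • h x) 2 μ := by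
  -- At each scale `t` the output weight is bounded through the decomposition `U = U₀ + U₁`, which
  -- costs `‖U₀‖² + t² ‖W' U₁‖²`.
  have key : ∀ t : ℝ, 0 < t →
      ∫⁻ y, ‖U y‖ₑ ^ 2 * ENNReal.ofReal ((t * W' y) ^ 2 / (1 + (t * W' y) ^ 2)) ∂ν ≤
      C ^ 2 * ∫⁻ x, ENNReal.ofReal (V x ^ 2) * ‖h x‖ₑ ^ 2 *
        ENNReal.ofReal ((t * W x) ^ 2 / (1 + (t * W x) ^ 2)) ∂μ := by
    intro t ht
    obtain ⟨U₀, U₁, hm0, hm1, hUU, hb0, hb1⟩ := H t ht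
    calc _ ≤ ∫⁻ y, (‖U₀ y‖ₑ ^ 2 + ENNReal.ofReal (t ^ 2) * ‖W' y • U₁ y‖ₑ ^ 2) ∂ν := by
          refine lintegral_mono_ae ?_
          filter_upwards [hUU] with y hy
          rw [hy]
          simp only [enorm_sq_eq_ofReal]
          rw [← ENNReal.ofReal_mul (by positivity), ← ENNReal.ofReal_mul (by positivity),
            ← ENNReal.ofReal_add (by positivity) (by positivity)]
          refine ENNReal.ofReal_le_ofReal ?_
          have := norm_add_sq_mul_le (U₀ y) (U₁ y) (s := (t * W' y) ^ 2)
            (by have := hW0' y; positivity)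
          rw [norm_smul, Real.norm_of_nonneg (hW0' y).le]
          refine this.trans (le_of_eq (by ring))
      _ = eLpNorm U₀ 2 ν ^ 2 + ENNReal.ofReal (t ^ 2) *
            eLpNorm (fun y => W' y • U₁ y) 2 ν ^ 2 := by
          rw [lintegral_add_left' (by fun_prop), lintegral_const_mul' _ _ ENNReal.ofReal_ne_top,
            eLpNorm_two_sq, eLpNorm_two_sq]
      _ ≤ (C * eLpNorm (fun x => (V x * ((t * W x) ^ 2 / (1 + (t * W x) ^ 2))) • h x) 2 μ) ^ 2 +
          ENNReal.ofReal (t ^ 2) *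
            (C * eLpNorm (fun x => (V x * W x * (1 / (1 + (t * W x) ^ 2))) • h x) 2 μ) ^ 2 := by
          gcongr
      _ = C ^ 2 * ∫⁻ x, (‖(V x * ((t * W x) ^ 2 / (1 + (t * W x) ^ 2))) • h x‖ₑ ^ 2 +
            ENNReal.ofReal (t ^ 2) * ‖(V x * W x * (1 / (1 + (t * W x) ^ 2))) • h x‖ₑ ^ 2) ∂μ := by
          rw [lintegral_add_left' (by fun_prop), lintegral_const_mul' _ _ ENNReal.ofReal_ne_top,
            mul_pow, mul_pow, eLpNorm_two_sq, eLpNorm_two_sq]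
          ring
      -- With `s = (tW)²` the two input weights recombine: `(s/(1+s))² + s/(1+s)² = s/(1+s)`, so
      -- nothing is lost.
      _ = _ := by
          congr 1
          refine lintegral_congr fun x => ?_
          simp only [enorm_sq_eq_ofReal]
          rw [← ENNReal.ofReal_mul (by positivity), ← ENNReal.ofReal_mul (by positivity),
            ← ENNReal.ofReal_mul (by positivity),
            ← ENNReal.ofReal_add (by positivity) (by positivity)]
          congr 1
          rw [norm_smul, norm_smul, mul_pow ‖_‖, mul_pow ‖_‖, Real.norm_eq_abs, sq_abs,
            Real.norm_eq_abs, sq_abs]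
          have : 1 + (t * W x) ^ 2 ≠ 0 := by positivity
          field_simp
          ring
  have hmeasK : Measurable (fun p : ℝ × ℝ => ENNReal.ofReal (interpKernel θ p.1 p.2)) :=
    (measurable_interpKernel θ).ennreal_ofReal
  -- Integrating the scale-`t` inequality against `t^{-2θ-1} dt` and exchanging integrals produces
  -- `W'^{2θ}` and `W^{2θ}` with the same constant, which is cancelled at the end.
  have main : ∫⁻ y, ‖U y‖ₑ ^ 2 * (ENNReal.ofReal (W' y ^ (2 * θ)) * interpConst θ) ∂ν ≤
      C ^ 2 * ∫⁻ x, ENNReal.ofReal (V x ^ 2) * ‖h x‖ₑ ^ 2 *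
        (ENNReal.ofReal (W x ^ (2 * θ)) * interpConst θ) ∂μ := by
    have hc : ∀ (a : ℝ≥0∞) (w : ℝ), 0 < w → a * (ENNReal.ofReal (w ^ (2 * θ)) * interpConst θ) =
        ∫⁻ t in Set.Ioi (0 : ℝ), a * ENNReal.ofReal (interpKernel θ w t) := fun a w hw => by
      rw [← lintegral_interpKernel θ hw]
      exact (lintegral_const_mul a (hmeasK.comp (measurable_const.prodMk measurable_id))).symm
    simp only [hc _ _ (hW0 _), hc _ _ (hW0' _)]
    rw [lintegral_lintegral_swap (μ := ν) (ν := volume.restrict (Set.Ioi (0 : ℝ))),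
      lintegral_lintegral_swap (μ := μ) (ν := volume.restrict (Set.Ioi (0 : ℝ))),
      ← lintegral_const_mul' _ _ (ENNReal.pow_ne_top hC)]
    · refine setLIntegral_mono' measurableSet_Ioi fun t ht => ?_
      have ht : (0 : ℝ) < t := ht
      have hs : ∀ w, ENNReal.ofReal (interpKernel θ w t) = ENNReal.ofReal (t ^ (-2 * θ - 1)) *
          ENNReal.ofReal ((t * w) ^ 2 / (1 + (t * w) ^ 2)) := fun w => by
        unfold interpKernel
        rw [ENNReal.ofReal_mul (Real.rpow_nonneg ht.le _)]
      have := mul_le_mul_right (key t ht) (ENNReal.ofReal (t ^ (-2 * θ - 1)))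
      simp only [hs]
      rw [mul_left_comm, ← lintegral_const_mul' _ _ ENNReal.ofReal_ne_top,
        ← lintegral_const_mul' _ _ ENNReal.ofReal_ne_top] at this
      convert this using 1
      · refine lintegral_congr fun y => by ring
      · congr 1
        refine lintegral_congr fun y => by ring
    · have : AEMeasurable (fun z : α × ℝ => ENNReal.ofReal (V z.1 ^ 2) * ‖h z.1‖ₑ ^ 2 *
          ENNReal.ofReal (interpKernel θ (W z.1) z.2)) (μ.prod (volume.restrict (Set.Ioi 0))) := by
        have h1 : AEMeasurable (fun z : α × ℝ => ‖h z.1‖ₑ) (μ.prod (volume.restrict (Set.Ioi 0))) :=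
          hh.enorm.comp_fst
        have h2 := hmeasK.comp ((hW.comp measurable_fst).prodMk
          (measurable_snd : Measurable (Prod.snd : α × ℝ → ℝ)))
        exact (AEMeasurable.mul (by fun_prop) (h1.pow_const 2)).mul h2.aemeasurable
      exact this
    · have : AEMeasurable (fun z : β × ℝ => ‖U z.1‖ₑ ^ 2 *
          ENNReal.ofReal (interpKernel θ (W' z.1) z.2)) (ν.prod (volume.restrict (Set.Ioi 0))) := by
        have h1 : AEMeasurable (fun z : β × ℝ => ‖U z.1‖ₑ) (ν.prod (volume.restrict (Set.Ioi 0))) :=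
          hU.enorm.comp_fst
        have h2 := hmeasK.comp ((hW'.comp measurable_fst).prodMk
          (measurable_snd : Measurable (Prod.snd : β × ℝ → ℝ)))
        exact (h1.pow_const 2).mul h2.aemeasurable
      exact this
  have hne := interpConst_ne_zero θ
  have hnt := interpConst_ne_top h0 h1
  simp only [← mul_assoc] at main
  rw [lintegral_mul_const' _ _ hnt, lintegral_mul_const' _ _ hnt, ← mul_assoc,
    ENNReal.mul_le_mul_iff_left hne hnt] at main
  rw [← ENNReal.pow_le_pow_left_iff two_ne_zero, mul_pow, eLpNorm_two_sq,
    eLpNorm_two_sq]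
  convert main using 2
  · refine funext fun y => ?_
    simp only [enorm_sq_eq_ofReal]
    rw [← ENNReal.ofReal_mul (by positivity), norm_smul, mul_pow, Real.norm_eq_abs, sq_abs, mul_comm,
      ← Real.rpow_natCast (W' y ^ θ), ← Real.rpow_mul (hW0' y).le]
    congr 3; push_cast; ring
  · refine lintegral_congr fun x => ?_
    simp only [enorm_sq_eq_ofReal]
    have := Real.rpow_nonneg (hW0 x).le (2 * θ)
    rw [← ENNReal.ofReal_mul (by positivity), ← ENNReal.ofReal_mul (by positivity), norm_smul,
      mul_pow, Real.norm_eq_abs, sq_abs, mul_pow,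
      ← Real.rpow_natCast (W x ^ θ), ← Real.rpow_mul (hW0 x).le]
    congr 1
    have : θ * ((2 : ℕ) : ℝ) = 2 * θ := by push_cast; ring
    rw [this]; ring

end Interpolation

/-! ### L² derivatives on the Fourier side -/

section WeakDerivatives

variable {E : Type*} [NormedAddCommGroup E] [InnerProductSpace ℝ E] [FiniteDimensional ℝ E]
  [MeasurableSpace E] [BorelSpace E]

open scoped SchwartzMap LineDeriv

lemma exists_l2hat_eq {w : E → ℂ} (hw : MemLp w 2 (volume : Measure E)) :
    ∃ h : E → ℂ, MemLp h 2 (volume : Measure E) ∧ l2hat h =ᵐ[volume] w := by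
  refine ⟨⇑(𝓕⁻ (hw.toLp w) : Lp ℂ 2 (volume : Measure E)), Lp.memLp _, ?_⟩
  rw [l2hat_eq (Lp.memLp _), Lp.toLp_coeFn, FourierTransform.fourier_fourierInv_eq]
  exact hw.coeFn_toLp

lemma ae_eq_of_l2hat_ae_eq {u v : E → ℂ} (hu : MemLp u 2 (volume : Measure E))
    (hv : MemLp v 2 (volume : Measure E)) (h : l2hat u =ᵐ[volume] l2hat v) : u =ᵐ[volume] v := by
  rw [l2hat_eq hu, l2hat_eq hv] at h
  have h2 := Lp.ext h
  have h3 := congrArg (fun f : Lp ℂ 2 (volume : Measure E) => (𝓕⁻ f : Lp ℂ 2 _)) h2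
  simp only [FourierTransform.fourierInv_fourier_eq] at h3
  exact (MemLp.toLp_eq_toLp_iff hu hv).1 h3

lemma hnorm_congr {r : ℝ} {u v : E → ℂ} (h : u =ᵐ[volume] v) : hnorm r u = hnorm r v := by
  unfold hnorm; rw [l2hat_congr h]

lemma hnorm_add_le (r : ℝ) {u v : E → ℂ} (hu : MemLp u 2 (volume : Measure E))
    (hv : MemLp v 2 (volume : Measure E)) : hnorm r (u + v) ≤ hnorm r u + hnorm r v := by
  unfold hnorm
  refine le_trans (le_of_eq ?_) (eLpNorm_add_le
    ((continuous_jb_rpow _).aestronglyMeasurable.smul (l2hat_memLp u).1)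
    ((continuous_jb_rpow _).aestronglyMeasurable.smul (l2hat_memLp v).1) (by norm_num))
  refine eLpNorm_congr_ae ?_
  filter_upwards [l2hat_add hu hv] with ξ hξ
  simp [hξ]

lemma hnorm_const_smul (r : ℝ) {u : E → ℂ} (hu : MemLp u 2 (volume : Measure E)) (c : ℂ) :
    hnorm r (c • u) = ‖c‖ₑ * hnorm r u := by
  unfold hnorm
  rw [← eLpNorm_const_smul]
  refine eLpNorm_congr_ae ?_
  filter_upwards [l2hat_const_smul hu c] with ξ hξ
  simp [hξ, mul_left_comm]

lemma hnorm_mono {r r' : ℝ} (h : r ≤ r') (u : E → ℂ) : hnorm r u ≤ hnorm r' u := by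
  refine eLpNorm_mono_ae (Filter.Eventually.of_forall fun ξ => ?_)
  rw [norm_smul, norm_smul, Real.norm_of_nonneg (jb_rpow_pos _ _).le,
    Real.norm_of_nonneg (jb_rpow_pos _ _).le]
  gcongr
  exact one_le_jb ξ

lemma hnorm_zero {u : E → ℂ} (hu : MemLp u 2 (volume : Measure E)) :
    hnorm 0 u = eLpNorm u 2 volume := by
  unfold hnorm; simp [eLpNorm_l2hat hu]

/-- `h` is the derivative of `u` in the direction `m`, in `L²`, on the Fourier side. -/
structure HasL2Deriv (m : E) (u h : E → ℂ) : Prop where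
  left : MemLp u 2 (volume : Measure E)
  right : MemLp h 2 (volume : Measure E)
  hat : l2hat h =ᵐ[volume] fun ξ => (2 * Real.pi * Complex.I * (inner ℝ ξ m : ℝ)) * l2hat u ξ

lemma integral_mul_lineDeriv_fourier {u : E → ℂ} (hu : MemLp u 2 (volume : Measure E)) (m : E)
    (ψ : 𝓢(E, ℂ)) : ∫ x, u x * (∂_{m} (𝓕 ψ)) x =
      -∫ ξ, ((2 * Real.pi * Complex.I * (inner ℝ ξ m : ℝ)) * l2hat u ξ) * ψ ξ := by
  have hg : (fun ξ : E => (inner ℝ ξ m : ℝ)).HasTemperateGrowth := by fun_prop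
  rw [SchwartzMap.lineDerivOp_fourier_eq, ← integral_l2hat_mul hu, ← integral_neg]
  refine integral_congr_ae (Filter.Eventually.of_forall fun ξ => ?_)
  simp [SchwartzMap.smulLeftCLM_apply_apply hg]
  ring

lemma HasL2Deriv.integral_eq {m : E} {u h : E → ℂ} (H : HasL2Deriv m u h) (φ : 𝓢(E, ℂ)) :
    ∫ x, u x * (∂_{m} φ) x = -∫ x, h x * φ x := by
  have e : φ = 𝓕 (𝓕⁻ φ) := (FourierTransform.fourier_fourierInv_eq φ).symm
  rw [e, integral_mul_lineDeriv_fourier H.left, ← integral_l2hat_mul H.right]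
  congr 1
  refine integral_congr_ae ?_
  filter_upwards [H.hat] with ξ hξ
  rw [hξ]

lemma HasL2Deriv.of_integral {m : E} {u h : E → ℂ} (hu : MemLp u 2 (volume : Measure E))
    (hh : MemLp h 2 (volume : Measure E))
    (H : ∀ φ : 𝓢(E, ℂ), ∫ x, u x * (∂_{m} φ) x = -∫ x, h x * φ x) : HasL2Deriv m u h := by
  refine ⟨hu, hh, ae_eq_of_integral_schwartz ((l2hat_memLp h).locallyIntegrable (by norm_num)) ?_
    fun ψ => ?_⟩
  · have hc : Continuous (fun ξ : E => (2 * Real.pi * Complex.I * (inner ℝ ξ m : ℝ) : ℂ)) := by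
      fun_prop
    exact ((l2hat_memLp u).locallyIntegrable (by norm_num)).continuous_smul hc
  · rw [integral_l2hat_mul hh]
    have h1 := H (𝓕 ψ)
    rw [integral_mul_lineDeriv_fourier hu, neg_inj] at h1
    exact h1.symm

/-- Real test functions with compact support suffice. Real and imaginary parts give complex ones,
and a Schwartz function is the limit of its products with `χ(x/(n+1))`; the term with the derivative
of the cutoff is `O(1/n)`, and dominated convergence applies. -/
lemma HasL2Deriv.of_testFunctions {m : E} {u h : E → ℂ} (hu : MemLp u 2 (volume : Measure E))
    (hh : MemLp h 2 (volume : Measure E))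
    (H : ∀ φ : E → ℝ, ContDiff ℝ ∞ φ → HasCompactSupport φ →
      ∫ x, u x * (fderiv ℝ φ x m : ℝ) = -∫ x, h x * φ x) : HasL2Deriv m u h := by
  -- complex test functions with compact support
  have Hc : ∀ φ : 𝓢(E, ℂ), HasCompactSupport φ →
      ∫ x, u x * (∂_{m} φ) x = -∫ x, h x * φ x := by
    intro φ hφ
    have hd : ∀ x, DifferentiableAt ℝ φ x := fun x => φ.differentiableAt
    have hre : ContDiff ℝ ∞ (fun x => (φ x).re) := Complex.reCLM.contDiff.comp (φ.smooth ⊤)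
    have him : ContDiff ℝ ∞ (fun x => (φ x).im) := Complex.imCLM.contDiff.comp (φ.smooth ⊤)
    have cre : HasCompactSupport (fun x => (φ x).re) := hφ.comp_left (g := Complex.re) rfl
    have cim : HasCompactSupport (fun x => (φ x).im) := hφ.comp_left (g := Complex.im) rfl
    have fre : ∀ x, fderiv ℝ (fun x => (φ x).re) x m = (fderiv ℝ φ x m).re := fun x => by
      have := (Complex.reCLM.hasFDerivAt.comp x (hd x).hasFDerivAt).fderiv
      exact congrArg (fun L : E →L[ℝ] ℝ => L m) this
    have fim : ∀ x, fderiv ℝ (fun x => (φ x).im) x m = (fderiv ℝ φ x m).im := fun x => by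
      have := (Complex.imCLM.hasFDerivAt.comp x (hd x).hasFDerivAt).fderiv
      exact congrArg (fun L : E →L[ℝ] ℝ => L m) this
    have h1 := H _ hre cre
    have h2 := H _ him cim
    have ml : ∀ (g : E → ℝ), ContDiff ℝ ∞ g → HasCompactSupport g →
        MemLp (fun x => (g x : ℂ)) 2 (volume : Measure E) := fun g hg hgc =>
      (Complex.continuous_ofReal.comp hg.continuous).memLp_of_hasCompactSupport
        (hgc.comp_left (g := Complex.ofReal) rfl)
    have mlm : ∀ (g : E → ℝ), ContDiff ℝ ∞ g → HasCompactSupport g →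
        MemLp (fun x => ((fderiv ℝ g x m : ℝ) : ℂ)) 2 (volume : Measure E) := fun g hg hgc => by
      refine (Complex.continuous_ofReal.comp ?_).memLp_of_hasCompactSupport
        (((hgc.fderiv ℝ).comp_left (g := fun L : E →L[ℝ] ℝ => L m) rfl).comp_left
          (g := Complex.ofReal) rfl)
      exact (hg.continuous_fderiv (by simp)).clm_apply continuous_const
    have e1 : ∫ x, u x * (∂_{m} φ) x = (∫ x, u x * (fderiv ℝ (fun x => (φ x).re) x m : ℝ)) +
        Complex.I * ∫ x, u x * (fderiv ℝ (fun x => (φ x).im) x m : ℝ) := by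
      rw [← integral_const_mul, ← integral_add (integrable_mul_of_memLp hu (mlm _ hre cre))
        ((integrable_mul_of_memLp hu (mlm _ him cim)).const_mul _)]
      refine integral_congr_ae (Filter.Eventually.of_forall fun x => ?_)
      simp only [SchwartzMap.lineDerivOp_apply_eq_fderiv, fre, fim]
      conv_lhs => rw [← Complex.re_add_im (fderiv ℝ φ x m)]
      ring
    have e2 : ∫ x, h x * φ x = (∫ x, h x * (φ x).re) + Complex.I * ∫ x, h x * (φ x).im := by
      rw [← integral_const_mul, ← integral_add (integrable_mul_of_memLp hh (ml _ hre cre))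
        ((integrable_mul_of_memLp hh (ml _ him cim)).const_mul _)]
      refine integral_congr_ae (Filter.Eventually.of_forall fun x => ?_)
      change h x * φ x = h x * ((φ x).re : ℂ) + Complex.I * (h x * ((φ x).im : ℂ))
      conv_lhs => rw [← Complex.re_add_im (φ x)]
      ring
    rw [e1, e2, h1, h2]; ring
  refine HasL2Deriv.of_integral hu hh fun φ => ?_
  -- cutoff
  let χ : ContDiffBump (0 : E) := ⟨1, 2, one_pos, one_lt_two⟩
  let c : ℕ → ℝ := fun n => 1 / ((n : ℝ) + 1)
  have hc0 : Filter.Tendsto c Filter.atTop (nhds 0) := tendsto_one_div_add_atTop_nhds_zero_nat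
  have hcpos : ∀ n, 0 < c n := fun n => by positivity
  have hcle : ∀ n, c n ≤ 1 := fun n => by
    simp only [c]; rw [div_le_one (by positivity)]; linarith [Nat.cast_nonneg (α := ℝ) n]
  have hχs : ∀ n, ContDiff ℝ ∞ (fun x : E => χ (c n • x)) := fun n =>
    χ.contDiff.comp (contDiff_const_smul _)
  have hχc : ∀ n, HasCompactSupport (fun x : E => χ (c n • x)) := fun n =>
    χ.hasCompactSupport.comp_smul (hcpos n).ne'
  have hφs : ∀ n, ContDiff ℝ ∞ (fun x : E => ((χ (c n • x) : ℝ) : ℂ) * φ x) := fun n =>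
    (Complex.ofRealCLM.contDiff.comp (hχs n)).mul (φ.smooth ⊤)
  have hφc : ∀ n, HasCompactSupport (fun x : E => ((χ (c n • x) : ℝ) : ℂ) * φ x) := fun n =>
    ((hχc n).comp_left (g := Complex.ofReal) rfl).mul_right
  obtain ⟨B, hB⟩ : ∃ B, ∀ x, ‖fderiv ℝ χ x‖ ≤ B :=
    (χ.hasCompactSupport.fderiv ℝ).exists_bound_of_continuous
      ((χ.contDiff (n := 1)).continuous_fderiv (by simp))
  have hfd : ∀ n x, fderiv ℝ (fun x : E => ((χ (c n • x) : ℝ) : ℂ) * φ x) x m =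
      ((c n * fderiv ℝ χ (c n • x) m : ℝ) : ℂ) * φ x + ((χ (c n • x) : ℝ) : ℂ) * (∂_{m} φ) x := by
    intro n x
    have h1 : HasFDerivAt (fun x : E => χ (c n • x))
        ((fderiv ℝ χ (c n • x)).comp (c n • ContinuousLinearMap.id ℝ E)) x :=
      HasFDerivAt.comp (g := χ) x ((χ.contDiff (n := 1)).differentiable (by simp) _).hasFDerivAt
        ((hasFDerivAt_id x).const_smul (c n))
    have h2 := (Complex.ofRealCLM.hasFDerivAt (x := χ (c n • x))).comp x h1
    have h3 := h2.mul φ.differentiableAt.hasFDerivAt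
    have h4 := congrArg (fun L : E →L[ℝ] ℂ => L m) h3.fderiv
    refine h4.trans ?_
    simp [SchwartzMap.lineDerivOp_apply_eq_fderiv]
    ring
  have hn := fun n => Hc ((hφc n).toSchwartzMap (hφs n)) (hφc n)
  have hχt : ∀ x : E, Filter.Tendsto (fun n => ((χ (c n • x) : ℝ) : ℂ)) Filter.atTop (nhds 1) := by
    intro x
    have h1 : Filter.Tendsto (fun n => χ (c n • x)) Filter.atTop (nhds (χ ((0 : ℝ) • x))) :=
      χ.continuous.continuousAt.tendsto.comp (hc0.smul_const x)
    have h2 : χ ((0 : ℝ) • x) = 1 := by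
      rw [zero_smul]; exact χ.one_of_mem_closedBall (by simp [χ])
    rw [h2] at h1
    have := (Complex.continuous_ofReal.tendsto 1).comp h1
    simpa [Function.comp_def] using this
  have hL : Filter.Tendsto (fun n => ∫ x, u x * (∂_{m} ((hφc n).toSchwartzMap (hφs n))) x)
      Filter.atTop (nhds (∫ x, u x * (∂_{m} φ) x)) := by
    refine tendsto_integral_of_dominated_convergence
      (fun x => ‖u x‖ * (B * ‖m‖ * ‖φ x‖ + ‖(∂_{m} φ) x‖)) (fun n => ?_) ?_ (fun n => ?_) ?_
    · exact hu.1.mul (SchwartzMap.continuous _).aestronglyMeasurable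
    · have i1 := (integrable_mul_of_memLp hu (φ.memLp 2)).norm.const_mul (B * ‖m‖)
      have i2 := (integrable_mul_of_memLp hu ((∂_{m} φ).memLp 2)).norm
      refine (i1.add i2).congr (Filter.Eventually.of_forall fun x => ?_)
      simp only [Pi.add_apply, norm_mul]; ring
    · refine Filter.Eventually.of_forall fun x => ?_
      rw [norm_mul, SchwartzMap.lineDerivOp_apply_eq_fderiv]
      change ‖u x‖ * ‖fderiv ℝ (fun x : E => ((χ (c n • x) : ℝ) : ℂ) * φ x) x m‖ ≤ _
      rw [hfd]
      gcongr
      refine (norm_add_le _ _).trans ?_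
      rw [norm_mul, norm_mul]
      gcongr
      · rw [Complex.norm_real, norm_mul, Real.norm_of_nonneg (hcpos n).le]
        calc _ ≤ 1 * (B * ‖m‖) := by
              gcongr
              · exact hcle n
              · exact (ContinuousLinearMap.le_opNorm _ _).trans (by gcongr; exact hB _)
          _ = _ := one_mul _
      · rw [Complex.norm_real, Real.norm_of_nonneg χ.nonneg]
        exact mul_le_of_le_one_left (norm_nonneg _) χ.le_one
    · refine Filter.Eventually.of_forall fun x => ?_
      have hD : ∀ n, (∂_{m} ((hφc n).toSchwartzMap (hφs n))) x =
          ((c n * fderiv ℝ χ (c n • x) m : ℝ) : ℂ) * φ x + ((χ (c n • x) : ℝ) : ℂ) * (∂_{m} φ) x :=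
        fun n => hfd n x
      simp only [hD]
      have z1 : Filter.Tendsto (fun n => ((c n * fderiv ℝ χ (c n • x) m : ℝ) : ℂ)) Filter.atTop
          (nhds 0) := by
        have : Filter.Tendsto (fun n => c n * fderiv ℝ χ (c n • x) m) Filter.atTop (nhds 0) := by
          refine squeeze_zero_norm (a := fun n => c n * (B * ‖m‖)) (fun n => ?_) ?_
          · rw [norm_mul, Real.norm_of_nonneg (hcpos n).le]
            have := hcpos n
            gcongr
            exact (ContinuousLinearMap.le_opNorm _ _).trans (by gcongr; exact hB _)
          · simpa using hc0.mul_const (B * ‖m‖)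
        have := (Complex.continuous_ofReal.tendsto 0).comp this
        simpa [Function.comp_def] using this
      have := ((z1.mul_const (φ x)).add ((hχt x).mul_const ((∂_{m} φ) x))).const_mul (u x)
      simpa using this
  have hR : Filter.Tendsto (fun n => -∫ x, h x * ((hφc n).toSchwartzMap (hφs n)) x)
      Filter.atTop (nhds (-∫ x, h x * φ x)) := by
    refine Filter.Tendsto.neg (tendsto_integral_of_dominated_convergence
      (fun x => ‖h x * φ x‖) (fun n => ?_) ?_ (fun n => ?_) ?_)
    · exact hh.1.mul (SchwartzMap.continuous _).aestronglyMeasurable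
    · exact (integrable_mul_of_memLp hh (φ.memLp 2)).norm
    · refine Filter.Eventually.of_forall fun x => ?_
      change ‖h x * (((χ (c n • x) : ℝ) : ℂ) * φ x)‖ ≤ _
      rw [norm_mul, norm_mul, norm_mul, Complex.norm_real, Real.norm_of_nonneg χ.nonneg]
      gcongr
      exact mul_le_of_le_one_left (norm_nonneg _) χ.le_one
    · refine Filter.Eventually.of_forall fun x => ?_
      change Filter.Tendsto (fun n => h x * (((χ (c n • x) : ℝ) : ℂ) * φ x)) Filter.atTop _
      have := ((hχt x).mul_const (φ x)).const_mul (h x)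
      simpa using this
  exact tendsto_nhds_unique hL (hR.congr fun n => (hn n).symm)

lemma norm_two_pi_inner_le (ξ m : E) :
    ‖(2 * Real.pi * Complex.I * (inner ℝ ξ m : ℝ) : ℂ)‖ ≤ ‖m‖ * jb ξ ^ (1 / 2 : ℝ) := by
  have h1 : ‖(2 * Real.pi * Complex.I * (inner ℝ ξ m : ℝ) : ℂ)‖ =
      2 * Real.pi * |inner ℝ ξ m| := by
    simp [abs_of_pos Real.pi_pos]
  rw [h1, ← Real.sqrt_eq_rpow]
  have h2 : 2 * Real.pi * ‖ξ‖ ≤ Real.sqrt (jb ξ) := Real.le_sqrt_of_sq_le (by unfold jb; linarith)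
  calc _ ≤ 2 * Real.pi * (‖ξ‖ * ‖m‖) := by gcongr; exact abs_real_inner_le_norm _ _
    _ = ‖m‖ * (2 * Real.pi * ‖ξ‖) := by ring
    _ ≤ _ := by gcongr

lemma HasL2Deriv.hnorm_le {m : E} {u h : E → ℂ} (H : HasL2Deriv m u h) (r : ℝ) :
    hnorm r h ≤ ‖m‖ₑ * hnorm (r + 1) u := by
  unfold hnorm
  rw [← enorm_norm m, ← eLpNorm_const_smul]
  refine eLpNorm_mono_ae ?_
  filter_upwards [H.hat] with ξ hξ
  rw [hξ, Pi.smul_apply, norm_smul, norm_smul, norm_smul, norm_mul,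
    Real.norm_of_nonneg (jb_rpow_pos _ _).le, Real.norm_of_nonneg (jb_rpow_pos _ _).le]
  have e : jb ξ ^ ((r + 1) / 2) = jb ξ ^ (r / 2) * jb ξ ^ (1 / 2 : ℝ) := by
    rw [← Real.rpow_add (jb_pos ξ)]; congr 1; ring
  rw [e]
  calc _ ≤ jb ξ ^ (r / 2) * ((‖m‖ * jb ξ ^ (1 / 2 : ℝ)) * ‖l2hat u ξ‖) := by
        have := (jb_rpow_pos (r / 2) ξ).le
        gcongr
        exact norm_two_pi_inner_le ξ m
    _ = _ := by rw [norm_norm]; ring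

lemma exists_hasL2Deriv {u : E → ℂ} (hu : MemLp u 2 (volume : Measure E)) (h1 : hnorm 1 u < ⊤)
    (m : E) : ∃ h, HasL2Deriv m u h := by
  have hw : MemLp (fun ξ => (2 * Real.pi * Complex.I * (inner ℝ ξ m : ℝ)) * l2hat u ξ) 2
      (volume : Measure E) := by
    have hc : Continuous (fun ξ : E => (2 * Real.pi * Complex.I * (inner ℝ ξ m : ℝ) : ℂ)) := by
      fun_prop
    have hm : MemLp (fun ξ : E => (jb ξ ^ (1 / 2 : ℝ) : ℝ) • l2hat u ξ) 2 (volume : Measure E) :=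
      ⟨(continuous_jb_rpow _).aestronglyMeasurable.smul (l2hat_memLp u).1, h1⟩
    refine (hm.const_smul ‖m‖).mono (hc.aestronglyMeasurable.mul (l2hat_memLp u).1)
      (Filter.Eventually.of_forall fun ξ => ?_)
    rw [norm_mul, Pi.smul_apply, norm_smul, norm_smul, norm_norm,
      Real.norm_of_nonneg (jb_rpow_pos _ _).le, ← mul_assoc]
    gcongr
    exact norm_two_pi_inner_le ξ m
  obtain ⟨h, hh, he⟩ := exists_l2hat_eq hw
  exact ⟨h, hu, hh, he⟩

/-- Pointwise in `ξ` this is `√(1 + ∑ aᵢ²) ≤ 1 + ∑ |aᵢ|` with `aᵢ = 2π ξ·bᵢ`. Together with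
`HasL2Deriv.hnorm_le` it drives every induction on the order of smoothness. -/
lemma hnorm_succ_le {ι : Type*} [Fintype ι] (b : OrthonormalBasis ι ℝ E) {u : E → ℂ}
    {h : ι → E → ℂ} (H : ∀ i, HasL2Deriv (b i) u (h i)) (r : ℝ) :
    hnorm (r + 1) u ≤ hnorm r u + ∑ i, hnorm r (h i) := by
  have hm : ∀ v : E → ℂ, AEStronglyMeasurable (fun ξ : E => (jb ξ ^ (r / 2) : ℝ) • l2hat v ξ)
      volume := fun v => (continuous_jb_rpow _).aestronglyMeasurable.smul (l2hat_memLp v).1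
  have hmn : ∀ v : E → ℂ, AEStronglyMeasurable (fun ξ : E => ‖(jb ξ ^ (r / 2) : ℝ) • l2hat v ξ‖)
      volume := fun v => (hm v).norm
  have hb : hnorm (r + 1) u ≤ eLpNorm ((fun ξ => ‖(jb ξ ^ (r / 2) : ℝ) • l2hat u ξ‖) +
      ∑ i, fun ξ => ‖(jb ξ ^ (r / 2) : ℝ) • l2hat (h i) ξ‖) 2 volume := by
    refine eLpNorm_mono_ae ?_
    filter_upwards [Filter.eventually_all.2 fun i => (H i).hat] with ξ hξ
    have e : jb ξ ^ ((r + 1) / 2) = jb ξ ^ (r / 2) * jb ξ ^ (1 / 2 : ℝ) := by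
      rw [← Real.rpow_add (jb_pos ξ)]; congr 1; ring
    have hn : 0 ≤ (((fun ξ => ‖(jb ξ ^ (r / 2) : ℝ) • l2hat u ξ‖) +
      ∑ i, fun ξ => ‖(jb ξ ^ (r / 2) : ℝ) • l2hat (h i) ξ‖) : E → ℝ) ξ := by
      simp only [Pi.add_apply, Finset.sum_apply]; positivity
    rw [Real.norm_of_nonneg hn]
    simp only [Pi.add_apply, Finset.sum_apply, norm_smul, Real.norm_of_nonneg (jb_rpow_pos _ _).le]
    rw [← Finset.mul_sum, ← mul_add, e, mul_assoc]
    have := (jb_rpow_pos (r / 2) ξ).le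
    gcongr
    have hs : ∀ i, ‖l2hat (h i) ξ‖ = 2 * Real.pi * |inner ℝ ξ (b i)| * ‖l2hat u ξ‖ := fun i => by
      rw [hξ i]; simp [abs_of_pos Real.pi_pos]
    simp only [hs]
    rw [← Finset.sum_mul, ← one_add_mul]
    gcongr
    rw [← Real.sqrt_eq_rpow]
    refine Real.sqrt_le_iff.2 ⟨by positivity, ?_⟩
    have hsum : ‖ξ‖ ^ 2 = ∑ i, |inner ℝ ξ (b i)| ^ 2 := by
      rw [← b.sum_sq_norm_inner_left ξ]; simp
    have hsq : ∑ i, (2 * Real.pi * |inner ℝ ξ (b i)|) ^ 2 ≤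
        (∑ i, 2 * Real.pi * |inner ℝ ξ (b i)|) ^ 2 :=
      Finset.sum_sq_le_sq_sum_of_nonneg fun i _ => by positivity
    have hnn : 0 ≤ ∑ i, 2 * Real.pi * |inner ℝ ξ (b i)| := by positivity
    unfold jb
    rw [mul_pow, hsum, Finset.mul_sum]
    simp only [mul_pow] at hsq ⊢
    nlinarith
  refine hb.trans ((eLpNorm_add_le (hmn u) (Finset.aestronglyMeasurable_sum _ fun i _ => hmn (h i))
    (by norm_num)).trans ?_)
  gcongr
  · rw [eLpNorm_norm]; rfl
  · refine (eLpNorm_sum_le (fun i _ => hmn (h i)) (by norm_num)).trans ?_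
    refine Finset.sum_le_sum fun i _ => ?_
    rw [eLpNorm_norm]; rfl

end WeakDerivatives

/-! ### Smooth functions with bounded derivatives -/

section BoundedDerivatives

variable {E F G H : Type*} [NormedAddCommGroup E] [NormedSpace ℝ E]
  [NormedAddCommGroup F] [NormedSpace ℝ F] [NormedAddCommGroup G] [NormedSpace ℝ G]
  [NormedAddCommGroup H] [NormedSpace ℝ H]

/-- A smooth function whose derivatives up to order `n` are bounded. -/
structure BddDeriv (n : ℕ) (a : E → F) : Prop where
  smooth : ContDiff ℝ ∞ a
  bound : ∀ i ≤ n, ∃ C, ∀ x, ‖iteratedFDeriv ℝ i a x‖ ≤ C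

/-- A smooth function all of whose derivatives are bounded. -/
def BddSmooth (a : E → F) : Prop := ∀ n, BddDeriv n a

lemma BddDeriv.bilinear {n : ℕ} {a : E → F} {b : E → G} (ha : BddDeriv n a) (hb : BddDeriv n b)
    (B : F →L[ℝ] G →L[ℝ] H) : BddDeriv n (fun x => B (a x) (b x)) := by
  refine ⟨(B.isBoundedBilinearMap.contDiff).comp (ha.smooth.prodMk hb.smooth), fun i hi => ?_⟩
  choose! Ca hCa using ha.bound
  choose! Cb hCb using hb.bound
  refine ⟨‖B‖ * ∑ j ∈ Finset.range (i + 1), (i.choose j : ℝ) * Ca j * Cb (i - j), fun x => ?_⟩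
  refine (B.norm_iteratedFDeriv_le_of_bilinear ha.smooth hb.smooth x
    (n := i) (by exact_mod_cast le_top)).trans ?_
  gcongr with j hj
  · have := (norm_nonneg _).trans (hCa j ((Finset.mem_range_succ_iff.1 hj).trans hi) x)
    positivity
  · exact hCa j ((Finset.mem_range_succ_iff.1 hj).trans hi) x
  · exact hCb (i - j) ((Nat.sub_le _ _).trans hi) x

lemma BddDeriv.const (n : ℕ) (c : F) : BddDeriv n (fun _ : E => c) := by
  refine ⟨contDiff_const, fun i _ => ⟨‖c‖, fun x => ?_⟩⟩
  rcases i with _ | i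
  · simp
  · simp [iteratedFDeriv_const_of_ne (Nat.succ_ne_zero i)]

lemma BddDeriv.clm_comp {n : ℕ} {a : E → F} (ha : BddDeriv n a) (L : F →L[ℝ] G) :
    BddDeriv n (fun x => L (a x)) :=
  (BddDeriv.const n L).bilinear ha (ContinuousLinearMap.id ℝ (F →L[ℝ] G))

lemma BddDeriv.add {n : ℕ} {a b : E → F} (ha : BddDeriv n a) (hb : BddDeriv n b) :
    BddDeriv n (fun x => a x + b x) := by
  refine ⟨ha.smooth.add hb.smooth, fun i hi => ?_⟩
  obtain ⟨Ca, hCa⟩ := ha.bound i hi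
  obtain ⟨Cb, hCb⟩ := hb.bound i hi
  refine ⟨Ca + Cb, fun x => ?_⟩
  have := iteratedFDeriv_add_apply (x := x) (i := i) (ha.smooth.contDiffAt.of_le
    (by exact_mod_cast le_top)) (hb.smooth.contDiffAt.of_le (by exact_mod_cast le_top))
  change ‖iteratedFDeriv ℝ i (a + b) x‖ ≤ _
  rw [this]
  exact (norm_add_le _ _).trans (add_le_add (hCa x) (hCb x))

lemma BddDeriv.of_fderiv {n : ℕ} {a : E → F} (ha : ContDiff ℝ ∞ a) {C : ℝ}
    (hC : ∀ x, ‖a x‖ ≤ C) (h : BddDeriv n (fderiv ℝ a)) : BddDeriv (n + 1) a := by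
  refine ⟨ha, fun i hi => ?_⟩
  rcases i with _ | i
  · exact ⟨C, fun x => by simpa using hC x⟩
  · obtain ⟨D, hD⟩ := h.bound i (by omega)
    exact ⟨D, fun x => by rw [← norm_iteratedFDeriv_fderiv]; exact hD x⟩

lemma BddSmooth.fderiv_apply {a : E → F} (ha : BddSmooth a) (m : E) :
    BddSmooth (fun x => fderiv ℝ a x m) := fun n => by
  have h : BddDeriv n (fderiv ℝ a) := by
    refine ⟨(ha 0).smooth.fderiv_right (m := ∞) (by simp), fun i _ => ?_⟩
    obtain ⟨C, hC⟩ := (ha (i + 1)).bound (i + 1) le_rfl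
    exact ⟨C, fun x => by rw [norm_iteratedFDeriv_fderiv]; exact hC x⟩
  exact h.clm_comp (ContinuousLinearMap.apply ℝ F m)

lemma BddSmooth.hasTemperateGrowth {a : E → F} (ha : BddSmooth a) : a.HasTemperateGrowth := by
  refine ⟨(ha 0).smooth, fun n => ?_⟩
  obtain ⟨C, hC⟩ := (ha n).bound n le_rfl
  exact ⟨0, C, fun x => by simpa using hC x⟩

lemma BddSmooth.exists_bound {a : E → F} (ha : BddSmooth a) : ∃ C, ∀ x, ‖a x‖ ≤ C := by
  obtain ⟨C, hC⟩ := (ha 0).bound 0 le_rfl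
  exact ⟨C, fun x => by simpa using hC x⟩

end BoundedDerivatives

/-! ### Derivatives of the logarithm of the weight -/

section Bracket

variable {E : Type*} [NormedAddCommGroup E] [InnerProductSpace ℝ E]

lemma hasFDerivAt_one_add_norm_sq_inv (v : E) :
    HasFDerivAt (fun v : E => (1 + ‖v‖ ^ 2)⁻¹)
      ((-2 * (1 + ‖v‖ ^ 2)⁻¹) • innerSL ℝ ((1 + ‖v‖ ^ 2)⁻¹ • v)) v := by
  have hne : (1 + ‖v‖ ^ 2) ≠ 0 := by positivity
  have h1 : HasFDerivAt (fun v : E => 1 + ‖v‖ ^ 2) (2 • innerSL ℝ v) v :=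
    ((hasStrictFDerivAt_norm_sq v).hasFDerivAt).const_add 1
  have h2 := (hasDerivAt_inv hne).comp_hasFDerivAt v h1
  refine h2.congr_fderiv ?_
  ext w
  simp
  field_simp

lemma hasFDerivAt_smul_one_add_norm_sq_inv (v : E) :
    HasFDerivAt (fun v : E => (1 + ‖v‖ ^ 2)⁻¹ • v)
      ((1 + ‖v‖ ^ 2)⁻¹ • ContinuousLinearMap.id ℝ E +
        (-2 : ℝ) • (innerSL ℝ ((1 + ‖v‖ ^ 2)⁻¹ • v)).smulRight ((1 + ‖v‖ ^ 2)⁻¹ • v)) v := by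
  refine ((hasFDerivAt_one_add_norm_sq_inv v).smul (hasFDerivAt_id v)).congr_fderiv ?_
  ext w
  simp [smul_smul]
  congr 1
  ring

lemma contDiff_one_add_norm_sq_inv : ContDiff ℝ ∞ (fun v : E => (1 + ‖v‖ ^ 2)⁻¹) :=
  (contDiff_const.add (contDiff_norm_sq ℝ)).inv fun v => by positivity

/-- The two functions are treated together because the first derivative of each is bilinear in this
same pair, so the induction on the order closes. -/
lemma bddDeriv_bracket_aux (n : ℕ) : BddDeriv n (fun v : E => (1 + ‖v‖ ^ 2)⁻¹) ∧
    BddDeriv n (fun v : E => (1 + ‖v‖ ^ 2)⁻¹ • v) := by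
  have hb1 : ∀ v : E, ‖(1 + ‖v‖ ^ 2)⁻¹‖ ≤ 1 := fun v => by
    rw [norm_inv]
    refine inv_le_one_of_one_le₀ ?_
    rw [Real.norm_of_nonneg (by positivity)]
    linarith [sq_nonneg ‖v‖]
  have hb2 : ∀ v : E, ‖(1 + ‖v‖ ^ 2)⁻¹ • v‖ ≤ 1 := fun v => by
    rw [norm_smul, Real.norm_of_nonneg (by positivity), inv_mul_le_one₀ (by positivity)]
    nlinarith [sq_nonneg (‖v‖ - 1)]
  have hs1 := contDiff_one_add_norm_sq_inv (E := E)
  have hs2 : ContDiff ℝ ∞ (fun v : E => (1 + ‖v‖ ^ 2)⁻¹ • v) := hs1.smul contDiff_id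
  have hf1 : fderiv ℝ (fun v : E => (1 + ‖v‖ ^ 2)⁻¹) =
      fun v => (-2 : ℝ) • ((1 + ‖v‖ ^ 2)⁻¹ • innerSL ℝ ((1 + ‖v‖ ^ 2)⁻¹ • v)) :=
    funext fun v => by rw [(hasFDerivAt_one_add_norm_sq_inv v).fderiv, smul_smul]
  have hf2 := funext fun v : E => (hasFDerivAt_smul_one_add_norm_sq_inv v).fderiv
  induction n with
  | zero =>
    refine ⟨⟨hs1, fun i hi => ⟨1, fun x => ?_⟩⟩, ⟨hs2, fun i hi => ⟨1, fun x => ?_⟩⟩⟩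
    · obtain rfl : i = 0 := by omega
      simpa using hb1 x
    · obtain rfl : i = 0 := by omega
      simpa using hb2 x
  | succ n ih =>
    obtain ⟨h1, h2⟩ := ih
    refine ⟨BddDeriv.of_fderiv hs1 hb1 ?_, BddDeriv.of_fderiv hs2 hb2 ?_⟩
    · rw [hf1]
      exact ((h1.bilinear (h2.clm_comp (innerSL ℝ)) (ContinuousLinearMap.lsmul ℝ ℝ))).clm_comp
        ((-2 : ℝ) • ContinuousLinearMap.id ℝ _)
    · rw [hf2]
      refine BddDeriv.add ?_ ?_
      · exact h1.bilinear (BddDeriv.const n (ContinuousLinearMap.id ℝ E))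
          (ContinuousLinearMap.lsmul ℝ ℝ)
      · exact ((h2.clm_comp (innerSL ℝ)).bilinear h2
          (ContinuousLinearMap.smulRightL ℝ E E)).clm_comp
            ((-2 : ℝ) • ContinuousLinearMap.id ℝ _)

/-- The logarithm of the weight `√(1+|v|²)`. -/
noncomputable def logBracket (v : E) : ℝ := 1 / 2 * Real.log (1 + ‖v‖ ^ 2)

lemma hasFDerivAt_logBracket (v : E) :
    HasFDerivAt logBracket (innerSL ℝ ((1 + ‖v‖ ^ 2)⁻¹ • v)) v := by
  have hne : (1 + ‖v‖ ^ 2) ≠ 0 := by positivity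
  have h1 : HasFDerivAt (fun v : E => 1 + ‖v‖ ^ 2) (2 • innerSL ℝ v) v :=
    ((hasStrictFDerivAt_norm_sq v).hasFDerivAt).const_add 1
  refine ((h1.log hne).const_mul (1 / 2)).congr_fderiv ?_
  ext w
  simp
  ring

lemma contDiff_logBracket : ContDiff ℝ ∞ (logBracket : E → ℝ) :=
  contDiff_const.mul ((contDiff_const.add (contDiff_norm_sq ℝ)).log fun v => by positivity)

/-- The gradient of `log⟨v⟩` is `v/(1+|v|²)`, all of whose derivatives are bounded. Order `0` is
excluded, the logarithm being unbounded. -/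
lemma exists_bound_iteratedFDeriv_logBracket (n : ℕ) (hn : 1 ≤ n) :
    ∃ C, ∀ v : E, ‖iteratedFDeriv ℝ n logBracket v‖ ≤ C := by
  obtain ⟨k, rfl⟩ : ∃ k, n = k + 1 := ⟨n - 1, by omega⟩
  have hf : fderiv ℝ (logBracket : E → ℝ) = fun v => innerSL ℝ ((1 + ‖v‖ ^ 2)⁻¹ • v) :=
    funext fun v => (hasFDerivAt_logBracket v).fderiv
  obtain ⟨C, hC⟩ := ((bddDeriv_bracket_aux (E := E) k).2.clm_comp (innerSL ℝ)).bound k le_rfl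
  exact ⟨C, fun v => by rw [← norm_iteratedFDeriv_fderiv, hf]; exact hC v⟩

end Bracket

/-! ### Bounded smooth functions as Sobolev multipliers -/

section Multiplication

variable {E : Type*} [NormedAddCommGroup E] [InnerProductSpace ℝ E] [FiniteDimensional ℝ E]
  [MeasurableSpace E] [BorelSpace E]

open scoped SchwartzMap LineDeriv

lemma BddSmooth.memLp_mul {a : E → ℝ} (ha : BddSmooth a) {u : E → ℂ}
    (hu : MemLp u 2 (volume : Measure E)) : MemLp (fun x => (a x : ℂ) * u x) 2 volume := by
  obtain ⟨C, hC⟩ := ha.exists_bound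
  have hc : Continuous fun x => (a x : ℂ) := Complex.continuous_ofReal.comp (ha 0).smooth.continuous
  refine (hu.const_smul C).mono (hc.aestronglyMeasurable.mul hu.1)
    (Filter.Eventually.of_forall fun x => ?_)
  rw [norm_mul, Complex.norm_real, Pi.smul_apply, norm_smul]
  gcongr
  exact (hC x).trans (le_abs_self C)

/-- Product rule, obtained by testing the derivative of `u` against `a φ`, which is again Schwartz.
-/
lemma HasL2Deriv.bddSmooth_mul {a : E → ℝ} (ha : BddSmooth a) {m : E} {u h : E → ℂ}
    (H : HasL2Deriv m u h) : HasL2Deriv m (fun x => (a x : ℂ) * u x)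
      ((fun x => (a x : ℂ) * h x) + fun x => ((fderiv ℝ a x m : ℝ) : ℂ) * u x) := by
  have h1 := ha.memLp_mul H.left
  have h2 := ha.memLp_mul H.right
  have h3 := (ha.fderiv_apply m).memLp_mul H.left
  refine HasL2Deriv.of_integral h1 (h2.add h3) fun φ => ?_
  have ht : (fun x => (a x : ℂ)).HasTemperateGrowth :=
    Complex.ofRealCLM.hasTemperateGrowth.comp ha.hasTemperateGrowth
  have key := H.integral_eq (SchwartzMap.smulLeftCLM ℂ (fun x => (a x : ℂ)) φ)
  have hd : ∀ x, (∂_{m} (SchwartzMap.smulLeftCLM ℂ (fun x => (a x : ℂ)) φ)) x =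
      (a x : ℂ) * (∂_{m} φ) x + ((fderiv ℝ a x m : ℝ) : ℂ) * φ x := fun x => by
    rw [SchwartzMap.lineDerivOp_apply_eq_fderiv, SchwartzMap.lineDerivOp_apply_eq_fderiv,
      SchwartzMap.smulLeftCLM_apply ht]
    have ha1 : HasFDerivAt a (fderiv ℝ a x) x :=
      ((ha 0).smooth.differentiable (by simp) x).hasFDerivAt
    have e1 := ((Complex.ofRealCLM.hasFDerivAt (x := a x)).comp x ha1).mul
      φ.differentiableAt.hasFDerivAt
    refine (congrArg (fun L : E →L[ℝ] ℂ => L m) e1.fderiv).trans ?_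
    simp
    ring
  simp only [hd, SchwartzMap.smulLeftCLM_apply_apply ht, smul_eq_mul] at key
  have i1 := integrable_mul_of_memLp h1 ((∂_{m} φ).memLp 2)
  have i2 := integrable_mul_of_memLp h3 (φ.memLp 2)
  have i3 := integrable_mul_of_memLp h2 (φ.memLp 2)
  have e1 : ∫ x, u x * ((a x : ℂ) * (∂_{m} φ) x + ((fderiv ℝ a x m : ℝ) : ℂ) * φ x) =
      (∫ x, ((a x : ℂ) * u x) * (∂_{m} φ) x) + ∫ x, (((fderiv ℝ a x m : ℝ) : ℂ) * u x) * φ x := by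
    rw [← integral_add i1 i2]
    exact integral_congr_ae (Filter.Eventually.of_forall fun x => by ring)
  have e2 : ∫ x, ((fun x => (a x : ℂ) * h x) + fun x => ((fderiv ℝ a x m : ℝ) : ℂ) * u x) x * φ x =
      (∫ x, ((a x : ℂ) * h x) * φ x) + ∫ x, (((fderiv ℝ a x m : ℝ) : ℂ) * u x) * φ x := by
    rw [← integral_add i3 i2]
    exact integral_congr_ae (Filter.Eventually.of_forall fun x => by simp only [Pi.add_apply]; ring)
  have e3 : ∫ x, h x * ((a x : ℂ) * φ x) = ∫ x, ((a x : ℂ) * h x) * φ x :=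
    integral_congr_ae (Filter.Eventually.of_forall fun x => by ring)
  rw [e1, e3] at key
  rw [e2]
  linear_combination key

/-- Multiplication by `a` is bounded on the Sobolev space of order `r`. -/
def IsMultiplier (r : ℝ) (a : E → ℝ) : Prop :=
  ∃ C : ℝ≥0, 0 < C ∧ ∀ u : E → ℂ, MemLp u 2 (volume : Measure E) →
    hnorm r (fun x => (a x : ℂ) * u x) ≤ C * hnorm r u

lemma isMultiplier_zero {a : E → ℝ} (ha : BddSmooth a) : IsMultiplier 0 a := by
  obtain ⟨C, hC⟩ := ha.exists_bound
  have hC0 : 0 ≤ C := (norm_nonneg _).trans (hC 0)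
  refine ⟨Real.toNNReal (C + 1), Real.toNNReal_pos.2 (by linarith), fun u hu => ?_⟩
  rw [hnorm_zero hu, hnorm_zero (ha.memLp_mul hu)]
  refine eLpNorm_le_nnreal_smul_eLpNorm_of_ae_le_mul (Filter.Eventually.of_forall fun x => ?_) 2
  rw [← NNReal.coe_le_coe, NNReal.coe_mul, coe_nnnorm, coe_nnnorm, norm_mul, Complex.norm_real,
    Real.coe_toNNReal _ (by linarith)]
  gcongr
  linarith [hC x]

/-- By the product rule the derivatives of `a u` are sums of products of order `r`. The hypothesis
is needed for all bounded smooth functions because the derivatives of `a` appear as multipliers too.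
-/
lemma IsMultiplier.succ {r : ℝ} (hr : 0 ≤ r) {a : E → ℝ} (ha : BddSmooth a)
    (H : ∀ a : E → ℝ, BddSmooth a → IsMultiplier r a) : IsMultiplier (r + 1) a := by
  let b := stdOrthonormalBasis ℝ E
  obtain ⟨C, hC0, hC⟩ := H a ha
  choose D hD0 hD using fun i => H _ (ha.fderiv_apply (b i))
  refine ⟨C + ∑ i, (C + D i), add_pos_of_pos_of_nonneg hC0 zero_le, fun u hu => ?_⟩
  -- When the norm is infinite the bound needs a nonzero constant, since `0 * ⊤ = 0`; hence the
  -- positivity in `IsMultiplier`.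
  by_cases htop : hnorm (r + 1) u = ⊤
  · rw [htop, ENNReal.mul_top]
    · exact le_top
    · have : 0 < C + ∑ i, (C + D i) := add_pos_of_pos_of_nonneg hC0 zero_le
      exact_mod_cast this.ne'
  have h1 : hnorm 1 u < ⊤ := (hnorm_mono (by linarith) u).trans_lt (Ne.lt_top htop)
  choose h hh using fun i => exists_hasL2Deriv hu h1 (b i)
  have hle : hnorm r u ≤ hnorm (r + 1) u := hnorm_mono (by linarith) u
  have hi : ∀ i, hnorm r (h i) ≤ hnorm (r + 1) u := fun i => by
    refine ((hh i).hnorm_le r).trans ?_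
    have : ‖b i‖ₑ = 1 := by
      rw [← ofReal_norm, b.norm_eq_one]; simp
    rw [this, one_mul]
  refine (hnorm_succ_le b (fun i => (hh i).bddSmooth_mul ha) r).trans ?_
  push_cast
  rw [add_mul, Finset.sum_mul]
  gcongr with i
  · exact (hC u hu).trans (by gcongr)
  · refine (hnorm_add_le r (ha.memLp_mul (hh i).right)
      ((ha.fderiv_apply _).memLp_mul hu)).trans ?_
    rw [add_mul]
    gcongr
    · exact (hC _ (hh i).right).trans (by gcongr; exact hi i)
    · exact (hD i u hu).trans (by gcongr)

/-- Interpolation between orders `0` and `1`, at both of which multiplication by `a` is bounded. -/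
lemma isMultiplier_of_lt_one {θ : ℝ} (h0 : 0 < θ) (h1 : θ < 1) {a : E → ℝ} (ha : BddSmooth a) :
    IsMultiplier θ a := by
  obtain ⟨C, hC0, hC⟩ := isMultiplier_zero ha
  obtain ⟨D, hD0, hD⟩ : IsMultiplier 1 a := by
    have := IsMultiplier.succ le_rfl ha fun a ha => isMultiplier_zero ha
    rwa [zero_add] at this
  refine ⟨C + D, add_pos hC0 hD0, fun u hu => ?_⟩
  have hmW : Measurable (fun ξ : E => jb ξ ^ (1 / 2 : ℝ)) := (continuous_jb_rpow _).measurable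
  have key := eLpNorm_interpolation (μ := (volume : Measure E)) (ν := (volume : Measure E)) h0 h1
    (W := fun ξ => jb ξ ^ (1 / 2 : ℝ)) (V := fun _ => 1) (W' := fun ξ => jb ξ ^ (1 / 2 : ℝ))
    hmW measurable_const hmW (fun _ => jb_rpow_pos _ _) (fun _ => jb_rpow_pos _ _)
    (h := l2hat u) (U := l2hat fun x => (a x : ℂ) * u x) (l2hat_memLp _).1 (l2hat_memLp _).1
    (C := C + D) (by simp) ?_
  · simp only [one_mul, ← Real.rpow_mul (jb_pos _).le] at key
    have e : 1 / 2 * θ = θ / 2 := by ring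
    rw [e] at key
    unfold hnorm
    exact_mod_cast key
  · intro t ht
    -- The decomposition at scale `t` is made on the Fourier side of `u`: `û₀ = p/(1+p) û` and `û₁ =
    -- 1/(1+p) û`. Multiplication by `a` is then applied to each part.
    set p : E → ℝ := fun ξ => (t * jb ξ ^ (1 / 2 : ℝ)) ^ 2 with hp
    have hp0 : ∀ ξ, 0 < p ξ := fun ξ => by have := jb_rpow_pos (1 / 2) ξ; positivity
    have hpc : Continuous p := by fun_prop
    have hm0 : MemLp (fun ξ => (p ξ / (1 + p ξ)) • l2hat u ξ) 2 (volume : Measure E) := by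
      refine (l2hat_memLp u).mono ((hpc.div (by fun_prop)
        fun ξ => by have := hp0 ξ; positivity).aestronglyMeasurable.smul (l2hat_memLp u).1)
        (Filter.Eventually.of_forall fun ξ => ?_)
      have := hp0 ξ
      rw [norm_smul, Real.norm_of_nonneg (by positivity)]
      refine mul_le_of_le_one_left (norm_nonneg _) ?_
      rw [div_le_one (by positivity)]; linarith
    have hm1 : MemLp (fun ξ => (1 / (1 + p ξ)) • l2hat u ξ) 2 (volume : Measure E) := by
      refine (l2hat_memLp u).mono ((Continuous.div (g := fun ξ => 1 + p ξ) continuous_const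
        (by fun_prop) fun ξ => by have := hp0 ξ; positivity).aestronglyMeasurable.smul (l2hat_memLp u).1)
        (Filter.Eventually.of_forall fun ξ => ?_)
      have := hp0 ξ
      rw [norm_smul, Real.norm_of_nonneg (by positivity)]
      refine mul_le_of_le_one_left (norm_nonneg _) ?_
      rw [div_le_one (by positivity)]; linarith
    obtain ⟨u₀, hu₀, he₀⟩ := exists_l2hat_eq hm0
    obtain ⟨u₁, hu₁, he₁⟩ := exists_l2hat_eq hm1
    have hsum : u =ᵐ[volume] u₀ + u₁ := by
      refine ae_eq_of_l2hat_ae_eq hu (hu₀.add hu₁) ?_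
      filter_upwards [l2hat_add hu₀ hu₁, he₀, he₁] with ξ h2 h3 h4
      rw [h2, Pi.add_apply, h3, h4, ← add_smul, ← add_div]
      have := hp0 ξ
      rw [add_comm (p ξ), div_self (by positivity), one_smul]
    refine ⟨_, _, (l2hat_memLp fun x => (a x : ℂ) * u₀ x).1,
      (l2hat_memLp fun x => (a x : ℂ) * u₁ x).1, ?_, ?_, ?_⟩
    · have : (fun x => (a x : ℂ) * u x) =ᵐ[volume]
          (fun x => (a x : ℂ) * u₀ x) + fun x => (a x : ℂ) * u₁ x := by
        filter_upwards [hsum] with x hx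
        rw [hx]; simp [mul_add]
      rw [l2hat_congr this]
      exact l2hat_add (ha.memLp_mul hu₀) (ha.memLp_mul hu₁)
    · have := hC u₀ hu₀
      rw [hnorm_zero hu₀, hnorm_zero (ha.memLp_mul hu₀), ← eLpNorm_l2hat (ha.memLp_mul hu₀),
        ← eLpNorm_l2hat hu₀, eLpNorm_congr_ae he₀] at this
      refine this.trans ?_
      simp only [one_mul]
      gcongr
      simp
    · have := hD u₁ hu₁
      unfold hnorm at this
      refine this.trans ?_
      gcongr
      · simp
      · refine le_of_eq (eLpNorm_congr_ae ?_)
        filter_upwards [he₁] with ξ hξ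
        rw [hξ, smul_smul, one_mul]

theorem isMultiplier_of_bddSmooth {r : ℝ} (hr : 0 ≤ r) {a : E → ℝ} (ha : BddSmooth a) :
    IsMultiplier r a := by
  have H : ∀ n : ℕ, ∀ θ : ℝ, 0 ≤ θ → θ < 1 → ∀ a : E → ℝ, BddSmooth a →
      IsMultiplier (θ + n) a := by
    intro n θ hθ0 hθ1
    induction n with
    | zero =>
      intro a ha
      rw [Nat.cast_zero, add_zero]
      rcases hθ0.eq_or_lt with rfl | h
      · exact isMultiplier_zero ha
      · exact isMultiplier_of_lt_one h hθ1 ha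
    | succ n ih =>
      intro a ha
      have := IsMultiplier.succ (r := θ + n) (by positivity) ha ih
      rw [Nat.cast_succ, ← add_assoc]; exact this
  have h1 := Nat.floor_le hr
  have h2 := Nat.lt_floor_add_one r
  have := H ⌊r⌋₊ (r - ⌊r⌋₊) (by linarith) (by linarith) a ha
  rwa [sub_add_cancel] at this

end Multiplication

/-! ### Multi-indices and weak derivatives -/

section Multiindex

variable {N : ℕ}

lemma contDiff_partialDeriv (i : Fin N) {φ : Vel N → ℝ} (h : ContDiff ℝ ∞ φ) :
    ContDiff ℝ ∞ (partialDeriv i φ) :=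
  (h.fderiv_right (m := ∞) (by simp)).clm_apply contDiff_const

lemma hasCompactSupport_partialDeriv (i : Fin N) {φ : Vel N → ℝ} (h : HasCompactSupport φ) :
    HasCompactSupport (partialDeriv i φ) :=
  (h.fderiv ℝ).comp_left (g := fun L : Vel N →L[ℝ] ℝ => L (EuclideanSpace.single i 1)) rfl

lemma partialDeriv_comm (i j : Fin N) {φ : Vel N → ℝ} (h : ContDiff ℝ ∞ φ) :
    partialDeriv i (partialDeriv j φ) = partialDeriv j (partialDeriv i φ) := by
  have hd : Differentiable ℝ (fderiv ℝ φ) :=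
    (h.fderiv_right (m := ∞) (by simp)).differentiable (by simp)
  have e : ∀ (k l : Fin N) (v : Vel N), partialDeriv k (partialDeriv l φ) v =
      fderiv ℝ (fderiv ℝ φ) v (EuclideanSpace.single k 1) (EuclideanSpace.single l 1) := by
    intro k l v
    have := ((hd v).hasFDerivAt.clm_apply
      (hasFDerivAt_const (EuclideanSpace.single l (1 : ℝ)) v)).fderiv
    refine (congrArg (fun L : Vel N →L[ℝ] ℝ => L (EuclideanSpace.single k 1)) this).trans ?_
    simp
  ext v
  rw [e, e]
  exact (h.contDiffAt.isSymmSndFDerivAt (by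
    rw [minSmoothness_of_isRCLikeNormedField]; exact WithTop.coe_le_coe.2 le_top)).eq _ _

lemma contDiff_iterate_partialDeriv (i : Fin N) (n : ℕ) {φ : Vel N → ℝ} (h : ContDiff ℝ ∞ φ) :
    ContDiff ℝ ∞ ((partialDeriv i)^[n] φ) := by
  induction n with
  | zero => exact h
  | succ n ih => rw [Function.iterate_succ_apply']; exact contDiff_partialDeriv i ih

lemma partialDeriv_iterate_comm (i j : Fin N) (n : ℕ) {φ : Vel N → ℝ} (h : ContDiff ℝ ∞ φ) :
    (partialDeriv j)^[n] (partialDeriv i φ) = partialDeriv i ((partialDeriv j)^[n] φ) := by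
  induction n with
  | zero => rfl
  | succ n ih =>
    rw [Function.iterate_succ_apply', Function.iterate_succ_apply', ih,
      partialDeriv_comm _ _ (contDiff_iterate_partialDeriv j n h)]

lemma contDiff_foldr_partialDeriv (α : Fin N → ℕ) (l : List (Fin N)) {φ : Vel N → ℝ}
    (h : ContDiff ℝ ∞ φ) :
    ContDiff ℝ ∞ (l.foldr (fun i ψ => (partialDeriv i)^[α i] ψ) φ) := by
  induction l with
  | nil => exact h
  | cons j l ih => exact contDiff_iterate_partialDeriv j _ ih

/-- The extra derivative is inserted at the place of `i` in the list and commuted outwards past the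
other coordinates; absence of duplicates ensures that it is inserted once. -/
lemma foldr_partialDeriv_add_single (α : Fin N → ℕ) (i : Fin N) (l : List (Fin N)) (hl : l.Nodup)
    {φ : Vel N → ℝ} (h : ContDiff ℝ ∞ φ) :
    l.foldr (fun j ψ => (partialDeriv j)^[(α + Pi.single i 1 : Fin N → ℕ) j] ψ) φ =
      if i ∈ l then partialDeriv i (l.foldr (fun j ψ => (partialDeriv j)^[α j] ψ) φ)
      else l.foldr (fun j ψ => (partialDeriv j)^[α j] ψ) φ := by
  induction l with
  | nil => simp
  | cons j l ih =>
    have hl' := (List.nodup_cons.1 hl)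
    rw [List.foldr_cons, ih hl'.2, List.foldr_cons]
    by_cases hij : i = j
    · subst hij
      rw [if_neg hl'.1, if_pos List.mem_cons_self]
      simp only [Pi.add_apply, Pi.single_eq_same]
      rw [Function.iterate_succ_apply']
    · have e : (α + Pi.single i 1 : Fin N → ℕ) j = α j := by simp [Ne.symm hij]
      rw [e]
      by_cases him : i ∈ l
      · rw [if_pos him, if_pos (List.mem_cons_of_mem _ him),
          partialDeriv_iterate_comm _ _ _ (contDiff_foldr_partialDeriv α l h)]
      · rw [if_neg him, if_neg (by simp [hij, him])]

lemma multiDeriv_add_single (α : Fin N → ℕ) (i : Fin N) {φ : Vel N → ℝ} (h : ContDiff ℝ ∞ φ) :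
    multiDeriv (α + Pi.single i 1) φ = partialDeriv i (multiDeriv α φ) := by
  unfold multiDeriv
  rw [foldr_partialDeriv_add_single α i _ (List.nodup_finRange N) h, if_pos (List.mem_finRange i)]

lemma multiDeriv_zero (φ : Vel N → ℝ) : multiDeriv 0 φ = φ := by
  unfold multiDeriv
  induction List.finRange N with
  | nil => rfl
  | cons j l ih => rw [List.foldr_cons, ih]; rfl

lemma contDiff_multiDeriv (α : Fin N → ℕ) {φ : Vel N → ℝ} (h : ContDiff ℝ ∞ φ) :
    ContDiff ℝ ∞ (multiDeriv α φ) := contDiff_foldr_partialDeriv α _ h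

/-- Induction on the order of a multi-index. -/
lemma multiIndex_induction {P : (Fin N → ℕ) → Prop} (h0 : P 0)
    (hs : ∀ α i, P α → P (α + Pi.single i 1)) (α : Fin N → ℕ) : P α := by
  have H : ∀ n : ℕ, ∀ α : Fin N → ℕ, ∑ i, α i = n → P α := by
    intro n
    induction n with
    | zero =>
      intro α hα
      have : α = 0 := by
        ext i; exact (Finset.sum_eq_zero_iff.1 hα) i (Finset.mem_univ i)
      rw [this]; exact h0
    | succ n ih =>
      intro α hα
      obtain ⟨i, -, hi⟩ := Finset.exists_ne_zero_of_sum_ne_zero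
        (by rw [hα]; exact Nat.succ_ne_zero n : ∑ i, α i ≠ 0)
      have e : α - Pi.single i 1 + Pi.single i 1 = α := by
        ext j
        by_cases hj : j = i
        · subst hj; simp; omega
        · simp [hj]
      rw [← e]
      refine hs _ i (ih _ ?_)
      have h2 : ∑ j, (α - Pi.single i 1 + Pi.single i 1 : Fin N → ℕ) j = n + 1 := by rw [e]; exact hα
      simp only [Pi.add_apply] at h2
      rw [Finset.sum_add_distrib, Finset.sum_pi_single'] at h2
      simpa using h2
  exact H _ α rfl

lemma sum_add_single (α : Fin N → ℕ) (i : Fin N) :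
    ∑ j, (α + Pi.single i 1 : Fin N → ℕ) j = ∑ j, α j + 1 := by
  simp only [Pi.add_apply]
  rw [Finset.sum_add_distrib, Finset.sum_pi_single']; simp

lemma hasCompactSupport_multiDeriv (α : Fin N → ℕ) {φ : Vel N → ℝ} (h : ContDiff ℝ ∞ φ)
    (hc : HasCompactSupport φ) : HasCompactSupport (multiDeriv α φ) := by
  induction α using multiIndex_induction with
  | h0 => rwa [multiDeriv_zero]
  | hs α i ih => rw [multiDeriv_add_single α i h]; exact hasCompactSupport_partialDeriv i ih

lemma multiDeriv_partialDeriv (α : Fin N → ℕ) (i : Fin N) {φ : Vel N → ℝ} (h : ContDiff ℝ ∞ φ) :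
    multiDeriv α (partialDeriv i φ) = partialDeriv i (multiDeriv α φ) := by
  induction α using multiIndex_induction with
  | h0 => rw [multiDeriv_zero, multiDeriv_zero]
  | hs α j ih =>
    rw [multiDeriv_add_single α j h, multiDeriv_add_single α j (contDiff_partialDeriv i h), ih,
      partialDeriv_comm _ _ (contDiff_multiDeriv α h)]

lemma mem_multiIndices {α : Fin N → ℕ} {k : ℕ} : α ∈ multiIndices N k ↔ ∑ i, α i ≤ k := by
  unfold multiIndices
  rw [Finset.mem_filter, Fintype.mem_piFinset]
  refine ⟨fun h => h.2, fun h => ⟨fun i => ?_, h⟩⟩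
  rw [Finset.mem_range]
  have := Finset.single_le_sum (f := α) (fun _ _ => Nat.zero_le _) (Finset.mem_univ i)
  omega

/-- First order weak derivative. -/
def IsWeakPartial (i : Fin N) (f h : Vel N → ℝ) : Prop :=
  ∀ φ : Vel N → ℝ, ContDiff ℝ ∞ φ → HasCompactSupport φ →
    ∫ v, f v * partialDeriv i φ v = -∫ v, h v * φ v

lemma IsWeakDeriv.isWeakPartial {i : Fin N} {f h : Vel N → ℝ}
    (H : IsWeakDeriv (Pi.single i 1) f h) : IsWeakPartial i f h := fun φ hφ hc => by
  have := H.2.2 φ hφ hc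
  have e : multiDeriv (Pi.single i 1) φ = partialDeriv i φ := by
    have := multiDeriv_add_single 0 i hφ
    rwa [zero_add, multiDeriv_zero] at this
  have hs : ∑ j, (Pi.single i 1 : Fin N → ℕ) j = 1 := by
    simp
  rw [e, hs] at this
  rw [this]; ring

/-- The derivatives of `∂ᵢ f` are read off from those of `f`, by testing the first-order relation
against `∂^α φ`. -/
lemma IsWeakDeriv.shift {i : Fin N} {α : Fin N → ℕ} {f h k : Vel N → ℝ}
    (H : IsWeakDeriv (Pi.single i 1) f h) (K : IsWeakDeriv (α + Pi.single i 1) f k) :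
    IsWeakDeriv α h k := by
  refine ⟨H.2.1, K.2.1, fun φ hφ hc => ?_⟩
  have h1 := H.isWeakPartial _ (contDiff_multiDeriv α hφ) (hasCompactSupport_multiDeriv α hφ hc)
  have h2 := K.2.2 φ hφ hc
  rw [multiDeriv_add_single α i hφ, h1, sum_add_single, pow_succ] at h2
  linarith

lemma IsWeakDeriv.succ {i : Fin N} {α : Fin N → ℕ} {f h k : Vel N → ℝ}
    (H : IsWeakDeriv α f h) (hk : LocallyIntegrable k volume) (K : IsWeakPartial i h k) :
    IsWeakDeriv (α + Pi.single i 1) f k := by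
  refine ⟨H.1, hk, fun φ hφ hc => ?_⟩
  have h1 := H.2.2 _ (contDiff_partialDeriv i hφ) (hasCompactSupport_partialDeriv i hc)
  rw [multiDeriv_partialDeriv α i hφ, ← multiDeriv_add_single α i hφ, K φ hφ hc] at h1
  rw [h1, sum_add_single, pow_succ]; ring

lemma IsWeakDeriv.zero_ae_eq {f h : Vel N → ℝ} (H : IsWeakDeriv 0 f h) : f =ᵐ[volume] h := by
  refine ae_eq_of_integral_contDiff_smul_eq H.1 H.2.1 fun φ hφ hc => ?_
  have := H.2.2 φ hφ hc
  rw [multiDeriv_zero] at this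
  simpa [mul_comm] using this

lemma isWeakDeriv_zero_self {f : Vel N → ℝ} (h : LocallyIntegrable f volume) :
    IsWeakDeriv 0 f f := ⟨h, h, fun φ _ _ => by simp [multiDeriv_zero]⟩

end Multiindex

/-! ### Weak derivatives of weighted functions -/

section WeightedDeriv

variable {N : ℕ}

lemma bracket_rpow (q : ℝ) (v : Vel N) : bracket v ^ q = Real.exp (q * logBracket v) := by
  have h : (0 : ℝ) < 1 + ‖v‖ ^ 2 := by positivity
  unfold bracket logBracket
  rw [Real.sqrt_eq_rpow, ← Real.rpow_mul h.le, Real.rpow_def_of_pos h]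
  congr 1; ring

lemma bracket_rpow_pos (q : ℝ) (v : Vel N) : 0 < bracket v ^ q := by
  rw [bracket_rpow]; exact Real.exp_pos _

lemma contDiff_bracket_rpow (q : ℝ) : ContDiff ℝ ∞ (fun v : Vel N => bracket v ^ q) := by
  simp only [bracket_rpow]
  exact Real.contDiff_exp.comp (contDiff_const.mul contDiff_logBracket)

lemma continuous_bracket_rpow (q : ℝ) : Continuous (fun v : Vel N => bracket v ^ q) :=
  (contDiff_bracket_rpow q).continuous

/-- The function `v_i / (1+|v|²)`, the `i`-th derivative of `log ⟨v⟩`. -/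
noncomputable def dlog (i : Fin N) (v : Vel N) : ℝ :=
  inner ℝ ((1 + ‖v‖ ^ 2)⁻¹ • v) (EuclideanSpace.single i (1 : ℝ))

lemma bddSmooth_dlog (i : Fin N) : BddSmooth (dlog i : Vel N → ℝ) := fun n =>
  (bddDeriv_bracket_aux n).2.clm_comp ((innerSL ℝ).flip (EuclideanSpace.single i (1 : ℝ)))

lemma partialDeriv_bracket_rpow_mul (q : ℝ) (i : Fin N) {φ : Vel N → ℝ} (hφ : ContDiff ℝ ∞ φ)
    (v : Vel N) : partialDeriv i (fun v => bracket v ^ q * φ v) v =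
      bracket v ^ q * partialDeriv i φ v + q * dlog i v * (bracket v ^ q * φ v) := by
  have h1 : HasFDerivAt (fun v : Vel N => bracket v ^ q)
      ((bracket v ^ q) • (q • innerSL ℝ ((1 + ‖v‖ ^ 2)⁻¹ • v))) v := by
    have := ((hasFDerivAt_logBracket v).const_mul q).exp
    simpa only [bracket_rpow] using this
  have h2 : HasFDerivAt (fun v : Vel N => bracket v ^ q * φ v) _ v :=
    h1.mul ((hφ.differentiable (by simp)) v).hasFDerivAt
  refine (congrArg (fun L : Vel N →L[ℝ] ℝ => L (EuclideanSpace.single i 1)) h2.fderiv).trans ?_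
  simp only [dlog, partialDeriv, add_apply, smul_apply,
    smul_eq_mul, innerSL_apply_apply]
  ring

/-- The weighted function `⟨v⟩^q f(v)` with complex values. -/
noncomputable def cweighted (q : ℝ) (f : Vel N → ℝ) : Vel N → ℂ :=
  fun v => ((weighted q f v : ℝ) : ℂ)

lemma cweighted_congr {q : ℝ} {f g : Vel N → ℝ} (h : f =ᵐ[volume] g) :
    cweighted q f =ᵐ[volume] cweighted q g := by
  filter_upwards [h] with v hv
  simp [cweighted, weighted, hv]

lemma locallyIntegrable_of_cweighted {q : ℝ} {f : Vel N → ℝ}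
    (h : MemLp (cweighted q f) 2 (volume : Measure (Vel N))) : LocallyIntegrable f volume := by
  have h1 : MemLp (weighted q f) 2 (volume : Measure (Vel N)) := by
    have := h.re
    exact this
  have h2 := (h1.locallyIntegrable (by norm_num)).continuous_smul (continuous_bracket_rpow (-q))
  convert h2 using 2 with v
  simp only [weighted, smul_eq_mul]
  rw [← mul_assoc, bracket_rpow, bracket_rpow, ← Real.exp_add]
  simp

lemma integral_ofReal_mul (f g : Vel N → ℝ) :
    ∫ v, (f v : ℂ) * (g v : ℂ) = ((∫ v, f v * g v : ℝ) : ℂ) := by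
  rw [← integral_complex_ofReal]; simp

lemma LocallyIntegrable.integrable_mul_test {f φ : Vel N → ℝ} (hf : LocallyIntegrable f volume)
    (hφ : Continuous φ) (hc : HasCompactSupport φ) : Integrable (fun v => f v * φ v) volume :=
  hf.integrable_smul_right_of_hasCompactSupport hφ hc

/-- Testing with `⟨v⟩^q φ` in place of `φ`, since `∂ᵢ⟨v⟩^q = q dlog i ⟨v⟩^q`. The commutator with
the weight is thus a bounded smooth multiplier times `q`, and linearity in `q` is what keeps the
dependence on the weight polynomial. -/
lemma IsWeakPartial.hasL2Deriv {q : ℝ} {i : Fin N} {f h : Vel N → ℝ}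
    (hf : MemLp (cweighted q f) 2 (volume : Measure (Vel N)))
    (hh : MemLp (cweighted q h) 2 (volume : Measure (Vel N))) (H : IsWeakPartial i f h) :
    HasL2Deriv (EuclideanSpace.single i (1 : ℝ)) (cweighted q f)
      (cweighted q h + (q : ℂ) • fun v => (dlog i v : ℂ) * cweighted q f v) := by
  have hd := (bddSmooth_dlog i).memLp_mul hf
  refine HasL2Deriv.of_testFunctions hf (hh.add (hd.const_smul (q : ℂ))) fun φ hφ hc => ?_
  have lf := locallyIntegrable_of_cweighted hf
  have lh := locallyIntegrable_of_cweighted hh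
  have hwφ : ContDiff ℝ ∞ (fun v => bracket v ^ q * φ v) := (contDiff_bracket_rpow q).mul hφ
  have hwc : HasCompactSupport (fun v => bracket v ^ q * φ v) := hc.mul_left
  have key := H _ hwφ hwc
  simp only [partialDeriv_bracket_rpow_mul q i hφ] at key
  have hdc : Continuous (dlog i : Vel N → ℝ) := ((bddSmooth_dlog i) 0).smooth.continuous
  have i1 : Integrable (fun v => f v * (bracket v ^ q * partialDeriv i φ v)) volume :=
    LocallyIntegrable.integrable_mul_test lf
      ((continuous_bracket_rpow q).mul (contDiff_partialDeriv i hφ).continuous)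
      (hasCompactSupport_partialDeriv i hc).mul_left
  have i2 : Integrable (fun v => f v * (q * dlog i v * (bracket v ^ q * φ v))) volume :=
    LocallyIntegrable.integrable_mul_test lf
      ((continuous_const.mul hdc).mul hwφ.continuous) hwc.mul_left
  have i3 : Integrable (fun v => h v * (bracket v ^ q * φ v)) volume :=
    LocallyIntegrable.integrable_mul_test lh hwφ.continuous hwc
  have e1 : ∫ v, cweighted q f v * ((fderiv ℝ φ v (EuclideanSpace.single i 1) : ℝ) : ℂ) =
      ((∫ v, f v * (bracket v ^ q * partialDeriv i φ v) : ℝ) : ℂ) := by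
    simp only [cweighted]
    rw [integral_ofReal_mul]
    congr 1
    refine integral_congr_ae (Filter.Eventually.of_forall fun v => ?_)
    simp only [weighted, partialDeriv]; ring
  have e2 : ∫ v, (cweighted q h + (q : ℂ) • fun v => (dlog i v : ℂ) * cweighted q f v) v *
      (φ v : ℂ) = ((∫ v, (h v * (bracket v ^ q * φ v) +
        f v * (q * dlog i v * (bracket v ^ q * φ v))) : ℝ) : ℂ) := by
    rw [← integral_complex_ofReal]
    refine integral_congr_ae (Filter.Eventually.of_forall fun v => ?_)
    simp only [cweighted, weighted, Pi.add_apply, Pi.smul_apply, smul_eq_mul]; push_cast; ring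
  rw [e1, e2, ← Complex.ofReal_neg]
  congr 1
  rw [integral_add i3 i2]
  have key2 : ∫ v, f v * (bracket v ^ q * partialDeriv i φ v +
      q * dlog i v * (bracket v ^ q * φ v)) = (∫ v, f v * (bracket v ^ q * partialDeriv i φ v)) +
      ∫ v, f v * (q * dlog i v * (bracket v ^ q * φ v)) := by
    rw [← integral_add i1 i2]
    simp only [mul_add]
  rw [key2] at key
  linarith

lemma exists_isWeakPartial {q : ℝ} (i : Fin N) {f : Vel N → ℝ}
    (hf : MemLp (cweighted q f) 2 (volume : Measure (Vel N))) (h1 : hnorm 1 (cweighted q f) < ⊤) :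
    ∃ h : Vel N → ℝ, MemLp (cweighted q h) 2 (volume : Measure (Vel N)) ∧ IsWeakPartial i f h := by
  obtain ⟨K, hK⟩ := exists_hasL2Deriv hf h1 (EuclideanSpace.single i (1 : ℝ))
  have hd := (bddSmooth_dlog i).memLp_mul hf
  -- The relation `∂ᵢ(⟨v⟩^q f) = ⟨v⟩^q ∂ᵢf + q dlog i ⟨v⟩^q f` solved for `∂ᵢ f`. The real part is
  -- taken because `K` is only known to be a complex L² function.
  let h : Vel N → ℝ := fun v => bracket v ^ (-q) * (K v).re - q * dlog i v * f v
  have hcw : ∀ v, cweighted q h v = ((K v).re : ℂ) - (q : ℂ) * ((dlog i v : ℂ) * cweighted q f v) :=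
    fun v => by
      have e : bracket v ^ q * bracket v ^ (-q) = 1 := by
        rw [bracket_rpow, bracket_rpow, ← Real.exp_add]; simp
      have e2 : weighted q h v = (K v).re - q * (dlog i v * weighted q f v) := by
        simp only [weighted, h]
        linear_combination (K v).re * e
      simp only [cweighted, e2]
      push_cast; ring
  have hh : MemLp (cweighted q h) 2 (volume : Measure (Vel N)) := by
    have : cweighted q h = (fun v => ((K v).re : ℂ)) -
        (q : ℂ) • fun v => (dlog i v : ℂ) * cweighted q f v := by
      ext v; rw [hcw]; rfl
    rw [this]
    exact (hK.right.re.ofReal).sub (hd.const_smul (q : ℂ))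
  refine ⟨h, hh, fun φ hφ hc => ?_⟩
  have lf := locallyIntegrable_of_cweighted hf
  have hψ : ContDiff ℝ ∞ (fun v => bracket v ^ (-q) * φ v) := (contDiff_bracket_rpow (-q)).mul hφ
  have hψc : HasCompactSupport (fun v => bracket v ^ (-q) * φ v) := hc.mul_left
  have hψC : ContDiff ℝ ∞ (fun v => ((bracket v ^ (-q) * φ v : ℝ) : ℂ)) :=
    Complex.ofRealCLM.contDiff.comp hψ
  have hψCc : HasCompactSupport (fun v => ((bracket v ^ (-q) * φ v : ℝ) : ℂ)) :=
    hψc.comp_left (g := Complex.ofReal) rfl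
  have key := hK.integral_eq (hψCc.toSchwartzMap hψC)
  have hD : ∀ v, (LineDeriv.lineDerivOp (EuclideanSpace.single i (1 : ℝ))
      (hψCc.toSchwartzMap hψC)) v =
      ((bracket v ^ (-q) * partialDeriv i φ v + (-q) * dlog i v * (bracket v ^ (-q) * φ v) : ℝ) :
        ℂ) := fun v => by
    rw [← partialDeriv_bracket_rpow_mul (-q) i hφ v, SchwartzMap.lineDerivOp_apply_eq_fderiv]
    have := (Complex.ofRealCLM.hasFDerivAt.comp v
      ((hψ.differentiable (by simp)) v).hasFDerivAt).fderiv
    exact congrArg (fun L : Vel N →L[ℝ] ℂ => L (EuclideanSpace.single i 1)) this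
  simp only [hD] at key
  have key2 := congrArg Complex.re key
  have hdc : Continuous (dlog i : Vel N → ℝ) := ((bddSmooth_dlog i) 0).smooth.continuous
  have i1 : Integrable (fun v => f v * partialDeriv i φ v) volume :=
    LocallyIntegrable.integrable_mul_test lf (contDiff_partialDeriv i hφ).continuous
      (hasCompactSupport_partialDeriv i hc)
  have i2 : Integrable (fun v => f v * (q * dlog i v * φ v)) volume :=
    LocallyIntegrable.integrable_mul_test lf
      ((continuous_const.mul hdc).mul hφ.continuous) hc.mul_left
  have i3 : Integrable (fun v => (K v).re * (bracket v ^ (-q) * φ v)) volume :=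
    LocallyIntegrable.integrable_mul_test (hK.right.re.locallyIntegrable (by norm_num))
      hψ.continuous hψc
  have e : ∀ v, bracket v ^ q * bracket v ^ (-q) = 1 := fun v : Vel N => by
    rw [bracket_rpow, bracket_rpow, ← Real.exp_add]; simp
  have eL : (∫ v, cweighted q f v * ((bracket v ^ (-q) * partialDeriv i φ v +
      (-q) * dlog i v * (bracket v ^ (-q) * φ v) : ℝ) : ℂ)).re =
      (∫ v, f v * partialDeriv i φ v) - ∫ v, f v * (q * dlog i v * φ v) := by
    simp only [cweighted]
    rw [integral_ofReal_mul, Complex.ofReal_re, ← integral_sub i1 i2]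
    refine integral_congr_ae (Filter.Eventually.of_forall fun v => ?_)
    simp only [weighted]
    linear_combination (f v * partialDeriv i φ v - q * f v * dlog i v * φ v) * e v
  have eR : (-∫ v, K v * (hψCc.toSchwartzMap hψC) v).re =
      -∫ v, (K v).re * (bracket v ^ (-q) * φ v) := by
    rw [Complex.neg_re]
    congr 1
    have hi := integrable_mul_of_memLp hK.right ((hψCc.toSchwartzMap hψC).memLp 2)
    have := integral_re hi
    refine this.symm.trans ?_
    refine integral_congr_ae (Filter.Eventually.of_forall fun v => ?_)
    change (K v * ((bracket v ^ (-q) * φ v : ℝ) : ℂ)).re = _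
    rw [Complex.re_mul_ofReal]
  rw [eL, eR] at key2
  have eH : ∫ v, h v * φ v = (∫ v, (K v).re * (bracket v ^ (-q) * φ v)) -
      ∫ v, f v * (q * dlog i v * φ v) := by
    rw [← integral_sub i3 i2]
    refine integral_congr_ae (Filter.Eventually.of_forall fun v => ?_)
    simp only [h]; ring
  rw [eH]
  linarith

end WeightedDeriv

/-! ### Weighted Sobolev norms against Fourier norms of weighted functions -/

section WeightedConversion

variable {N : ℕ}

lemma eLpNorm_weight_nonneg_aux {η : ℝ} (hη : 0 ≤ η) : ‖(η : ℂ)‖ₑ ≤ ENNReal.ofReal (1 + η) := by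
  rw [← ofReal_norm, Complex.norm_real, Real.norm_of_nonneg hη]
  exact ENNReal.ofReal_le_ofReal (by linarith)

lemma one_le_ofReal_one_add {η : ℝ} (hη : 0 ≤ η) : 1 ≤ ENNReal.ofReal (1 + η) := by
  rw [← ENNReal.ofReal_one]; exact ENNReal.ofReal_le_ofReal (by linarith)

lemma sum_shift_le (F : (Fin N → ℕ) → ℝ≥0∞) (i : Fin N) (n : ℕ) :
    ∑ α ∈ multiIndices N n, F (α + Pi.single i 1) ≤ ∑ α ∈ multiIndices N (n + 1), F α := by
  have hinj : Function.Injective fun α : Fin N → ℕ => α + Pi.single i 1 := add_left_injective _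
  refine (Finset.sum_map (multiIndices N n) ⟨_, hinj⟩ F).symm.trans_le ?_
  refine Finset.sum_le_sum_of_subset fun α hα => ?_
  obtain ⟨β, hβ, rfl⟩ := Finset.mem_map.1 hα
  rw [mem_multiIndices] at hβ ⊢
  change ∑ j, (β + Pi.single i 1 : Fin N → ℕ) j ≤ _
  rw [sum_add_single]; omega

lemma exists_isMultiplier_dlog {r : ℝ} (hr : 0 ≤ r) : ∃ M : ℝ≥0, ∀ i : Fin N, ∀ u : Vel N → ℂ,
    MemLp u 2 volume → hnorm r (fun v => (dlog i v : ℂ) * u v) ≤ M * hnorm r u := by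
  have h : ∀ i : Fin N, IsMultiplier r (dlog i : Vel N → ℝ) := fun i =>
    isMultiplier_of_bddSmooth hr (bddSmooth_dlog i)
  choose M hM using h
  refine ⟨∑ i, M i, fun i u hu => ((hM i).2 u hu).trans ?_⟩
  gcongr
  exact Finset.single_le_sum (f := M) (fun _ _ => zero_le) (Finset.mem_univ i)

/-- Each order of differentiation produces one commutator `η dlog i`, hence one factor `1+η`. The
induction hypothesis is applied to `g` and to each `∂ᵢ g`, whose derivatives are a shift of the
family `D`. -/
lemma hnorm_cweighted_le_sum (θ : ℝ) (hθ : 0 ≤ θ) (n : ℕ) : ∃ C : ℝ≥0, ∀ η : ℝ, 0 ≤ η →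
    ∀ (g : Vel N → ℝ) (D : (Fin N → ℕ) → Vel N → ℝ),
      (∀ α ∈ multiIndices N n, IsWeakDeriv α g (D α) ∧ MemLp (cweighted η (D α)) 2 volume) →
      hnorm (θ + n) (cweighted η g) ≤ C * ENNReal.ofReal (1 + η) ^ n *
        ∑ α ∈ multiIndices N n, hnorm θ (cweighted η (D α)) := by
  induction n with
  | zero =>
    refine ⟨1, fun η _ g D hD => ?_⟩
    have h0 : (0 : Fin N → ℕ) ∈ multiIndices N 0 := by simp [mem_multiIndices]
    simp only [Nat.cast_zero, add_zero, ENNReal.coe_one, pow_zero, one_mul]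
    rw [hnorm_congr (cweighted_congr (hD 0 h0).1.zero_ae_eq)]
    exact Finset.single_le_sum (f := fun α => hnorm θ (cweighted η (D α)))
      (fun _ _ => zero_le) h0
  | succ n ih =>
    obtain ⟨C, hC⟩ := ih
    obtain ⟨M, hM⟩ := exists_isMultiplier_dlog (N := N) (r := θ + n) (by positivity)
    refine ⟨C + N * (C + M * C), fun η hη g D hD => ?_⟩
    set e := ENNReal.ofReal (1 + η)
    have he : 1 ≤ e := one_le_ofReal_one_add hη
    set S := ∑ α ∈ multiIndices N (n + 1), hnorm θ (cweighted η (D α))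
    have hsub : multiIndices N n ⊆ multiIndices N (n + 1) := fun α hα => by
      rw [mem_multiIndices] at hα ⊢; omega
    have hg : hnorm (θ + n) (cweighted η g) ≤ C * e ^ n * S :=
      (hC η hη g D fun α hα => hD α (hsub hα)).trans
        (by gcongr; exact Finset.sum_le_sum_of_subset hsub)
    have h0 := hD 0 (by simp [mem_multiIndices])
    have gmem : MemLp (cweighted η g) 2 volume :=
      h0.2.ae_eq (cweighted_congr h0.1.zero_ae_eq).symm
    have hi : ∀ i : Fin N, IsWeakDeriv (Pi.single i 1) g (D (Pi.single i 1)) ∧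
        MemLp (cweighted η (D (Pi.single i 1))) 2 volume := fun i => hD _ (by
      rw [mem_multiIndices]; simp)
    have hdi : ∀ i : Fin N, hnorm (θ + n) (cweighted η (D (Pi.single i 1))) ≤ C * e ^ n * S := by
      intro i
      refine (hC η hη (D (Pi.single i 1)) (fun α => D (α + Pi.single i 1)) fun α hα => ?_).trans ?_
      · have := hD (α + Pi.single i 1) (by
          rw [mem_multiIndices] at hα ⊢; rw [sum_add_single]; omega)
        exact ⟨(hi i).1.shift this.1, this.2⟩
      · gcongr
        exact sum_shift_le (fun α => hnorm θ (cweighted η (D α))) i n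
    have key := hnorm_succ_le (EuclideanSpace.basisFun (Fin N) ℝ) (r := θ + n) (u := cweighted η g)
      (h := fun i => cweighted η (D (Pi.single i 1)) +
        (η : ℂ) • fun v => (dlog i v : ℂ) * cweighted η g v) (fun i => by
          rw [EuclideanSpace.basisFun_apply]
          exact (hi i).1.isWeakPartial.hasL2Deriv gmem (hi i).2)
    have hterm : ∀ i : Fin N, hnorm (θ + n) (cweighted η (D (Pi.single i 1)) +
        (η : ℂ) • fun v => (dlog i v : ℂ) * cweighted η g v) ≤
        C * e ^ n * S + e * (M * (C * e ^ n * S)) := fun i => by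
      have hd := (bddSmooth_dlog i).memLp_mul gmem
      refine (hnorm_add_le _ (hi i).2 (hd.const_smul _)).trans (add_le_add (hdi i) ?_)
      rw [hnorm_const_smul _ hd]
      refine mul_le_mul' (eLpNorm_weight_nonneg_aux hη) ((hM i _ gmem).trans ?_)
      gcongr
    have e0 : θ + ((n + 1 : ℕ) : ℝ) = θ + n + 1 := by push_cast; ring
    rw [e0]
    refine key.trans ((add_le_add hg (Finset.sum_le_sum fun i _ => hterm i)).trans ?_)
    rw [Finset.sum_const, Finset.card_univ, Fintype.card_fin, nsmul_eq_mul]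
    have h1 : C * e ^ n * S ≤ C * e ^ (n + 1) * S := by
      gcongr
      exact n.le_succ
    calc (C : ℝ≥0∞) * e ^ n * S + N * (C * e ^ n * S + e * (M * (C * e ^ n * S)))
        ≤ C * e ^ (n + 1) * S + N * (C * e ^ (n + 1) * S + e * (M * (C * e ^ n * S))) := by gcongr
      _ = ((C + N * (C + M * C) : ℝ≥0) : ℝ≥0∞) * e ^ (n + 1) * S := by push_cast; ring

/-- Reverse direction: derivatives are constructed one at a time, each trading one order of `hnorm`
for a factor `1+η`. The order `ρ` is quantified inside the induction because it is raised by one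
when the number of derivatives drops. -/
lemma exists_isWeakDeriv_hnorm_le (n : ℕ) : ∀ ρ : ℝ, 0 ≤ ρ → ∃ C : ℝ≥0, ∀ η : ℝ, 0 ≤ η →
    ∀ u : Vel N → ℝ, MemLp (cweighted η u) 2 volume → hnorm (ρ + n) (cweighted η u) < ⊤ →
      ∀ α : Fin N → ℕ, ∑ i, α i = n → ∃ h, IsWeakDeriv α u h ∧
        MemLp (cweighted η h) 2 volume ∧ hnorm ρ (cweighted η h) ≤
          C * ENNReal.ofReal (1 + η) ^ n * hnorm (ρ + n) (cweighted η u) := by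
  induction n with
  | zero =>
    refine fun ρ _ => ⟨1, fun η _ u hu _ α hα => ⟨u, ?_, hu, by simp⟩⟩
    have : α = 0 := by
      ext i; exact (Finset.sum_eq_zero_iff.1 hα) i (Finset.mem_univ i)
    rw [this]
    exact isWeakDeriv_zero_self (locallyIntegrable_of_cweighted hu)
  | succ n ih =>
    intro ρ hρ
    obtain ⟨C, hC⟩ := ih (ρ + 1) (by linarith)
    obtain ⟨M, hM⟩ := exists_isMultiplier_dlog (N := N) hρ
    refine ⟨(1 + M) * C, fun η hη u hu hfin α hα => ?_⟩
    set e := ENNReal.ofReal (1 + η)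
    have he : 1 ≤ e := one_le_ofReal_one_add hη
    have e0 : ρ + ((n + 1 : ℕ) : ℝ) = ρ + 1 + n := by push_cast; ring
    rw [e0] at hfin ⊢
    obtain ⟨β, i, rfl⟩ : ∃ (β : Fin N → ℕ) (i : Fin N), α = β + Pi.single i 1 := by
      obtain ⟨i, -, hi⟩ := Finset.exists_ne_zero_of_sum_ne_zero
        (by rw [hα]; exact Nat.succ_ne_zero n : ∑ i, α i ≠ 0)
      refine ⟨α - Pi.single i 1, i, ?_⟩
      ext j
      by_cases hj : j = i
      · subst hj; simp; omega
      · simp [hj]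
    rw [sum_add_single] at hα
    obtain ⟨h', w', m', b'⟩ := hC η hη u hu hfin β (by omega)
    have hfin' : hnorm (ρ + 1) (cweighted η h') < ⊤ := b'.trans_lt
      (ENNReal.mul_lt_top (ENNReal.mul_lt_top ENNReal.coe_lt_top
        (ENNReal.pow_lt_top ENNReal.ofReal_lt_top)) hfin)
    obtain ⟨h, hm, hw⟩ := exists_isWeakPartial i m'
      ((hnorm_mono (by linarith) _).trans_lt hfin')
    refine ⟨h, w'.succ (locallyIntegrable_of_cweighted hm) hw, hm, ?_⟩
    have hd := (bddSmooth_dlog i).memLp_mul m'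
    have H := hw.hasL2Deriv m' hm
    have e1 : cweighted η h = (cweighted η h + (η : ℂ) • fun v => (dlog i v : ℂ) * cweighted η h' v)
        + (-(η : ℂ)) • fun v => (dlog i v : ℂ) * cweighted η h' v := by
      rw [neg_smul, add_neg_cancel_right]
    have h1 := H.hnorm_le ρ
    rw [← ofReal_norm (EuclideanSpace.single i (1 : ℝ)), PiLp.norm_single, norm_one,
      ENNReal.ofReal_one, one_mul] at h1
    have h2 : hnorm ρ (cweighted η h) ≤
        hnorm (ρ + 1) (cweighted η h') + e * (M * hnorm (ρ + 1) (cweighted η h')) := by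
      rw [e1]
      refine (hnorm_add_le _ H.right (hd.const_smul _)).trans (add_le_add h1 ?_)
      rw [hnorm_const_smul _ hd, enorm_neg]
      refine mul_le_mul' (eLpNorm_weight_nonneg_aux hη) ((hM i _ m').trans ?_)
      gcongr
      exact hnorm_mono (by linarith) _
    calc hnorm ρ (cweighted η h)
        ≤ 1 * hnorm (ρ + 1) (cweighted η h') + e * (M * hnorm (ρ + 1) (cweighted η h')) := by
          rwa [one_mul]
      _ ≤ e * hnorm (ρ + 1) (cweighted η h') + e * (M * hnorm (ρ + 1) (cweighted η h')) := by
          gcongr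
      _ = e * (1 + M) * hnorm (ρ + 1) (cweighted η h') := by ring
      _ ≤ e * (1 + M) * (C * e ^ n * hnorm (ρ + 1 + n) (cweighted η u)) := by gcongr
      _ = _ := by push_cast; ring

lemma fourierSobolevNorm_weighted {r q : ℝ} {f : Vel N → ℝ}
    (h : MemLp (cweighted q f) 2 (volume : Measure (Vel N))) :
    fourierSobolevNorm r (weighted q f) = hnorm r (cweighted q f) := fourierSobolevNorm_eq r h

lemma sq_rpow_half (x : ℝ≥0∞) : (x ^ 2) ^ (1 / 2 : ℝ) = x := by
  rw [← ENNReal.rpow_natCast, ← ENNReal.rpow_mul]; norm_num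

/-- The weighted Sobolev norm controls the Fourier norm of the weighted function. -/
theorem hnorm_cweighted_le_sobolevNorm {s : ℝ} (hs : 0 ≤ s) : ∃ C : ℝ≥0, ∀ η : ℝ, 0 ≤ η →
    ∀ g : Vel N → ℝ, MemSobolevSpace s η g → MemLp (cweighted η g) 2 volume ∧
      hnorm s (cweighted η g) ≤ C * ENNReal.ofReal (1 + η) ^ ⌊s⌋₊ * sobolevNorm s η g := by
  obtain ⟨C, hC⟩ := hnorm_cweighted_le_sum (N := N) (s - ⌊s⌋₊)
    (by linarith [Nat.floor_le hs]) ⌊s⌋₊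
  set k := ⌊s⌋₊
  have main : ∀ η : ℝ, 0 ≤ η → ∀ (g : Vel N → ℝ) (D : (Fin N → ℕ) → Vel N → ℝ),
      (∀ α ∈ multiIndices N k, IsWeakDeriv α g (D α)) →
      (∑ α ∈ multiIndices N k, fourierSobolevNorm (s - k) (weighted η (D α)) ^ 2) ^ (1 / 2 : ℝ) < ⊤ →
      MemLp (cweighted η g) 2 volume ∧ hnorm s (cweighted η g) ≤
        ((C + 1) * ((multiIndices N k).card + 1) : ℝ≥0) * ENNReal.ofReal (1 + η) ^ k *
        (∑ α ∈ multiIndices N k, fourierSobolevNorm (s - k) (weighted η (D α)) ^ 2) ^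
          (1 / 2 : ℝ) := by
    intro η hη g D hD hfin
    set T := (∑ α ∈ multiIndices N k, fourierSobolevNorm (s - k) (weighted η (D α)) ^ 2) ^
          (1 / 2 : ℝ)
    have hle : ∀ α ∈ multiIndices N k, fourierSobolevNorm (s - k) (weighted η (D α)) ≤ T := by
      intro α hα
      rw [← sq_rpow_half (fourierSobolevNorm (s - k) (weighted η (D α)))]
      refine ENNReal.rpow_le_rpow ?_ (by norm_num)
      exact Finset.single_le_sum
        (f := fun α => fourierSobolevNorm (s - k) (weighted η (D α)) ^ 2) (fun _ _ => zero_le) hα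
    have hm : ∀ α ∈ multiIndices N k, MemLp (cweighted η (D α)) 2 volume := fun α hα =>
      memLp_of_fourierSobolevNorm_lt_top ((hle α hα).trans_lt hfin)
    have h0 : (0 : Fin N → ℕ) ∈ multiIndices N k := by simp [mem_multiIndices]
    refine ⟨(hm 0 h0).ae_eq (cweighted_congr (hD 0 h0).zero_ae_eq).symm, ?_⟩
    have h1 := hC η hη g D fun α hα => ⟨hD α hα, hm α hα⟩
    rw [sub_add_cancel] at h1
    refine h1.trans ?_
    have h2 : ∑ α ∈ multiIndices N k, hnorm (s - k) (cweighted η (D α)) ≤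
        (multiIndices N k).card * T := by
      rw [← nsmul_eq_mul]
      refine Finset.sum_le_card_nsmul _ _ _ fun α hα => ?_
      rw [← fourierSobolevNorm_weighted (hm α hα)]
      exact hle α hα
    calc _ ≤ C * ENNReal.ofReal (1 + η) ^ k * ((multiIndices N k).card * T) := by gcongr
      _ ≤ (C + 1) * ENNReal.ofReal (1 + η) ^ k * (((multiIndices N k).card + 1) * T) := by
        gcongr <;> exact le_self_add
      _ = _ := by push_cast; ring
  refine ⟨(C + 1) * ((multiIndices N k).card + 1), fun η hη g hg => ?_⟩
  constructor
  · unfold MemSobolevSpace sobolevNorm at hg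
    rw [iInf_lt_iff] at hg
    obtain ⟨D, hD⟩ := hg
    rw [iInf_lt_iff] at hD
    obtain ⟨hD, hlt⟩ := hD
    exact (main η hη g D hD hlt).1
  · set c : ℝ≥0∞ := ((C + 1) * ((multiIndices N k).card + 1) : ℝ≥0) * ENNReal.ofReal (1 + η) ^ k
    have hc0 : c ≠ 0 := by
      refine mul_ne_zero (ENNReal.coe_ne_zero.2 (by positivity)) (pow_ne_zero _ ?_)
      exact (lt_of_lt_of_le one_pos (one_le_ofReal_one_add hη)).ne'
    have hct : c ≠ ⊤ := ENNReal.mul_ne_top ENNReal.coe_ne_top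
      (ENNReal.pow_ne_top ENNReal.ofReal_ne_top)
    -- Dividing by the finite nonzero constant allows the infimum over families of derivatives to be
    -- taken directly; families with infinite sum are harmless.
    have : hnorm s (cweighted η g) / c ≤ sobolevNorm s η g := by
      unfold sobolevNorm
      refine le_iInf₂ fun D hD => ?_
      by_cases hT : (∑ α ∈ multiIndices N k, fourierSobolevNorm (s - k) (weighted η (D α)) ^ 2) ^
          (1 / 2 : ℝ) < ⊤
      · exact ENNReal.div_le_of_le_mul' (main η hη g D hD hT).2
      · rw [not_lt_top_iff] at hT
        rw [hT]; exact le_top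
    exact (ENNReal.div_le_iff' hc0 hct).1 this

/-- The Fourier norm of the weighted function controls the weighted Sobolev norm. -/
theorem sobolevNorm_le_hnorm_cweighted {s : ℝ} (hs : 0 ≤ s) : ∃ C : ℝ≥0, ∀ η : ℝ, 0 ≤ η →
    ∀ u : Vel N → ℝ, MemLp (cweighted η u) 2 volume → hnorm s (cweighted η u) < ⊤ →
      sobolevNorm s η u ≤ C * ENNReal.ofReal (1 + η) ^ ⌊s⌋₊ * hnorm s (cweighted η u) := by
  set k := ⌊s⌋₊
  have hk : (k : ℝ) ≤ s := Nat.floor_le hs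
  have H : ∀ n : ℕ, ∃ C : ℝ≥0, n ≤ k → ∀ η : ℝ, 0 ≤ η →
    ∀ u : Vel N → ℝ, MemLp (cweighted η u) 2 volume → hnorm s (cweighted η u) < ⊤ →
      ∀ α : Fin N → ℕ, ∑ i, α i = n → ∃ h, IsWeakDeriv α u h ∧
        MemLp (cweighted η h) 2 volume ∧ hnorm (s - n) (cweighted η h) ≤
          C * ENNReal.ofReal (1 + η) ^ n * hnorm s (cweighted η u) := by
    intro n
    by_cases hn : n ≤ k
    · have hnk : (n : ℝ) ≤ k := by exact_mod_cast hn
      obtain ⟨C, hC⟩ := exists_isWeakDeriv_hnorm_le (N := N) n (s - n) (by linarith)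
      rw [sub_add_cancel] at hC
      exact ⟨C, fun _ => hC⟩
    · exact ⟨0, fun h => absurd h hn⟩
  choose C hC using H
  refine ⟨(multiIndices N k).card * ∑ n ∈ Finset.range (k + 1), C n, fun η hη u hu hfin => ?_⟩
  set e := ENNReal.ofReal (1 + η)
  have he : 1 ≤ e := one_le_ofReal_one_add hη
  -- A derivative of order `n ≤ k` is controlled at order `s - n`, which is at least the order `s -
  -- k` required by the norm.
  have hD : ∀ α : Fin N → ℕ, ∃ h, α ∈ multiIndices N k → IsWeakDeriv α u h ∧
        MemLp (cweighted η h) 2 volume ∧ hnorm (s - k) (cweighted η h) ≤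
          (∑ n ∈ Finset.range (k + 1), C n : ℝ≥0) * e ^ k * hnorm s (cweighted η u) := by
    intro α
    by_cases hα : α ∈ multiIndices N k
    · rw [mem_multiIndices] at hα
      obtain ⟨h, h1, h2, h3⟩ := hC _ hα η hη u hu hfin α rfl
      refine ⟨h, fun _ => ⟨h1, h2, ?_⟩⟩
      have hα' : ((∑ i, α i : ℕ) : ℝ) ≤ k := by exact_mod_cast hα
      refine (hnorm_mono (by linarith) _).trans (h3.trans ?_)
      gcongr
      · exact Finset.single_le_sum (f := C) (fun _ _ => zero_le)
          (Finset.mem_range.2 (by omega))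
    · exact ⟨0, fun h => absurd h hα⟩
  choose D hD using hD
  unfold sobolevNorm
  refine (iInf₂_le D fun α hα => (hD α hα).1).trans ?_
  set B : ℝ≥0∞ := (∑ n ∈ Finset.range (k + 1), C n : ℝ≥0) * e ^ k * hnorm s (cweighted η u)
  have hsum : ∑ α ∈ multiIndices N k, fourierSobolevNorm (s - k) (weighted η (D α)) ^ 2 ≤
      ((multiIndices N k).card * B) ^ 2 := by
    calc _ ≤ ∑ α ∈ multiIndices N k, B ^ 2 := Finset.sum_le_sum fun α hα => by
          rw [fourierSobolevNorm_weighted (hD α hα).2.1]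
          gcongr
          exact (hD α hα).2.2
      _ = (multiIndices N k).card * B ^ 2 := by rw [Finset.sum_const, nsmul_eq_mul]
      _ ≤ (multiIndices N k).card ^ 2 * B ^ 2 := by
        gcongr
        exact_mod_cast Nat.le_self_pow two_ne_zero _
      _ = _ := (mul_pow _ _ _).symm
  refine (ENNReal.rpow_le_rpow hsum (by norm_num)).trans ?_
  rw [sq_rpow_half]
  simp only [B]
  push_cast
  rw [← mul_assoc, ← mul_assoc]

end WeightedConversion

/-! ### Polar coordinates and integration over hyperplanes -/

section PlaneSwap

variable {E : Type*} [NormedAddCommGroup E] [InnerProductSpace ℝ E] [FiniteDimensional ℝ E]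
  [MeasurableSpace E] [BorelSpace E]

/-- Integration in polar coordinates. -/
lemma lintegral_polar [Nontrivial E] {F : E → ℝ≥0∞} (hF : Measurable F) :
    ∫⁻ x, F x = ∫⁻ ϑ, (∫⁻ r in Set.Ioi (0 : ℝ), ENNReal.ofReal (r ^ (Module.finrank ℝ E - 1)) *
      F (r • (ϑ : E))) ∂(volume : Measure E).toSphere := by
  have mp := (volume : Measure E).measurePreserving_homeomorphUnitSphereProd
  have h1 : ∫⁻ x, F x = ∫⁻ x : ({0}ᶜ : Set E), F x ∂((volume : Measure E).comap Subtype.val) := by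
    refine Eq.trans ?_ (lintegral_subtype_comap (measurableSet_singleton (0 : E)).compl F).symm
    rw [restrict_compl_singleton]
  have h2 : ∀ x : ({0}ᶜ : Set E), F x = (fun p : Metric.sphere (0 : E) 1 × Set.Ioi (0 : ℝ) =>
      F ((p.2 : ℝ) • (p.1 : E))) (homeomorphUnitSphereProd E x) := by
    intro x
    have := congrArg Subtype.val ((homeomorphUnitSphereProd E).symm_apply_apply x)
    rw [homeomorphUnitSphereProd_symm_apply_coe] at this
    exact (congrArg F this).symm
  have hm : Measurable (fun p : Metric.sphere (0 : E) 1 × Set.Ioi (0 : ℝ) =>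
      F ((p.2 : ℝ) • (p.1 : E))) := hF.comp (by fun_prop)
  rw [h1]
  simp_rw [h2]
  rw [mp.lintegral_comp hm, lintegral_prod _ hm.aemeasurable]
  refine lintegral_congr fun ϑ => ?_
  rw [Measure.volumeIoiPow]
  refine (lintegral_withDensity_eq_lintegral_mul _ (by fun_prop)
    (hm.comp (measurable_prodMk_left (x := ϑ)))).trans ?_
  exact lintegral_subtype_comap measurableSet_Ioi
    (fun r : ℝ => ENNReal.ofReal (r ^ (Module.finrank ℝ E - 1)) * F (r • (ϑ : E)))

/-- The linear involution of `E × ℝ` exchanging the component along `ϑ` with the scalar. -/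
noncomputable def planeSwap (ϑ : E) : (E × ℝ) →ₗ[ℝ] (E × ℝ) where
  toFun z := (z.1 + (z.2 - inner ℝ ϑ z.1) • ϑ, inner ℝ ϑ z.1)
  map_add' a b := by
    ext
    · simp only [Prod.fst_add, Prod.snd_add, inner_add_right]; module
    · simp [inner_add_right]
  map_smul' c a := by
    ext
    · simp only [Prod.smul_fst, Prod.smul_snd, inner_smul_right, smul_eq_mul, RingHom.id_apply]
      module
    · simp [inner_smul_right]

lemma planeSwap_apply (ϑ : E) (z : E × ℝ) :
    planeSwap ϑ z = (z.1 + (z.2 - inner ℝ ϑ z.1) • ϑ, inner ℝ ϑ z.1) := rfl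

lemma planeSwap_planeSwap {ϑ : E} (hϑ : ‖ϑ‖ = 1) (z : E × ℝ) :
    planeSwap ϑ (planeSwap ϑ z) = z := by
  have h1 : inner ℝ ϑ (z.1 + (z.2 - inner ℝ ϑ z.1) • ϑ) = z.2 := by
    rw [inner_add_right, inner_smul_right, real_inner_self_eq_norm_sq, hϑ]; ring
  rw [planeSwap_apply, planeSwap_apply]
  ext
  · simp only [h1]; module
  · exact h1

/-- A linear involution has determinant `±1`. -/
lemma measurePreserving_planeSwap {ϑ : E} (hϑ : ‖ϑ‖ = 1) :
    MeasurePreserving (planeSwap ϑ) ((volume : Measure E).prod (volume : Measure ℝ))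
      ((volume : Measure E).prod volume) := by
  have h1 : planeSwap ϑ ∘ₗ planeSwap ϑ = LinearMap.id :=
    LinearMap.ext fun z => planeSwap_planeSwap hϑ z
  have h2 : LinearMap.det (planeSwap ϑ) * LinearMap.det (planeSwap ϑ) = 1 := by
    rw [← LinearMap.det_comp, h1, LinearMap.det_id]
  have h3 : |LinearMap.det (planeSwap ϑ)| = 1 := by
    rw [← abs_mul_abs_self] at h2
    nlinarith [abs_nonneg (LinearMap.det (planeSwap ϑ))]
  have h4 : LinearMap.det (planeSwap ϑ) ≠ 0 := by
    intro h; rw [h] at h2; simp at h2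
  refine ⟨(LinearMap.continuous_of_finiteDimensional _).measurable, ?_⟩
  rw [Measure.map_linearMap_addHaar_eq_smul_addHaar _ h4, abs_inv, h3]
  simp

/-- The orthogonal projection onto `x⊥`. -/
noncomputable def perpProj (x ξ : E) : E := ξ - ((‖x‖ ^ 2)⁻¹ * inner ℝ x ξ) • x

lemma perpProj_of_norm_one {ϑ : E} (hϑ : ‖ϑ‖ = 1) (p : E) :
    perpProj ϑ p = p - (inner ℝ ϑ p) • ϑ := by simp [perpProj, hϑ]

lemma perpProj_smul {r : ℝ} (hr : r ≠ 0) (x ξ : E) : perpProj (r • x) ξ = perpProj x ξ := by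
  unfold perpProj
  rw [norm_smul, inner_smul_left, smul_smul]
  congr 2
  by_cases hx : ‖x‖ = 0
  · simp [norm_eq_zero.1 hx]
  · simp only [Real.norm_eq_abs, mul_pow, sq_abs, conj_trivial]
    field_simp

lemma inner_perpProj {x : E} (hx : x ≠ 0) (ξ : E) : inner ℝ x (perpProj x ξ) = 0 := by
  have : ‖x‖ ≠ 0 := norm_ne_zero_iff.2 hx
  unfold perpProj
  rw [inner_sub_right, inner_smul_right, real_inner_self_eq_norm_sq]
  field_simp; ring

lemma norm_perpProj_sq {x : E} (hx : x ≠ 0) (ξ : E) :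
    ‖perpProj x ξ‖ ^ 2 = ‖ξ‖ ^ 2 - (‖x‖ ^ 2)⁻¹ * inner ℝ x ξ ^ 2 := by
  have : ‖x‖ ≠ 0 := norm_ne_zero_iff.2 hx
  unfold perpProj
  rw [norm_sub_sq_real, inner_smul_right, norm_smul, real_inner_comm, mul_pow, Real.norm_eq_abs,
    sq_abs]
  field_simp; ring

@[fun_prop]
lemma measurable_perpProj : Measurable (fun z : E × E => perpProj z.1 z.2) := by
  unfold perpProj; fun_prop

/-- Integration over hyperplanes orthogonal to `ϑ` without a measure on them: `p` ranges over the
whole space, only `P_ϑ p` enters the point, and the idle component `ϑ·p` takes over the role of the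
auxiliary scalar, typically weighted by a normalized Gaussian. -/
lemma lintegral_planeSwap {ϑ : E} (hϑ : ‖ϑ‖ = 1) {F : E → ℝ → ℝ≥0∞}
    (hF : Measurable (Function.uncurry F)) :
    ∫⁻ p : E, ∫⁻ t : ℝ, F (t • ϑ + perpProj ϑ p) (inner ℝ ϑ p) = ∫⁻ u, ∫⁻ s, F u s := by
  have h : ∫⁻ z, (Function.uncurry F ∘ planeSwap ϑ) z ∂((volume : Measure E).prod volume) = _ :=
    (measurePreserving_planeSwap hϑ).lintegral_comp hF
  rw [lintegral_prod _ (hF.comp (measurePreserving_planeSwap hϑ).measurable).aemeasurable,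
    lintegral_prod _ hF.aemeasurable] at h
  rw [← show _ = ∫⁻ u, ∫⁻ s, F u s from h]
  refine lintegral_congr fun p => lintegral_congr fun t => ?_
  rw [perpProj_of_norm_one hϑ, Function.comp_apply, planeSwap_apply]
  simp only [Function.uncurry]
  congr 1
  module

end PlaneSwap

/-! ### The sphere parametrized by reflections -/

section Reflection

variable {N : ℕ}

/-- The map `p ↦ |p|² θ - 2 (θ·p) p`. -/
noncomputable def reflMap (θ p : Vel N) : Vel N := (‖p‖ ^ 2) • θ - (2 * inner ℝ θ p) • p

/-- The derivative of `reflMap θ` at `p`. -/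
noncomputable def reflMapDeriv (θ p : Vel N) : Vel N →L[ℝ] Vel N :=
  (2 • innerSL ℝ p).smulRight θ - ((2 * inner ℝ θ p) • ContinuousLinearMap.id ℝ (Vel N) +
    ((2 : ℝ) • innerSL ℝ θ).smulRight p)

lemma hasFDerivAt_reflMap (θ p : Vel N) : HasFDerivAt (reflMap θ) (reflMapDeriv θ p) p := by
  have h1 : HasFDerivAt (fun p : Vel N => ‖p‖ ^ 2) (2 • innerSL ℝ p) p :=
    (hasStrictFDerivAt_norm_sq p).hasFDerivAt
  have h2 : HasFDerivAt (fun p : Vel N => 2 * inner ℝ θ p) ((2 : ℝ) • innerSL ℝ θ) p :=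
    ((innerSL ℝ θ).hasFDerivAt).const_mul 2
  exact (h1.smul_const θ).sub (h2.smul (hasFDerivAt_id p))

/-- The derivative is `-2(θ·p)` times a rank-two perturbation of the identity, so the determinant
reduces to a `2 × 2` one through `det(1+UV) = det(1+VU)`. -/
lemma det_reflMapDeriv (hN : 2 ≤ N) {θ : Vel N} (hθ : ‖θ‖ = 1) {p : Vel N} (hp : 0 < inner ℝ θ p) :
    |(reflMapDeriv θ p).det| = 2 ^ N * inner ℝ θ p ^ (N - 2) * ‖p‖ ^ 2 := by
  set a : ℝ := inner ℝ θ p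
  let U : Matrix (Fin N) (Fin 2) ℝ := Matrix.of fun i k => if k = 0 then θ i else p i
  let V : Matrix (Fin 2) (Fin N) ℝ := Matrix.of fun k j => if k = 0 then -a⁻¹ * p j else a⁻¹ * θ j
  have hb := LinearMap.det_toMatrix (EuclideanSpace.basisFun (Fin N) ℝ).toBasis
    (reflMapDeriv θ p : Vel N →ₗ[ℝ] Vel N)
  have hM : LinearMap.toMatrix (EuclideanSpace.basisFun (Fin N) ℝ).toBasis
      (EuclideanSpace.basisFun (Fin N) ℝ).toBasis (reflMapDeriv θ p : Vel N →ₗ[ℝ] Vel N) =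
      (-2 * a) • (1 + U * V) := by
    ext i j
    rw [LinearMap.toMatrix_apply]
    simp only [OrthonormalBasis.coe_toBasis, OrthonormalBasis.coe_toBasis_repr_apply,
      EuclideanSpace.basisFun_apply, EuclideanSpace.basisFun_repr, ContinuousLinearMap.coe_coe,
      Matrix.smul_apply, Matrix.add_apply, Matrix.mul_apply, Fin.sum_univ_two, U, V,
      Matrix.of_apply, Matrix.one_apply, reflMapDeriv]
    simp [EuclideanSpace.inner_single_right, a]
    have ha : (inner ℝ θ p : ℝ) ≠ 0 := hp.ne'
    split_ifs <;> field_simp <;> ring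
  have hVU : (V * U) = !![-1, -a⁻¹ * ‖p‖ ^ 2; a⁻¹, 1] := by
    have ha : a ≠ 0 := hp.ne'
    have e1 : ∑ i, θ i * p i = a := by simp [a, PiLp.inner_apply, mul_comm]
    have e2 : ∑ i, p i * p i = ‖p‖ ^ 2 := by
      rw [EuclideanSpace.real_norm_sq_eq]; simp [sq]
    have e3 : ∑ i, θ i * θ i = 1 := by
      rw [← one_pow 2, ← hθ, EuclideanSpace.real_norm_sq_eq]; simp [sq]
    ext i j
    fin_cases i <;> fin_cases j <;>
      simp [U, V, Matrix.mul_apply, mul_assoc, ← Finset.mul_sum, e1, e2, e3, mul_comm (p _) (θ _), ha]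
  have ha : a ≠ 0 := hp.ne'
  change |LinearMap.det (reflMapDeriv θ p : Vel N →ₗ[ℝ] Vel N)| = _
  rw [← hb, hM, Matrix.det_smul, Matrix.det_one_add_mul_comm, hVU, Fintype.card_fin]
  have hd : (1 + !![-1, -a⁻¹ * ‖p‖ ^ 2; a⁻¹, 1] : Matrix (Fin 2) (Fin 2) ℝ).det =
      ‖p‖ ^ 2 / a ^ 2 := by
    rw [Matrix.det_fin_two]
    simp
    field_simp
  rw [hd, abs_mul, abs_pow, abs_mul, abs_of_nonneg (by positivity : 0 ≤ ‖p‖ ^ 2 / a ^ 2),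
    abs_of_pos hp]
  obtain ⟨m, rfl⟩ := Nat.exists_eq_add_of_le hN
  rw [show 2 + m - 2 = m by omega]
  simp only [abs_neg, abs_two]
  field_simp
  ring

lemma norm_reflMap {θ : Vel N} (hθ : ‖θ‖ = 1) (p : Vel N) : ‖reflMap θ p‖ = ‖p‖ ^ 2 := by
  rw [← sq_eq_sq₀ (norm_nonneg _) (by positivity)]
  unfold reflMap
  rw [norm_sub_sq_real, norm_smul, norm_smul, inner_smul_left, inner_smul_right, hθ]
  simp only [Real.norm_eq_abs, mul_pow, sq_abs, conj_trivial]
  ring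

lemma inner_reflMap {θ : Vel N} (hθ : ‖θ‖ = 1) (p : Vel N) :
    inner ℝ θ (reflMap θ p) = ‖p‖ ^ 2 - 2 * inner ℝ θ p ^ 2 := by
  unfold reflMap
  rw [inner_sub_right, inner_smul_right, inner_smul_right, real_inner_self_eq_norm_sq, hθ]
  ring

/-- The image determines `|p|²` through its norm, then `θ·p > 0` through its component along `θ`,
and then `p` itself. -/
lemma injOn_reflMap {θ : Vel N} (hθ : ‖θ‖ = 1) :
    Set.InjOn (reflMap θ) {p | 0 < inner ℝ θ p} := by
  intro p hp q hq h
  simp only [Set.mem_ofPred_eq] at hp hq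
  have h1 : ‖p‖ ^ 2 = ‖q‖ ^ 2 := by rw [← norm_reflMap hθ, h, norm_reflMap hθ]
  have h2 := inner_reflMap hθ p
  rw [h, inner_reflMap hθ, h1] at h2
  have h3 : (inner ℝ θ p : ℝ) = inner ℝ θ q := by
    rw [← sq_eq_sq₀ hp.le hq.le]; linarith
  unfold reflMap at h
  rw [h1, h3] at h
  have h4 := sub_right_injective h
  exact smul_right_injective _ (by positivity : (2 * inner ℝ θ q : ℝ) ≠ 0) h4

lemma image_reflMap {θ : Vel N} (hθ : ‖θ‖ = 1) :
    reflMap θ '' {p | 0 < inner ℝ θ p} = {q | inner ℝ θ q < ‖q‖} := by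
  ext q
  constructor
  · rintro ⟨p, hp, rfl⟩
    simp only [Set.mem_ofPred_eq] at hp ⊢
    rw [inner_reflMap hθ, norm_reflMap hθ]
    nlinarith
  · intro hq
    simp only [Set.mem_ofPred_eq] at hq
    -- The preimage must be parallel to `|q|θ - q`, the normal of the reflection sending `|q|θ` to
    -- `q`; its component `a` along `θ` is forced by `inner_reflMap`.
    set a : ℝ := Real.sqrt ((‖q‖ - inner ℝ θ q) / 2)
    have ha : 0 < a := Real.sqrt_pos.2 (by linarith)
    have ha2 : a ^ 2 = (‖q‖ - inner ℝ θ q) / 2 := Real.sq_sqrt (by linarith)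
    set p : Vel N := (2 * a)⁻¹ • (‖q‖ • θ - q)
    have h1 : inner ℝ θ p = a := by
      simp only [p]
      rw [inner_smul_right, inner_sub_right, inner_smul_right, real_inner_self_eq_norm_sq, hθ]
      field_simp; linarith
    have h2 : ‖p‖ ^ 2 = ‖q‖ := by
      simp only [p]
      rw [norm_smul, mul_pow, norm_sub_sq_real, norm_smul, inner_smul_left, hθ]
      simp only [Real.norm_eq_abs, inv_pow, abs_norm, conj_trivial, mul_one, norm_inv, sq_abs]
      field_simp
      rw [ha2]; ring
    refine ⟨p, by simp only [Set.mem_ofPred_eq]; rw [h1]; exact ha, ?_⟩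
    unfold reflMap
    rw [h1, h2]
    simp only [p]
    rw [smul_smul, mul_inv_cancel₀ (by positivity)]
    module

/-- The exceptional set is contained in the line spanned by `θ`, which is negligible because `N ≥
2`. -/
lemma ae_inner_lt_norm (hN : 2 ≤ N) {θ : Vel N} (hθ : ‖θ‖ = 1) :
    ∀ᵐ q : Vel N, inner ℝ θ q < ‖q‖ := by
  have hs : (Submodule.span ℝ {θ} : Submodule ℝ (Vel N)) ≠ ⊤ := by
    intro h
    have h1 := finrank_span_singleton (K := ℝ) (v := θ) (by intro h0; simp [h0] at hθ)
    rw [h, finrank_top, finrank_euclideanSpace, Fintype.card_fin] at h1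
    omega
  have h0 := Measure.addHaar_submodule (volume : Measure (Vel N)) _ hs
  refine measure_mono_null (fun q hq => ?_) h0
  simp only [Set.mem_compl_iff, Set.mem_ofPred_eq, not_lt] at hq
  have h1 : inner ℝ θ q = ‖θ‖ * ‖q‖ := le_antisymm (real_inner_le_norm _ _) (by rwa [hθ, one_mul])
  rw [inner_eq_norm_mul_iff_real, hθ, one_smul] at h1
  rw [← h1]
  exact Submodule.smul_mem _ _ (Submodule.mem_span_singleton_self θ)

end Reflection

/-! ### Change of variables on the sphere and Carleman coordinates -/

section Carleman

variable {N : ℕ}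

lemma lintegral_pow_unit (n : ℕ) : ∫⁻ r in Set.Ioi (0 : ℝ), ENNReal.ofReal (r ^ n) *
    (if r < 1 then 1 else 0) = ENNReal.ofReal (1 / (n + 1)) := by
  have h1 : ∀ r : ℝ, ENNReal.ofReal (r ^ n) * (if r < 1 then 1 else 0) =
      (Set.Iio 1).indicator (fun r : ℝ => ENNReal.ofReal (r ^ n)) r := fun r => by
    by_cases h : r < 1 <;> simp [h]
  simp_rw [h1]
  rw [lintegral_indicator measurableSet_Iio, Measure.restrict_restrict measurableSet_Iio,
    Set.inter_comm, Set.Ioi_inter_Iio, ← ofReal_integral_eq_lintegral_ofReal]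
  · rw [← integral_Ioc_eq_integral_Ioo, ← intervalIntegral.integral_of_le zero_le_one,
      integral_pow]
    simp
  · exact ((continuous_pow n).integrableOn_Icc (a := (0 : ℝ)) (b := 1)).mono_set
      Set.Ioo_subset_Icc_self
  · filter_upwards [ae_restrict_mem measurableSet_Ioo] with r hr
    exact pow_nonneg hr.1.le n

lemma measurable_reflMap (θ : Vel N) : Measurable (reflMap θ) := by
  unfold reflMap; fun_prop

lemma reflMap_smul (θ : Vel N) (r : ℝ) (p : Vel N) : reflMap θ (r • p) = r ^ 2 • reflMap θ p := by
  unfold reflMap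
  rw [norm_smul, inner_smul_right, mul_pow, Real.norm_eq_abs, sq_abs]
  module

/-- Parametrization of the sphere by the normal of the reflection exchanging `θ` and `σ`. -/
theorem lintegral_sphere_eq_reflection (hN : 2 ≤ N) {θ : Vel N} (hθ : ‖θ‖ = 1)
    {φ : Vel N → ℝ≥0∞} (hφ : Measurable φ) :
    ∫⁻ σ : Sph N, φ σ ∂(volume : Measure (Vel N)).toSphere = 2 ^ (N - 1) *
      ∫⁻ ϑ : Sph N, (if 0 < inner ℝ θ (ϑ : Vel N) then
        ENNReal.ofReal (inner ℝ θ (ϑ : Vel N) ^ (N - 2)) * φ (reflMap θ ϑ) else 0)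
          ∂(volume : Measure (Vel N)).toSphere := by
  have : Nontrivial (Vel N) := by
    have : Nonempty (Fin N) := ⟨⟨0, by omega⟩⟩
    infer_instance
  have hfin : Module.finrank ℝ (Vel N) = N := by simp
  have hnorm : ∀ ϑ : Sph N, ‖(ϑ : Vel N)‖ = 1 := fun ϑ => by simp
  -- Both sides are compared with the integral over the unit ball of the extension of `φ` constant
  -- on rays, where the Jacobian formula in `ℝ^N` is available.
  set F : Vel N → ℝ≥0∞ := fun q => if ‖q‖ < 1 then φ (‖q‖⁻¹ • q) else 0
  have hF : Measurable F :=
    Measurable.ite (measurableSet_lt measurable_norm measurable_const)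
      (hφ.comp (by fun_prop)) measurable_const
  have hhalf : MeasurableSet {p : Vel N | 0 < inner ℝ θ p} :=
    measurableSet_lt measurable_const (by fun_prop)
  have A : ∫⁻ q, F q = (∫⁻ σ : Sph N, φ σ ∂(volume : Measure (Vel N)).toSphere) *
      ENNReal.ofReal (1 / N) := by
    have hφ' : Measurable (fun σ : Sph N => φ σ) := hφ.comp measurable_subtype_coe
    rw [lintegral_polar hF, hfin, ← lintegral_mul_const _ hφ']
    refine lintegral_congr fun σ => ?_
    have e : ((N - 1 : ℕ) : ℝ) + 1 = N := by
      rw [Nat.cast_sub (by omega)]; simp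
    rw [← e, ← lintegral_pow_unit (N - 1), ← lintegral_const_mul _ (by
      refine Measurable.mul (by fun_prop) ?_
      exact Measurable.ite measurableSet_Iio measurable_const measurable_const)]
    refine setLIntegral_congr_fun measurableSet_Ioi fun r hr => ?_
    have hr : 0 < r := hr
    simp only [F]
    rw [norm_smul, hnorm, mul_one, Real.norm_of_nonneg hr.le, smul_smul, inv_mul_cancel₀ hr.ne',
      one_smul]
    split_ifs <;> simp [mul_comm]
  have B : ∫⁻ q, F q = 2 ^ N * (∫⁻ ϑ : Sph N, (if 0 < inner ℝ θ (ϑ : Vel N) then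
        ENNReal.ofReal (inner ℝ θ (ϑ : Vel N) ^ (N - 2)) * φ (reflMap θ ϑ) else 0)
          ∂(volume : Measure (Vel N)).toSphere) * ENNReal.ofReal (1 / (2 * N)) := by
    have h1 : ∫⁻ q, F q = ∫⁻ q in reflMap θ '' {p | 0 < inner ℝ θ p}, F q := by
      rw [image_reflMap hθ]
      exact congrArg (fun μ => ∫⁻ q, F q ∂μ) (Measure.restrict_eq_self_of_ae_mem
        (s := {q : Vel N | inner ℝ θ q < ‖q‖}) (ae_inner_lt_norm hN hθ)).symm
    rw [h1, lintegral_image_eq_lintegral_abs_det_fderiv_mul volume hhalf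
      (fun p _ => (hasFDerivAt_reflMap θ p).hasFDerivWithinAt) (injOn_reflMap hθ),
      ← lintegral_indicator hhalf]
    have h2 : ∀ p, ({p : Vel N | 0 < inner ℝ θ p}).indicator
        (fun p => ENNReal.ofReal |(reflMapDeriv θ p).det| * F (reflMap θ p)) p =
        if 0 < inner ℝ θ p then ENNReal.ofReal (2 ^ N * inner ℝ θ p ^ (N - 2) * ‖p‖ ^ 2) *
          F (reflMap θ p) else 0 := fun p => by
      by_cases h : 0 < inner ℝ θ p
      · rw [Set.indicator_of_mem (by exact h), det_reflMapDeriv hN hθ h, if_pos h]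
      · rw [Set.indicator_of_notMem (by exact h), if_neg h]
    simp_rw [h2]
    have hm : Measurable (fun p : Vel N => if 0 < inner ℝ θ p then
        ENNReal.ofReal (2 ^ N * inner ℝ θ p ^ (N - 2) * ‖p‖ ^ 2) * F (reflMap θ p) else 0) :=
      Measurable.ite hhalf (Measurable.mul (by fun_prop) (hF.comp (measurable_reflMap θ)))
        measurable_const
    have hm2 : Measurable (fun ϑ : Sph N => if 0 < inner ℝ θ (ϑ : Vel N) then
        ENNReal.ofReal (inner ℝ θ (ϑ : Vel N) ^ (N - 2)) * φ (reflMap θ ϑ) else 0) :=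
      (Measurable.ite hhalf (Measurable.mul (by fun_prop) (hφ.comp (measurable_reflMap θ)))
        measurable_const : Measurable (fun p : Vel N => if 0 < inner ℝ θ p then
        ENNReal.ofReal (inner ℝ θ p ^ (N - 2)) * φ (reflMap θ p) else 0)).comp
          measurable_subtype_coe
    rw [lintegral_polar hm, hfin, ← lintegral_const_mul _ hm2,
      ← lintegral_mul_const _ (hm2.const_mul _)]
    refine lintegral_congr fun ϑ => ?_
    -- The radial power is `r^{N-1}` from polar coordinates times `r^{N-2} r²` from the Jacobian. As
    -- `reflMap` is homogeneous of degree two, the ball condition is `r² < 1`, and the radial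
    -- integral is `1/(2N)`.
    have e : ((2 * N - 1 : ℕ) : ℝ) + 1 = 2 * N := by
      rw [Nat.cast_sub (by omega)]; push_cast; ring
    rw [← e, ← lintegral_pow_unit (2 * N - 1), ← lintegral_const_mul _ (by
      refine Measurable.mul (by fun_prop) ?_
      exact Measurable.ite measurableSet_Iio measurable_const measurable_const)]
    refine setLIntegral_congr_fun measurableSet_Ioi fun r hr => ?_
    have hr : 0 < r := hr
    simp only [F]
    rw [inner_smul_right, reflMap_smul, norm_smul, norm_smul, norm_reflMap hθ, hnorm, one_pow,
      mul_one, mul_one, Real.norm_of_nonneg hr.le, Real.norm_of_nonneg (sq_nonneg r), smul_smul,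
      inv_mul_cancel₀ (by positivity), one_smul]
    simp only [mul_pos_iff_of_pos_left hr, sq_lt_one_iff₀ hr.le]
    by_cases ha : 0 < inner ℝ θ (ϑ : Vel N)
    · by_cases hr1 : r < 1
      · simp only [ha, hr1, if_true]
        rw [← mul_assoc, ← ENNReal.ofReal_mul (by positivity), mul_one]
        have e2 : (2 : ℝ≥0∞) ^ N = ENNReal.ofReal (2 ^ N) := by
          rw [ENNReal.ofReal_pow (by norm_num)]; simp
        have e5 : ∀ x y z w : ℝ≥0∞, x * (y * z) * w = x * y * w * z := fun x y z w => by ring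
        rw [e2, e5, ← ENNReal.ofReal_mul (by positivity), ← ENNReal.ofReal_mul (by positivity)]
        congr 2
        obtain ⟨m, rfl⟩ := Nat.exists_eq_add_of_le hN
        rw [show 2 + m - 1 = m + 1 by omega, show 2 + m - 2 = m by omega,
          show 2 * (2 + m) - 1 = m + 1 + m + 2 by omega]
        rw [mul_pow]; ring
      · simp [ha, hr1]
    · simp [ha]
  rw [A] at B
  have hNpos : (0 : ℝ) < N := by exact_mod_cast (by omega : 0 < N)
  have hK : ENNReal.ofReal (1 / N) ≠ 0 := by
    rw [Ne, ENNReal.ofReal_eq_zero, not_le]; positivity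
  refine (ENNReal.mul_left_inj hK ENNReal.ofReal_ne_top).1 (B.trans ?_)
  have e3 : (2 : ℝ≥0∞) ^ N = 2 ^ (N - 1) * 2 := by
    rw [← pow_succ]; congr 1; omega
  have e4 : 2 * ENNReal.ofReal (1 / (2 * N)) = ENNReal.ofReal (1 / N) := by
    rw [show (2 : ℝ≥0∞) = ENNReal.ofReal 2 by simp, ← ENNReal.ofReal_mul (by norm_num)]
    congr 1; field_simp
  rw [e3, ← e4]; ring

/-- `x = v - 'v = (β/2)(u - |u|σ)`. -/
noncomputable def collX (β : ℝ) (u q : Vel N) : Vel N := (β / 2) • (u - ‖u‖ • q)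

/-- The Jacobian of the Carleman parametrization, up to the Gaussian factor. -/
noncomputable def carlJac (β : ℝ) (x y : Vel N) : ℝ :=
  2 ^ (N - 1) * β⁻¹ * (‖x‖ ^ (N - 1))⁻¹ * (‖x‖ / (β * ‖(2 : ℝ) • x - y‖)) ^ (N - 2)

/-- The Gaussian in the direction of `x`. -/
noncomputable def dirGauss (x p : Vel N) : ℝ := Real.exp (-Real.pi * (‖x‖⁻¹ * inner ℝ x p) ^ 2)

/-- `κ = 2 - 1/β`. -/
noncomputable def kap (β : ℝ) : ℝ := 2 - β⁻¹

/-- The parametrization of `y` by `(x, p)`. -/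
noncomputable def carlY (β : ℝ) (x p : Vel N) : Vel N := kap β • x + perpProj x p

@[fun_prop]
lemma measurable_carlY (β : ℝ) : Measurable (fun z : Vel N × Vel N => carlY β z.1 z.2) := by
  have := measurable_perpProj (E := Vel N)
  unfold carlY; fun_prop

lemma lintegral_Ioi_mul {β : ℝ} (hβ : 0 < β) {K : ℝ → ℝ≥0∞} (hK : Measurable K) :
    ∫⁻ t in Set.Ioi (0 : ℝ), K (β * t) = ENNReal.ofReal β⁻¹ * ∫⁻ r in Set.Ioi (0 : ℝ), K r := by
  have h := Real.smul_map_volume_mul_left hβ.ne'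
  have h2 : ∫⁻ r in Set.Ioi (0 : ℝ), K r = ENNReal.ofReal β *
      ∫⁻ t in Set.Ioi (0 : ℝ), K (β * t) := by
    rw [← lintegral_indicator measurableSet_Ioi, ← lintegral_indicator measurableSet_Ioi]
    conv_lhs => rw [← h]
    rw [lintegral_smul_measure, lintegral_map (hK.indicator measurableSet_Ioi) (by fun_prop),
      abs_of_pos hβ, smul_eq_mul]
    congr 1
    refine lintegral_congr fun t => ?_
    by_cases ht : 0 < t
    · rw [Set.indicator_of_mem (by exact mul_pos hβ ht), Set.indicator_of_mem (by exact ht)]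
    · rw [Set.indicator_of_notMem (by simp only [Set.mem_Ioi]; intro h'; exact ht (by
        exact (mul_pos_iff_of_pos_left hβ).1 h')), Set.indicator_of_notMem (by exact ht)]
  rw [h2, ← mul_assoc, ← ENNReal.ofReal_mul (by positivity), inv_mul_cancel₀ hβ.ne']
  simp

lemma lintegral_gauss : ∫⁻ s : ℝ, ENNReal.ofReal (Real.exp (-Real.pi * s ^ 2)) = 1 := by
  rw [← ofReal_integral_eq_lintegral_ofReal (integrable_exp_neg_mul_sq Real.pi_pos)
    (Filter.Eventually.of_forall fun _ => (Real.exp_pos _).le), integral_gaussian,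
    div_self Real.pi_ne_zero]
  simp

end Carleman

/-! ### The Carleman representation -/

section CarlemanFormula

variable {N : ℕ}

lemma perpProj_neg (x p : Vel N) : perpProj x (-p) = -perpProj x p := by
  unfold perpProj; rw [inner_neg_right]; module

/-- If `σ` is the reflection of `û` across `ϑ⊥`, then `u - |u|σ = 2(ϑ·u)ϑ`, so that `x = β(ϑ·u)ϑ` is
parallel to the new variable `ϑ`. This is the point of the reflection parametrization. -/
lemma lintegral_sphere_collX (hN : 2 ≤ N) (β : ℝ) {Ψ : Vel N → Vel N → ℝ≥0∞}
    (hΨ : Measurable (Function.uncurry Ψ)) {u : Vel N} (hu : u ≠ 0) :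
    ∫⁻ σ : Sph N, Ψ (collX β u σ) ((2 : ℝ) • collX β u σ - u)
      ∂(volume : Measure (Vel N)).toSphere = 2 ^ (N - 1) *
      ∫⁻ ϑ : Sph N, (if 0 < inner ℝ (ϑ : Vel N) u then
        ENNReal.ofReal ((inner ℝ (ϑ : Vel N) u / ‖u‖) ^ (N - 2)) *
          Ψ ((β * inner ℝ (ϑ : Vel N) u) • (ϑ : Vel N))
            ((2 * (β * inner ℝ (ϑ : Vel N) u)) • (ϑ : Vel N) - u) else 0)
        ∂(volume : Measure (Vel N)).toSphere := by
  have hu' : 0 < ‖u‖ := norm_pos_iff.2 hu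
  have hθ : ‖‖u‖⁻¹ • u‖ = 1 := by rw [norm_smul, norm_inv, norm_norm, inv_mul_cancel₀ hu'.ne']
  have hm : Measurable (fun q : Vel N => Ψ (collX β u q) ((2 : ℝ) • collX β u q - u)) := by
    have h : Measurable (fun q : Vel N => (collX β u q, (2 : ℝ) • collX β u q - u)) := by
      unfold collX; fun_prop
    exact hΨ.comp h
  rw [lintegral_sphere_eq_reflection hN hθ hm]
  congr 1
  refine lintegral_congr fun ϑ => ?_
  have h1 : inner ℝ (‖u‖⁻¹ • u) (ϑ : Vel N) = inner ℝ (ϑ : Vel N) u / ‖u‖ := by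
    rw [inner_smul_left, real_inner_comm]; simp [div_eq_inv_mul]
  have h2 : collX β u (reflMap (‖u‖⁻¹ • u) (ϑ : Vel N)) =
      (β * inner ℝ (ϑ : Vel N) u) • (ϑ : Vel N) := by
    unfold collX reflMap
    rw [h1, show ‖(ϑ : Vel N)‖ = 1 by simp]
    have e1 : ‖u‖ • ((1 ^ 2 : ℝ) • ‖u‖⁻¹ • u - (2 * (inner ℝ (ϑ : Vel N) u / ‖u‖)) • (ϑ : Vel N)) =
        u - (2 * inner ℝ (ϑ : Vel N) u) • (ϑ : Vel N) := by
      rw [smul_sub, smul_smul, smul_smul, smul_smul,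
        show ‖u‖ * 1 ^ 2 * ‖u‖⁻¹ = 1 by field_simp,
        show ‖u‖ * (2 * (inner ℝ (ϑ : Vel N) u / ‖u‖)) = 2 * inner ℝ (ϑ : Vel N) u by field_simp,
        one_smul]
    rw [e1]
    module
  simp only [h1, h2, div_pos_iff_of_pos_right hu', smul_smul]

/-- The kernel obtained from the reflection parametrization of the sphere. -/
noncomputable def reflKernel (β : ℝ) (Ψ : Vel N → Vel N → ℝ≥0∞) (u ϑ : Vel N) : ℝ≥0∞ :=
  if 0 < inner ℝ ϑ u then ENNReal.ofReal ((inner ℝ ϑ u / ‖u‖) ^ (N - 2)) *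
    Ψ ((β * inner ℝ ϑ u) • ϑ) ((2 * (β * inner ℝ ϑ u)) • ϑ - u) else 0

lemma measurable_reflKernel (β : ℝ) {Ψ : Vel N → Vel N → ℝ≥0∞}
    (hΨ : Measurable (Function.uncurry Ψ)) :
    Measurable (fun z : Vel N × Vel N => reflKernel β Ψ z.1 z.2) := by
  unfold reflKernel
  refine Measurable.ite (measurableSet_lt measurable_const (by fun_prop)) ?_ measurable_const
  refine Measurable.mul (by fun_prop) ?_
  exact hΨ.comp (f := fun z : Vel N × Vel N => ((β * inner ℝ z.2 z.1) • z.2,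
    (2 * (β * inner ℝ z.2 z.1)) • z.2 - z.1)) (by fun_prop)

/-- The integrand on the ray through `x`. -/
noncomputable def rayKernel (β : ℝ) (Ψ : Vel N → Vel N → ℝ≥0∞) (ϑ : Vel N) (r : ℝ) (p : Vel N) :
    ℝ≥0∞ :=
  ENNReal.ofReal ((r / (β * ‖(2 : ℝ) • (r • ϑ) - carlY β (r • ϑ) p‖)) ^ (N - 2)) *
    Ψ (r • ϑ) (carlY β (r • ϑ) p) * ENNReal.ofReal (Real.exp (-Real.pi * inner ℝ ϑ p ^ 2))

lemma measurable_rayKernel (β : ℝ) {Ψ : Vel N → Vel N → ℝ≥0∞}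
    (hΨ : Measurable (Function.uncurry Ψ)) (ϑ : Vel N) :
    Measurable (fun z : ℝ × Vel N => rayKernel β Ψ ϑ z.1 z.2) := by
  have h : Measurable (fun z : ℝ × Vel N => carlY β (z.1 • ϑ) z.2) :=
    (measurable_carlY β).comp (f := fun z : ℝ × Vel N => (z.1 • ϑ, z.2)) (by fun_prop)
  unfold rayKernel
  refine Measurable.mul (Measurable.mul (by fun_prop) ?_) (by fun_prop)
  exact hΨ.comp (f := fun z : ℝ × Vel N => (z.1 • ϑ, carlY β (z.1 • ϑ) z.2)) (by fun_prop)

/-- Decompose `u = tϑ + u⊥`. Then `x = βtϑ` depends only on `r = βt`, while `y = 2x - u = κx - u⊥`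
fills a hyperplane orthogonal to `x`. -/
lemma lintegral_reflKernel {β : ℝ} (hβ : 0 < β) {Ψ : Vel N → Vel N → ℝ≥0∞}
    (hΨ : Measurable (Function.uncurry Ψ)) {ϑ : Vel N} (hϑ : ‖ϑ‖ = 1) :
    ∫⁻ u, reflKernel β Ψ u ϑ = ENNReal.ofReal β⁻¹ *
      ∫⁻ r in Set.Ioi (0 : ℝ), ∫⁻ p, rayKernel β Ψ ϑ r p := by
  have hϑ0 : ϑ ≠ 0 := by intro h; simp [h] at hϑ
  have hm := measurable_reflKernel β hΨ
  have h1 : ∫⁻ u, reflKernel β Ψ u ϑ =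
      ∫⁻ u, ∫⁻ s : ℝ, reflKernel β Ψ u ϑ * ENNReal.ofReal (Real.exp (-Real.pi * s ^ 2)) := by
    refine lintegral_congr fun u => ?_
    rw [lintegral_const_mul _ (by fun_prop), lintegral_gauss, mul_one]
  have hF : Measurable (Function.uncurry fun (u : Vel N) (s : ℝ) => reflKernel β Ψ u ϑ *
      ENNReal.ofReal (Real.exp (-Real.pi * s ^ 2))) :=
    (hm.comp (f := fun z : Vel N × ℝ => (z.1, ϑ)) (by fun_prop)).mul (by fun_prop)
  -- The change `p ↦ -p` replaces `κx - P_x p` by `κx + P_x p`.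
  rw [h1, ← lintegral_planeSwap hϑ hF, ← lintegral_neg_eq_self]
  have hray := measurable_rayKernel β hΨ ϑ
  have hray' : Measurable (fun r : ℝ => ∫⁻ p, rayKernel β Ψ ϑ r p) := hray.lintegral_prod_right'
  rw [← lintegral_Ioi_mul hβ hray']
  have h2 : ∀ (p : Vel N) (t : ℝ), reflKernel β Ψ (t • ϑ + perpProj ϑ (-p)) ϑ *
      ENNReal.ofReal (Real.exp (-Real.pi * inner ℝ ϑ (-p) ^ 2)) =
      (Set.Ioi 0).indicator (fun t : ℝ => rayKernel β Ψ ϑ (β * t) p) t := by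
    intro p t
    have e1 : inner ℝ ϑ (t • ϑ + perpProj ϑ (-p)) = t := by
      rw [inner_add_right, inner_perpProj hϑ0, inner_smul_right, real_inner_self_eq_norm_sq, hϑ]
      ring
    unfold reflKernel rayKernel
    rw [e1]
    by_cases ht : 0 < t
    · have e2 : carlY β ((β * t) • ϑ) p = (2 * (β * t)) • ϑ - (t • ϑ + perpProj ϑ (-p)) := by
        unfold carlY kap
        rw [perpProj_smul (by positivity), perpProj_neg, smul_smul,
          show (2 - β⁻¹) * (β * t) = 2 * (β * t) - t by field_simp]
        module
      have e3 : (2 : ℝ) • ((β * t) • ϑ) - carlY β ((β * t) • ϑ) p =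
          t • ϑ + perpProj ϑ (-p) := by
        rw [e2]; module
      rw [if_pos ht, Set.indicator_of_mem (by exact ht), e3, e2, inner_neg_right, neg_sq,
        mul_div_mul_left _ _ hβ.ne']
    · rw [if_neg ht, Set.indicator_of_notMem (by exact ht), zero_mul]
  simp_rw [h2]
  rw [lintegral_lintegral_swap, ← lintegral_indicator measurableSet_Ioi]
  · refine lintegral_congr fun t => ?_
    by_cases ht : t ∈ Set.Ioi (0 : ℝ)
    · simp only [Set.indicator_of_mem ht]
    · simp only [Set.indicator_of_notMem ht, lintegral_zero]
  · have h3 : (Function.uncurry fun (p : Vel N) (t : ℝ) =>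
        (Set.Ioi 0).indicator (fun t : ℝ => rayKernel β Ψ ϑ (β * t) p) t) =
        (Prod.snd ⁻¹' Set.Ioi (0 : ℝ)).indicator
          (fun z : Vel N × ℝ => rayKernel β Ψ ϑ (β * z.2) z.1) := by
      ext z
      by_cases hz : z.2 ∈ Set.Ioi (0 : ℝ)
      · rw [Set.indicator_of_mem (by exact hz)]
        simp only [Function.uncurry, Set.indicator_of_mem hz]
      · rw [Set.indicator_of_notMem (by exact hz)]
        simp only [Function.uncurry, Set.indicator_of_notMem hz]
    rw [h3]
    refine (Measurable.indicator ?_ (measurable_snd measurableSet_Ioi)).aemeasurable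
    exact hray.comp (f := fun z : Vel N × ℝ => (β * z.2, z.1)) (by fun_prop)

lemma const_mul_rayKernel {β : ℝ} (hβ : 0 < β) (Ψ : Vel N → Vel N → ℝ≥0∞) {ϑ : Vel N}
    (hϑ : ‖ϑ‖ = 1) {r : ℝ} (hr : 0 < r) (p : Vel N) :
    2 ^ (N - 1) * ENNReal.ofReal β⁻¹ * rayKernel β Ψ ϑ r p =
      ENNReal.ofReal (r ^ (N - 1)) * (ENNReal.ofReal (carlJac β (r • ϑ) (carlY β (r • ϑ) p) *
        dirGauss (r • ϑ) p) * Ψ (r • ϑ) (carlY β (r • ϑ) p)) := by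
  simp only [rayKernel, carlJac, dirGauss]
  have e2 : (2 : ℝ≥0∞) ^ (N - 1) = ENNReal.ofReal (2 ^ (N - 1)) := by
    rw [ENNReal.ofReal_pow (by norm_num)]; simp
  have e5 : ∀ x y z w t : ℝ≥0∞, x * y * (z * w * t) = x * y * z * t * w :=
    fun x y z w t => by ring
  generalize carlY β (r • ϑ) p = y
  have hn : ‖r • ϑ‖ = r := by rw [norm_smul, hϑ, mul_one, Real.norm_of_nonneg hr.le]
  have hpow : 0 ≤ (r / (β * ‖(2 : ℝ) • r • ϑ - y‖)) ^ (N - 2) := by positivity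
  rw [hn]
  generalize (r / (β * ‖(2 : ℝ) • r • ϑ - y‖)) ^ (N - 2) = J at *
  rw [e2, e5, ← mul_assoc, ← ENNReal.ofReal_mul (by positivity),
    ← ENNReal.ofReal_mul (by positivity), ← ENNReal.ofReal_mul (by positivity),
    ← ENNReal.ofReal_mul (by positivity), inner_smul_left]
  congr 2
  simp only [conj_trivial]
  rw [← mul_assoc r⁻¹, inv_mul_cancel₀ hr.ne', one_mul]
  have : r ^ (N - 1) ≠ 0 := (pow_pos hr _).ne'
  generalize r ^ (N - 1) = R at *
  field_simp

lemma measurable_carlIntegrand (β : ℝ) {Ψ : Vel N → Vel N → ℝ≥0∞}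
    (hΨ : Measurable (Function.uncurry Ψ)) : Measurable (fun z : Vel N × Vel N =>
      ENNReal.ofReal (carlJac β z.1 (carlY β z.1 z.2) * dirGauss z.1 z.2) *
        Ψ z.1 (carlY β z.1 z.2)) := by
  have h := measurable_carlY (N := N) β
  refine Measurable.mul ?_ (hΨ.comp (f := fun z : Vel N × Vel N => (z.1, carlY β z.1 z.2))
    (by fun_prop))
  unfold carlJac dirGauss
  fun_prop

lemma lintegral_reflKernel_eq_ray {β : ℝ} (hβ : 0 < β) {Ψ : Vel N → Vel N → ℝ≥0∞}
    (hΨ : Measurable (Function.uncurry Ψ)) {ϑ : Vel N} (hϑ : ‖ϑ‖ = 1) :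
    2 ^ (N - 1) * ∫⁻ u, reflKernel β Ψ u ϑ = ∫⁻ r in Set.Ioi (0 : ℝ), ENNReal.ofReal (r ^ (N - 1)) *
      ∫⁻ p : Vel N, ENNReal.ofReal (carlJac β (r • ϑ) (carlY β (r • ϑ) p) * dirGauss (r • ϑ) p) *
        Ψ (r • ϑ) (carlY β (r • ϑ) p) := by
  have hray := measurable_rayKernel β hΨ ϑ
  have hR := measurable_carlIntegrand β hΨ
  have hray' : Measurable fun r : ℝ => ∫⁻ p, rayKernel β Ψ ϑ r p := hray.lintegral_prod_right'
  rw [lintegral_reflKernel hβ hΨ hϑ, ← mul_assoc, ← lintegral_const_mul _ hray']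
  refine setLIntegral_congr_fun measurableSet_Ioi fun r hr => ?_
  have hr : 0 < r := hr
  have m1 : Measurable fun p => rayKernel β Ψ ϑ r p := hray.comp (f := fun p => (r, p)) (by fun_prop)
  have m2 : Measurable fun p => ENNReal.ofReal (carlJac β (r • ϑ) (carlY β (r • ϑ) p) *
      dirGauss (r • ϑ) p) * Ψ (r • ϑ) (carlY β (r • ϑ) p) :=
    hR.comp (f := fun p => (r • ϑ, p)) (by fun_prop)
  rw [← lintegral_const_mul _ m1, ← lintegral_const_mul _ m2]
  exact lintegral_congr fun p => const_mul_rayKernel hβ Ψ hϑ hr p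

/-- **Carleman representation** of the collision integral. -/
theorem lintegral_carleman (hN : 2 ≤ N) {β : ℝ} (hβ : 0 < β) {Ψ : Vel N → Vel N → ℝ≥0∞}
    (hΨ : Measurable (Function.uncurry Ψ)) :
    ∫⁻ u : Vel N, ∫⁻ σ : Sph N, Ψ (collX β u σ) ((2 : ℝ) • collX β u σ - u)
      ∂(volume : Measure (Vel N)).toSphere =
    ∫⁻ x : Vel N, ∫⁻ p : Vel N, ENNReal.ofReal (carlJac β x (carlY β x p) * dirGauss x p) *
      Ψ x (carlY β x p) := by
  have : Nontrivial (Vel N) := by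
    have : Nonempty (Fin N) := ⟨⟨0, by omega⟩⟩
    infer_instance
  have hfin : Module.finrank ℝ (Vel N) = N := by simp
  have hm := measurable_reflKernel β hΨ
  have hm' : Measurable (fun z : Vel N × Sph N => reflKernel β Ψ z.1 z.2) :=
    hm.comp (f := fun z : Vel N × Sph N => (z.1, (z.2 : Vel N))) (by fun_prop)
  have h1 : ∫⁻ u : Vel N, ∫⁻ σ : Sph N, Ψ (collX β u σ) ((2 : ℝ) • collX β u σ - u)
      ∂(volume : Measure (Vel N)).toSphere = ∫⁻ u : Vel N, 2 ^ (N - 1) * ∫⁻ ϑ : Sph N,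
        reflKernel β Ψ u ϑ ∂(volume : Measure (Vel N)).toSphere := by
    refine lintegral_congr_ae ?_
    have h0 : ∀ᵐ u : Vel N, u ≠ 0 := by
      rw [ae_iff]; simp
    filter_upwards [h0] with u hu
    exact lintegral_sphere_collX hN β hΨ hu
  rw [h1, lintegral_const_mul _ hm'.lintegral_prod_right',
    lintegral_lintegral_swap hm'.aemeasurable]
  have hR := measurable_carlIntegrand β hΨ
  have hmϑ : Measurable fun ϑ : Sph N => ∫⁻ u, reflKernel β Ψ u ϑ := hm'.lintegral_prod_left'
  have hR' : Measurable fun x : Vel N => ∫⁻ p : Vel N, ENNReal.ofReal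
      (carlJac β x (carlY β x p) * dirGauss x p) * Ψ x (carlY β x p) := hR.lintegral_prod_right'
  rw [lintegral_polar hR', hfin, ← lintegral_const_mul _ hmϑ]
  exact lintegral_congr fun ϑ => lintegral_reflKernel_eq_ray hβ hΨ (by simp)

end CarlemanFormula

/-! ### Plancherel along a line -/

section LineFourier

variable {E : Type*} [NormedAddCommGroup E] [InnerProductSpace ℝ E] [FiniteDimensional ℝ E]
  [MeasurableSpace E] [BorelSpace E]

lemma sq_lintegral_le {α : Type*} [MeasurableSpace α] (ν : Measure α) {f : α → ℝ≥0∞}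
    (hf : AEMeasurable f ν) : (∫⁻ x, f x ∂ν) ^ 2 ≤ (∫⁻ x, f x ^ 2 ∂ν) * ν Set.univ := by
  have h := ENNReal.lintegral_mul_le_Lp_mul_Lq ν (p := 2) (q := 2)
    (Real.holderConjugate_iff.2 ⟨by norm_num, by norm_num⟩) hf (aemeasurable_const (b := (1 : ℝ≥0∞)))
  simp only [Pi.mul_apply, mul_one, ENNReal.one_rpow, lintegral_const, one_mul] at h
  calc (∫⁻ x, f x ∂ν) ^ 2 ≤ ((∫⁻ x, f x ^ (2 : ℝ) ∂ν) ^ (1 / 2 : ℝ) * ν Set.univ ^ (1 / 2 : ℝ)) ^ 2 := by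
        gcongr
    _ = _ := by
      rw [mul_pow, ← ENNReal.rpow_natCast, ← ENNReal.rpow_natCast, ← ENNReal.rpow_mul,
        ← ENNReal.rpow_mul]
      norm_num

lemma lintegral_exp_neg_mul_sq_norm {b : ℝ} (hb : 0 < b) :
    ∫⁻ v : E, ENNReal.ofReal (Real.exp (-b * ‖v‖ ^ 2)) =
      ENNReal.ofReal ((Real.pi / b) ^ (Module.finrank ℝ E / 2 : ℝ)) := by
  have h := GaussianFourier.integral_rexp_neg_mul_sq_norm (V := E) hb
  have hi : Integrable fun v : E => Real.exp (-b * ‖v‖ ^ 2) := by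
    by_contra hc
    rw [integral_undef hc] at h
    have : 0 < (Real.pi / b) ^ (Module.finrank ℝ E / 2 : ℝ) := by have := Real.pi_pos; positivity
    linarith
  rw [← ofReal_integral_eq_lintegral_ofReal hi
    (Filter.Eventually.of_forall fun _ => (Real.exp_pos _).le), h]

lemma lintegral_fourier_sq {u : E → ℂ} (hi : Integrable u) (h2 : MemLp u 2 volume) :
    ∫⁻ ξ, ‖𝓕 u ξ‖ₑ ^ 2 = ∫⁻ x, ‖u x‖ₑ ^ 2 := by
  have h : 𝓕 u =ᵐ[volume] l2hat u := by
    refine ae_eq_of_integral_schwartz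
      (Continuous.locallyIntegrable (VectorFourier.fourierIntegral_continuous Real.continuous_fourierChar
        (by exact continuous_inner) hi))
      ((l2hat_memLp u).locallyIntegrable (by norm_num)) fun ψ => ?_
    rw [integral_l2hat_mul h2]
    have := VectorFourier.integral_fourierIntegral_smul_eq_flip (L := innerₗ E)
      Real.continuous_fourierChar (by exact continuous_inner) hi (ψ.integrable (μ := volume))
    simp only [flip_innerₗ, smul_eq_mul] at this
    exact this
  rw [← eLpNorm_two_sq, ← eLpNorm_two_sq, eLpNorm_congr_ae h, eLpNorm_l2hat h2]

/-- The integrals of `K` over the hyperplanes orthogonal to `ϑ`. -/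
noncomputable def planeIntegral (ϑ : E) (K : E → ℂ) (t : ℝ) : ℂ :=
  ∫ p : E, K (t • ϑ + perpProj ϑ p) * (Real.exp (-Real.pi * inner ℝ ϑ p ^ 2) : ℂ)

lemma perpProj_add_smul {ϑ : E} (hϑ : ‖ϑ‖ = 1) (t : ℝ) (p : E) :
    perpProj ϑ (t • ϑ + perpProj ϑ p) = perpProj ϑ p := by
  have h0 : ϑ ≠ 0 := by intro h; simp [h] at hϑ
  have e : inner ℝ ϑ (t • ϑ + perpProj ϑ p) = t := by
    rw [inner_add_right, inner_perpProj h0, inner_smul_right, real_inner_self_eq_norm_sq, hϑ]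
    ring
  rw [perpProj_of_norm_one hϑ (t • ϑ + perpProj ϑ p), e]
  module

lemma integrable_swap {ϑ : E} (hϑ : ‖ϑ‖ = 1) {K : E → ℂ} (hK : Integrable K) :
    Integrable (fun z : E × ℝ => K (z.2 • ϑ + perpProj ϑ z.1) *
      (Real.exp (-Real.pi * inner ℝ ϑ z.1 ^ 2) : ℂ)) ((volume : Measure E).prod volume) := by
  have hg : Integrable (fun s : ℝ => (Real.exp (-Real.pi * s ^ 2) : ℂ)) :=
    (integrable_exp_neg_mul_sq Real.pi_pos).ofReal
  have h := (measurePreserving_planeSwap hϑ).integrable_comp_of_integrable (hK.mul_prod hg)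
  refine h.congr (Filter.Eventually.of_forall fun z => ?_)
  simp only [Function.comp_apply, planeSwap_apply, perpProj_of_norm_one hϑ]
  congr 2
  module

/-- Fourier slice principle: restricted to the line through `ϑ`, the Fourier integral is the
one-dimensional transform of the hyperplane integrals. -/
lemma integral_mul_cexp_eq_planeIntegral {ϑ : E} (hϑ : ‖ϑ‖ = 1) {K : E → ℂ} (hK : Integrable K)
    (r : ℝ) : ∫ ξ, K ξ * Complex.exp (2 * Real.pi * Complex.I * (r * inner ℝ ϑ ξ : ℝ)) =
      ∫ t, planeIntegral ϑ K t * Complex.exp (2 * Real.pi * Complex.I * (r * t : ℝ)) := by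
  have h0 : ϑ ≠ 0 := by intro h; simp [h] at hϑ
  have hbd : ∀ x : ℝ, ‖Complex.exp (2 * Real.pi * Complex.I * (x : ℝ))‖ = 1 := fun x => by
    rw [show (2 * Real.pi * Complex.I * (x : ℝ) : ℂ) = ((2 * Real.pi * x : ℝ) : ℂ) * Complex.I by
      push_cast; ring, Complex.norm_exp_ofReal_mul_I]
  have hKe : Integrable fun ξ => K ξ *
      Complex.exp (2 * Real.pi * Complex.I * (r * inner ℝ ϑ ξ : ℝ)) :=
    hK.mul_bdd (c := 1) (by fun_prop) (Filter.Eventually.of_forall fun ξ => (hbd _).le)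
  have hg : Integrable (fun s : ℝ => (Real.exp (-Real.pi * s ^ 2) : ℂ)) :=
    (integrable_exp_neg_mul_sq Real.pi_pos).ofReal
  have hg1 : ∫ s : ℝ, (Real.exp (-Real.pi * s ^ 2) : ℂ) = 1 := by
    rw [integral_complex_ofReal, integral_gaussian, div_self Real.pi_ne_zero]; simp
  have mp := measurePreserving_planeSwap hϑ
  have hZ := integrable_swap hϑ hKe
  calc ∫ ξ, K ξ * Complex.exp (2 * Real.pi * Complex.I * (r * inner ℝ ϑ ξ : ℝ))
      = ∫ z : E × ℝ, (K z.1 * Complex.exp (2 * Real.pi * Complex.I * (r * inner ℝ ϑ z.1 : ℝ))) *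
          (Real.exp (-Real.pi * z.2 ^ 2) : ℂ) ∂((volume : Measure E).prod volume) := by
        have := integral_prod_mul (μ := (volume : Measure E)) (ν := (volume : Measure ℝ)) (fun ξ =>
          K ξ * Complex.exp (2 * Real.pi * Complex.I * (r * inner ℝ ϑ ξ : ℝ)))
          (fun s : ℝ => (Real.exp (-Real.pi * s ^ 2) : ℂ))
        rw [this, hg1, mul_one]
    _ = ∫ z : E × ℝ, (K (z.2 • ϑ + perpProj ϑ z.1) * Complex.exp (2 * Real.pi * Complex.I *
          (r * inner ℝ ϑ (z.2 • ϑ + perpProj ϑ z.1) : ℝ))) *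
          (Real.exp (-Real.pi * inner ℝ ϑ z.1 ^ 2) : ℂ) ∂((volume : Measure E).prod volume) := by
        conv_lhs => rw [← mp.map_eq]
        rw [integral_map mp.measurable.aemeasurable
          (by rw [mp.map_eq]; exact (hKe.mul_prod hg).aestronglyMeasurable)]
        refine integral_congr_ae (Filter.Eventually.of_forall fun z => ?_)
        have e : z.1 + (z.2 - inner ℝ ϑ z.1) • ϑ = z.2 • ϑ + perpProj ϑ z.1 := by
          rw [perpProj_of_norm_one hϑ]; module
        simp only [planeSwap_apply, e]
    _ = ∫ t : ℝ, ∫ p : E, (K (t • ϑ + perpProj ϑ p) * Complex.exp (2 * Real.pi * Complex.I *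
          (r * inner ℝ ϑ (t • ϑ + perpProj ϑ p) : ℝ))) *
          (Real.exp (-Real.pi * inner ℝ ϑ p ^ 2) : ℂ) := integral_prod_symm _ hZ
    _ = _ := by
        refine integral_congr_ae (Filter.Eventually.of_forall fun t => ?_)
        simp only [planeIntegral]
        rw [← integral_mul_const]
        refine integral_congr_ae (Filter.Eventually.of_forall fun p => ?_)
        have e : inner ℝ ϑ (t • ϑ + perpProj ϑ p) = t := by
          rw [inner_add_right, inner_perpProj h0, inner_smul_right, real_inner_self_eq_norm_sq, hϑ]
          ring
        simp only [e]; ring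

/-- Plancherel along a line, for functions with Gaussian decay in the orthogonal directions. -/
lemma lintegral_line_fourier_sq_le {a : ℝ} (ha : 0 < a) (ha' : a ≤ Real.pi) {ϑ : E} (hϑ : ‖ϑ‖ = 1)
    {K : E → ℂ} (hK : Integrable K) {H : E → ℝ≥0∞} (hH : Measurable H)
    (hKH : ∀ ξ, ‖K ξ‖ₑ ≤ H ξ * ENNReal.ofReal (Real.exp (-a * ‖perpProj ϑ ξ‖ ^ 2))) :
    ∫⁻ r : ℝ, ‖∫ ξ, K ξ * Complex.exp (2 * Real.pi * Complex.I * (r * inner ℝ ϑ ξ : ℝ))‖ₑ ^ 2 ≤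
      ENNReal.ofReal ((Real.pi / a) ^ (Module.finrank ℝ E / 2 : ℝ)) *
        ∫⁻ ξ, H ξ ^ 2 * ENNReal.ofReal (Real.exp (-a * ‖perpProj ϑ ξ‖ ^ 2)) := by
  have h0 : ϑ ≠ 0 := by intro h; simp [h] at hϑ
  set A := ENNReal.ofReal ((Real.pi / a) ^ (Module.finrank ℝ E / 2 : ℝ))
  set R := ∫⁻ ξ, H ξ ^ 2 * ENNReal.ofReal (Real.exp (-a * ‖perpProj ϑ ξ‖ ^ 2))
  have hP : Measurable fun p : E => perpProj ϑ p :=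
    measurable_perpProj.comp (measurable_prodMk_left (x := ϑ))
  have hGi : Integrable (planeIntegral ϑ K) := (integrable_swap hϑ hK).integral_prod_right
  set w : E → ℝ≥0∞ := fun p => ENNReal.ofReal (Real.exp (-a * ‖perpProj ϑ p‖ ^ 2)) *
    ENNReal.ofReal (Real.exp (-Real.pi * inner ℝ ϑ p ^ 2))
  have hw : Measurable w := by fun_prop
  -- Since `a ≤ π`, the two Gaussians together are at most `exp(-a|p|²)`.
  have hwA : ∫⁻ p, w p ≤ A := by
    rw [show A = _ from (lintegral_exp_neg_mul_sq_norm (E := E) ha).symm]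
    refine lintegral_mono fun p => ?_
    simp only [w]
    rw [← ENNReal.ofReal_mul (Real.exp_pos _).le, ← Real.exp_add]
    refine ENNReal.ofReal_le_ofReal (Real.exp_le_exp.2 ?_)
    rw [norm_perpProj_sq h0, hϑ]
    nlinarith [sq_nonneg (inner ℝ ϑ p)]
  -- Cauchy–Schwarz on each hyperplane with respect to the finite measure of density `w`.
  have hG : ∀ t, ‖planeIntegral ϑ K t‖ₑ ^ 2 ≤ A * ∫⁻ p, H (t • ϑ + perpProj ϑ p) ^ 2 * w p := by
    intro t
    have h1 : ‖planeIntegral ϑ K t‖ₑ ≤ ∫⁻ p, H (t • ϑ + perpProj ϑ p) ∂(volume.withDensity w) := by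
      unfold planeIntegral
      refine (enorm_integral_le_lintegral_enorm _).trans ?_
      rw [lintegral_withDensity_eq_lintegral_mul _ hw (by fun_prop)]
      refine lintegral_mono fun p => ?_
      have e : ‖(Real.exp (-Real.pi * inner ℝ ϑ p ^ 2) : ℂ)‖ₑ =
          ENNReal.ofReal (Real.exp (-Real.pi * inner ℝ ϑ p ^ 2)) := by
        rw [← ofReal_norm, Complex.norm_real, Real.norm_of_nonneg (Real.exp_pos _).le]
      rw [enorm_mul, e]
      refine (mul_le_mul_left (hKH _) _).trans (le_of_eq ?_)
      rw [perpProj_add_smul hϑ]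
      simp only [w, Pi.mul_apply]; ring
    refine (ENNReal.pow_le_pow_left h1).trans ((sq_lintegral_le _ (by fun_prop)).trans ?_)
    rw [withDensity_apply _ MeasurableSet.univ, Measure.restrict_univ, mul_comm,
      lintegral_withDensity_eq_lintegral_mul _ hw (by fun_prop)]
    refine mul_le_mul' hwA (le_of_eq (lintegral_congr fun p => ?_))
    simp only [Pi.mul_apply]; ring
  have hGR : ∫⁻ t, ‖planeIntegral ϑ K t‖ₑ ^ 2 ≤ A * R := by
    have hF : Measurable (Function.uncurry fun (u : E) (s : ℝ) => H u ^ 2 *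
        ENNReal.ofReal (Real.exp (-a * ‖perpProj ϑ u‖ ^ 2)) *
          ENNReal.ofReal (Real.exp (-Real.pi * s ^ 2))) := by
      have : Measurable fun z : E × ℝ => perpProj ϑ z.1 := hP.comp measurable_fst
      unfold Function.uncurry; fun_prop
    have h2 := lintegral_planeSwap hϑ hF
    have h3 : ∀ u : E, ∫⁻ s : ℝ, H u ^ 2 * ENNReal.ofReal (Real.exp (-a * ‖perpProj ϑ u‖ ^ 2)) *
          ENNReal.ofReal (Real.exp (-Real.pi * s ^ 2)) =
        H u ^ 2 * ENNReal.ofReal (Real.exp (-a * ‖perpProj ϑ u‖ ^ 2)) := fun u => by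
      rw [lintegral_const_mul _ (by fun_prop), lintegral_gauss, mul_one]
    simp_rw [h3] at h2
    have hm : Measurable fun z : E × ℝ => H (z.2 • ϑ + perpProj ϑ z.1) ^ 2 * w z.1 := by
      have : Measurable fun z : E × ℝ => perpProj ϑ z.1 := hP.comp measurable_fst
      fun_prop
    refine (lintegral_mono hG).trans ?_
    rw [lintegral_const_mul _ hm.lintegral_prod_left']
    refine mul_le_mul_right (le_of_eq ?_) _
    rw [show R = _ from h2.symm, ← lintegral_lintegral_swap hm.aemeasurable]
    refine lintegral_congr fun p => lintegral_congr fun t => ?_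
    rw [perpProj_add_smul hϑ]
    simp only [w]; ring
  -- Finiteness is what puts the hyperplane integrals in L², as Plancherel requires; otherwise the
  -- claim is void.
  by_cases hR : A * R = ⊤
  · rw [hR]; exact le_top
  have hG2 : MemLp (planeIntegral ϑ K) 2 volume := by
    refine ⟨hGi.aestronglyMeasurable, ?_⟩
    have : eLpNorm (planeIntegral ϑ K) 2 volume ^ 2 < ⊤ := by
      rw [eLpNorm_two_sq]; exact hGR.trans_lt (Ne.lt_top hR)
    by_contra hc
    rw [not_lt_top_iff] at hc
    rw [hc] at this
    simp at this
  refine le_trans (le_of_eq ?_) hGR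
  rw [← lintegral_fourier_sq hGi hG2, ← lintegral_neg_eq_self]
  refine lintegral_congr fun r => ?_
  rw [integral_mul_cexp_eq_planeIntegral hϑ hK, Real.fourier_real_eq_integral_exp_smul]
  congr 2
  refine integral_congr_ae (Filter.Eventually.of_forall fun t => ?_)
  simp only [smul_eq_mul]
  rw [mul_comm]
  congr 2
  push_cast; ring

end LineFourier

/-! ### Spherical averages of transverse Gaussians -/

section SphereGaussian

variable {N : ℕ}

/-- Multiplying by a Gaussian in an auxiliary scalar and applying `lintegral_planeSwap` gives the
Gaussian integral over the whole space times the width `2` of the slab; the auxiliary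
one-dimensional factor is then cancelled. -/
lemma lintegral_slab_gauss {θ : Vel N} (hθ : ‖θ‖ = 1) {b : ℝ} (hb : 0 < b) :
    ∫⁻ x : Vel N, (if |inner ℝ θ x| < 1 then 1 else 0) *
      ENNReal.ofReal (Real.exp (-b * ‖perpProj θ x‖ ^ 2)) =
      2 * ENNReal.ofReal ((Real.pi / b) ^ (((N : ℝ) - 1) / 2)) := by
  have h0 : θ ≠ 0 := by intro h; simp [h] at hθ
  have hP : Measurable fun p : Vel N => perpProj θ p :=
    measurable_perpProj.comp (measurable_prodMk_left (x := θ))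
  set I : Vel N → ℝ≥0∞ := fun x => (if |inner ℝ θ x| < 1 then 1 else 0) *
      ENNReal.ofReal (Real.exp (-b * ‖perpProj θ x‖ ^ 2))
  have hind : Measurable fun x : Vel N => (if |inner ℝ θ x| < 1 then (1 : ℝ≥0∞) else 0) :=
    Measurable.ite (measurableSet_lt (by fun_prop) measurable_const) measurable_const
      measurable_const
  have hI : Measurable I := by fun_prop
  have hF : Measurable (Function.uncurry fun (u : Vel N) (s : ℝ) => I u *
      ENNReal.ofReal (Real.exp (-b * s ^ 2))) := by unfold Function.uncurry; fun_prop
  have h := lintegral_planeSwap hθ hF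
  have hg : ∫⁻ s : ℝ, ENNReal.ofReal (Real.exp (-b * s ^ 2)) =
      ENNReal.ofReal ((Real.pi / b) ^ (1 / 2 : ℝ)) := by
    have := lintegral_exp_neg_mul_sq_norm (E := ℝ) hb
    simpa using this
  have hR : ∫⁻ u, ∫⁻ s : ℝ, I u * ENNReal.ofReal (Real.exp (-b * s ^ 2)) =
      (∫⁻ u, I u) * ENNReal.ofReal ((Real.pi / b) ^ (1 / 2 : ℝ)) := by
    rw [← hg, ← lintegral_mul_const _ hI]
    exact lintegral_congr fun u => lintegral_const_mul _ (by fun_prop)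
  have hL : ∫⁻ p : Vel N, ∫⁻ t : ℝ, I (t • θ + perpProj θ p) *
      ENNReal.ofReal (Real.exp (-b * inner ℝ θ p ^ 2)) =
      2 * ENNReal.ofReal ((Real.pi / b) ^ ((N : ℝ) / 2)) := by
    have e := lintegral_exp_neg_mul_sq_norm (E := Vel N) hb
    rw [finrank_euclideanSpace, Fintype.card_fin] at e
    rw [← e, ← lintegral_const_mul _ (by fun_prop)]
    refine lintegral_congr fun p => ?_
    have h1 : ∀ t : ℝ, I (t • θ + perpProj θ p) * ENNReal.ofReal (Real.exp (-b * inner ℝ θ p ^ 2)) =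
        (Set.Ioo (-1 : ℝ) 1).indicator (fun _ => (1 : ℝ≥0∞)) t *
          ENNReal.ofReal (Real.exp (-b * ‖p‖ ^ 2)) := by
      intro t
      have e1 : inner ℝ θ (t • θ + perpProj θ p) = t := by
        rw [inner_add_right, inner_perpProj h0, inner_smul_right, real_inner_self_eq_norm_sq, hθ]
        ring
      simp only [I, e1]
      rw [perpProj_add_smul hθ, mul_assoc, ← ENNReal.ofReal_mul (Real.exp_pos _).le,
        ← Real.exp_add, norm_perpProj_sq h0, hθ]
      congr 1
      · by_cases ht : |t| < 1
        · rw [if_pos ht, Set.indicator_of_mem (by exact abs_lt.1 ht)]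
        · rw [if_neg ht, Set.indicator_of_notMem (s := Set.Ioo (-1 : ℝ) 1)
            (fun h => ht (abs_lt.2 ⟨h.1, h.2⟩))]
      · congr 2; ring
    simp_rw [h1]
    rw [lintegral_mul_const _ (measurable_const.indicator measurableSet_Ioo),
      lintegral_indicator measurableSet_Ioo]
    simp
    norm_num
  rw [hR] at h
  rw [hL] at h
  have hpos : 0 < (Real.pi / b) ^ (1 / 2 : ℝ) := by have := Real.pi_pos; positivity
  have hpb : 0 < Real.pi / b := by have := Real.pi_pos; positivity
  refine (ENNReal.mul_left_inj (c := ENNReal.ofReal ((Real.pi / b) ^ (1 / 2 : ℝ)))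
    (by rw [Ne, ENNReal.ofReal_eq_zero, not_le]; exact hpos) ENNReal.ofReal_ne_top).1 ?_
  rw [← h, mul_assoc, ← ENNReal.ofReal_mul (by positivity), ← Real.rpow_add hpb]
  congr 3; ring

/-- Both sides equal `|x|²|ξ|² - (x·ξ)²`. -/
lemma norm_perpProj_symm {x ξ : Vel N} (hx : x ≠ 0) (hξ : ξ ≠ 0) :
    ‖perpProj x ξ‖ ^ 2 * ‖x‖ ^ 2 = ‖perpProj ξ x‖ ^ 2 * ‖ξ‖ ^ 2 := by
  have h1 : ‖x‖ ≠ 0 := norm_ne_zero_iff.2 hx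
  have h2 : ‖ξ‖ ≠ 0 := norm_ne_zero_iff.2 hξ
  rw [norm_perpProj_sq hx, norm_perpProj_sq hξ, real_inner_comm]
  field_simp

/-- The average over the sphere of a Gaussian in the variable orthogonal to the direction. -/
lemma lintegral_sphere_gauss_le (hN : 2 ≤ N) {a : ℝ} (ha : 0 < a) : ∃ C : ℝ≥0, ∀ ξ : Vel N,
    ∫⁻ ϑ : Sph N, ENNReal.ofReal (Real.exp (-a * ‖perpProj (ϑ : Vel N) ξ‖ ^ 2))
      ∂(volume : Measure (Vel N)).toSphere ≤ C * ENNReal.ofReal (jb ξ ^ (-(((N : ℝ) - 1) / 2))) := by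
  have : Nontrivial (Vel N) := by
    have : Nonempty (Fin N) := ⟨⟨0, by omega⟩⟩
    infer_instance
  have hfin : Module.finrank ℝ (Vel N) = N := by simp
  set q : ℝ := ((N : ℝ) - 1) / 2
  have hq : 0 ≤ q := by
    have : (2 : ℝ) ≤ N := by exact_mod_cast hN
    simp only [q]; linarith
  set S : ℝ≥0∞ := (volume : Measure (Vel N)).toSphere Set.univ
  have hS : S ≠ ⊤ := measure_ne_top _ _
  set κ : ℝ := 1 + (2 * Real.pi) ^ 2
  have hκ : 0 < κ := by positivity
  -- large frequencies
  have large : ∀ ξ : Vel N, 1 ≤ ‖ξ‖ →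
      ∫⁻ ϑ : Sph N, ENNReal.ofReal (Real.exp (-a * ‖perpProj (ϑ : Vel N) ξ‖ ^ 2))
        ∂(volume : Measure (Vel N)).toSphere ≤
      ENNReal.ofReal (N * (2 * (Real.pi / a * κ) ^ q)) * ENNReal.ofReal (jb ξ ^ (-q)) := by
    intro ξ hξ
    have hξ0 : 0 < ‖ξ‖ := by linarith
    have hξ' : ξ ≠ 0 := norm_pos_iff.1 hξ0
    set θ : Vel N := ‖ξ‖⁻¹ • ξ
    have hθ : ‖θ‖ = 1 := by
      simp only [θ]; rw [norm_smul, norm_inv, norm_norm, inv_mul_cancel₀ hξ0.ne']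
    have hPm : Measurable fun x : Vel N => perpProj x ξ :=
      measurable_perpProj.comp (measurable_prodMk_right (y := ξ))
    set F : Vel N → ℝ≥0∞ := fun x => (if ‖x‖ < 1 then 1 else 0) *
      ENNReal.ofReal (Real.exp (-a * ‖perpProj x ξ‖ ^ 2))
    have hF : Measurable F := Measurable.mul (Measurable.ite
      (measurableSet_lt measurable_norm measurable_const) measurable_const measurable_const)
      (by fun_prop)
    have e1 : ∫⁻ x, F x = (∫⁻ ϑ : Sph N, ENNReal.ofReal
        (Real.exp (-a * ‖perpProj (ϑ : Vel N) ξ‖ ^ 2)) ∂(volume : Measure (Vel N)).toSphere) *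
        ENNReal.ofReal (1 / N) := by
      have hm : Measurable fun ϑ : Sph N => ENNReal.ofReal
          (Real.exp (-a * ‖perpProj (ϑ : Vel N) ξ‖ ^ 2)) := by
        have : Measurable fun ϑ : Sph N => perpProj (ϑ : Vel N) ξ :=
          hPm.comp measurable_subtype_coe
        fun_prop
      rw [lintegral_polar hF, hfin, ← lintegral_mul_const _ hm]
      refine lintegral_congr fun ϑ => ?_
      have e : ((N - 1 : ℕ) : ℝ) + 1 = N := by rw [Nat.cast_sub (by omega)]; simp
      rw [← e, ← lintegral_pow_unit (N - 1), ← lintegral_const_mul _ (by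
        refine Measurable.mul (by fun_prop) ?_
        exact Measurable.ite measurableSet_Iio measurable_const measurable_const)]
      refine setLIntegral_congr_fun measurableSet_Ioi fun r hr => ?_
      have hr : 0 < r := hr
      simp only [F]
      rw [perpProj_smul hr.ne', norm_smul, Real.norm_of_nonneg hr.le, show ‖(ϑ : Vel N)‖ = 1 by simp,
        mul_one]
      ring
    -- In the unit ball `|P_x ξ|² ≥ |ξ|²|P_ξ x|²`, and the ball lies in the slab `|θ·x| < 1`. The
    -- average becomes a Gaussian integral over `ξ⊥` with variance of order `|ξ|^{-2}`, which yields
    -- `|ξ|^{-(N-1)}`.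
    have e2 : ∫⁻ x, F x ≤ 2 * ENNReal.ofReal ((Real.pi / (a * ‖ξ‖ ^ 2)) ^ q) := by
      rw [← lintegral_slab_gauss hθ (by positivity : 0 < a * ‖ξ‖ ^ 2)]
      refine lintegral_mono_ae ?_
      have h0 : ∀ᵐ u : Vel N, u ≠ 0 := by rw [ae_iff]; simp
      filter_upwards [h0] with x hx
      simp only [F]
      by_cases h1 : ‖x‖ < 1
      · have h2 : |inner ℝ θ x| < 1 := by
          refine (abs_real_inner_le_norm _ _).trans_lt ?_
          rwa [hθ, one_mul]
        rw [if_pos h1, if_pos h2]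
        refine mul_le_mul' le_rfl (ENNReal.ofReal_le_ofReal (Real.exp_le_exp.2 ?_))
        have h3 := norm_perpProj_symm hx hξ'
        have h4 : perpProj θ x = perpProj ξ x := perpProj_smul (inv_ne_zero hξ0.ne') ξ x
        rw [h4]
        have h5 : ‖x‖ ^ 2 ≤ 1 := by nlinarith [norm_nonneg x]
        have h6 : ‖perpProj ξ x‖ ^ 2 * ‖ξ‖ ^ 2 ≤ ‖perpProj x ξ‖ ^ 2 := by
          rw [← h3]; exact mul_le_of_le_one_right (by positivity) h5
        nlinarith
      · rw [if_neg h1, zero_mul]; exact zero_le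
    have hNpos : (0 : ℝ) < N := by exact_mod_cast (by omega : 0 < N)
    have e3 : ∫⁻ ϑ : Sph N, ENNReal.ofReal
        (Real.exp (-a * ‖perpProj (ϑ : Vel N) ξ‖ ^ 2)) ∂(volume : Measure (Vel N)).toSphere =
        (∫⁻ x, F x) * ENNReal.ofReal N := by
      rw [e1, mul_assoc, ← ENNReal.ofReal_mul (by positivity), one_div,
        inv_mul_cancel₀ hNpos.ne', ENNReal.ofReal_one, mul_one]
    have hpi := Real.pi_pos
    have e4 : (Real.pi / (a * ‖ξ‖ ^ 2)) ^ q ≤ (Real.pi / a * κ) ^ q * jb ξ ^ (-q) := by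
      rw [Real.rpow_neg (jb_pos ξ).le, ← div_eq_mul_inv, ← Real.div_rpow (by positivity)
        (jb_pos ξ).le]
      refine Real.rpow_le_rpow (by positivity) ?_ hq
      rw [div_le_div_iff₀ (by positivity) (jb_pos ξ)]
      have h7 : jb ξ ≤ κ * ‖ξ‖ ^ 2 := by
        unfold jb; simp only [κ]; nlinarith [norm_nonneg ξ]
      calc Real.pi * jb ξ ≤ Real.pi * (κ * ‖ξ‖ ^ 2) := by gcongr
        _ = _ := by field_simp
    rw [e3]
    calc (∫⁻ x, F x) * ENNReal.ofReal N
        ≤ 2 * ENNReal.ofReal ((Real.pi / a * κ) ^ q * jb ξ ^ (-q)) * ENNReal.ofReal N := by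
          gcongr
          exact e2.trans (by gcongr)
      _ = _ := by
        have e5 : ∀ x : ℝ, 2 * ENNReal.ofReal x = ENNReal.ofReal (2 * x) := fun x => by
          rw [ENNReal.ofReal_mul (by norm_num)]; simp
        rw [e5, ← ENNReal.ofReal_mul (by have := jb_rpow_pos (-q) ξ; positivity),
          ← ENNReal.ofReal_mul (by positivity)]
        congr 1; ring
  -- For bounded frequencies the total mass of the sphere is enough, `jb` being comparable to `1`.
  have small : ∀ ξ : Vel N, ‖ξ‖ ≤ 1 →
      ∫⁻ ϑ : Sph N, ENNReal.ofReal (Real.exp (-a * ‖perpProj (ϑ : Vel N) ξ‖ ^ 2))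
        ∂(volume : Measure (Vel N)).toSphere ≤
      S * ENNReal.ofReal (κ ^ q) * ENNReal.ofReal (jb ξ ^ (-q)) := by
    intro ξ hξ
    have h1 : ∫⁻ ϑ : Sph N, ENNReal.ofReal (Real.exp (-a * ‖perpProj (ϑ : Vel N) ξ‖ ^ 2))
        ∂(volume : Measure (Vel N)).toSphere ≤ S := by
      refine (lintegral_mono (g := fun _ => 1) fun ϑ => ?_).trans (by simp [S])
      rw [← ENNReal.ofReal_one]
      refine ENNReal.ofReal_le_ofReal (Real.exp_le_one_iff.2 ?_)
      have := mul_nonneg ha.le (sq_nonneg ‖perpProj (ϑ : Vel N) ξ‖)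
      linarith
    refine h1.trans ?_
    rw [mul_assoc, ← ENNReal.ofReal_mul (by positivity)]
    refine le_mul_of_one_le_right zero_le ?_
    rw [ENNReal.one_le_ofReal, Real.rpow_neg (jb_pos ξ).le, ← div_eq_mul_inv,
      one_le_div (Real.rpow_pos_of_pos (jb_pos ξ) _)]
    refine Real.rpow_le_rpow (jb_pos ξ).le ?_ hq
    have h2 : (2 * Real.pi * ‖ξ‖) ^ 2 ≤ (2 * Real.pi) ^ 2 := by
      have := Real.pi_pos
      exact pow_le_pow_left₀ (by positivity) (mul_le_of_le_one_right (by positivity) hξ) 2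
    unfold jb; simp only [κ]; linarith
  refine ⟨(ENNReal.ofReal (N * (2 * (Real.pi / a * κ) ^ q)) +
    S * ENNReal.ofReal (κ ^ q)).toNNReal, fun ξ => ?_⟩
  rw [ENNReal.coe_toNNReal (ENNReal.add_ne_top.2 ⟨ENNReal.ofReal_ne_top,
    ENNReal.mul_ne_top hS ENNReal.ofReal_ne_top⟩)]
  rcases le_total 1 ‖ξ‖ with h | h
  · exact (large ξ h).trans (by gcongr; exact le_self_add)
  · exact (small ξ h).trans (by gcongr; exact le_add_self)

end SphereGaussian

/-! ### Rapidly decaying functions -/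

section RapidDecay

variable {E : Type*} [NormedAddCommGroup E] [InnerProductSpace ℝ E] [FiniteDimensional ℝ E]
  [MeasurableSpace E] [BorelSpace E]

/-- Measurable functions decaying faster than any power. -/
structure Rapid (h : E → ℂ) : Prop where
  meas : Measurable h
  decay : ∀ n : ℕ, ∃ C : ℝ, ∀ ξ, ‖h ξ‖ ≤ C * jb ξ ^ (-(n : ℝ))

lemma one_add_norm_sq_le_jb (ξ : E) : 1 + ‖ξ‖ ^ 2 ≤ jb ξ := by
  have h3 := Real.pi_gt_three
  have : 1 ≤ 2 * Real.pi := by linarith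
  unfold jb
  have h4 : 1 ≤ (2 * Real.pi) ^ 2 := one_le_pow₀ this
  rw [mul_pow]
  nlinarith [sq_nonneg ‖ξ‖]

lemma norm_le_jb_rpow_half (ξ : E) : ‖ξ‖ ≤ jb ξ ^ (1 / 2 : ℝ) := by
  rw [← Real.sqrt_eq_rpow]
  exact Real.le_sqrt_of_sq_le (by linarith [one_add_norm_sq_le_jb ξ])

lemma integrable_jb_rpow {r : ℝ} (hr : (Module.finrank ℝ E : ℝ) < 2 * r) :
    Integrable (fun ξ : E => jb ξ ^ (-r)) := by
  have h := integrable_rpow_neg_one_add_norm_sq (E := E) (μ := volume) hr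
  refine h.mono (continuous_jb_rpow _).aestronglyMeasurable (Filter.Eventually.of_forall fun ξ => ?_)
  rw [Real.norm_of_nonneg (jb_rpow_pos _ _).le, Real.norm_of_nonneg (by positivity)]
  rw [show -(2 * r) / 2 = -r by ring]
  have hr0 : 0 ≤ r := by
    have : (0 : ℝ) ≤ Module.finrank ℝ E := by positivity
    linarith
  exact Real.rpow_le_rpow_of_nonpos (by positivity) (one_add_norm_sq_le_jb ξ) (by linarith)

lemma Rapid.of_le {h h' : E → ℂ} (H : Rapid h) (hm : Measurable h') {C : ℝ} {m : ℕ}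
    (hle : ∀ ξ, ‖h' ξ‖ ≤ C * jb ξ ^ (m : ℝ) * ‖h ξ‖) : Rapid h' := by
  refine ⟨hm, fun n => ?_⟩
  obtain ⟨D, hD⟩ := H.decay (n + m)
  have hC : 0 ≤ |C| := abs_nonneg C
  refine ⟨|C| * D, fun ξ => (hle ξ).trans ?_⟩
  have h1 := jb_rpow_pos (m : ℝ) ξ
  calc C * jb ξ ^ (m : ℝ) * ‖h ξ‖ ≤ |C| * jb ξ ^ (m : ℝ) * (D * jb ξ ^ (-((n + m : ℕ) : ℝ))) := by
        gcongr
        · exact le_abs_self C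
        · exact hD ξ
    _ = |C| * D * (jb ξ ^ (m : ℝ) * jb ξ ^ (-((n + m : ℕ) : ℝ))) := by ring
    _ = _ := by
      rw [← Real.rpow_add (jb_pos ξ)]
      congr 2; push_cast; ring

lemma Rapid.memLp {h : E → ℂ} (H : Rapid h) (p : ℝ≥0∞) (hp : p = 1 ∨ p = 2) : MemLp h p volume := by
  obtain ⟨C, hC⟩ := H.decay (Module.finrank ℝ E + 1)
  have hC0 : 0 ≤ C := by
    have := (norm_nonneg _).trans (hC 0)
    exact nonneg_of_mul_nonneg_left this (jb_rpow_pos _ _)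
  have hd : (0 : ℝ) ≤ Module.finrank ℝ E := Nat.cast_nonneg _
  have h1 : MemLp (fun ξ : E => C * jb ξ ^ (-((Module.finrank ℝ E + 1 : ℕ) : ℝ))) p volume := by
    rcases hp with rfl | rfl
    · rw [memLp_one_iff_integrable]
      exact (integrable_jb_rpow (by push_cast; linarith)).const_mul C
    · rw [memLp_two_iff_integrable_sq (by
        exact (continuous_const.mul (continuous_jb_rpow _)).aestronglyMeasurable)]
      have := (integrable_jb_rpow (E := E) (r := 2 * ((Module.finrank ℝ E + 1 : ℕ) : ℝ))
        (by push_cast; linarith)).const_mul (C ^ 2)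
      refine this.congr (Filter.Eventually.of_forall fun ξ => ?_)
      simp only
      rw [mul_pow, ← Real.rpow_natCast (jb ξ ^ _) 2, ← Real.rpow_mul (jb_pos ξ).le]
      congr 2; push_cast; ring
  refine h1.mono H.meas.aestronglyMeasurable (Filter.Eventually.of_forall fun ξ => ?_)
  refine (hC ξ).trans (le_abs_self _)

lemma Rapid.integrable {h : E → ℂ} (H : Rapid h) : Integrable h :=
  memLp_one_iff_integrable.1 (H.memLp 1 (Or.inl rfl))

lemma Rapid.eLpNorm_jb_lt_top {h : E → ℂ} (H : Rapid h) (r : ℝ) :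
    eLpNorm (fun ξ => (jb ξ ^ r : ℝ) • h ξ) 2 volume < ⊤ := by
  obtain ⟨m, hm⟩ := exists_nat_ge r
  have hmeas : Measurable fun ξ => (jb ξ ^ r : ℝ) • h ξ :=
    (continuous_jb_rpow r).measurable.smul H.meas
  refine ((H.of_le (C := 1) (m := m) hmeas fun ξ => ?_).memLp 2 (Or.inr rfl)).2
  rw [norm_smul, Real.norm_of_nonneg (jb_rpow_pos r ξ).le, one_mul]
  gcongr
  exact one_le_jb ξ

end RapidDecay

/-! ### Amplitudes and the oscillatory operator -/

section Amplitudes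

variable {N : ℕ}

/-- The kernel `exp(2πiκ x·ξ - π|P_x ξ|²)`. -/
noncomputable def planeKernel (κ : ℝ) (x ξ : Vel N) : ℂ :=
  Complex.exp (2 * Real.pi * Complex.I * (κ * inner ℝ x ξ : ℝ) -
    (Real.pi * ‖perpProj x ξ‖ ^ 2 : ℝ))

lemma norm_planeKernel (κ : ℝ) (x ξ : Vel N) :
    ‖planeKernel κ x ξ‖ = Real.exp (-(Real.pi * ‖perpProj x ξ‖ ^ 2)) := by
  unfold planeKernel
  rw [Complex.norm_exp]
  congr 1
  rw [Complex.sub_re, Complex.ofReal_re, show (2 * Real.pi * Complex.I * (κ * inner ℝ x ξ : ℝ) : ℂ) =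
    ((2 * Real.pi * (κ * inner ℝ x ξ) : ℝ) : ℂ) * Complex.I by push_cast; ring]
  simp

@[fun_prop]
lemma measurable_planeKernel (κ : ℝ) :
    Measurable (fun z : Vel N × Vel N => planeKernel κ z.1 z.2) := by
  have := measurable_perpProj (E := Vel N)
  unfold planeKernel; fun_prop

/-- Smooth functions with compact support away from the origin. -/
structure CutOff (c : Vel N → ℂ) : Prop where
  smooth : ContDiff ℝ ∞ c
  compact : HasCompactSupport c
  zero : (0 : Vel N) ∉ tsupport c

/-- Monomials in `ξ` (of degree `k`) and `P_x ξ` (of any degree). -/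
inductive QMon : ℕ → (Vel N → Vel N → ℂ) → Prop
  | one : QMon 0 (fun _ _ => 1)
  | xi {k : ℕ} {q : Vel N → Vel N → ℂ} (i : Fin N) (h : QMon k q) :
      QMon (k + 1) (fun x ξ => ((ξ i : ℝ) : ℂ) * q x ξ)
  | proj {k : ℕ} {q : Vel N → Vel N → ℂ} (i : Fin N) (h : QMon k q) :
      QMon k (fun x ξ => ((perpProj x ξ i : ℝ) : ℂ) * q x ξ)

/-- The amplitudes of order `k`. -/
inductive Amp : ℕ → (Vel N → Vel N → ℂ) → Prop
  | term {k : ℕ} {c : Vel N → ℂ} {q : Vel N → Vel N → ℂ} (hc : CutOff c) (hq : QMon k q) :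
      Amp k (fun x ξ => c x * q x ξ)
  | add {k : ℕ} {a b : Vel N → Vel N → ℂ} (ha : Amp k a) (hb : Amp k b) :
      Amp k (fun x ξ => a x ξ + b x ξ)
  | mono {k l : ℕ} {a : Vel N → Vel N → ℂ} (ha : Amp k a) (hkl : k ≤ l) : Amp l a

lemma QMon.measurable {k : ℕ} {q : Vel N → Vel N → ℂ} (h : QMon k q) :
    Measurable (fun z : Vel N × Vel N => q z.1 z.2) := by
  induction h with
  | one => exact measurable_const
  | xi i h ih => fun_prop
  | proj i h ih =>
    have := measurable_perpProj (E := Vel N)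
    refine Measurable.mul ?_ ih
    exact Complex.measurable_ofReal.comp ((EuclideanSpace.proj (𝕜 := ℝ) i).measurable.comp this)

lemma QMon.smul {k : ℕ} {q : Vel N → Vel N → ℂ} (h : QMon k q) {r : ℝ} (hr : r ≠ 0)
    (x ξ : Vel N) : q (r • x) ξ = q x ξ := by
  induction h with
  | one => rfl
  | xi i h ih => simp only [ih]
  | proj i h ih => simp only [ih, perpProj_smul hr]

lemma abs_coord_le (v : Vel N) (i : Fin N) : |v i| ≤ ‖v‖ := PiLp.norm_apply_le v i

lemma le_mul_exp_sq {ε : ℝ} (hε : 0 < ε) (t : ℝ) :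
    t ≤ (1 + ε⁻¹) * Real.exp (ε * t ^ 2) := by
  have h1 := Real.add_one_le_exp (ε * t ^ 2)
  have h2 : t ≤ 1 + t ^ 2 := by nlinarith [sq_nonneg (t - 1)]
  have h3 : 1 ≤ Real.exp (ε * t ^ 2) := Real.one_le_exp (by positivity)
  have h4 : t ^ 2 ≤ ε⁻¹ * Real.exp (ε * t ^ 2) := by
    rw [← div_eq_inv_mul, le_div_iff₀ hε]; linarith
  linarith

/-- A factor `P_x ξ` is bounded by an arbitrarily slow Gaussian growth `exp(ε|P_x ξ|²)`, which the
decay of the kernel compensates; hence it does not count in the order `k`. -/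
lemma QMon.exists_bound {k : ℕ} {q : Vel N → Vel N → ℂ} (h : QMon k q) :
    ∀ ε : ℝ, 0 < ε → ∃ C : ℝ, 0 ≤ C ∧ ∀ x ξ, ‖q x ξ‖ ≤
      C * jb ξ ^ ((k : ℝ) / 2) * Real.exp (ε * ‖perpProj x ξ‖ ^ 2) := by
  induction h with
  | one =>
    refine fun ε hε => ⟨1, zero_le_one, fun x ξ => ?_⟩
    simp only [norm_one, Nat.cast_zero, zero_div, Real.rpow_zero, one_mul]
    exact Real.one_le_exp (by positivity)
  | @xi k q i h ih =>
    intro ε hε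
    obtain ⟨C, hC, hb⟩ := ih ε hε
    refine ⟨C, hC, fun x ξ => ?_⟩
    rw [norm_mul, Complex.norm_real, Real.norm_eq_abs]
    have e : jb ξ ^ (((k + 1 : ℕ) : ℝ) / 2) = jb ξ ^ (1 / 2 : ℝ) * jb ξ ^ ((k : ℝ) / 2) := by
      rw [← Real.rpow_add (jb_pos ξ)]; congr 1; push_cast; ring
    rw [e]
    have h1 := (abs_coord_le ξ i).trans (norm_le_jb_rpow_half ξ)
    have h2 := jb_rpow_pos (1 / 2) ξ
    calc |ξ i| * ‖q x ξ‖ ≤ jb ξ ^ (1 / 2 : ℝ) *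
          (C * jb ξ ^ ((k : ℝ) / 2) * Real.exp (ε * ‖perpProj x ξ‖ ^ 2)) := by
          gcongr; exact hb x ξ
      _ = _ := by ring
  | @proj k q i h ih =>
    intro ε hε
    obtain ⟨C, hC, hb⟩ := ih (ε / 2) (by positivity)
    refine ⟨(1 + (ε / 2)⁻¹) * C, by positivity, fun x ξ => ?_⟩
    rw [norm_mul, Complex.norm_real, Real.norm_eq_abs]
    have h1 := (abs_coord_le (perpProj x ξ) i).trans
      (le_mul_exp_sq (by positivity : 0 < ε / 2) ‖perpProj x ξ‖)
    have h2 := jb_rpow_pos ((k : ℝ) / 2) ξ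
    have e : Real.exp (ε * ‖perpProj x ξ‖ ^ 2) = Real.exp (ε / 2 * ‖perpProj x ξ‖ ^ 2) *
        Real.exp (ε / 2 * ‖perpProj x ξ‖ ^ 2) := by
      rw [← Real.exp_add]; congr 1; ring
    calc _ ≤ (1 + (ε / 2)⁻¹) * Real.exp (ε / 2 * ‖perpProj x ξ‖ ^ 2) *
          (C * jb ξ ^ ((k : ℝ) / 2) * Real.exp (ε / 2 * ‖perpProj x ξ‖ ^ 2)) := by
          gcongr; exact hb x ξ
      _ = _ := by rw [e]; ring

/-- The operator with kernel `a(x,ξ) exp(2πiκ x·ξ - π|P_x ξ|²)`. -/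
noncomputable def planeOp (κ : ℝ) (a : Vel N → Vel N → ℂ) (h : Vel N → ℂ) (x : Vel N) : ℂ :=
  ∫ ξ, h ξ * (a x ξ * planeKernel κ x ξ)

lemma Amp.measurable {k : ℕ} {a : Vel N → Vel N → ℂ} (h : Amp k a) :
    Measurable (fun z : Vel N × Vel N => a z.1 z.2) := by
  induction h with
  | term hc hq => exact (hc.smooth.continuous.measurable.comp measurable_fst).mul hq.measurable
  | add ha hb iha ihb => exact iha.add ihb
  | mono ha hkl ih => exact ih

lemma CutOff.exists_bound {c : Vel N → ℂ} (hc : CutOff c) : ∃ M : ℝ, 0 ≤ M ∧ ∀ x, ‖c x‖ ≤ M := by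
  obtain ⟨M, hM⟩ := hc.compact.exists_bound_of_continuous hc.smooth.continuous
  exact ⟨M, (norm_nonneg _).trans (hM 0), hM⟩

lemma Amp.exists_bound {k : ℕ} {a : Vel N → Vel N → ℂ} (h : Amp k a) : ∃ C : ℝ, 0 ≤ C ∧ ∀ κ x ξ,
    ‖a x ξ * planeKernel κ x ξ‖ ≤ C * jb ξ ^ (k : ℝ) := by
  induction h with
  | @term k c q hc hq =>
    obtain ⟨M, hM0, hM⟩ := hc.exists_bound
    obtain ⟨C, hC0, hC⟩ := hq.exists_bound Real.pi Real.pi_pos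
    refine ⟨M * C, by positivity, fun κ x ξ => ?_⟩
    rw [norm_mul, norm_mul, norm_planeKernel]
    have h1 := jb_rpow_pos ((k : ℝ) / 2) ξ
    have h2 := hM x
    have h3 := hC x ξ
    calc ‖c x‖ * ‖q x ξ‖ * Real.exp (-(Real.pi * ‖perpProj x ξ‖ ^ 2))
        ≤ M * (C * jb ξ ^ ((k : ℝ) / 2) * Real.exp (Real.pi * ‖perpProj x ξ‖ ^ 2)) *
          Real.exp (-(Real.pi * ‖perpProj x ξ‖ ^ 2)) := by gcongr
      _ = M * C * jb ξ ^ ((k : ℝ) / 2) := by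
        rw [Real.exp_neg]; field_simp
      _ ≤ _ := by
        gcongr
        · exact one_le_jb ξ
        · linarith [Nat.cast_nonneg (α := ℝ) k]
  | add ha hb iha ihb =>
    obtain ⟨C, hC0, hC⟩ := iha
    obtain ⟨D, hD0, hD⟩ := ihb
    refine ⟨C + D, by positivity, fun κ x ξ => ?_⟩
    rw [add_mul, add_mul]
    exact (norm_add_le _ _).trans (add_le_add (hC κ x ξ) (hD κ x ξ))
  | mono ha hkl ih =>
    obtain ⟨C, hC0, hC⟩ := ih
    refine ⟨C, hC0, fun κ x ξ => (hC κ x ξ).trans ?_⟩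
    gcongr
    exact one_le_jb ξ

lemma Amp.rapid {k : ℕ} {a : Vel N → Vel N → ℂ} (ha : Amp k a) {h : Vel N → ℂ} (H : Rapid h)
    (κ : ℝ) (x : Vel N) : Rapid (fun ξ => h ξ * (a x ξ * planeKernel κ x ξ)) := by
  obtain ⟨C, hC0, hC⟩ := ha.exists_bound
  refine H.of_le (C := C) (m := k) ?_ fun ξ => ?_
  · exact H.meas.mul ((ha.measurable.comp (f := fun ξ => (x, ξ)) (by fun_prop)).mul
      ((measurable_planeKernel κ).comp (f := fun ξ => (x, ξ)) (by fun_prop)))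
  · rw [norm_mul, mul_comm]
    exact mul_le_mul_of_nonneg_right (hC κ x ξ) (norm_nonneg _)

lemma Amp.measurable_planeOp {k : ℕ} {a : Vel N → Vel N → ℂ} (ha : Amp k a) {h : Vel N → ℂ}
    (H : Measurable h) (κ : ℝ) : Measurable (planeOp κ a h) := by
  have hm : Measurable (fun z : Vel N × Vel N => h z.2 * (a z.1 z.2 * planeKernel κ z.1 z.2)) :=
    (H.comp measurable_snd).mul (ha.measurable.mul (measurable_planeKernel κ))
  exact (StronglyMeasurable.integral_prod_right (f := fun x ξ => h ξ * (a x ξ * planeKernel κ x ξ))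
    hm.stronglyMeasurable).measurable

end Amplitudes

/-! ### The L² gain of `(N-1)/2` derivatives -/

section PlaneOpL2

variable {N : ℕ}

/-- The restriction of the kernel to a line, without the oscillating factor. -/
noncomputable def lineKernel (q : Vel N → Vel N → ℂ) (h : Vel N → ℂ) (ϑ ξ : Vel N) : ℂ :=
  h ξ * (q ϑ ξ * (Real.exp (-(Real.pi * ‖perpProj ϑ ξ‖ ^ 2)) : ℂ))

lemma measurable_lineKernel {k : ℕ} {q : Vel N → Vel N → ℂ} (hq : QMon k q) {h : Vel N → ℂ}
    (hm : Measurable h) : Measurable (fun z : Vel N × Vel N => lineKernel q h z.1 z.2) := by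
  have := measurable_perpProj (E := Vel N)
  refine (hm.comp measurable_snd).mul (hq.measurable.mul ?_)
  fun_prop

/-- The monomial and the projection depend only on the direction of `x`, so along a ray the only
radial dependence is the character, evaluated at frequency `κr`, and the cutoff. -/
lemma planeOp_smul {k : ℕ} (κ : ℝ) (c : Vel N → ℂ) {q : Vel N → Vel N → ℂ} (hq : QMon k q)
    (h : Vel N → ℂ) {r : ℝ} (hr : 0 < r) (ϑ : Vel N) :
    planeOp κ (fun x ξ => c x * q x ξ) h (r • ϑ) = c (r • ϑ) *
      ∫ ξ, lineKernel q h ϑ ξ * Complex.exp (2 * Real.pi * Complex.I *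
        ((κ * r) * inner ℝ ϑ ξ : ℝ)) := by
  unfold planeOp
  rw [← integral_const_mul]
  refine integral_congr_ae (Filter.Eventually.of_forall fun ξ => ?_)
  simp only [planeKernel, lineKernel]
  rw [hq.smul hr.ne', perpProj_smul hr.ne', sub_eq_add_neg, Complex.exp_add, inner_smul_left]
  push_cast
  simp only [conj_trivial]
  rw [show (κ : ℂ) * (r * (inner ℝ ϑ ξ : ℝ)) = κ * r * (inner ℝ ϑ ξ : ℝ) by ring]
  ring

/-- Half of the Gaussian absorbs the factors `P_ϑ ξ`; the other half remains for Plancherel on the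
line and for the average over directions. -/
lemma lintegral_line_planeOp_le {k : ℕ} {q : Vel N → Vel N → ℂ} (hq : QMon k q) : ∃ A : ℝ≥0,
    ∀ h : Vel N → ℂ, Rapid h → ∀ ϑ : Vel N, ‖ϑ‖ = 1 →
      ∫⁻ r : ℝ, ‖∫ ξ, lineKernel q h ϑ ξ *
        Complex.exp (2 * Real.pi * Complex.I * (r * inner ℝ ϑ ξ : ℝ))‖ₑ ^ 2 ≤
      A * ∫⁻ ξ, ‖(jb ξ ^ ((k : ℝ) / 2) : ℝ) • h ξ‖ₑ ^ 2 *
        ENNReal.ofReal (Real.exp (-(Real.pi / 2) * ‖perpProj ϑ ξ‖ ^ 2)) := by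
  obtain ⟨C, hC0, hC⟩ := hq.exists_bound (Real.pi / 2) (by have := Real.pi_pos; positivity)
  have hpi := Real.pi_pos
  set G := ENNReal.ofReal ((Real.pi / (Real.pi / 2)) ^ (Module.finrank ℝ (Vel N) / 2 : ℝ))
  refine ⟨(G * ENNReal.ofReal C ^ 2).toNNReal, fun h H ϑ hϑ => ?_⟩
  rw [ENNReal.coe_toNNReal (ENNReal.mul_ne_top ENNReal.ofReal_ne_top
    (ENNReal.pow_ne_top ENNReal.ofReal_ne_top))]
  have hJm : Measurable fun ξ : Vel N => (jb ξ ^ ((k : ℝ) / 2) : ℝ) • h ξ :=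
    (continuous_jb_rpow _).measurable.smul H.meas
  have hPm : Measurable fun ξ : Vel N => perpProj ϑ ξ :=
    measurable_perpProj.comp (measurable_prodMk_left (x := ϑ))
  have hpt : ∀ ξ, ‖lineKernel q h ϑ ξ‖ ≤ C * ‖(jb ξ ^ ((k : ℝ) / 2) : ℝ) • h ξ‖ *
      Real.exp (-(Real.pi / 2) * ‖perpProj ϑ ξ‖ ^ 2) := fun ξ => by
    unfold lineKernel
    rw [norm_mul, norm_mul, norm_smul, Complex.norm_real, Real.norm_of_nonneg (Real.exp_pos _).le,
      Real.norm_of_nonneg (jb_rpow_pos _ _).le]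
    have e : Real.exp (-(Real.pi / 2) * ‖perpProj ϑ ξ‖ ^ 2) =
        Real.exp (Real.pi / 2 * ‖perpProj ϑ ξ‖ ^ 2) *
          Real.exp (-(Real.pi * ‖perpProj ϑ ξ‖ ^ 2)) := by
      rw [← Real.exp_add]; congr 1; ring
    calc _ ≤ ‖h ξ‖ * ((C * jb ξ ^ ((k : ℝ) / 2) * Real.exp (Real.pi / 2 * ‖perpProj ϑ ξ‖ ^ 2)) *
          Real.exp (-(Real.pi * ‖perpProj ϑ ξ‖ ^ 2))) := by gcongr; exact hC ϑ ξ
      _ = _ := by rw [e]; ring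
  have hK : Integrable (lineKernel q h ϑ) := by
    refine Rapid.integrable (H.of_le (C := C) (m := k)
      ((measurable_lineKernel hq H.meas).comp (f := fun ξ => (ϑ, ξ)) (by fun_prop)) fun ξ => ?_)
    refine (hpt ξ).trans ?_
    rw [norm_smul, Real.norm_of_nonneg (jb_rpow_pos _ _).le]
    have h1 : Real.exp (-(Real.pi / 2) * ‖perpProj ϑ ξ‖ ^ 2) ≤ 1 :=
      Real.exp_le_one_iff.2 (by nlinarith [sq_nonneg ‖perpProj ϑ ξ‖])
    have h2 := jb_rpow_pos ((k : ℝ) / 2) ξ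
    have h4 := jb_rpow_pos (k : ℝ) ξ
    have h3 : jb ξ ^ ((k : ℝ) / 2) ≤ jb ξ ^ (k : ℝ) :=
      Real.rpow_le_rpow_of_exponent_le (one_le_jb ξ) (by linarith [Nat.cast_nonneg (α := ℝ) k])
    calc _ ≤ C * (jb ξ ^ (k : ℝ) * ‖h ξ‖) * 1 := by gcongr
      _ = _ := by ring
  have main := lintegral_line_fourier_sq_le (a := Real.pi / 2) (by positivity) (by linarith) hϑ hK
    (H := fun ξ => ENNReal.ofReal C * ‖(jb ξ ^ ((k : ℝ) / 2) : ℝ) • h ξ‖ₑ) (by fun_prop) fun ξ => by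
      rw [← ofReal_norm, ← ofReal_norm, ← ENNReal.ofReal_mul hC0,
        ← ENNReal.ofReal_mul (by positivity)]
      exact ENNReal.ofReal_le_ofReal (hpt ξ)
  refine main.trans (le_of_eq ?_)
  rw [mul_assoc]
  congr 1
  rw [← lintegral_const_mul _ (by fun_prop)]
  refine lintegral_congr fun ξ => ?_
  simp only [mul_pow]
  ring

lemma CutOff.exists_radius {c : Vel N → ℂ} (hc : CutOff c) :
    ∃ R : ℝ, 0 < R ∧ ∀ x, R < ‖x‖ → c x = 0 := by
  obtain ⟨R, hR⟩ := hc.compact.isCompact.isBounded.exists_norm_le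
  refine ⟨|R| + 1, by positivity, fun x hx => ?_⟩
  by_contra h
  have h1 := hR x (subset_tsupport c h)
  linarith [le_abs_self R]

/-- The source of the smoothing. In polar coordinates, Plancherel is applied on each ray; then the
integral in `ϑ` falls only on `exp(-(π/2)|P_ϑ ξ|²)` and yields `jb^{-(N-1)/2}` inside the squared
norm. -/
theorem eLpNorm_planeOp_term_le (hN : 2 ≤ N) {κ : ℝ} (hκ : 0 < κ) {k : ℕ} {c : Vel N → ℂ}
    (hc : CutOff c) {q : Vel N → Vel N → ℂ} (hq : QMon k q) : ∃ C : ℝ≥0, ∀ h : Vel N → ℂ, Rapid h →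
      eLpNorm (planeOp κ (fun x ξ => c x * q x ξ) h) 2 volume ≤
        C * eLpNorm (fun ξ => (jb ξ ^ ((k : ℝ) / 2 - ((N : ℝ) - 1) / 4) : ℝ) • h ξ) 2 volume := by
  have : Nontrivial (Vel N) := by
    have : Nonempty (Fin N) := ⟨⟨0, by omega⟩⟩
    infer_instance
  have hfin : Module.finrank ℝ (Vel N) = N := by simp
  obtain ⟨A, hA⟩ := lintegral_line_planeOp_le hq
  obtain ⟨M, hM0, hM⟩ := hc.exists_bound
  obtain ⟨R, hR0, hR⟩ := hc.exists_radius
  obtain ⟨S, hS⟩ := lintegral_sphere_gauss_le hN (a := Real.pi / 2)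
    (by have := Real.pi_pos; positivity)
  set B := ENNReal.ofReal (R ^ (N - 1) * M ^ 2)
  set D : ℝ≥0∞ := B * ENNReal.ofReal κ⁻¹ * A * S
  have hD : D ≠ ⊤ := by
    simp only [D, B]
    exact ENNReal.mul_ne_top (ENNReal.mul_ne_top (ENNReal.mul_ne_top ENNReal.ofReal_ne_top
      ENNReal.ofReal_ne_top) ENNReal.coe_ne_top) ENNReal.coe_ne_top
  refine ⟨(D + 1).toNNReal, fun h H => ?_⟩
  rw [ENNReal.coe_toNNReal (by simpa using hD)]
  have ha : Amp k (fun x ξ => c x * q x ξ) := Amp.term hc hq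
  have hTm := ha.measurable_planeOp H.meas κ
  set nrm := eLpNorm (fun ξ => (jb ξ ^ ((k : ℝ) / 2 - ((N : ℝ) - 1) / 4) : ℝ) • h ξ) 2 volume
  set F : Vel N → ℝ → ℝ≥0∞ := fun ϑ r => ‖∫ ξ, lineKernel q h ϑ ξ *
        Complex.exp (2 * Real.pi * Complex.I * (r * inner ℝ ϑ ξ : ℝ))‖ₑ ^ 2
  have hFm : ∀ ϑ, Measurable (F ϑ) := fun ϑ => by
    have h1 : Measurable fun z : ℝ × Vel N => lineKernel q h ϑ z.2 *
        Complex.exp (2 * Real.pi * Complex.I * (z.1 * inner ℝ ϑ z.2 : ℝ)) :=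
      ((measurable_lineKernel hq H.meas).comp (f := fun z : ℝ × Vel N => (ϑ, z.2))
        (by fun_prop)).mul (by fun_prop)
    have h2 := (StronglyMeasurable.integral_prod_right (ν := (volume : Measure (Vel N)))
      (f := fun (r : ℝ) ξ => lineKernel q h ϑ ξ *
        Complex.exp (2 * Real.pi * Complex.I * (r * inner ℝ ϑ ξ : ℝ))) h1.stronglyMeasurable)
    exact h2.measurable.enorm.pow_const 2
  have hJm : Measurable fun ξ : Vel N => ‖(jb ξ ^ ((k : ℝ) / 2) : ℝ) • h ξ‖ₑ ^ 2 :=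
    ((continuous_jb_rpow _).measurable.smul H.meas).enorm.pow_const 2
  set W : Vel N → Vel N → ℝ≥0∞ := fun ϑ ξ => ‖(jb ξ ^ ((k : ℝ) / 2) : ℝ) • h ξ‖ₑ ^ 2 *
        ENNReal.ofReal (Real.exp (-(Real.pi / 2) * ‖perpProj ϑ ξ‖ ^ 2))
  have hWm : Measurable fun z : Sph N × Vel N => W z.1 z.2 := by
    have h1 : Measurable fun z : Sph N × Vel N => perpProj (z.1 : Vel N) z.2 :=
      measurable_perpProj.comp (f := fun z : Sph N × Vel N => ((z.1 : Vel N), z.2)) (by fun_prop)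
    exact (hJm.comp measurable_snd).mul (by fun_prop)
  -- The cutoff bounds the radial weight by `R^{N-1}`, and the substitution `r ↦ κr` costs `κ⁻¹`.
  have hline : ∀ ϑ : Sph N, ∫⁻ r in Set.Ioi (0 : ℝ), ENNReal.ofReal (r ^ (N - 1)) *
      ‖planeOp κ (fun x ξ => c x * q x ξ) h (r • (ϑ : Vel N))‖ₑ ^ 2 ≤
      B * ENNReal.ofReal κ⁻¹ * A * ∫⁻ ξ, W ϑ ξ := by
    intro ϑ
    have hϑ : ‖(ϑ : Vel N)‖ = 1 := by simp
    have hFκ : Measurable fun r => F ϑ (κ * r) := (hFm ϑ).comp (by fun_prop)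
    calc _ ≤ ∫⁻ r in Set.Ioi (0 : ℝ), B * F ϑ (κ * r) := by
          refine setLIntegral_mono (hFκ.const_mul B) fun r hr => ?_
          have hr : 0 < r := hr
          rw [planeOp_smul κ c hq h hr, enorm_mul, mul_pow, ← mul_assoc]
          refine mul_le_mul' ?_ le_rfl
          by_cases hrR : R < r
          · rw [hR _ (by rw [norm_smul, hϑ, mul_one, Real.norm_of_nonneg hr.le]; exact hrR)]
            simp
          · rw [enorm_sq_eq_ofReal, ← ENNReal.ofReal_mul (by positivity)]
            refine ENNReal.ofReal_le_ofReal ?_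
            have := hM (r • (ϑ : Vel N))
            have h2 := not_lt.1 hrR
            gcongr
      _ = B * (ENNReal.ofReal κ⁻¹ * ∫⁻ r in Set.Ioi (0 : ℝ), F ϑ r) := by
          rw [lintegral_const_mul _ hFκ, lintegral_Ioi_mul hκ (hFm ϑ)]
      _ ≤ B * (ENNReal.ofReal κ⁻¹ * (A * ∫⁻ ξ, W ϑ ξ)) := by
          gcongr
          exact (setLIntegral_le_lintegral _ _).trans (hA h H ϑ hϑ)
      _ = _ := by ring
  have key : eLpNorm (planeOp κ (fun x ξ => c x * q x ξ) h) 2 volume ^ 2 ≤ D * nrm ^ 2 := by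
    rw [eLpNorm_two_sq, lintegral_polar (hTm.enorm.pow_const 2), hfin]
    calc _ ≤ ∫⁻ ϑ : Sph N, (B * ENNReal.ofReal κ⁻¹ * A * ∫⁻ ξ : Vel N, W ϑ ξ)
            ∂(volume : Measure (Vel N)).toSphere := lintegral_mono hline
      _ = B * ENNReal.ofReal κ⁻¹ * A * ∫⁻ ξ : Vel N, ‖(jb ξ ^ ((k : ℝ) / 2) : ℝ) • h ξ‖ₑ ^ 2 *
          ∫⁻ ϑ : Sph N, ENNReal.ofReal (Real.exp (-(Real.pi / 2) * ‖perpProj (ϑ : Vel N) ξ‖ ^ 2))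
            ∂(volume : Measure (Vel N)).toSphere := by
          rw [lintegral_const_mul _ hWm.lintegral_prod_right',
            lintegral_lintegral_swap hWm.aemeasurable]
          congr 1
          refine lintegral_congr fun ξ => ?_
          have h1 : Measurable fun ϑ : Sph N => perpProj (ϑ : Vel N) ξ :=
            measurable_perpProj.comp (f := fun ϑ : Sph N => ((ϑ : Vel N), ξ)) (by fun_prop)
          simp only [W]
          rw [lintegral_const_mul _ (by fun_prop)]
      _ ≤ B * ENNReal.ofReal κ⁻¹ * A * ∫⁻ ξ, ‖(jb ξ ^ ((k : ℝ) / 2) : ℝ) • h ξ‖ₑ ^ 2 *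
          (S * ENNReal.ofReal (jb ξ ^ (-(((N : ℝ) - 1) / 2)))) := by
          gcongr with ξ
          exact hS ξ
      _ = D * nrm ^ 2 := by
          simp only [nrm, D]
          rw [eLpNorm_two_sq, mul_assoc _ (S : ℝ≥0∞)]
          congr 1
          rw [← lintegral_const_mul _ (by
            exact ((continuous_jb_rpow _).measurable.smul H.meas).enorm.pow_const 2)]
          refine lintegral_congr fun ξ => ?_
          rw [enorm_sq_eq_ofReal, enorm_sq_eq_ofReal, norm_smul, norm_smul,
            Real.norm_of_nonneg (jb_rpow_pos _ _).le, Real.norm_of_nonneg (jb_rpow_pos _ _).le,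
            mul_left_comm, ← ENNReal.ofReal_mul (by positivity)]
          congr 2
          rw [mul_pow, mul_pow, mul_right_comm, ← Real.rpow_natCast (jb ξ ^ _) 2,
            ← Real.rpow_natCast (jb ξ ^ _) 2, ← Real.rpow_mul (jb_pos ξ).le,
            ← Real.rpow_mul (jb_pos ξ).le, ← Real.rpow_add (jb_pos ξ)]
          congr 2; push_cast; ring
  have h2 : eLpNorm (planeOp κ (fun x ξ => c x * q x ξ) h) 2 volume ^ 2 ≤ ((D + 1) * nrm) ^ 2 := by
    refine key.trans ?_
    rw [mul_pow]
    gcongr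
    calc D ≤ D + 1 := le_self_add
      _ = (D + 1) ^ 1 := (pow_one _).symm
      _ ≤ (D + 1) ^ 2 := pow_le_pow_right₀ le_add_self (by norm_num)
  exact (ENNReal.pow_le_pow_left_iff (by norm_num)).1 h2

/-- `L²` bound for operators with amplitude of order `k`. -/
theorem Amp.eLpNorm_planeOp_le (hN : 2 ≤ N) {κ : ℝ} (hκ : 0 < κ) {k : ℕ} {a : Vel N → Vel N → ℂ}
    (ha : Amp k a) : ∃ C : ℝ≥0, ∀ h : Vel N → ℂ, Rapid h →
      eLpNorm (planeOp κ a h) 2 volume ≤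
        C * eLpNorm (fun ξ => (jb ξ ^ ((k : ℝ) / 2 - ((N : ℝ) - 1) / 4) : ℝ) • h ξ) 2 volume := by
  induction ha with
  | term hc hq => exact eLpNorm_planeOp_term_le hN hκ hc hq
  | @add k a b ha hb iha ihb =>
    obtain ⟨C, hC⟩ := iha
    obtain ⟨D, hD⟩ := ihb
    refine ⟨C + D, fun h H => ?_⟩
    have e : planeOp κ (fun x ξ => a x ξ + b x ξ) h = planeOp κ a h + planeOp κ b h := by
      ext x
      simp only [planeOp, Pi.add_apply]
      rw [← integral_add (ha.rapid H κ x).integrable (hb.rapid H κ x).integrable]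
      exact integral_congr_ae (Filter.Eventually.of_forall fun ξ => by simp only; ring)
    rw [e]
    refine (eLpNorm_add_le (ha.measurable_planeOp H.meas κ).aestronglyMeasurable
      (hb.measurable_planeOp H.meas κ).aestronglyMeasurable (by norm_num)).trans ?_
    push_cast
    rw [add_mul]
    exact add_le_add (hC h H) (hD h H)
  | @mono k l a ha hkl ih =>
    obtain ⟨C, hC⟩ := ih
    refine ⟨C, fun h H => (hC h H).trans ?_⟩
    gcongr
    refine eLpNorm_mono fun ξ => ?_
    rw [norm_smul, norm_smul, Real.norm_of_nonneg (jb_rpow_pos _ _).le,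
      Real.norm_of_nonneg (jb_rpow_pos _ _).le]
    have : (k : ℝ) ≤ l := by exact_mod_cast hkl
    gcongr
    exact one_le_jb ξ

lemma Amp.memLp_planeOp (hN : 2 ≤ N) {κ : ℝ} (hκ : 0 < κ) {k : ℕ} {a : Vel N → Vel N → ℂ}
    (ha : Amp k a) {h : Vel N → ℂ} (H : Rapid h) : MemLp (planeOp κ a h) 2 volume := by
  obtain ⟨C, hC⟩ := ha.eLpNorm_planeOp_le hN hκ
  exact ⟨(ha.measurable_planeOp H.meas κ).aestronglyMeasurable, (hC h H).trans_lt
    (ENNReal.mul_lt_top ENNReal.coe_lt_top (H.eLpNorm_jb_lt_top _))⟩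

end PlaneOpL2

/-! ### Differentiation of amplitudes -/

section AmplitudeDeriv

variable {N : ℕ}

lemma contDiff_of_tsupport {F : Type*} [NormedAddCommGroup F] [NormedSpace ℝ F] {f : Vel N → F}
    (h : ∀ x ∈ tsupport f, ContDiffAt ℝ ∞ f x) : ContDiff ℝ ∞ f := by
  rw [contDiff_iff_contDiffAt]
  intro x
  by_cases hx : x ∈ tsupport f
  · exact h x hx
  · exact contDiffAt_const.congr_of_eventuallyEq (notMem_tsupport_iff_eventuallyEq.1 hx)

lemma CutOff.mul {c : Vel N → ℂ} (hc : CutOff c) {d : Vel N → ℂ}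
    (hd : ∀ x, x ≠ 0 → ContDiffAt ℝ ∞ d x) : CutOff (fun x => d x * c x) := by
  have hsub : tsupport (fun x => d x * c x) ⊆ tsupport c := tsupport_mul_subset_right
  refine ⟨contDiff_of_tsupport fun x hx => ?_, hc.compact.mul_left, fun h => hc.zero (hsub h)⟩
  refine (hd x ?_).mul hc.smooth.contDiffAt
  rintro rfl
  exact hc.zero (hsub hx)

lemma CutOff.fderiv_apply {c : Vel N → ℂ} (hc : CutOff c) (m : Vel N) :
    CutOff (fun x => fderiv ℝ c x m) := by
  have hsub : tsupport (fun x => fderiv ℝ c x m) ⊆ tsupport c := tsupport_fderiv_apply_subset ℝ m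
  refine ⟨(hc.smooth.fderiv_right (m := ∞) (by simp)).clm_apply contDiff_const, ?_,
    fun h => hc.zero (hsub h)⟩
  exact hc.compact.of_isClosed_subset (isClosed_tsupport _) hsub

lemma CutOff.of_zero : CutOff (fun _ : Vel N => 0) :=
  ⟨contDiff_const, HasCompactSupport.zero, by
    rw [show (fun _ : Vel N => (0 : ℂ)) = 0 from rfl, tsupport_zero]; simp⟩

lemma Amp.congr {k : ℕ} {a b : Vel N → Vel N → ℂ} (ha : Amp k a) (h : ∀ x ξ, b x ξ = a x ξ) :
    Amp k b := by
  have : b = a := by ext x ξ; exact h x ξ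
  rw [this]; exact ha

lemma Amp.of_zero (k : ℕ) : Amp k (fun _ _ : Vel N => 0) :=
  ((Amp.term CutOff.of_zero QMon.one).congr fun _ _ => by simp).mono (Nat.zero_le k)

lemma Amp.sum {k : ℕ} {ι : Type*} (s : Finset ι) {a : ι → Vel N → Vel N → ℂ}
    (h : ∀ i ∈ s, Amp k (a i)) : Amp k (fun x ξ => ∑ i ∈ s, a i x ξ) := by
  classical
  induction s using Finset.induction_on with
  | empty => exact (Amp.of_zero k).congr fun _ _ => by simp
  | insert i s hi ih =>
    exact ((h i (Finset.mem_insert_self i s)).add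
      (ih fun j hj => h j (Finset.mem_insert_of_mem hj))).congr fun _ _ => Finset.sum_insert hi

lemma Amp.xi_mul {k : ℕ} {a : Vel N → Vel N → ℂ} (ha : Amp k a) (i : Fin N) :
    Amp (k + 1) (fun x ξ => ((ξ i : ℝ) : ℂ) * a x ξ) := by
  induction ha with
  | term hc hq => exact (Amp.term hc (hq.xi i)).congr fun _ _ => by ring
  | add ha hb iha ihb => exact (iha.add ihb).congr fun _ _ => by ring
  | mono ha hkl ih => exact ih.mono (by omega)

lemma Amp.proj_mul {k : ℕ} {a : Vel N → Vel N → ℂ} (ha : Amp k a) (i : Fin N) :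
    Amp k (fun x ξ => ((perpProj x ξ i : ℝ) : ℂ) * a x ξ) := by
  induction ha with
  | term hc hq => exact (Amp.term hc (hq.proj i)).congr fun _ _ => by ring
  | add ha hb iha ihb => exact (iha.add ihb).congr fun _ _ => by ring
  | mono ha hkl ih => exact ih.mono hkl

lemma Amp.smooth_mul {k : ℕ} {a : Vel N → Vel N → ℂ} (ha : Amp k a) {d : Vel N → ℂ}
    (hd : ∀ x, x ≠ 0 → ContDiffAt ℝ ∞ d x) : Amp k (fun x ξ => d x * a x ξ) := by
  induction ha with
  | term hc hq => exact (Amp.term (hc.mul hd) hq).congr fun _ _ => by ring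
  | add ha hb iha ihb => exact (iha.add ihb).congr fun _ _ => by ring
  | mono ha hkl ih => exact ih.mono hkl

lemma Amp.eventually_eq_zero {k : ℕ} {a : Vel N → Vel N → ℂ} (ha : Amp k a) :
    ∀ᶠ x in nhds (0 : Vel N), ∀ ξ, a x ξ = 0 := by
  induction ha with
  | @term k c q hc hq =>
    filter_upwards [notMem_tsupport_iff_eventuallyEq.1 hc.zero] with x hx ξ
    rw [hx]; simp
  | add ha hb iha ihb =>
    filter_upwards [iha, ihb] with x h1 h2 ξ
    rw [h1, h2, add_zero]
  | mono ha hkl ih => exact ih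

/-- `f` is differentiable at `x` and its derivative in the direction `m` is `v`. -/
def HasDirDeriv (f : Vel N → ℂ) (m x : Vel N) (v : ℂ) : Prop :=
  ∃ L : Vel N →L[ℝ] ℂ, HasFDerivAt f L x ∧ L m = v

lemma HasDirDeriv.mul {f g : Vel N → ℂ} {m x : Vel N} {v w : ℂ} (hf : HasDirDeriv f m x v)
    (hg : HasDirDeriv g m x w) : HasDirDeriv (fun x => f x * g x) m x (f x * w + v * g x) := by
  obtain ⟨L, hL, rfl⟩ := hf
  obtain ⟨K, hK, rfl⟩ := hg
  refine ⟨_, hL.mul hK, ?_⟩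
  simp [mul_comm]

lemma HasDirDeriv.add {f g : Vel N → ℂ} {m x : Vel N} {v w : ℂ} (hf : HasDirDeriv f m x v)
    (hg : HasDirDeriv g m x w) : HasDirDeriv (fun x => f x + g x) m x (v + w) := by
  obtain ⟨L, hL, rfl⟩ := hf
  obtain ⟨K, hK, rfl⟩ := hg
  exact ⟨_, hL.add hK, rfl⟩

lemma hasDirDeriv_const (z : ℂ) (m x : Vel N) : HasDirDeriv (fun _ => z) m x 0 :=
  ⟨0, hasFDerivAt_const z x, rfl⟩

lemma HasDirDeriv.of_eq {f : Vel N → ℂ} {m x : Vel N} {v w : ℂ} (hf : HasDirDeriv f m x v)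
    (h : w = v) : HasDirDeriv f m x w := h ▸ hf

/-- The derivative of `(P_x ξ)_i` in the direction `e_j` is `∑_l projCoef i j l x ξ_l`. -/
noncomputable def projCoef (i j l : Fin N) (x : Vel N) : ℝ :=
  2 * ((‖x‖ ^ 2)⁻¹) ^ 2 * x j * x i * x l - (‖x‖ ^ 2)⁻¹ * x i * (if l = j then 1 else 0) -
    (‖x‖ ^ 2)⁻¹ * x l * (if i = j then 1 else 0)

lemma contDiffAt_norm_sq_inv {x : Vel N} (hx : x ≠ 0) :
    ContDiffAt ℝ ∞ (fun x : Vel N => (‖x‖ ^ 2)⁻¹) x :=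
  (contDiff_norm_sq ℝ).contDiffAt.inv (by have := norm_pos_iff.2 hx; positivity)

lemma contDiff_coord (i : Fin N) : ContDiff ℝ ∞ (fun x : Vel N => x i) :=
  (EuclideanSpace.proj (𝕜 := ℝ) i).contDiff

lemma contDiffAt_projCoef (i j l : Fin N) {x : Vel N} (hx : x ≠ 0) :
    ContDiffAt ℝ ∞ (fun x => ((projCoef i j l x : ℝ) : ℂ)) x := by
  have h1 := contDiffAt_norm_sq_inv hx
  have h2 := fun i : Fin N => (contDiff_coord i).contDiffAt (x := x)
  have h : ContDiffAt ℝ ∞ (fun x : Vel N => projCoef i j l x) x :=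
    (((((contDiffAt_const.mul (h1.pow 2)).mul (h2 j)).mul (h2 i)).mul (h2 l)).sub
      ((h1.mul (h2 i)).mul contDiffAt_const)).sub ((h1.mul (h2 l)).mul contDiffAt_const)
  exact Complex.ofRealCLM.contDiff.contDiffAt.comp x h

lemma inner_eq_sum_coord (x ξ : Vel N) : inner ℝ x ξ = ∑ l, x l * ξ l := by
  rw [PiLp.inner_apply]
  exact Finset.sum_congr rfl fun l _ => by simp [mul_comm]

lemma hasFDerivAt_norm_sq_inv {x : Vel N} (hx : x ≠ 0) :
    HasFDerivAt (fun x : Vel N => (‖x‖ ^ 2)⁻¹)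
      ((-((‖x‖ ^ 2) ^ 2)⁻¹) • ((2 : ℕ) • innerSL ℝ x)) x := by
  have h0 : ‖x‖ ^ 2 ≠ 0 := by have := norm_pos_iff.2 hx; positivity
  exact (hasDerivAt_inv h0).comp_hasFDerivAt x (hasStrictFDerivAt_norm_sq x).hasFDerivAt

lemma hasDirDeriv_ofReal {f : Vel N → ℝ} {L : Vel N →L[ℝ] ℝ} {m x : Vel N}
    (h : HasFDerivAt f L x) : HasDirDeriv (fun x => ((f x : ℝ) : ℂ)) m x ((L m : ℝ) : ℂ) :=
  ⟨_, Complex.ofRealCLM.hasFDerivAt.comp x h, rfl⟩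

lemma hasDirDeriv_norm_sq_inv (j : Fin N) {x : Vel N} (hx : x ≠ 0) :
    HasDirDeriv (fun x : Vel N => (((‖x‖ ^ 2)⁻¹ : ℝ) : ℂ)) (EuclideanSpace.single j 1) x
      ((-(2 * ((‖x‖ ^ 2)⁻¹) ^ 2 * x j) : ℝ) : ℂ) := by
  refine (hasDirDeriv_ofReal (hasFDerivAt_norm_sq_inv hx)).of_eq ?_
  have h : inner ℝ x (EuclideanSpace.single j (1 : ℝ)) = x j := by
    rw [EuclideanSpace.inner_single_right]; simp
  congr 1
  simp only [smul_apply, smul_eq_mul, innerSL_apply_apply, h, inv_pow, nsmul_eq_mul]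
  push_cast; ring

lemma hasDirDeriv_inner (j : Fin N) (x ξ : Vel N) :
    HasDirDeriv (fun x : Vel N => ((inner ℝ x ξ : ℝ) : ℂ)) (EuclideanSpace.single j 1) x
      ((ξ j : ℝ) : ℂ) := by
  have h2 : HasFDerivAt (fun x : Vel N => inner ℝ x ξ) ((innerSL ℝ).flip ξ) x :=
    ((innerSL ℝ).flip ξ).hasFDerivAt
  refine (hasDirDeriv_ofReal h2).of_eq ?_
  have h : inner ℝ (EuclideanSpace.single j (1 : ℝ)) ξ = ξ j := by
    rw [EuclideanSpace.inner_single_left]; simp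
  rw [ContinuousLinearMap.flip_apply, innerSL_apply_apply, h]

lemma hasDirDeriv_coord (i j : Fin N) (x : Vel N) :
    HasDirDeriv (fun x : Vel N => ((x i : ℝ) : ℂ)) (EuclideanSpace.single j 1) x
      (((if i = j then 1 else 0 : ℝ) : ℝ) : ℂ) := by
  have h3 : HasFDerivAt (fun x : Vel N => x i) (EuclideanSpace.proj (𝕜 := ℝ) i) x :=
    (EuclideanSpace.proj (𝕜 := ℝ) i).hasFDerivAt
  refine (hasDirDeriv_ofReal h3).of_eq ?_
  have h : (EuclideanSpace.proj (𝕜 := ℝ) i) (EuclideanSpace.single j (1 : ℝ)) =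
    (EuclideanSpace.single j (1 : ℝ) : Vel N) i := rfl
  rw [h, PiLp.single_apply]

/-- The derivative in `x` is linear in the full vector `ξ`, with coefficients smooth away from `0`:
one factor `P_x ξ` becomes one factor `ξ`, so the order rises by one. -/
lemma hasDirDeriv_perpProj (i j : Fin N) {x : Vel N} (hx : x ≠ 0) (ξ : Vel N) :
    HasDirDeriv (fun x => ((perpProj x ξ i : ℝ) : ℂ)) (EuclideanSpace.single j 1) x
      (∑ l, ((projCoef i j l x : ℝ) : ℂ) * ((ξ l : ℝ) : ℂ)) := by
  have h := (hasDirDeriv_const ((ξ i : ℝ) : ℂ) (EuclideanSpace.single j 1) x).add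
    ((hasDirDeriv_const (-1) (EuclideanSpace.single j 1) x).mul
      (((hasDirDeriv_norm_sq_inv j hx).mul (hasDirDeriv_inner j x ξ)).mul (hasDirDeriv_coord i j x)))
  have e0 : (fun x => ((perpProj x ξ i : ℝ) : ℂ)) = fun x : Vel N => ((ξ i : ℝ) : ℂ) +
      -1 * ((((‖x‖ ^ 2)⁻¹ : ℝ) : ℂ) * ((inner ℝ x ξ : ℝ) : ℂ) * ((x i : ℝ) : ℂ)) := by
    ext x
    have : perpProj x ξ i = ξ i - (‖x‖ ^ 2)⁻¹ * inner ℝ x ξ * x i := rfl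
    rw [this]; push_cast; ring
  rw [e0]
  refine h.of_eq ?_
  have e1 : ∑ l, projCoef i j l x * ξ l = 2 * ((‖x‖ ^ 2)⁻¹) ^ 2 * x j * x i * inner ℝ x ξ -
      (‖x‖ ^ 2)⁻¹ * x i * ξ j - (‖x‖ ^ 2)⁻¹ * (if i = j then 1 else 0) * inner ℝ x ξ := by
    rw [inner_eq_sum_coord, Finset.mul_sum, Finset.mul_sum]
    have e2 : (‖x‖ ^ 2)⁻¹ * x i * ξ j =
        ∑ l, (‖x‖ ^ 2)⁻¹ * x i * (if l = j then 1 else 0) * ξ l := by simp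
    rw [e2, ← Finset.sum_sub_distrib, ← Finset.sum_sub_distrib]
    refine Finset.sum_congr rfl fun l _ => ?_
    unfold projCoef; ring
  rw [show ∑ l, ((projCoef i j l x : ℝ) : ℂ) * ((ξ l : ℝ) : ℂ) =
    ((∑ l, projCoef i j l x * ξ l : ℝ) : ℂ) by push_cast; rfl, e1]
  push_cast; ring

lemma CutOff.hasDirDeriv {c : Vel N → ℂ} (hc : CutOff c) (m x : Vel N) :
    HasDirDeriv c m x (fderiv ℝ c x m) :=
  ⟨_, ((hc.smooth.differentiable (by simp)) x).hasFDerivAt, rfl⟩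

/-- The cutoff is quantified inside the induction and kept attached to the monomial, because the
coefficients produced by differentiation are smooth only off the origin and must be localized to
give amplitudes. -/
lemma QMon.exists_dirDeriv {k : ℕ} {q : Vel N → Vel N → ℂ} (hq : QMon k q) (j : Fin N) :
    ∀ c : Vel N → ℂ, CutOff c → ∃ a' : Vel N → Vel N → ℂ, Amp (k + 1) a' ∧ ∀ x, x ≠ 0 → ∀ ξ,
      HasDirDeriv (fun x => c x * q x ξ) (EuclideanSpace.single j 1) x (a' x ξ) := by
  induction hq with
  | one =>
    intro c hc
    refine ⟨_, (Amp.term (hc.fderiv_apply (EuclideanSpace.single j 1)) QMon.one).mono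
      (Nat.zero_le 1), fun x hx ξ => ?_⟩
    exact ((hc.hasDirDeriv _ x).mul (hasDirDeriv_const 1 _ x)).of_eq (by ring)
  | @xi k q i h ih =>
    intro c hc
    obtain ⟨a', ha', H⟩ := ih c hc
    refine ⟨_, ha'.xi_mul i, fun x hx ξ => ?_⟩
    have := (hasDirDeriv_const ((ξ i : ℝ) : ℂ) (EuclideanSpace.single j 1) x).mul (H x hx ξ)
    rw [show (fun x => c x * (((ξ i : ℝ) : ℂ) * q x ξ)) =
      fun x => ((ξ i : ℝ) : ℂ) * (c x * q x ξ) by ext x; ring]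
    exact this.of_eq (by ring)
  | @proj k q i h ih =>
    intro c hc
    obtain ⟨a', ha', H⟩ := ih c hc
    refine ⟨_, (ha'.proj_mul i).add (Amp.sum (Finset.univ : Finset (Fin N)) (a := fun l x ξ =>
      ((projCoef i j l x : ℝ) : ℂ) * (((ξ l : ℝ) : ℂ) * (c x * q x ξ))) fun l _ =>
        ((Amp.term hc h).xi_mul l).smooth_mul fun x hx => contDiffAt_projCoef i j l hx),
      fun x hx ξ => ?_⟩
    have := (hasDirDeriv_perpProj i j hx ξ).mul (H x hx ξ)
    rw [show (fun x => c x * (((perpProj x ξ i : ℝ) : ℂ) * q x ξ)) =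
      fun x => ((perpProj x ξ i : ℝ) : ℂ) * (c x * q x ξ) by ext x; ring]
    refine this.of_eq ?_
    rw [Finset.sum_mul]
    congr 1
    exact Finset.sum_congr rfl fun l _ => by ring

lemma Amp.exists_dirDeriv {k : ℕ} {a : Vel N → Vel N → ℂ} (ha : Amp k a) (j : Fin N) :
    ∃ a' : Vel N → Vel N → ℂ, Amp (k + 1) a' ∧ ∀ x, x ≠ 0 → ∀ ξ,
      HasDirDeriv (fun x => a x ξ) (EuclideanSpace.single j 1) x (a' x ξ) := by
  induction ha with
  | term hc hq => exact hq.exists_dirDeriv j _ hc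
  | add ha hb iha ihb =>
    obtain ⟨a', ha', H⟩ := iha
    obtain ⟨b', hb', K⟩ := ihb
    exact ⟨_, ha'.add hb', fun x hx ξ => (H x hx ξ).add (K x hx ξ)⟩
  | mono ha hkl ih =>
    obtain ⟨a', ha', H⟩ := ih
    exact ⟨a', ha'.mono (by omega), H⟩

lemma HasDirDeriv.cexp {f : Vel N → ℂ} {m x : Vel N} {v : ℂ} (hf : HasDirDeriv f m x v) :
    HasDirDeriv (fun x => Complex.exp (f x)) m x (Complex.exp (f x) * v) := by
  obtain ⟨L, hL, rfl⟩ := hf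
  exact ⟨_, hL.cexp, rfl⟩

lemma HasDirDeriv.congr {f g : Vel N → ℂ} {m x : Vel N} {v : ℂ} (hf : HasDirDeriv f m x v)
    (h : g =ᶠ[nhds x] f) : HasDirDeriv g m x v := by
  obtain ⟨L, hL, rfl⟩ := hf
  exact ⟨L, hL.congr_of_eventuallyEq h, rfl⟩

/-- The Gaussian exponent is quadratic in `ξ`, but its derivative contains the factor `P_x ξ`, which
is free. Differentiating the kernel therefore costs one power of `ξ`, as for the oscillating part.
-/
lemma hasDirDeriv_planeKernel (κ : ℝ) (j : Fin N) {x : Vel N} (hx : x ≠ 0) (ξ : Vel N) :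
    HasDirDeriv (fun x => planeKernel κ x ξ) (EuclideanSpace.single j 1) x
      (planeKernel κ x ξ * (2 * Real.pi * Complex.I * κ * ((ξ j : ℝ) : ℂ) +
        2 * Real.pi * ((perpProj x ξ j : ℝ) : ℂ) *
          ((((‖x‖ ^ 2)⁻¹ : ℝ) : ℂ) * ((inner ℝ x ξ : ℝ) : ℂ)))) := by
  have hi := hasDirDeriv_inner j x ξ
  have hn := hasDirDeriv_norm_sq_inv j hx
  have h := ((((hasDirDeriv_const (2 * Real.pi * Complex.I * κ) (EuclideanSpace.single j 1) x).mul
    hi).add (hasDirDeriv_const (-Real.pi * ((‖ξ‖ ^ 2 : ℝ) : ℂ)) _ x)).add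
      ((hasDirDeriv_const (Real.pi : ℂ) _ x).mul (hn.mul (hi.mul hi)))).cexp
  have e (y : Vel N) (hy : y ≠ 0) : 2 * Real.pi * Complex.I * (κ * inner ℝ y ξ : ℝ) -
      (Real.pi * ‖perpProj y ξ‖ ^ 2 : ℝ) = 2 * Real.pi * Complex.I * κ * ((inner ℝ y ξ : ℝ) : ℂ) +
        -Real.pi * ((‖ξ‖ ^ 2 : ℝ) : ℂ) + (Real.pi : ℂ) * ((((‖y‖ ^ 2)⁻¹ : ℝ) : ℂ) *
          (((inner ℝ y ξ : ℝ) : ℂ) * ((inner ℝ y ξ : ℝ) : ℂ))) := by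
    rw [norm_perpProj_sq hy]; push_cast; ring
  refine (h.congr ?_).of_eq ?_
  · filter_upwards [isOpen_ne.mem_nhds hx] with y hy
    unfold planeKernel
    rw [e y hy]
  · unfold planeKernel
    rw [← e x hx]
    have e0 : perpProj x ξ j = ξ j - (‖x‖ ^ 2)⁻¹ * inner ℝ x ξ * x j := rfl
    rw [e0]
    push_cast; ring

lemma Amp.exists_dirDeriv_planeKernel {k : ℕ} {a : Vel N → Vel N → ℂ} (ha : Amp k a) (κ : ℝ)
    (j : Fin N) : ∃ a' : Vel N → Vel N → ℂ, Amp (k + 1) a' ∧ ∀ x ξ,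
      HasDirDeriv (fun x => a x ξ * planeKernel κ x ξ) (EuclideanSpace.single j 1) x
        (a' x ξ * planeKernel κ x ξ) := by
  obtain ⟨a₁, ha₁, H⟩ := ha.exists_dirDeriv j
  have h2 : Amp (k + 1) (fun x ξ => (2 * Real.pi * Complex.I * κ) * (((ξ j : ℝ) : ℂ) * a x ξ)) :=
    (ha.xi_mul j).smooth_mul fun x hx => contDiffAt_const
  have h3 : Amp (k + 1) (fun x ξ => ∑ l, (2 * Real.pi * (((‖x‖ ^ 2)⁻¹ : ℝ) : ℂ) *
      ((x l : ℝ) : ℂ)) * (((perpProj x ξ j : ℝ) : ℂ) * (((ξ l : ℝ) : ℂ) * a x ξ))) :=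
    Amp.sum _ fun l _ => ((ha.xi_mul l).proj_mul j).smooth_mul fun x hx =>
      (contDiffAt_const.mul (Complex.ofRealCLM.contDiff.contDiffAt.comp x
        (contDiffAt_norm_sq_inv hx))).mul
        (Complex.ofRealCLM.contDiff.contDiffAt.comp x (contDiff_coord l).contDiffAt)
  have h4 := (ha₁.add h2).add h3
  refine ⟨_, h4, fun x ξ => ?_⟩
  -- The projection is singular at the origin, but amplitudes vanish identically near it.
  by_cases hx : x = 0
  · subst hx
    have e1 := ha.eventually_eq_zero
    have e2 := h4.eventually_eq_zero.self_of_nhds ξ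
    refine ((hasDirDeriv_const 0 _ 0).congr ?_).of_eq (by rw [e2, zero_mul])
    filter_upwards [e1] with y hy
    rw [hy ξ, zero_mul]
  · refine ((H x hx ξ).mul (hasDirDeriv_planeKernel κ j hx ξ)).of_eq ?_
    have e : ∑ l, (2 * Real.pi * (((‖x‖ ^ 2)⁻¹ : ℝ) : ℂ) *
      ((x l : ℝ) : ℂ)) * (((perpProj x ξ j : ℝ) : ℂ) * (((ξ l : ℝ) : ℂ) * a x ξ)) =
        2 * Real.pi * (((‖x‖ ^ 2)⁻¹ : ℝ) : ℂ) * ((perpProj x ξ j : ℝ) : ℂ) * a x ξ *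
          ((inner ℝ x ξ : ℝ) : ℂ) := by
      rw [inner_eq_sum_coord]
      push_cast
      rw [Finset.mul_sum]
      exact Finset.sum_congr rfl fun l _ => by ring
    rw [e]
    ring

end AmplitudeDeriv

/-! ### Sobolev bounds for the oscillatory operator -/

section PlaneOpSobolev

variable {N : ℕ}

lemma integral_planeOp_mul {k : ℕ} {a : Vel N → Vel N → ℂ} (ha : Amp k a) {h : Vel N → ℂ}
    (H : Rapid h) (κ : ℝ) {ψ : Vel N → ℂ} (hψ : Integrable ψ) :
    ∫ x, planeOp κ a h x * ψ x = ∫ ξ, h ξ * ∫ x, (a x ξ * planeKernel κ x ξ) * ψ x := by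
  obtain ⟨C, hC0, hC⟩ := ha.exists_bound
  have hH : Rapid fun ξ => (jb ξ ^ (k : ℝ) : ℝ) • h ξ :=
    H.of_le (C := 1) (m := k) ((continuous_jb_rpow _).measurable.smul H.meas) fun ξ => by
      rw [norm_smul, Real.norm_of_nonneg (jb_rpow_pos _ ξ).le, one_mul]
  have hI : Integrable (fun z : Vel N × Vel N => h z.2 * (a z.1 z.2 * planeKernel κ z.1 z.2) * ψ z.1)
      (volume.prod volume) := by
    have hb : Integrable (fun z : Vel N × Vel N => (C : ℂ) * (ψ z.1 * ((jb z.2 ^ (k : ℝ) : ℝ) • h z.2)))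
      (volume.prod volume) := (hψ.mul_prod hH.integrable).const_mul _
    refine hb.mono ?_ (Filter.Eventually.of_forall fun z => ?_)
    · exact ((H.meas.comp measurable_snd).mul (ha.measurable.mul
        (measurable_planeKernel κ))).aestronglyMeasurable.mul hψ.1.comp_fst
    · have h1 := hC κ z.1 z.2
      have h2 := (jb_rpow_pos (k : ℝ) z.2).le
      rw [norm_mul, norm_mul, norm_mul (C : ℂ), norm_mul (ψ z.1), norm_smul, Complex.norm_real,
        Real.norm_of_nonneg hC0, Real.norm_of_nonneg h2]
      calc _ ≤ ‖h z.2‖ * (C * jb z.2 ^ (k : ℝ)) * ‖ψ z.1‖ := by gcongr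
        _ = _ := by ring
  calc ∫ x, planeOp κ a h x * ψ x
      = ∫ x, ∫ ξ, h ξ * (a x ξ * planeKernel κ x ξ) * ψ x := by
        refine integral_congr_ae (Filter.Eventually.of_forall fun x => ?_)
        exact (integral_mul_const _ _).symm
    _ = ∫ ξ, ∫ x, h ξ * (a x ξ * planeKernel κ x ξ) * ψ x := integral_integral_swap hI
    _ = _ := by
        refine integral_congr_ae (Filter.Eventually.of_forall fun ξ => ?_)
        simp only [mul_assoc]
        exact integral_const_mul _ _

lemma Amp.integrable_mul {k : ℕ} {a : Vel N → Vel N → ℂ} (ha : Amp k a) (κ : ℝ) (ξ : Vel N)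
    {ψ : Vel N → ℂ} (hψ : Integrable ψ) :
    Integrable fun x => (a x ξ * planeKernel κ x ξ) * ψ x := by
  obtain ⟨C, hC0, hC⟩ := ha.exists_bound
  refine hψ.bdd_mul (c := C * jb ξ ^ (k : ℝ)) ?_ (Filter.Eventually.of_forall fun x => hC κ x ξ)
  exact ((ha.measurable.comp (f := fun x => (x, ξ)) (by fun_prop)).mul
      ((measurable_planeKernel κ).comp (f := fun x => (x, ξ)) (by fun_prop))).aestronglyMeasurable

/-- Fubini and integration by parts in `x` at fixed `ξ` move the derivative from the test function
to the kernel, which is again of amplitude type. -/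
lemma Amp.exists_hasL2Deriv (hN : 2 ≤ N) {κ : ℝ} (hκ : 0 < κ) {k : ℕ} {a : Vel N → Vel N → ℂ}
    (ha : Amp k a) (j : Fin N) : ∃ a' : Vel N → Vel N → ℂ, Amp (k + 1) a' ∧ ∀ h, Rapid h →
      HasL2Deriv (EuclideanSpace.single j 1) (planeOp κ a h) (planeOp κ a' h) := by
  obtain ⟨a', ha', hD⟩ := ha.exists_dirDeriv_planeKernel κ j
  refine ⟨a', ha', fun h H => HasL2Deriv.of_testFunctions (ha.memLp_planeOp hN hκ H)
    (ha'.memLp_planeOp hN hκ H) fun φ hφ hφc => ?_⟩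
  set m : Vel N := EuclideanSpace.single j 1
  have hφd : ContDiff ℝ ∞ (fun x => ((φ x : ℝ) : ℂ)) := Complex.ofRealCLM.contDiff.comp hφ
  have hφd' : Continuous (fun x => ((fderiv ℝ φ x m : ℝ) : ℂ)) :=
    Complex.continuous_ofReal.comp ((hφ.continuous_fderiv (by simp)).clm_apply continuous_const)
  have e (x : Vel N) : fderiv ℝ (fun x => ((φ x : ℝ) : ℂ)) x m = ((fderiv ℝ φ x m : ℝ) : ℂ) := by
    have h1 : HasFDerivAt φ (fderiv ℝ φ x) x := ((hφ.differentiable (by simp)) x).hasFDerivAt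
    have h2 : HasFDerivAt (fun x => ((φ x : ℝ) : ℂ)) (Complex.ofRealCLM.comp (fderiv ℝ φ x)) x :=
      Complex.ofRealCLM.hasFDerivAt.comp x h1
    rw [h2.fderiv]; rfl
  have i1 : Integrable (fun x => ((φ x : ℝ) : ℂ)) :=
    hφd.continuous.integrable_of_hasCompactSupport (hφc.comp_left (g := ((↑) : ℝ → ℂ)) (by simp))
  have i2 : Integrable (fun x => ((fderiv ℝ φ x m : ℝ) : ℂ)) :=
    hφd'.integrable_of_hasCompactSupport
      ((hφc.fderiv_apply (𝕜 := ℝ) m).comp_left (g := ((↑) : ℝ → ℂ)) (by simp))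
  rw [integral_planeOp_mul ha H κ i2, integral_planeOp_mul ha' H κ i1, ← integral_neg]
  refine integral_congr_ae (Filter.Eventually.of_forall fun ξ => ?_)
  simp only [← mul_neg]
  congr 1
  have hF (x : Vel N) : fderiv ℝ (fun x => a x ξ * planeKernel κ x ξ) x m =
      a' x ξ * planeKernel κ x ξ := by
    obtain ⟨L, hL, hm⟩ := hD x ξ
    rw [hL.fderiv, hm]
  have key := integral_mul_fderiv_eq_neg_fderiv_mul_of_integrable (𝕜 := ℂ)
    (μ := (volume : Measure (Vel N))) (f := fun x => a x ξ * planeKernel κ x ξ)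
    (g := fun x => ((φ x : ℝ) : ℂ)) (v := m) ?_ ?_ ?_ ?_ ?_
  · simpa only [e, hF] using key
  · simp only [hF]; exact ha'.integrable_mul κ ξ i1
  · simp only [e]; exact ha.integrable_mul κ ξ i2
  · exact ha.integrable_mul κ ξ i1
  · intro x _
    obtain ⟨L, hL, hm⟩ := hD x ξ
    exact hL.differentiableAt
  · exact fun x _ => hφd.differentiable (by simp) x

/-- Each derivative raises the order of the amplitude by one and hence the exponent of `jb` by one
half. -/
lemma Amp.hnorm_nat_planeOp_le (hN : 2 ≤ N) {κ : ℝ} (hκ : 0 < κ) (n : ℕ) :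
    ∀ (k : ℕ) (a : Vel N → Vel N → ℂ), Amp k a → ∃ C : ℝ≥0, ∀ h, Rapid h →
      hnorm n (planeOp κ a h) ≤ C * eLpNorm (fun ξ =>
        (jb ξ ^ (((k : ℝ) + n) / 2 - ((N : ℝ) - 1) / 4) : ℝ) • h ξ) 2 volume := by
  induction n with
  | zero =>
    intro k a ha
    obtain ⟨C, hC⟩ := ha.eLpNorm_planeOp_le hN hκ
    refine ⟨C, fun h H => ?_⟩
    rw [Nat.cast_zero, hnorm_zero (ha.memLp_planeOp hN hκ H), add_zero]
    exact hC h H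
  | succ n ih =>
    intro k a ha
    obtain ⟨C, hC⟩ := ih k a ha
    choose a' ha' hD using ha.exists_hasL2Deriv hN hκ
    choose D hD' using fun j => ih (k + 1) (a' j) (ha' j)
    refine ⟨C + ∑ j, D j, fun h H => ?_⟩
    have h1 := hnorm_succ_le (EuclideanSpace.basisFun (Fin N) ℝ) (u := planeOp κ a h)
      (h := fun j => planeOp κ (a' j) h) (fun j => by
        rw [EuclideanSpace.basisFun_apply]; exact hD j h H) n
    rw [Nat.cast_succ]
    refine h1.trans ?_
    push_cast
    rw [add_mul, Finset.sum_mul]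
    refine add_le_add ((hC h H).trans (mul_le_mul_right (eLpNorm_mono fun ξ => ?_) _))
      (Finset.sum_le_sum fun j _ => ?_)
    · rw [norm_smul, norm_smul, Real.norm_of_nonneg (jb_rpow_pos _ ξ).le,
        Real.norm_of_nonneg (jb_rpow_pos _ ξ).le]
      gcongr
      · exact one_le_jb ξ
      · linarith
    · have := hD' j h H
      rwa [Nat.cast_succ, show (k : ℝ) + 1 + n = k + (n + 1) by ring] at this

/-- Real orders are obtained from integer ones by interpolation, with the fixed weight `V =
jb^{-(N-1)/4}` recording the gain. -/
theorem hnorm_planeOp_le (hN : 2 ≤ N) {κ : ℝ} (hκ : 0 < κ) {r : ℝ} (hr : 0 ≤ r)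
    {a : Vel N → Vel N → ℂ} (ha : Amp 0 a) : ∃ C : ℝ≥0, ∀ h, Rapid h →
      hnorm r (planeOp κ a h) ≤ C * eLpNorm (fun ξ =>
        (jb ξ ^ (r / 2 - ((N : ℝ) - 1) / 4) : ℝ) • h ξ) 2 volume := by
  obtain ⟨C, hC⟩ := Amp.hnorm_nat_planeOp_le hN hκ 0 0 a ha
  rcases hr.eq_or_lt with rfl | hr0
  · refine ⟨C, fun h H => ?_⟩
    simpa using hC h H
  -- An integer strictly above `r`, so that `r / n` is an admissible interpolation parameter.
  set n := ⌊r⌋₊ + 1 with hn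
  have hrn : r < n := by rw [hn]; push_cast; exact Nat.lt_floor_add_one r
  have hn0 : (0 : ℝ) < n := hr0.trans hrn
  obtain ⟨D, hD⟩ := Amp.hnorm_nat_planeOp_le hN hκ n 0 a ha
  refine ⟨C + D, fun h H => ?_⟩
  have hmW : Measurable (fun ξ : Vel N => jb ξ ^ ((n : ℝ) / 2)) := (continuous_jb_rpow _).measurable
  have hM := ha.memLp_planeOp hN hκ H
  have key := eLpNorm_interpolation (μ := (volume : Measure (Vel N)))
    (ν := (volume : Measure (Vel N))) (θ := r / n) (by positivity) ((div_lt_one hn0).2 hrn)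
    (W := fun ξ => jb ξ ^ ((n : ℝ) / 2)) (V := fun ξ => jb ξ ^ (-(((N : ℝ) - 1) / 4)))
    (W' := fun ξ => jb ξ ^ ((n : ℝ) / 2)) hmW (continuous_jb_rpow _).measurable hmW
    (fun _ => jb_rpow_pos _ _) (fun _ => jb_rpow_pos _ _)
    (h := h) (U := l2hat (planeOp κ a h)) H.meas.aestronglyMeasurable (l2hat_memLp _).1
    (C := C + D) (by simp) ?_
  · simp only [← Real.rpow_mul (jb_pos _).le, ← Real.rpow_add (jb_pos _)] at key
    have e : (n : ℝ) / 2 * (r / n) = r / 2 := by field_simp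
    rw [e, show -(((N : ℝ) - 1) / 4) + r / 2 = r / 2 - ((N : ℝ) - 1) / 4 by ring] at key
    unfold hnorm
    exact_mod_cast key
  · intro t ht
    -- The splitting is made on `h` by bounded multipliers, which preserve rapid decay; the operator
    -- is linear, so its output splits accordingly.
    set p : Vel N → ℝ := fun ξ => (t * jb ξ ^ ((n : ℝ) / 2)) ^ 2 with hp
    have hp0 : ∀ ξ, 0 < p ξ := fun ξ => by have := jb_rpow_pos ((n : ℝ) / 2) ξ; positivity
    have hpm : Measurable p := by fun_prop
    have H0 : Rapid fun ξ => (p ξ / (1 + p ξ)) • h ξ := by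
      refine H.of_le (C := 1) (m := 0) ((hpm.div (measurable_const.add hpm)).smul H.meas) fun ξ => ?_
      have := hp0 ξ
      rw [norm_smul, Real.norm_of_nonneg (by positivity), Nat.cast_zero, Real.rpow_zero, mul_one]
      gcongr
      rw [div_le_one (by positivity)]; linarith
    have H1 : Rapid fun ξ => (1 / (1 + p ξ)) • h ξ := by
      refine H.of_le (C := 1) (m := 0)
        ((measurable_const.div (measurable_const.add hpm)).smul H.meas) fun ξ => ?_
      have := hp0 ξ
      rw [norm_smul, Real.norm_of_nonneg (by positivity), Nat.cast_zero, Real.rpow_zero, mul_one]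
      gcongr
      rw [div_le_one (by positivity)]; linarith
    have M0 := ha.memLp_planeOp hN hκ H0
    have M1 := ha.memLp_planeOp hN hκ H1
    refine ⟨l2hat (planeOp κ a fun ξ => (p ξ / (1 + p ξ)) • h ξ),
      l2hat (planeOp κ a fun ξ => (1 / (1 + p ξ)) • h ξ),
      (l2hat_memLp _).1, (l2hat_memLp _).1, ?_, ?_, ?_⟩
    · have : planeOp κ a h = planeOp κ a (fun ξ => (p ξ / (1 + p ξ)) • h ξ) +
          planeOp κ a (fun ξ => (1 / (1 + p ξ)) • h ξ) := by
        ext x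
        rw [Pi.add_apply]
        unfold planeOp
        rw [← integral_add (ha.rapid H0 κ x).integrable (ha.rapid H1 κ x).integrable]
        refine integral_congr_ae (Filter.Eventually.of_forall fun ξ => ?_)
        have := hp0 ξ
        simp only [← add_mul, ← add_smul, ← add_div]
        rw [add_comm (p ξ), div_self (by positivity), one_smul]
      rw [this]
      exact l2hat_add M0 M1
    · have := hC _ H0
      rw [Nat.cast_zero, hnorm_zero M0, ← eLpNorm_l2hat M0] at this
      refine this.trans (mul_le_mul' (by simp) (le_of_eq ?_))
      congr 1
      ext1 ξ
      simp only [smul_smul]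
      congr 3
      ring
    · have := hD _ H1
      unfold hnorm at this
      refine this.trans (mul_le_mul' (by simp) (le_of_eq ?_))
      congr 1
      ext1 ξ
      simp only [smul_smul]
      rw [← Real.rpow_add (jb_pos ξ)]
      congr 3
      push_cast; ring

end PlaneOpSobolev

/-! ### Fourier decay of the weighted amplitude, uniform in the weight -/

section AmplitudeFourier

variable {V : Type*} [NormedAddCommGroup V] [InnerProductSpace ℝ V] [FiniteDimensional ℝ V]
  [MeasurableSpace V] [BorelSpace V]

lemma jb_pow_le (ξ : V) (m : ℕ) : jb ξ ^ m ≤ 2 ^ m * (1 + (2 * Real.pi) ^ (2 * m) * ‖ξ‖ ^ (2 * m)) := by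
  have h0 : 0 ≤ (2 * Real.pi * ‖ξ‖) ^ 2 := by positivity
  have h1 : jb ξ ≤ 2 * max 1 ((2 * Real.pi * ‖ξ‖) ^ 2) := by
    unfold jb
    linarith [le_max_left 1 ((2 * Real.pi * ‖ξ‖) ^ 2), le_max_right 1 ((2 * Real.pi * ‖ξ‖) ^ 2)]
  refine (pow_le_pow_left₀ (jb_pos ξ).le h1 m).trans ?_
  rw [mul_pow]
  gcongr
  rcases le_total ((2 * Real.pi * ‖ξ‖) ^ 2) 1 with h | h
  · rw [max_eq_left h, one_pow]; linarith [show 0 ≤ (2 * Real.pi) ^ (2 * m) * ‖ξ‖ ^ (2 * m) by positivity]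
  · rw [max_eq_right h, ← pow_mul, mul_pow]; linarith

/-- The constant depends on the function only through its support radius and a bound for its
derivatives up to order `2m`; this gives estimates uniform in `η` and `w` later. -/
lemma exists_norm_fourier_le (R : ℝ) (m : ℕ) : ∃ C : ℝ, 0 ≤ C ∧ ∀ (f : V → ℂ) (M : ℝ),
    ContDiff ℝ ∞ f → tsupport f ⊆ Metric.closedBall 0 R →
    (∀ n ≤ 2 * m, ∀ v, ‖iteratedFDeriv ℝ n f v‖ ≤ M) →
      ∀ ξ, ‖𝓕 f ξ‖ ≤ C * M * jb ξ ^ (-(m : ℝ)) := by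
  set vb := volume.real (Metric.closedBall (0 : V) R) with hvb
  have hvb0 : 0 ≤ vb := measureReal_nonneg
  refine ⟨2 ^ m * (vb + (2 * Real.pi) ^ (2 * m) * (2 ^ (2 * m) * ((2 * m + 1 : ℕ) * vb))),
    by positivity, fun f M hf hs hM ξ => ?_⟩
  have hc : HasCompactSupport f := (isCompact_closedBall 0 R).of_isClosed_subset
    (isClosed_tsupport f) hs
  have hcn (n : ℕ) : Continuous (iteratedFDeriv ℝ n f) := hf.continuous_iteratedFDeriv (by exact_mod_cast le_top)
  have hint (n : ℕ) (hn : n ≤ 2 * m) : ∫ v, ‖iteratedFDeriv ℝ n f v‖ ≤ M * vb := by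
    have e : ∫ v, ‖iteratedFDeriv ℝ n f v‖ =
        ∫ v in Metric.closedBall 0 R, ‖iteratedFDeriv ℝ n f v‖ := by
      refine (setIntegral_eq_integral_of_forall_compl_eq_zero fun v hv => ?_).symm
      rw [norm_eq_zero]
      exact image_eq_zero_of_notMem_tsupport fun h => hv (hs (tsupport_iteratedFDeriv_subset n h))
    rw [e]
    refine (integral_mono_of_nonneg (Filter.Eventually.of_forall fun _ => norm_nonneg _)
      (integrableOn_const (C := M) ((isCompact_closedBall (0 : V) R).measure_lt_top.ne))
      (Filter.Eventually.of_forall fun v => hM n hn v)).trans ?_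
    rw [setIntegral_const, smul_eq_mul, mul_comm]
  have key (n : ℕ) (hn : n ≤ 2 * m) : ‖ξ‖ ^ n * ‖𝓕 f ξ‖ ≤ 2 ^ n * ((n + 1 : ℕ) * (M * vb)) := by
    have := Real.pow_mul_norm_iteratedFDeriv_fourier_le (f := f) (K := ⊤) (N := ⊤) hf
      (fun k n _ _ => ?_) (k := 0) (n := n) le_top le_top ξ
    · simp only [norm_iteratedFDeriv_zero, pow_zero, one_mul, Nat.cast_zero, mul_zero, zero_add] at this
      refine this.trans ?_
      gcongr
      rw [Finset.sum_product, Finset.range_one, Finset.sum_singleton]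
      refine (Finset.sum_le_sum fun j hj => ?_).trans
        (by rw [Finset.sum_const, Finset.card_range, nsmul_eq_mul])
      simp only [pow_zero, one_mul]
      exact hint j (by have := Finset.mem_range.1 hj; omega)
    · refine Continuous.integrable_of_hasCompactSupport (by have := hcn n; fun_prop) ?_
      exact ((hc.iteratedFDeriv (𝕜 := ℝ) n).norm).mul_left
  have k0 := key 0 (Nat.zero_le _)
  have k1 := key (2 * m) le_rfl
  simp only [pow_zero, one_mul, zero_add, Nat.cast_one] at k0
  rw [Real.rpow_neg (jb_pos ξ).le, Real.rpow_natCast, ← div_eq_mul_inv,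
    le_div_iff₀ (pow_pos (jb_pos ξ) m)]
  calc ‖𝓕 f ξ‖ * jb ξ ^ m
      ≤ ‖𝓕 f ξ‖ * (2 ^ m * (1 + (2 * Real.pi) ^ (2 * m) * ‖ξ‖ ^ (2 * m))) := by
        gcongr; exact jb_pow_le ξ m
    _ = 2 ^ m * (‖𝓕 f ξ‖ + (2 * Real.pi) ^ (2 * m) * (‖ξ‖ ^ (2 * m) * ‖𝓕 f ξ‖)) := by ring
    _ ≤ 2 ^ m * (M * vb + (2 * Real.pi) ^ (2 * m) * (2 ^ (2 * m) * ((2 * m + 1 : ℕ) * (M * vb)))) := by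
        gcongr
    _ = _ := by ring

lemma eq_integral_fourier {f : V → ℂ} (hf : ContDiff ℝ ∞ f) (hc : HasCompactSupport f) (z : V) :
    f z = ∫ ζ, 𝓕 f ζ * Complex.exp (2 * Real.pi * Complex.I * (inner ℝ ζ z : ℝ)) := by
  have h1 : 𝓕⁻ (𝓕 f) = f := Continuous.fourierInv_fourier_eq hf.continuous
    (hf.continuous.integrable_of_hasCompactSupport hc) (by
      have := (𝓕 (hc.toSchwartzMap hf) : SchwartzMap V ℂ).integrable (μ := volume)
      rwa [SchwartzMap.fourier_coe] at this)
  conv_lhs => rw [← h1, Real.fourierInv_eq']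
  refine integral_congr_ae (Filter.Eventually.of_forall fun ζ => ?_)
  simp only [smul_eq_mul]
  rw [mul_comm]
  congr 2
  push_cast; ring

variable {E : Type*} [NormedAddCommGroup E] [InnerProductSpace ℝ E]

/-- `log(⟨w+x⟩ / (⟨w+y⟩ ⟨w⟩²))` for `x = P₁ z`, `y = P₂ z`. -/
noncomputable def logRatio (P₁ P₂ : V →L[ℝ] E) (w : E) (z : V) : ℝ :=
  logBracket (w + P₁ z) - logBracket (w + P₂ z) - 2 * logBracket w

lemma contDiff_logBracket_comp (P : V →L[ℝ] E) (w : E) :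
    ContDiff ℝ ∞ (fun z => logBracket (w + P z)) :=
  contDiff_logBracket.comp (contDiff_const.add P.contDiff)

lemma contDiff_logRatio (P₁ P₂ : V →L[ℝ] E) (w : E) : ContDiff ℝ ∞ (logRatio P₁ P₂ w) :=
  ((contDiff_logBracket_comp P₁ w).sub (contDiff_logBracket_comp P₂ w)).sub contDiff_const

lemma exists_bound_iteratedFDeriv_logBracket_comp (P : V →L[ℝ] E) (n : ℕ) (hn : 1 ≤ n) :
    ∃ C, ∀ w z, ‖iteratedFDeriv ℝ n (fun z => logBracket (w + P z)) z‖ ≤ C := by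
  obtain ⟨C, hC⟩ := exists_bound_iteratedFDeriv_logBracket (E := E) n hn
  have hC0 : 0 ≤ C := (norm_nonneg _).trans (hC 0)
  refine ⟨C * ‖P‖ ^ n, fun w z => ?_⟩
  have h1 : ContDiff ℝ ∞ (fun x : E => logBracket (w + x)) :=
    contDiff_logBracket.comp (contDiff_const.add contDiff_id)
  rw [show (fun z => logBracket (w + P z)) = (fun x : E => logBracket (w + x)) ∘ P from rfl,
    P.iteratedFDeriv_comp_right h1 z (by exact_mod_cast le_top)]
  refine (ContinuousMultilinearMap.norm_compContinuousLinearMap_le _ _).trans ?_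
  rw [Finset.prod_const, Finset.card_univ, Fintype.card_fin, iteratedFDeriv_comp_add_left]
  gcongr
  exact hC _

/-- Bounds independent of `w`, since derivatives of `log⟨·⟩` of positive order are bounded on the
whole space. -/
lemma exists_bound_iteratedFDeriv_logRatio (P₁ P₂ : V →L[ℝ] E) (n : ℕ) (hn : 1 ≤ n) :
    ∃ C, ∀ w z, ‖iteratedFDeriv ℝ n (logRatio P₁ P₂ w) z‖ ≤ C := by
  obtain ⟨C, hC⟩ := exists_bound_iteratedFDeriv_logBracket_comp P₁ n hn
  obtain ⟨D, hD⟩ := exists_bound_iteratedFDeriv_logBracket_comp P₂ n hn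
  refine ⟨C + D, fun w z => ?_⟩
  have hle : ((n : ℕ) : WithTop ℕ∞) ≤ (∞ : WithTop ℕ∞) := by exact_mod_cast le_top
  have h1 := ((contDiff_logBracket_comp P₁ w).of_le hle).contDiffAt (x := z)
  have h2 := ((contDiff_logBracket_comp P₂ w).of_le hle).contDiffAt (x := z)
  have e : logRatio P₁ P₂ w = ((fun z => logBracket (w + P₁ z)) - fun z => logBracket (w + P₂ z)) -
    fun _ => 2 * logBracket w := rfl
  rw [e, iteratedFDeriv_sub_apply (f := (fun z => logBracket (w + P₁ z)) - fun z => logBracket (w + P₂ z))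
      (h1.sub h2) contDiffAt_const, iteratedFDeriv_sub_apply h1 h2,
    iteratedFDeriv_const_of_ne (by omega), Pi.zero_apply, sub_zero]
  exact (norm_sub_le _ _).trans (add_le_add (hC w z) (hD w z))

/-- In the formula for derivatives of a composition each derivative of `ηψ` brings at most a factor
of order `1+η`, whence `(1+η)^n` times the exponential itself. -/
lemma exists_bound_iteratedFDeriv_exp_logRatio (P₁ P₂ : V →L[ℝ] E) (n : ℕ) :
    ∃ C, 0 ≤ C ∧ ∀ η, 0 ≤ η → ∀ w z,
      ‖iteratedFDeriv ℝ n (fun z => Real.exp (η * logRatio P₁ P₂ w z)) z‖ ≤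
        C * (1 + η) ^ n * Real.exp (η * logRatio P₁ P₂ w z) := by
  have hB : ∃ M : ℝ, 1 ≤ M ∧ ∀ i, 1 ≤ i → i ≤ n → ∀ w z,
      ‖iteratedFDeriv ℝ i (logRatio P₁ P₂ w) z‖ ≤ M := by
    choose! C hC using fun i hi => exists_bound_iteratedFDeriv_logRatio P₁ P₂ i hi
    refine ⟨1 + ∑ i ∈ Finset.range (n + 1), |C i|, by
      have := Finset.sum_nonneg (s := Finset.range (n + 1)) fun i _ => abs_nonneg (C i)
      linarith, fun i h1 h2 w z => (hC i h1 w z).trans ?_⟩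
    have := Finset.single_le_sum (s := Finset.range (n + 1)) (f := fun i => |C i|)
      (fun i _ => abs_nonneg _) (Finset.mem_range.2 (by omega : i < n + 1))
    linarith [le_abs_self (C i)]
  obtain ⟨M, hM1, hM⟩ := hB
  refine ⟨n.factorial * M ^ n, by positivity, fun η hη w z => ?_⟩
  have hle : ((n : ℕ) : WithTop ℕ∞) ≤ (∞ : WithTop ℕ∞) := by exact_mod_cast le_top
  have hs : ContDiff ℝ ∞ (fun z => η * logRatio P₁ P₂ w z) :=
    contDiff_const.mul (contDiff_logRatio P₁ P₂ w)
  have := norm_iteratedFDeriv_comp_le (g := Real.exp) (f := fun z => η * logRatio P₁ P₂ w z)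
    (n := n) (N := ∞) Real.contDiff_exp hs hle z
    (C := Real.exp (η * logRatio P₁ P₂ w z)) (D := (1 + η) * M) ?_ ?_
  · refine this.trans (le_of_eq ?_)
    rw [mul_pow]; ring
  · intro i _
    rw [norm_iteratedFDeriv_eq_norm_iteratedDeriv, iteratedDeriv_eq_iterate, Real.iter_deriv_exp,
      Real.norm_of_nonneg (Real.exp_pos _).le]
  · intro i h1 h2
    have hle : ((i : ℕ) : WithTop ℕ∞) ≤ (∞ : WithTop ℕ∞) := by exact_mod_cast le_top
    have e : iteratedFDeriv ℝ i (fun z => η * logRatio P₁ P₂ w z) z =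
        η • iteratedFDeriv ℝ i (logRatio P₁ P₂ w) z :=
      iteratedFDeriv_const_smul_apply (a := η)
        (((contDiff_logRatio P₁ P₂ w).of_le hle).contDiffAt (x := z))
    rw [e, norm_smul, Real.norm_of_nonneg hη]
    calc η * ‖iteratedFDeriv ℝ i (logRatio P₁ P₂ w) z‖ ≤ (1 + η) * M := by
          gcongr
          · linarith
          · exact hM i h1 h2 w z
      _ ≤ _ := le_self_pow₀ (by nlinarith) (by omega)

lemma exists_pow_mul_exp_le {c : ℝ} (hc : 0 < c) (n : ℕ) :
    ∃ C : ℝ, 0 ≤ C ∧ ∀ η, 0 ≤ η → (1 + η) ^ n * Real.exp (-(c * η)) ≤ C := by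
  refine ⟨n.factorial * Real.exp c / c ^ n, by positivity, fun η hη => ?_⟩
  have h := Real.pow_div_factorial_le_exp (c * (1 + η)) (by positivity) n
  have hf : (0 : ℝ) < n.factorial := by positivity
  rw [div_le_iff₀ hf, mul_pow] at h
  rw [le_div_iff₀ (by positivity)]
  have e : Real.exp (c * (1 + η)) * Real.exp (-(c * η)) = Real.exp c := by
    rw [← Real.exp_add]; congr 1; ring
  calc (1 + η) ^ n * Real.exp (-(c * η)) * c ^ n
      = (c ^ n * (1 + η) ^ n) * Real.exp (-(c * η)) := by ring
    _ ≤ (Real.exp (c * (1 + η)) * n.factorial) * Real.exp (-(c * η)) := by gcongr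
    _ = _ := by rw [← e]; ring

/-- The amplitude `Θ(z) exp(η ψ_w(z))`. -/
noncomputable def weightAmp (P₁ P₂ : V →L[ℝ] E) (Θ : V → ℂ) (η : ℝ) (w : E) (z : V) : ℂ :=
  Real.exp (η * logRatio P₁ P₂ w z) • Θ z

lemma contDiff_weightAmp (P₁ P₂ : V →L[ℝ] E) {Θ : V → ℂ} (hΘ : ContDiff ℝ ∞ Θ) (η : ℝ) (w : E) :
    ContDiff ℝ ∞ (weightAmp P₁ P₂ Θ η w) :=
  (Real.contDiff_exp.comp (contDiff_const.mul (contDiff_logRatio P₁ P₂ w))).smul hΘ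

lemma tsupport_weightAmp_subset (P₁ P₂ : V →L[ℝ] E) (Θ : V → ℂ) (η : ℝ) (w : E) :
    tsupport (weightAmp P₁ P₂ Θ η w) ⊆ tsupport Θ := tsupport_smul_subset_right _ _

/-- On the support the exponential is at most `e^{-cη}`, which dominates `(1+η)^n` and leaves any
prescribed negative power `(1+η)^{-J}`. -/
lemma exists_bound_iteratedFDeriv_weightAmp (P₁ P₂ : V →L[ℝ] E) {Θ : V → ℂ}
    (hΘ : ContDiff ℝ ∞ Θ) (hΘc : HasCompactSupport Θ) {c : ℝ} (hc : 0 < c)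
    (hneg : ∀ z ∈ tsupport Θ, ∀ w, logRatio P₁ P₂ w z ≤ -c) (J n : ℕ) :
    ∃ C, 0 ≤ C ∧ ∀ η, 0 ≤ η → ∀ w z,
      ‖iteratedFDeriv ℝ n (weightAmp P₁ P₂ Θ η w) z‖ ≤ C * ((1 + η) ^ J)⁻¹ := by
  have hle (n : ℕ) : ((n : ℕ) : WithTop ℕ∞) ≤ (∞ : WithTop ℕ∞) := by exact_mod_cast le_top
  choose B hB0 hB using exists_bound_iteratedFDeriv_exp_logRatio P₁ P₂
  have hT (i : ℕ) : ∃ C, ∀ z, ‖iteratedFDeriv ℝ i Θ z‖ ≤ C :=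
    (hΘc.iteratedFDeriv (𝕜 := ℝ) i).exists_bound_of_continuous (hΘ.continuous_iteratedFDeriv (hle i))
  choose T hT using hT
  have hT0 (i : ℕ) : 0 ≤ T i := (norm_nonneg _).trans (hT i 0)
  obtain ⟨X, hX0, hX⟩ := exists_pow_mul_exp_le hc (n + J)
  refine ⟨(∑ i ∈ Finset.range (n + 1), (n.choose i : ℝ) * B i * T (n - i)) * X, ?_, fun η hη w z => ?_⟩
  · exact mul_nonneg (Finset.sum_nonneg fun i _ => by have := hB0 i; have := hT0 (n - i); positivity) hX0
  by_cases hz : z ∈ tsupport Θ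
  · have h1 : Real.exp (η * logRatio P₁ P₂ w z) ≤ Real.exp (-(c * η)) := by
      refine Real.exp_le_exp.2 ?_
      nlinarith [hneg z hz w]
    refine (norm_iteratedFDeriv_smul_le (Real.contDiff_exp.comp
      (contDiff_const.mul (contDiff_logRatio P₁ P₂ w))) hΘ z (hle n)).trans ?_
    rw [← div_eq_mul_inv, le_div_iff₀ (by positivity)]
    calc _ ≤ (∑ i ∈ Finset.range (n + 1), (n.choose i : ℝ) * (B i * (1 + η) ^ n *
            Real.exp (-(c * η))) * T (n - i)) * (1 + η) ^ J := by
          gcongr with i hi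
          · have := hB0 i; positivity
          · refine (hB i η hη w z).trans ?_
            have := hB0 i
            gcongr
            · linarith
            · have := Finset.mem_range.1 hi; omega
          · exact hT (n - i) z
      _ = (∑ i ∈ Finset.range (n + 1), (n.choose i : ℝ) * B i * T (n - i)) *
          ((1 + η) ^ (n + J) * Real.exp (-(c * η))) := by
          rw [Finset.sum_mul, Finset.sum_mul]
          exact Finset.sum_congr rfl fun i _ => by rw [pow_add]; ring
      _ ≤ _ := by
          refine mul_le_mul_of_nonneg_left (hX η hη) (Finset.sum_nonneg fun i _ => ?_)
          have := hB0 i; have := hT0 (n - i); positivity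
  · have h0 : iteratedFDeriv ℝ n (weightAmp P₁ P₂ Θ η w) z = 0 :=
      image_eq_zero_of_notMem_tsupport fun h =>
        hz (tsupport_weightAmp_subset P₁ P₂ Θ η w (tsupport_iteratedFDeriv_subset n h))
    rw [h0, norm_zero]
    have : 0 ≤ ∑ i ∈ Finset.range (n + 1), (n.choose i : ℝ) * B i * T (n - i) :=
      Finset.sum_nonneg fun i _ => by have := hB0 i; have := hT0 (n - i); positivity
    positivity

theorem exists_norm_fourier_weightAmp_le (P₁ P₂ : V →L[ℝ] E) {Θ : V → ℂ}
    (hΘ : ContDiff ℝ ∞ Θ) (hΘc : HasCompactSupport Θ) {c : ℝ} (hc : 0 < c)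
    (hneg : ∀ z ∈ tsupport Θ, ∀ w, logRatio P₁ P₂ w z ≤ -c) (J m : ℕ) :
    ∃ C, 0 ≤ C ∧ ∀ η, 0 ≤ η → ∀ w ζ,
      ‖𝓕 (weightAmp P₁ P₂ Θ η w) ζ‖ ≤ C * ((1 + η) ^ J)⁻¹ * jb ζ ^ (-(m : ℝ)) := by
  obtain ⟨R, hR⟩ := hΘc.isCompact.isBounded.subset_closedBall 0
  obtain ⟨D, hD0, hD⟩ := exists_norm_fourier_le (V := V) R m
  choose B hB0 hB using exists_bound_iteratedFDeriv_weightAmp P₁ P₂ hΘ hΘc hc hneg J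
  refine ⟨D * ∑ n ∈ Finset.range (2 * m + 1), B n,
    mul_nonneg hD0 (Finset.sum_nonneg fun i _ => hB0 i), fun η hη w ζ => ?_⟩
  have := hD (weightAmp P₁ P₂ Θ η w) ((∑ n ∈ Finset.range (2 * m + 1), B n) * ((1 + η) ^ J)⁻¹)
    (contDiff_weightAmp P₁ P₂ hΘ η w) ((tsupport_weightAmp_subset P₁ P₂ Θ η w).trans hR)
    (fun n hn v => (hB n η hη w v).trans ?_) ζ
  · rwa [← mul_assoc] at this
  · gcongr
    exact Finset.single_le_sum (f := B) (fun i _ => hB0 i) (Finset.mem_range.2 (by omega))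

end AmplitudeFourier

/-! ### The model pairing with amplitude depending on `x` only -/

section PlanePairing

open scoped SchwartzMap

variable {N : ℕ}

/-- The Gaussian weight `exp(-π(κ²|x|² + |p|²))`. -/
noncomputable def gaussW (β : ℝ) (x p : Vel N) : ℝ :=
  Real.exp (-Real.pi * ((kap β) ^ 2 * ‖x‖ ^ 2 + ‖p‖ ^ 2))

lemma continuous_gaussW (β : ℝ) : Continuous (fun z : Vel N × Vel N => gaussW β z.1 z.2) := by
  unfold gaussW; fun_prop

lemma norm_carlY_sq (β : ℝ) {x : Vel N} (hx : x ≠ 0) (p : Vel N) :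
    ‖carlY β x p‖ ^ 2 = (kap β) ^ 2 * ‖x‖ ^ 2 + ‖perpProj x p‖ ^ 2 := by
  unfold carlY
  rw [norm_add_sq_real, inner_smul_left, inner_perpProj hx, norm_smul, mul_pow, Real.norm_eq_abs,
    sq_abs]
  simp

/-- Since `|y|² = κ²|x|² + |P_x p|²`, splitting off `exp(-π|y|²)` completes the Gaussian along `x`
to an isotropic Gaussian in `p`, whose Fourier transform is explicit. -/
lemma exp_mul_dirGauss (β : ℝ) {x : Vel N} (hx : x ≠ 0) (p : Vel N) :
    Real.exp (-Real.pi * ‖carlY β x p‖ ^ 2) * dirGauss x p = gaussW β x p := by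
  unfold dirGauss gaussW
  rw [← Real.exp_add, norm_carlY_sq β hx, norm_perpProj_sq hx]
  congr 1
  rw [mul_pow, inv_pow]
  ring

lemma inner_perpProj_comm (x p ξ : Vel N) :
    inner ℝ (perpProj x p) ξ = inner ℝ (perpProj x ξ) p := by
  unfold perpProj
  simp only [inner_sub_left, inner_smul_left, real_inner_comm p ξ]
  simp only [RCLike.conj_to_real]
  ring

lemma cexp_carlY_mul_gaussW (β : ℝ) (x p ξ : Vel N) :
    Complex.exp (2 * Real.pi * Complex.I * (inner ℝ (carlY β x p) ξ : ℝ)) * gaussW β x p =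
      Complex.exp (2 * Real.pi * Complex.I * (kap β * inner ℝ x ξ : ℝ) -
        Real.pi * kap β ^ 2 * ‖x‖ ^ 2) * Complex.exp (-(Real.pi : ℂ) * (‖p‖ : ℂ) ^ 2 +
          (2 * Real.pi * Complex.I) * (inner ℝ (perpProj x ξ) p : ℝ)) := by
  unfold gaussW
  rw [Complex.ofReal_exp, ← Complex.exp_add, ← Complex.exp_add]
  congr 1
  unfold carlY
  rw [inner_add_left, inner_smul_left, inner_perpProj_comm]
  simp only [RCLike.conj_to_real]
  push_cast
  ring

/-- The frequency seen by the variable `p` is `P_x ξ`, which is how `exp(-π|P_x ξ|²)` enters the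
plane kernel. -/
lemma integral_gaussW (β : ℝ) (x ξ : Vel N) :
    ∫ p, Complex.exp (2 * Real.pi * Complex.I * (inner ℝ (carlY β x p) ξ : ℝ)) * gaussW β x p =
      Complex.exp (-(Real.pi * kap β ^ 2 * ‖x‖ ^ 2)) * planeKernel (kap β) x ξ := by
  simp only [cexp_carlY_mul_gaussW]
  have hpi : (0 : ℝ) < ((Real.pi : ℝ) : ℂ).re := by simpa using Real.pi_pos
  have h0 : (Real.pi : ℂ) ≠ 0 := by exact_mod_cast Real.pi_ne_zero
  rw [integral_const_mul, GaussianFourier.integral_cexp_neg_mul_sq_norm_add hpi, div_self h0,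
    Complex.one_cpow, one_mul, ← Complex.exp_add]
  unfold planeKernel
  rw [← Complex.exp_add]
  congr 1
  push_cast
  have : (2 * Real.pi * Complex.I) ^ 2 * (‖perpProj x ξ‖ : ℂ) ^ 2 / (4 * Real.pi) =
      -(Real.pi * (‖perpProj x ξ‖ : ℂ) ^ 2) := by
    rw [mul_pow, Complex.I_sq]; field_simp; ring
  rw [this]
  ring

lemma integrable_gauss_norm : Integrable (fun p : Vel N => Real.exp (-Real.pi * ‖p‖ ^ 2)) := by
  have hpi : (0 : ℝ) < ((Real.pi : ℝ) : ℂ).re := by simpa using Real.pi_pos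
  have h := (GaussianFourier.integrable_cexp_neg_mul_sq_norm_add (V := Vel N) hpi 0 0).norm
  refine h.congr (Filter.Eventually.of_forall fun p => ?_)
  simp only [zero_mul, add_zero, Complex.norm_exp]
  congr 1
  rw [show -(Real.pi : ℂ) * (‖p‖ : ℂ) ^ 2 = ((-Real.pi * ‖p‖ ^ 2 : ℝ) : ℂ) by push_cast; ring,
    Complex.ofReal_re]

lemma gaussW_le (β : ℝ) (x p : Vel N) : gaussW β x p ≤ Real.exp (-Real.pi * ‖p‖ ^ 2) := by
  unfold gaussW
  refine Real.exp_le_exp.2 ?_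
  have := Real.pi_pos
  nlinarith [show 0 ≤ Real.pi * ((kap β) ^ 2 * ‖x‖ ^ 2) by positivity]

lemma gaussW_pos (β : ℝ) (x p : Vel N) : 0 < gaussW β x p := Real.exp_pos _

lemma rapid_schwartz (G : 𝓢(Vel N, ℂ)) : Rapid (⇑G) := by
  refine ⟨G.continuous.measurable, fun n => ?_⟩
  obtain ⟨C₀, h0⟩ := G.decay 0 0
  obtain ⟨C₁, h1⟩ := G.decay (2 * n) 0
  simp only [norm_iteratedFDeriv_zero, pow_zero, one_mul] at h0 h1
  refine ⟨2 ^ n * (C₀ + (2 * Real.pi) ^ (2 * n) * C₁), fun ξ => ?_⟩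
  rw [Real.rpow_neg (jb_pos ξ).le, Real.rpow_natCast, ← div_eq_mul_inv,
    le_div_iff₀ (pow_pos (jb_pos ξ) n)]
  calc ‖G ξ‖ * jb ξ ^ n
      ≤ ‖G ξ‖ * (2 ^ n * (1 + (2 * Real.pi) ^ (2 * n) * ‖ξ‖ ^ (2 * n))) := by
        gcongr; exact jb_pow_le ξ n
    _ = 2 ^ n * (‖G ξ‖ + (2 * Real.pi) ^ (2 * n) * (‖ξ‖ ^ (2 * n) * ‖G ξ‖)) := by ring
    _ ≤ _ := by
        gcongr
        · exact h0.2 ξ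
        · exact h1.2 ξ

lemma schwartz_eq_integral (G : 𝓢(Vel N, ℂ)) (y : Vel N) :
    G y = ∫ ξ, (𝓕 G : 𝓢(Vel N, ℂ)) ξ *
      Complex.exp (2 * Real.pi * Complex.I * (inner ℝ y ξ : ℝ)) := by
  conv_lhs => rw [← FourierTransform.fourierInv_fourier_eq (F := 𝓢(Vel N, ℂ)) G]
  rw [SchwartzMap.fourierInv_coe, Real.fourierInv_eq']
  refine integral_congr_ae (Filter.Eventually.of_forall fun ξ => ?_)
  simp only [smul_eq_mul]
  rw [mul_comm, real_inner_comm]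
  congr 2
  push_cast; ring

lemma integral_schwartz_carlY (β : ℝ) (G : 𝓢(Vel N, ℂ)) (x : Vel N) :
    ∫ p, G (carlY β x p) * gaussW β x p = Complex.exp (-(Real.pi * kap β ^ 2 * ‖x‖ ^ 2)) *
      ∫ ξ, (𝓕 G : 𝓢(Vel N, ℂ)) ξ * planeKernel (kap β) x ξ := by
  have hmp : Measurable (fun p : Vel N => carlY β x p) :=
    (measurable_carlY β).comp (f := fun p => (x, p)) (by fun_prop)
  have hcp : Continuous (gaussW β x) := (continuous_gaussW β).comp (f := fun p => (x, p)) (by fun_prop)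
  have hI : Integrable (fun z : Vel N × Vel N => (𝓕 G : 𝓢(Vel N, ℂ)) z.2 *
      (Complex.exp (2 * Real.pi * Complex.I * (inner ℝ (carlY β x z.1) z.2 : ℝ)) * gaussW β x z.1))
      (volume.prod volume) := by
    have hb := (integrable_gauss_norm (N := N)).mul_prod
      ((𝓕 G : 𝓢(Vel N, ℂ)).integrable (μ := volume)).norm
    refine hb.mono' ?_ (Filter.Eventually.of_forall fun z => ?_)
    · refine Measurable.aestronglyMeasurable ?_
      refine ((𝓕 G : 𝓢(Vel N, ℂ)).continuous.measurable.comp measurable_snd).mul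
        (Measurable.mul ?_ (Complex.measurable_ofReal.comp (hcp.measurable.comp measurable_fst)))
      have : Measurable (fun z : Vel N × Vel N => carlY β x z.1) := hmp.comp measurable_fst
      have h2 : Measurable (fun z : Vel N × Vel N => inner ℝ (carlY β x z.1) z.2) :=
        this.inner measurable_snd
      fun_prop
    · have e : ‖Complex.exp (2 * Real.pi * Complex.I * (inner ℝ (carlY β x z.1) z.2 : ℝ))‖ = 1 := by
        rw [show (2 * Real.pi * Complex.I * (inner ℝ (carlY β x z.1) z.2 : ℝ) : ℂ) =
          ((2 * Real.pi * inner ℝ (carlY β x z.1) z.2 : ℝ) : ℂ) * Complex.I by push_cast; ring]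
        exact Complex.norm_exp_ofReal_mul_I _
      rw [norm_mul, norm_mul, e, one_mul, Complex.norm_real,
        Real.norm_of_nonneg (gaussW_pos β x z.1).le, mul_comm]
      exact mul_le_mul_of_nonneg_right (gaussW_le β x z.1) (norm_nonneg _)
  calc _ = ∫ p, ∫ ξ, (𝓕 G : 𝓢(Vel N, ℂ)) ξ *
      (Complex.exp (2 * Real.pi * Complex.I * (inner ℝ (carlY β x p) ξ : ℝ)) * gaussW β x p) := by
        refine integral_congr_ae (Filter.Eventually.of_forall fun p => ?_)
        simp only [← mul_assoc]
        rw [integral_mul_const, ← schwartz_eq_integral]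
    _ = _ := by
        rw [integral_integral_swap hI, ← integral_const_mul]
        refine integral_congr_ae (Filter.Eventually.of_forall fun ξ => ?_)
        simp only []
        rw [integral_const_mul, integral_gaussW]
        ring

/-- The kernel of the pairing of `G` and `φ`, in the variables `(x, p)`. -/
noncomputable def pairKernel (β : ℝ) (c : Vel N → ℂ) (G φ : Vel N → ℂ) (z : Vel N × Vel N) : ℂ :=
  φ z.1 * (c z.1 * (G (carlY β z.1 z.2) * gaussW β z.1 z.2))

lemma integrable_pairKernel (β : ℝ) {c : Vel N → ℂ} (hc : CutOff c) (G φ : 𝓢(Vel N, ℂ)) :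
    Integrable (pairKernel β c G φ) (volume.prod volume) := by
  obtain ⟨M, hM0, hM⟩ := hc.exists_bound
  obtain ⟨C, hC⟩ := G.decay 0 0
  simp only [norm_iteratedFDeriv_zero, pow_zero, one_mul] at hC
  have hC0 : 0 ≤ C := (norm_nonneg _).trans (hC.2 0)
  have hb := ((φ.integrable (μ := volume)).norm.mul_prod (integrable_gauss_norm (N := N))).const_mul (M * C)
  refine hb.mono' ?_ (Filter.Eventually.of_forall fun z => ?_)
  · exact ((φ.continuous.measurable.comp measurable_fst).mul
      ((hc.smooth.continuous.measurable.comp measurable_fst).mul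
        ((G.continuous.measurable.comp (measurable_carlY β)).mul
          (Complex.measurable_ofReal.comp (continuous_gaussW β).measurable)))).aestronglyMeasurable
  · unfold pairKernel
    rw [norm_mul, norm_mul, norm_mul, Complex.norm_real, Real.norm_of_nonneg (gaussW_pos β _ _).le]
    calc _ ≤ ‖φ z.1‖ * (M * (C * Real.exp (-Real.pi * ‖z.2‖ ^ 2))) := by
          have := (gaussW_pos β z.1 z.2).le
          gcongr
          · exact hM _
          · exact hC.2 _
          · exact gaussW_le β _ _
      _ = _ := by ring

lemma CutOff.mul_gauss {c : Vel N → ℂ} (hc : CutOff c) (a : ℝ) :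
    CutOff (fun x => Complex.exp (-(a * ‖x‖ ^ 2)) * c x) := by
  refine hc.mul fun x _ => ContDiff.contDiffAt ?_
  have h1 : ContDiff ℝ ∞ (fun x : Vel N => -((a : ℂ) * ((‖x‖ ^ 2 : ℝ) : ℂ))) :=
    (contDiff_const.mul (Complex.ofRealCLM.contDiff.comp (contDiff_norm_sq ℝ))).neg
  push_cast at h1
  exact h1.cexp

lemma integral_pairKernel (β : ℝ) {c : Vel N → ℂ} (hc : CutOff c) (G φ : 𝓢(Vel N, ℂ)) :
    ∫ z, pairKernel β c G φ z ∂(volume.prod volume) =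
      ∫ x, planeOp (kap β) (fun x _ => Complex.exp (-((Real.pi * kap β ^ 2 : ℝ) * ‖x‖ ^ 2)) * c x * 1)
        (𝓕 G : 𝓢(Vel N, ℂ)) x * φ x := by
  rw [integral_prod _ (integrable_pairKernel β hc G φ)]
  refine integral_congr_ae (Filter.Eventually.of_forall fun x => ?_)
  simp only [pairKernel]
  rw [integral_const_mul, integral_const_mul, integral_schwartz_carlY]
  unfold planeOp
  have : ∀ ξ, (𝓕 G : 𝓢(Vel N, ℂ)) ξ * (Complex.exp (-((Real.pi * kap β ^ 2 : ℝ) * ‖x‖ ^ 2)) * c x * 1 *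
      planeKernel (kap β) x ξ) = (Complex.exp (-((Real.pi * kap β ^ 2 : ℝ) * ‖x‖ ^ 2)) * c x) *
      ((𝓕 G : 𝓢(Vel N, ℂ)) ξ * planeKernel (kap β) x ξ) := fun ξ => by ring
  simp only [this]
  rw [integral_const_mul]
  push_cast
  ring

/-- Integrating out `p` turns the pairing into `planeOp` applied to the Fourier transform of `G`. At
order `s + (N-1)/2` its bound involves the exponent `(s + (N-1)/2)/2 - (N-1)/4 = s/2`, the `H^s`
weight of `G`. -/
lemma enorm_integral_pairKernel_le (hN : 2 ≤ N) {β : ℝ} (hβ : 0 < kap β) {c : Vel N → ℂ}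
    (hc : CutOff c) {s : ℝ} (hs : 0 ≤ s) : ∃ C : ℝ≥0, ∀ G φ : 𝓢(Vel N, ℂ),
      ‖∫ z, pairKernel β c G φ z ∂(volume.prod volume)‖ₑ ≤
        C * eLpNorm (fun ξ => (jb ξ ^ (s / 2) : ℝ) • (𝓕 G : 𝓢(Vel N, ℂ)) ξ) 2 volume *
          dualNorm (s + ((N : ℝ) - 1) / 2) φ := by
  have hN' : (2 : ℝ) ≤ N := by exact_mod_cast hN
  have hA := Amp.term (hc.mul_gauss (Real.pi * kap β ^ 2)) QMon.one
  obtain ⟨C, hC⟩ := hnorm_planeOp_le hN hβ (r := s + ((N : ℝ) - 1) / 2) (by linarith) hA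
  refine ⟨C, fun G φ => ?_⟩
  have hR := rapid_schwartz (𝓕 G : 𝓢(Vel N, ℂ))
  rw [integral_pairKernel β hc]
  refine (enorm_integral_le_hnorm_mul_dualNorm (s + ((N : ℝ) - 1) / 2)
    (hA.memLp_planeOp hN hβ hR) φ).trans ?_
  have := hC _ hR
  rw [show (s + ((N : ℝ) - 1) / 2) / 2 - ((N : ℝ) - 1) / 4 = s / 2 by ring] at this
  gcongr

end PlanePairing

/-! ### General amplitudes by superposition of characters -/

section ModulatedPairing

open scoped SchwartzMap

section General

variable {E : Type*} [NormedAddCommGroup E] [InnerProductSpace ℝ E] [FiniteDimensional ℝ E]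
  [MeasurableSpace E] [BorelSpace E]

/-- Translation of a Schwartz function. -/
noncomputable def translate (w : E) (G : 𝓢(E, ℂ)) : 𝓢(E, ℂ) := SchwartzMap.compSubConstCLM ℂ (-w) G

lemma translate_apply (w : E) (G : 𝓢(E, ℂ)) (x : E) : translate w G x = G (w + x) := by
  unfold translate
  rw [SchwartzMap.compSubConstCLM_apply, sub_neg_eq_add, add_comm]

/-- The product of a Schwartz function and the character `e^{2πi q·x}`. -/
noncomputable def modulate (q : E) (G : 𝓢(E, ℂ)) : 𝓢(E, ℂ) := 𝓕⁻ (translate (-q) (𝓕 G))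

lemma fourier_modulate (q : E) (G : 𝓢(E, ℂ)) (ξ : E) :
    (𝓕 (modulate q G) : 𝓢(E, ℂ)) ξ = (𝓕 G : 𝓢(E, ℂ)) (-q + ξ) := by
  unfold modulate
  rw [FourierTransform.fourier_fourierInv_eq, translate_apply]

lemma modulate_apply (q : E) (G : 𝓢(E, ℂ)) (x : E) :
    modulate q G x = Complex.exp (2 * Real.pi * Complex.I * (inner ℝ q x : ℝ)) * G x := by
  have h1 : G x = ∫ ξ, Complex.exp (↑(2 * Real.pi * inner ℝ ξ x) * Complex.I) • (𝓕 G : 𝓢(E, ℂ)) ξ := by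
    conv_lhs => rw [← FourierTransform.fourierInv_fourier_eq (F := 𝓢(E, ℂ)) G]
    rw [SchwartzMap.fourierInv_coe, Real.fourierInv_eq']
  rw [h1]
  unfold modulate
  rw [SchwartzMap.fourierInv_coe, Real.fourierInv_eq', ← integral_const_mul,
    ← integral_add_left_eq_self _ q]
  refine integral_congr_ae (Filter.Eventually.of_forall fun ξ => ?_)
  simp only [translate_apply, neg_add_cancel_left, smul_eq_mul]
  rw [← mul_assoc, ← Complex.exp_add, inner_add_left]
  congr 2
  push_cast; ring

lemma fourierInv_modulate (q : E) (G : 𝓢(E, ℂ)) (ξ : E) :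
    𝓕⁻ (⇑(modulate q G)) ξ = 𝓕⁻ (⇑G) (q + ξ) := by
  rw [Real.fourierInv_eq', Real.fourierInv_eq']
  refine integral_congr_ae (Filter.Eventually.of_forall fun v => ?_)
  simp only [modulate_apply, smul_eq_mul]
  rw [← mul_assoc, ← Complex.exp_add, inner_add_right, real_inner_comm v q]
  congr 2
  push_cast; ring

lemma norm_fourier_translate (w : E) (G : 𝓢(E, ℂ)) (ξ : E) :
    ‖𝓕 (⇑(translate w G)) ξ‖ = ‖𝓕 (⇑G) ξ‖ := by
  have : 𝓕 (⇑(translate w G)) ξ =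
      Complex.exp (((2 * Real.pi * inner ℝ w ξ : ℝ) : ℂ) * Complex.I) * 𝓕 (⇑G) ξ := by
    rw [Real.fourier_eq', Real.fourier_eq', ← integral_const_mul,
      ← integral_add_left_eq_self (fun v => _ * _) w]
    refine integral_congr_ae (Filter.Eventually.of_forall fun v => ?_)
    simp only [translate_apply, smul_eq_mul]
    rw [← mul_assoc, ← Complex.exp_add, inner_add_left]
    congr 2
    push_cast; ring
  rw [this, norm_mul, Complex.norm_exp_ofReal_mul_I, one_mul]

lemma dualNorm_translate (r : ℝ) (w : E) (φ : 𝓢(E, ℂ)) :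
    dualNorm r (translate w φ) = dualNorm r φ := by
  unfold dualNorm
  refine eLpNorm_congr_norm_ae (Filter.Eventually.of_forall fun ξ => ?_)
  rw [norm_smul, norm_smul, SchwartzMap.fourierInv_coe, SchwartzMap.fourierInv_coe,
    Real.fourierInv_eq_fourier_neg, Real.fourierInv_eq_fourier_neg, norm_fourier_translate]

lemma jb_add_le (q ξ : E) : jb (q + ξ) ≤ 2 * jb q * jb ξ := by
  have h1 : ‖q + ξ‖ ^ 2 ≤ 2 * ‖q‖ ^ 2 + 2 * ‖ξ‖ ^ 2 := by
    have := norm_add_le q ξ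
    nlinarith [sq_nonneg (‖q‖ - ‖ξ‖), norm_nonneg (q + ξ), norm_nonneg q, norm_nonneg ξ]
  unfold jb
  simp only [mul_pow]
  have h2 : 0 ≤ 2 ^ 2 * Real.pi ^ 2 := by positivity
  nlinarith [mul_le_mul_of_nonneg_left h1 h2, sq_nonneg (‖q‖), sq_nonneg ‖ξ‖,
    mul_nonneg (mul_nonneg h2 (sq_nonneg ‖q‖)) (mul_nonneg h2 (sq_nonneg ‖ξ‖))]

lemma jb_neg (q : E) : jb (-q) = jb q := by unfold jb; rw [norm_neg]

/-- Peetre's inequality; negative exponents follow by applying the subadditivity estimate to `ξ = -q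
+ (q + ξ)`. -/
lemma jb_rpow_add_le (a : ℝ) (q ξ : E) : jb (q + ξ) ^ a ≤ (2 * jb q) ^ |a| * jb ξ ^ a := by
  have hq : 0 < 2 * jb q := by have := jb_pos q; positivity
  rcases le_total 0 a with ha | ha
  · rw [abs_of_nonneg ha, ← Real.mul_rpow hq.le (jb_pos ξ).le]
    exact Real.rpow_le_rpow (jb_pos _).le (jb_add_le q ξ) ha
  · rw [abs_of_nonpos ha]
    have h : jb ξ ≤ 2 * jb q * jb (q + ξ) := by
      have := jb_add_le (-q) (q + ξ)
      rwa [neg_add_cancel_left, jb_neg] at this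
    have h2 := Real.rpow_le_rpow (jb_pos _).le h (neg_nonneg.2 ha)
    rw [Real.mul_rpow hq.le (jb_pos _).le, Real.rpow_neg (jb_pos ξ).le,
      Real.rpow_neg (jb_pos (q + ξ)).le] at h2
    have p1 := jb_rpow_pos a ξ
    have p2 := jb_rpow_pos a (q + ξ)
    rw [← div_eq_mul_inv, le_div_iff₀ p2, inv_mul_le_iff₀ p1] at h2
    linarith

lemma eLpNorm_jb_translate_le (a : ℝ) (q : E) {h : E → ℂ} (hh : Continuous h) :
    eLpNorm (fun ξ => (jb ξ ^ a : ℝ) • h (-q + ξ)) 2 volume ≤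
      ENNReal.ofReal ((2 * jb q) ^ |a|) * eLpNorm (fun ξ => (jb ξ ^ a : ℝ) • h ξ) 2 volume := by
  have hq : 0 < 2 * jb q := by have := jb_pos q; positivity
  have e : (fun ξ => (jb ξ ^ a : ℝ) • h (-q + ξ)) =
      (fun ξ => (jb (q + ξ) ^ a : ℝ) • h ξ) ∘ fun ξ => -q + ξ := by
    ext ξ; simp
  have hc : Continuous fun ξ => (jb (q + ξ) ^ a : ℝ) • h ξ :=
    ((continuous_jb_rpow a).comp (continuous_const.add continuous_id)).smul hh
  rw [e, eLpNorm_comp_measurePreserving hc.aestronglyMeasurable (measurePreserving_add_left _ (-q)),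
    ← Real.enorm_of_nonneg (by positivity : 0 ≤ (2 * jb q) ^ |a|), ← eLpNorm_const_smul]
  refine eLpNorm_mono fun ξ => ?_
  rw [Pi.smul_apply, norm_smul, norm_smul, norm_smul, Real.norm_of_nonneg (jb_rpow_pos _ _).le,
    Real.norm_of_nonneg (jb_rpow_pos _ _).le, Real.norm_of_nonneg (by positivity), ← mul_assoc]
  exact mul_le_mul_of_nonneg_right (jb_rpow_add_le a q ξ) (norm_nonneg _)

lemma integrable_prod_mul_cexp {α γ : Type*} [MeasurableSpace α] [MeasurableSpace γ] {μ : Measure α}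
    {ν : Measure γ} [SFinite μ] [SFinite ν] {f : α → ℂ} {g : γ → ℂ} (hf : Integrable f μ)
    (hg : Integrable g ν) {ψ : α × γ → ℝ} (hψ : Measurable ψ) :
    Integrable (fun q => g q.2 * (Complex.exp (2 * Real.pi * Complex.I * (ψ q : ℝ)) * f q.1))
      (μ.prod ν) := by
  have hexp : Measurable fun q => Complex.exp (2 * Real.pi * Complex.I * (ψ q : ℝ)) := by fun_prop
  refine ((hf.mul_prod hg).bdd_mul (c := 1) hexp.aestronglyMeasurable
    (Filter.Eventually.of_forall fun q => ?_)).congr (Filter.Eventually.of_forall fun q => ?_)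
  · rw [show (2 * Real.pi * Complex.I * (ψ q : ℝ) : ℂ) = ((2 * Real.pi * ψ q : ℝ) : ℂ) * Complex.I by
      push_cast; ring, Complex.norm_exp_ofReal_mul_I]
  · simp only []; ring

end General

variable {N : ℕ}

/-- Pairs of velocities, with the Euclidean norm. -/
abbrev VelPair (N : ℕ) : Type := WithLp 2 (Vel N × Vel N)

/-- The two components of a pair. -/
noncomputable abbrev fstP (N : ℕ) : VelPair N →L[ℝ] Vel N := WithLp.fstL 2 ℝ (Vel N) (Vel N)

/-- The second component of a pair. -/
noncomputable abbrev sndP (N : ℕ) : VelPair N →L[ℝ] Vel N := WithLp.sndL 2 ℝ (Vel N) (Vel N)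

/-- The pair `(x, y)`. -/
def mkP (x y : Vel N) : VelPair N := WithLp.toLp 2 (x, y)

lemma inner_mkP (ζ : VelPair N) (x y : Vel N) :
    inner ℝ ζ (mkP x y) = inner ℝ (fstP N ζ) x + inner ℝ (sndP N ζ) y :=
  WithLp.prod_inner_apply ζ (mkP x y)

lemma norm_sq_pair (ζ : VelPair N) : ‖ζ‖ ^ 2 = ‖fstP N ζ‖ ^ 2 + ‖sndP N ζ‖ ^ 2 :=
  WithLp.prod_norm_sq_eq_of_L2 ζ

lemma jb_fstP_le (ζ : VelPair N) : jb (fstP N ζ) ≤ jb ζ := by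
  unfold jb
  rw [mul_pow _ ‖fstP N ζ‖, mul_pow _ ‖ζ‖, norm_sq_pair]
  have : 0 ≤ (2 * Real.pi) ^ 2 * ‖sndP N ζ‖ ^ 2 := by positivity
  linarith

lemma jb_sndP_le (ζ : VelPair N) : jb (sndP N ζ) ≤ jb ζ := by
  unfold jb
  rw [mul_pow _ ‖sndP N ζ‖, mul_pow _ ‖ζ‖, norm_sq_pair]
  have : 0 ≤ (2 * Real.pi) ^ 2 * ‖fstP N ζ‖ ^ 2 := by positivity
  linarith

lemma continuous_mkP : Continuous fun z : Vel N × Vel N => mkP z.1 z.2 :=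
  WithLp.prod_continuous_toLp 2 _ _

lemma pairKernel_modulate (β : ℝ) (c : Vel N → ℂ) (G φ : 𝓢(Vel N, ℂ)) (ζ : VelPair N)
    (z : Vel N × Vel N) :
    pairKernel β c (modulate (sndP N ζ) G) (modulate (fstP N ζ) φ) z =
      Complex.exp (2 * Real.pi * Complex.I * (inner ℝ ζ (mkP z.1 (carlY β z.1 z.2)) : ℝ)) *
        pairKernel β c G φ z := by
  unfold pairKernel
  rw [modulate_apply, modulate_apply, inner_mkP]
  push_cast
  rw [mul_add, Complex.exp_add]
  ring

/-- Fourier inversion writes `A(x,y)` as a superposition of `e^{2πi ζ·(x,y)}`, and each character is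
absorbed by modulating `φ` and `G`. Modulation translates frequencies, at a cost polynomial in `ζ`
that the decay of `𝓕 A` compensates. -/
lemma enorm_integral_amp_pairKernel_le (hN : 2 ≤ N) {β : ℝ} (hβ : 0 < kap β) {c : Vel N → ℂ}
    (hc : CutOff c) {s : ℝ} (hs : 0 ≤ s) : ∃ (m : ℕ) (C : ℝ≥0), ∀ A : VelPair N → ℂ,
      ContDiff ℝ ∞ A → HasCompactSupport A → ∀ M : ℝ, 0 ≤ M →
      (∀ ζ, ‖𝓕 A ζ‖ ≤ M * jb ζ ^ (-(m : ℝ))) → ∀ G φ : 𝓢(Vel N, ℂ),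
      ‖∫ z, A (mkP z.1 (carlY β z.1 z.2)) * pairKernel β c G φ z ∂(volume.prod volume)‖ₑ ≤
        C * ENNReal.ofReal M * eLpNorm (fun ξ => (jb ξ ^ (s / 2) : ℝ) • 𝓕 (⇑G) ξ) 2 volume *
          dualNorm (s + ((N : ℝ) - 1) / 2) φ := by
  obtain ⟨C, hC⟩ := enorm_integral_pairKernel_le hN hβ hc hs
  set r := s + ((N : ℝ) - 1) / 2 with hr
  -- The total power of `jb ζ` lost in modulating `G` and `φ`; `m` is taken so large that `jb^{t-m}`
  -- is integrable over pairs `ζ`.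
  obtain ⟨t, ht⟩ : ∃ t, t = |s / 2| + |-r / 2| := ⟨_, rfl⟩
  have ht0 : 0 ≤ t := by rw [ht]; positivity
  obtain ⟨m, hm⟩ := exists_nat_gt ((Module.finrank ℝ (VelPair N) : ℝ) / 2 + t)
  have hI : Integrable (fun ζ : VelPair N => jb ζ ^ (-((m : ℝ) - t))) :=
    integrable_jb_rpow (by linarith)
  set K : ℝ := ∫ ζ : VelPair N, 2 ^ t * jb ζ ^ (-((m : ℝ) - t)) with hK
  refine ⟨m, C * K.toNNReal, fun A hA hAc M hM0 hM G φ => ?_⟩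
  set N1 := eLpNorm (fun ξ => (jb ξ ^ (s / 2) : ℝ) • 𝓕 (⇑G) ξ) 2 volume with hN1
  set N2 := dualNorm r φ with hN2
  have hint := integrable_pairKernel β hc G φ
  have hmz : Measurable fun z : Vel N × Vel N => mkP z.1 (carlY β z.1 z.2) :=
    continuous_mkP.measurable.comp (measurable_fst.prodMk (measurable_carlY β))
  have hAF : Integrable (𝓕 A) := by
    have := (𝓕 (hAc.toSchwartzMap hA) : 𝓢(VelPair N, ℂ)).integrable (μ := volume)
    rwa [SchwartzMap.fourier_coe] at this
  have hprod : Integrable (fun q : (Vel N × Vel N) × VelPair N => 𝓕 A q.2 *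
      (Complex.exp (2 * Real.pi * Complex.I * (inner ℝ q.2 (mkP q.1.1 (carlY β q.1.1 q.1.2)) : ℝ)) *
        pairKernel β c G φ q.1)) ((volume.prod volume).prod volume) := by
    have h1 : Measurable fun q : (Vel N × Vel N) × VelPair N =>
        mkP q.1.1 (carlY β q.1.1 q.1.2) := hmz.comp measurable_fst
    exact integrable_prod_mul_cexp hint hAF
      (Measurable.inner (𝕜 := ℝ) (E := VelPair N) measurable_snd h1)
  have e : ∫ z, A (mkP z.1 (carlY β z.1 z.2)) * pairKernel β c G φ z ∂(volume.prod volume) =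
      ∫ ζ, 𝓕 A ζ * ∫ z, pairKernel β c (modulate (sndP N ζ) G) (modulate (fstP N ζ) φ) z
        ∂(volume.prod volume) := by
    calc _ = ∫ z : Vel N × Vel N, (∫ ζ : VelPair N, 𝓕 A ζ * (Complex.exp (2 * Real.pi * Complex.I *
          (inner ℝ ζ (mkP z.1 (carlY β z.1 z.2)) : ℝ)) * pairKernel β c G φ z))
            ∂(volume.prod volume) := by
          refine integral_congr_ae (Filter.Eventually.of_forall fun z => ?_)
          simp only [← mul_assoc]
          rw [integral_mul_const, ← eq_integral_fourier hA hAc]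
      _ = _ := by
          rw [integral_integral_swap hprod]
          refine integral_congr_ae (Filter.Eventually.of_forall fun ζ => ?_)
          simp only [pairKernel_modulate]
          rw [integral_const_mul]
  rw [e]
  have hb (ζ : VelPair N) : ‖∫ z, pairKernel β c (modulate (sndP N ζ) G) (modulate (fstP N ζ) φ) z
      ∂(volume.prod volume)‖ₑ ≤ C * N1 * N2 * ENNReal.ofReal (2 ^ t * jb ζ ^ t) := by
    have hz := jb_pos ζ
    have h1 : eLpNorm (fun ξ => (jb ξ ^ (s / 2) : ℝ) •
        (𝓕 (modulate (sndP N ζ) G) : 𝓢(Vel N, ℂ)) ξ) 2 volume ≤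
          ENNReal.ofReal ((2 * jb ζ) ^ |s / 2|) * N1 := by
      simp only [fourier_modulate]
      refine (eLpNorm_jb_translate_le _ _ (𝓕 G : 𝓢(Vel N, ℂ)).continuous).trans ?_
      rw [hN1, SchwartzMap.fourier_coe]
      refine mul_le_mul_left (ENNReal.ofReal_le_ofReal (Real.rpow_le_rpow ?_ ?_ (abs_nonneg _))) _
      · have := jb_pos (sndP N ζ); positivity
      · linarith [jb_sndP_le ζ]
    have h2 : dualNorm r (modulate (fstP N ζ) φ) ≤ ENNReal.ofReal ((2 * jb ζ) ^ |-r / 2|) * N2 := by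
      have h3 := eLpNorm_jb_translate_le (-r / 2) (-fstP N ζ) (𝓕⁻ φ : 𝓢(Vel N, ℂ)).continuous
      have h4 : dualNorm r (modulate (fstP N ζ) φ) = eLpNorm (fun ξ => (jb ξ ^ (-r / 2) : ℝ) •
          (𝓕⁻ φ : 𝓢(Vel N, ℂ)) (- -fstP N ζ + ξ)) 2 volume := by
        unfold dualNorm
        simp only [SchwartzMap.fourierInv_coe, fourierInv_modulate, neg_neg]
      rw [h4]
      refine h3.trans (mul_le_mul_left (ENNReal.ofReal_le_ofReal
        (Real.rpow_le_rpow ?_ ?_ (abs_nonneg _))) _)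
      · have := jb_pos (-fstP N ζ); positivity
      · rw [jb_neg]; linarith [jb_fstP_le ζ]
    refine (hC _ _).trans ?_
    calc _ ≤ C * (ENNReal.ofReal ((2 * jb ζ) ^ |s / 2|) * N1) *
          (ENNReal.ofReal ((2 * jb ζ) ^ |-r / 2|) * N2) := by gcongr
      _ = C * N1 * N2 * (ENNReal.ofReal ((2 * jb ζ) ^ |s / 2|) *
          ENNReal.ofReal ((2 * jb ζ) ^ |-r / 2|)) := by ring
      _ = _ := by
          rw [← ENNReal.ofReal_mul (by positivity), ← Real.rpow_add (by positivity),
            Real.mul_rpow (by norm_num) hz.le, ← ht]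
  calc _ ≤ ∫⁻ ζ, ‖𝓕 A ζ * ∫ z, pairKernel β c (modulate (sndP N ζ) G) (modulate (fstP N ζ) φ) z
        ∂(volume.prod volume)‖ₑ := enorm_integral_le_lintegral_enorm _
    _ ≤ ∫⁻ ζ, (C * N1 * N2 * ENNReal.ofReal M) *
          ENNReal.ofReal (2 ^ t * jb ζ ^ (-((m : ℝ) - t))) := by
        refine lintegral_mono fun ζ => ?_
        rw [enorm_mul]
        have hz := jb_pos ζ
        have h1 : ‖𝓕 A ζ‖ₑ ≤ ENNReal.ofReal (M * jb ζ ^ (-(m : ℝ))) := by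
          rw [← ofReal_norm]; exact ENNReal.ofReal_le_ofReal (hM ζ)
        refine (mul_le_mul' h1 (hb ζ)).trans (le_of_eq ?_)
        rw [ENNReal.ofReal_mul hM0, show -((m : ℝ) - t) = -(m : ℝ) + t by ring, Real.rpow_add hz,
          ENNReal.ofReal_mul (by positivity), ENNReal.ofReal_mul (by positivity),
          ENNReal.ofReal_mul (by positivity)]
        ring
    _ = (C * N1 * N2 * ENNReal.ofReal M) * ENNReal.ofReal K := by
        rw [lintegral_const_mul, hK, ofReal_integral_eq_lintegral_ofReal (hI.const_mul _)]
        · exact Filter.Eventually.of_forall fun ζ => by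
            have := jb_rpow_pos (-((m : ℝ) - t)) ζ; positivity
        · exact ((continuous_const.mul (continuous_jb_rpow _)).measurable).ennreal_ofReal
    _ = _ := by
        rw [ENNReal.coe_mul, show ((K.toNNReal : ℝ≥0) : ℝ≥0∞) = ENNReal.ofReal K from rfl]
        ring

/-- Unweighted Sobolev norms are translation invariant, which gives uniformity in the
pre-collisional velocity `w`. -/
theorem enorm_integral_amp_translate_le (hN : 2 ≤ N) {β : ℝ} (hβ : 0 < kap β) {c : Vel N → ℂ}
    (hc : CutOff c) {s : ℝ} (hs : 0 ≤ s) : ∃ (m : ℕ) (C : ℝ≥0), ∀ A : VelPair N → ℂ,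
      ContDiff ℝ ∞ A → HasCompactSupport A → ∀ M : ℝ, 0 ≤ M →
      (∀ ζ, ‖𝓕 A ζ‖ ≤ M * jb ζ ^ (-(m : ℝ))) → ∀ (G φ : 𝓢(Vel N, ℂ)) (w : Vel N),
      ‖∫ z, A (mkP z.1 (carlY β z.1 z.2)) * pairKernel β c (fun y => G (w + y))
        (fun x => φ (w + x)) z ∂(volume.prod volume)‖ₑ ≤
        C * ENNReal.ofReal M * hnorm s G * dualNorm (s + ((N : ℝ) - 1) / 2) φ := by
  obtain ⟨m, C, hC⟩ := enorm_integral_amp_pairKernel_le hN hβ hc hs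
  refine ⟨m, C, fun A hA hAc M hM0 hM G φ w => ?_⟩
  have := hC A hA hAc M hM0 hM (translate w G) (translate w φ)
  rw [dualNorm_translate] at this
  have e : eLpNorm (fun ξ => (jb ξ ^ (s / 2) : ℝ) • 𝓕 (⇑(translate w G)) ξ) 2 volume = hnorm s G := by
    unfold hnorm
    refine eLpNorm_congr_norm_ae ?_
    filter_upwards [l2hat_schwartz G] with ξ hξ
    rw [hξ, norm_smul, norm_smul, norm_fourier_translate, SchwartzMap.fourier_coe]
  rw [e] at this
  refine le_of_eq_of_le ?_ this
  congr 1
  refine integral_congr_ae (Filter.Eventually.of_forall fun z => ?_)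
  simp only [pairKernel, translate_apply]

end ModulatedPairing

/-! ### Geometry of collisions and sign of the weight exponent -/

section CollisionAmplitude

variable {N : ℕ}

/-- The collision kernel as a function of `x = v - 'v` and `y = 'v_* - 'v`. -/
noncomputable def kernelXY (β : ℝ) (Φ : Vel N → ℝ) (b : ℝ → ℝ) (x y : Vel N) : ℝ :=
  Φ ((2 : ℝ) • x - y) * b (1 - 2 * ‖x‖ ^ 2 / (β ^ 2 * ‖(2 : ℝ) • x - y‖ ^ 2))

lemma norm_collX_sq (β : ℝ) (u : Vel N) {q : Vel N} (hq : ‖q‖ = 1) :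
    ‖collX β u q‖ ^ 2 = β ^ 2 / 2 * (‖u‖ ^ 2 - ‖u‖ * inner ℝ u q) := by
  unfold collX
  rw [norm_smul, mul_pow, norm_sub_sq_real, norm_smul, inner_smul_right, hq, norm_norm,
    Real.norm_eq_abs, sq_abs]
  ring

/-- Here `u = 2x - y`, and `|x|² = β²|u|²(1 - û·σ)/2` determines the scattering angle from `x` and
`y`. At `u = 0` both sides vanish with `Φ`. -/
lemma collisionKernel_eq_kernelXY {β : ℝ} (hβ : 0 < β) {Φ : Vel N → ℝ}
    (hΦ0 : (0 : Vel N) ∉ tsupport Φ) (b : ℝ → ℝ) (u : Vel N) (σ : Sph N) :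
    collisionKernel Φ b u σ = kernelXY β Φ b (collX β u σ) ((2 : ℝ) • collX β u σ - u) := by
  unfold collisionKernel kernelXY
  rw [sub_sub_cancel]
  by_cases hu : u = 0
  · rw [hu, image_eq_zero_of_notMem_tsupport hΦ0, zero_mul, zero_mul]
  · have hn : ‖u‖ ≠ 0 := norm_ne_zero_iff.2 hu
    congr 2
    have hσ : ‖(σ : Vel N)‖ = 1 := by simp
    rw [norm_collX_sq β u hσ, inner_smul_left]
    simp only [RCLike.conj_to_real]
    field_simp
    ring

lemma exists_norm_bounds {Φ : Vel N → ℝ} (hΦc : HasCompactSupport Φ)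
    (hΦ0 : (0 : Vel N) ∉ tsupport Φ) :
    ∃ ρ R : ℝ, 0 < ρ ∧ 1 ≤ R ∧ ∀ u, Φ u ≠ 0 → ρ ≤ ‖u‖ ∧ ‖u‖ ≤ R := by
  obtain ⟨R, hR⟩ := hΦc.isCompact.isBounded.exists_norm_le
  obtain ⟨ρ, hρ, hb⟩ := Metric.isOpen_iff.1 (isClosed_tsupport Φ).isOpen_compl 0 hΦ0
  refine ⟨ρ, max 1 R, hρ, le_max_left _ _, fun u hu => ?_⟩
  have h1 : u ∈ tsupport Φ := subset_tsupport Φ hu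
  refine ⟨?_, (hR u h1).trans (le_max_right _ _)⟩
  by_contra h
  exact hb (mem_ball_zero_iff.2 (not_le.1 h)) h1

/-- Compactness of the support inside the open interval excludes a neighbourhood of grazing and of
backward scattering; both ends are used in `collSet_bounds`. -/
lemma exists_support_bound {b : ℝ → ℝ} (hbs : tsupport b ⊆ Set.Ioo (-1) 1) :
    ∃ δ : ℝ, 0 < δ ∧ δ < 1 ∧ ∀ t, b t ≠ 0 → -1 + δ ≤ t ∧ t ≤ 1 - δ := by
  have hK : IsCompact (tsupport b) := Metric.isCompact_of_isClosed_isBounded (isClosed_tsupport b)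
    ((Metric.isBounded_Ioo (-1) 1).subset hbs)
  obtain ⟨δ, hδ, h⟩ := hK.exists_cthickening_subset_open isOpen_Ioo hbs
  have hd : ∀ t, b t ≠ 0 → ∀ s : ℝ, |s| ≤ δ → t + s ∈ Set.Ioo (-1 : ℝ) 1 := fun t ht s hs =>
    h (Metric.mem_cthickening_of_dist_le _ t _ _ (subset_tsupport b ht) (by
      rw [Real.dist_eq, add_sub_cancel_left]; exact hs))
  refine ⟨min δ (1 / 2), by positivity, by
    have := min_le_right δ (1 / 2 : ℝ); linarith, fun t ht => ?_⟩
  have h1 := hd t ht δ (abs_of_pos hδ).le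
  have h2 := hd t ht (-δ) (by rw [abs_neg]; exact (abs_of_pos hδ).le)
  have := min_le_left δ (1 / 2)
  exact ⟨by linarith [h2.1], by linarith [h1.2]⟩

lemma exists_cutOff {a R : ℝ} (ha : 0 < a) (hR : 0 < R) :
    ∃ c : Vel N → ℂ, CutOff c ∧ ∀ x, a ≤ ‖x‖ → ‖x‖ ≤ R → c x = 1 := by
  let b₁ : ContDiffBump (0 : Vel N) := ⟨a / 4, a / 2, by positivity, by linarith⟩
  let b₂ : ContDiffBump (0 : Vel N) := ⟨R, R + 1, hR, by linarith⟩
  refine ⟨fun x => ((b₂ x * (1 - b₁ x) : ℝ) : ℂ), ⟨?_, ?_, ?_⟩, fun x h1 h2 => ?_⟩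
  · exact Complex.ofRealCLM.contDiff.comp (b₂.contDiff.mul (contDiff_const.sub b₁.contDiff))
  · exact (b₂.hasCompactSupport.mul_right (f' := fun x => 1 - b₁ x)).comp_left
      (g := ((↑) : ℝ → ℂ)) (by simp)
  · rw [notMem_tsupport_iff_eventuallyEq]
    filter_upwards [Metric.closedBall_mem_nhds (0 : Vel N) b₁.rIn_pos] with x hx
    rw [b₁.one_of_mem_closedBall hx]; simp
  · have e1 : b₂ x = 1 := b₂.one_of_mem_closedBall (mem_closedBall_zero_iff.2 h2)
    have e2 : b₁ x = 0 := b₁.zero_of_le_dist (by rw [dist_zero_right]; change a / 2 ≤ _; linarith)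
    simp only [e1, e2]; norm_num

lemma logBracket_nonneg (v : Vel N) : 0 ≤ logBracket v := by
  unfold logBracket
  have := Real.log_nonneg (show (1 : ℝ) ≤ 1 + ‖v‖ ^ 2 by nlinarith [sq_nonneg ‖v‖])
  linarith

/-- Negativity of the weight exponent for `w` away from `0`. -/
lemma logBracket_le_of_far {κ ε h : ℝ} (hκ : 1 ≤ κ) (hε : 0 ≤ ε) (hh : 0 ≤ h) {x y w : Vel N}
    (hτ : |inner ℝ x y - κ * ‖x‖ ^ 2| ≤ ε) (hw : h ≤ ‖w‖) :
    logBracket (w + x) - logBracket (w + y) - 2 * logBracket w ≤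
      ε - 1 / 2 * Real.log (1 + h ^ 2) := by
  have hτ' := (abs_le.1 hτ).1
  -- Expanding `|w + y - x|² ≥ 0`. For `ε = 0` this is `|v|² ≤ |'v|² + |'v_*|²`, valid because `κ ≥
  -- 1`.
  have e1 : ‖w + x‖ ^ 2 ≤ ‖w‖ ^ 2 + ‖w + y‖ ^ 2 + 2 * ε := by
    have h1 := norm_add_sq_real w x
    have h2 := norm_add_sq_real w y
    have h3 := norm_sub_sq_real (w + y) x
    rw [inner_add_left, real_inner_comm x y, h2] at h3
    rw [h1, h2]
    nlinarith [sq_nonneg (‖w + y - x‖), mul_nonneg (sub_nonneg.2 hκ) (sq_nonneg ‖x‖)]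
  have p1 : (0 : ℝ) < 1 + ‖w‖ ^ 2 := by positivity
  have p2 : (0 : ℝ) < 1 + ‖w + y‖ ^ 2 := by positivity
  have p3 : (0 : ℝ) < 1 + 2 * ε := by positivity
  have e2 : 1 + ‖w + x‖ ^ 2 ≤ (1 + ‖w‖ ^ 2) * (1 + ‖w + y‖ ^ 2) * (1 + 2 * ε) := by
    have h4 : 1 ≤ (1 + ‖w‖ ^ 2) * (1 + ‖w + y‖ ^ 2) := by
      nlinarith [sq_nonneg ‖w‖, sq_nonneg ‖w + y‖, mul_nonneg (sq_nonneg ‖w‖) (sq_nonneg ‖w + y‖)]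
    nlinarith [mul_nonneg (sq_nonneg ‖w‖) (sq_nonneg ‖w + y‖)]
  have e3 := Real.log_le_log (by positivity) e2
  rw [Real.log_mul (by positivity) p3.ne', Real.log_mul p1.ne' p2.ne'] at e3
  have e4 := Real.log_le_sub_one_of_pos p3
  have e5 := Real.log_le_log (by positivity : (0 : ℝ) < 1 + h ^ 2)
    (show 1 + h ^ 2 ≤ 1 + ‖w‖ ^ 2 by gcongr)
  unfold logBracket
  linarith

/-- Negativity of the weight exponent for `w` near `0`. -/
lemma logBracket_le_of_near {D h R : ℝ} (hD : 0 < D) (hR : 0 < R) (hh : 0 ≤ h)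
    (hhR : 8 * R * h ≤ D) {x y w : Vel N} (hx : ‖x‖ ≤ R) (hy : ‖y‖ ≤ R)
    (hxy : D ≤ ‖y‖ ^ 2 - ‖x‖ ^ 2) (hw : ‖w‖ ≤ h) :
    logBracket (w + x) - logBracket (w + y) - 2 * logBracket w ≤
      -(D / (4 * (1 + (h + R) ^ 2))) := by
  have h1 := norm_add_sq_real w x
  have h2 := norm_add_sq_real w y
  have h3 : inner ℝ w x - inner ℝ w y ≤ 2 * (h * R) := by
    have a1 := (abs_le.1 (abs_real_inner_le_norm w x)).2
    have a2 := (abs_le.1 (abs_real_inner_le_norm w y)).1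
    have a3 : ‖w‖ * ‖x‖ ≤ h * R := by gcongr
    have a4 : ‖w‖ * ‖y‖ ≤ h * R := by gcongr
    linarith
  -- The gap `D` between `|y|²` and `|x|²` survives a displacement by `w`, whose effect is at most
  -- `4hR ≤ D/2`.
  have h4 : ‖w + x‖ ^ 2 + D / 2 ≤ ‖w + y‖ ^ 2 := by
    rw [h1, h2]; nlinarith
  have p1 : (0 : ℝ) < 1 + ‖w + x‖ ^ 2 := by positivity
  have p2 : (0 : ℝ) < 1 + ‖w + y‖ ^ 2 := by positivity
  have h5 : ‖w + y‖ ≤ h + R := (norm_add_le _ _).trans (add_le_add hw hy)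
  have h6 : 1 + ‖w + y‖ ^ 2 ≤ 1 + (h + R) ^ 2 := by gcongr
  have h7 := Real.log_le_sub_one_of_pos (div_pos p1 p2)
  rw [Real.log_div p1.ne' p2.ne'] at h7
  have h8 : (1 + ‖w + x‖ ^ 2) / (1 + ‖w + y‖ ^ 2) - 1 ≤ -(D / (2 * (1 + (h + R) ^ 2))) := by
    rw [div_sub_one p2.ne', ← neg_le_neg_iff, neg_neg, ← neg_div, div_le_div_iff₀ (by positivity) p2]
    nlinarith
  have h9 := logBracket_nonneg w
  have h10 : D / (4 * (1 + (h + R) ^ 2)) = 1 / 2 * (D / (2 * (1 + (h + R) ^ 2))) := by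
    have : (1 + (h + R) ^ 2) ≠ 0 := by positivity
    field_simp; norm_num
  rw [h10]
  unfold logBracket at h9 ⊢
  linarith

/-- The pairs `(x, y)` which occur in a collision with nonzero kernel. -/
def collSet (N : ℕ) (β ρ R δ : ℝ) : Set (VelPair N) :=
  {z | ρ ≤ ‖(2 : ℝ) • fstP N z - sndP N z‖ ∧ ‖(2 : ℝ) • fstP N z - sndP N z‖ ≤ R ∧
    δ / 2 * (β ^ 2 * ‖(2 : ℝ) • fstP N z - sndP N z‖ ^ 2) ≤ ‖fstP N z‖ ^ 2 ∧
    ‖fstP N z‖ ^ 2 ≤ (1 - δ / 2) * (β ^ 2 * ‖(2 : ℝ) • fstP N z - sndP N z‖ ^ 2)}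

lemma isClosed_collSet (β ρ R δ : ℝ) : IsClosed (collSet N β ρ R δ) := by
  have h1 : Continuous fun z : VelPair N => (2 : ℝ) • fstP N z - sndP N z := by fun_prop
  have h2 : Continuous fun z : VelPair N => fstP N z := (fstP N).continuous
  exact (isClosed_le continuous_const h1.norm).inter ((isClosed_le h1.norm continuous_const).inter
    ((isClosed_le (continuous_const.mul (continuous_const.mul (h1.norm.pow 2))) (h2.norm.pow 2)).inter
      (isClosed_le (h2.norm.pow 2) (continuous_const.mul (continuous_const.mul (h1.norm.pow 2))))))

lemma tsupport_kernelXY_subset {β : ℝ} (hβ : 0 < β) {Φ : Vel N → ℝ} {b : ℝ → ℝ} {ρ R δ : ℝ}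
    (hρ : 0 < ρ) (hΦ : ∀ u, Φ u ≠ 0 → ρ ≤ ‖u‖ ∧ ‖u‖ ≤ R)
    (hb : ∀ t, b t ≠ 0 → -1 + δ ≤ t ∧ t ≤ 1 - δ) :
    tsupport (fun z : VelPair N => kernelXY β Φ b (fstP N z) (sndP N z)) ⊆ collSet N β ρ R δ := by
  refine closure_minimal (fun z hz => ?_) (isClosed_collSet β ρ R δ)
  rw [Function.mem_support] at hz
  unfold kernelXY at hz
  have h1 := hΦ _ (left_ne_zero_of_mul hz)
  have h2 := hb _ (right_ne_zero_of_mul hz)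
  have hu : 0 < β ^ 2 * ‖(2 : ℝ) • fstP N z - sndP N z‖ ^ 2 := by
    have : 0 < ‖(2 : ℝ) • fstP N z - sndP N z‖ := hρ.trans_le h1.1
    positivity
  have e : 2 * ‖fstP N z‖ ^ 2 / (β ^ 2 * ‖(2 : ℝ) • fstP N z - sndP N z‖ ^ 2) =
    2 * (‖fstP N z‖ ^ 2 / (β ^ 2 * ‖(2 : ℝ) • fstP N z - sndP N z‖ ^ 2)) := by ring
  rw [e] at h2
  refine ⟨h1.1, h1.2, ?_, ?_⟩
  · rw [← le_div_iff₀ hu]; linarith [h2.2]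
  · rw [← div_le_iff₀ hu]; linarith [h2.1]

/-- With `τ = x·y - κ|x|²`, one has `|y|² - |x|² - 4τ = |u|² + (4κ-5)|x|²`. Insert `|u|² ≥
β⁻²(1+δ/2)|x|²` (no backward scattering): the right side is at least `((2-β⁻¹)² - 1 + β⁻²δ/2)|x|²`,
and `(2-β⁻¹)² ≥ 1` as `β ≥ 1`. The lower bound of `|x|` (no grazing) then gives a positive gap. The
term in `τ` is kept because the amplitude lives in a neighbourhood of the surface `τ = 0`. -/
lemma collSet_bounds {β ρ R δ : ℝ} (hβ : 1 ≤ β) (hρ : 0 < ρ) (hδ : 0 < δ) (hδ1 : δ < 1)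
    {z : VelPair N} (hz : z ∈ collSet N β ρ R δ) :
    (fstP N z ≠ 0 ∧ (2 : ℝ) • fstP N z - sndP N z ≠ 0) ∧
      (√(δ / 2) * ρ ≤ ‖fstP N z‖ ∧ ‖fstP N z‖ ≤ 3 * β * R ∧ ‖sndP N z‖ ≤ 3 * β * R) ∧
      δ ^ 2 * ρ ^ 2 / 4 ≤ ‖sndP N z‖ ^ 2 - ‖fstP N z‖ ^ 2 -
        4 * (inner ℝ (fstP N z) (sndP N z) - kap β * ‖fstP N z‖ ^ 2) := by
  obtain ⟨h1, h2, h3, h4⟩ := hz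
  set x := fstP N z
  set y := sndP N z
  set u := (2 : ℝ) • x - y with hu
  have hβ0 : 0 < β := by linarith
  have hu0 : 0 < ‖u‖ := hρ.trans_le h1
  have hR : 0 < R := hu0.trans_le h2
  have hlow : √(δ / 2) * ρ ≤ ‖x‖ := by
    refine le_of_sq_le_sq ?_ (norm_nonneg x)
    rw [mul_pow, Real.sq_sqrt (by positivity)]
    refine le_trans ?_ h3
    gcongr
    calc ρ ^ 2 ≤ ‖u‖ ^ 2 := by gcongr
      _ ≤ β ^ 2 * ‖u‖ ^ 2 := le_mul_of_one_le_left (by positivity) (one_le_pow₀ hβ)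
  have hx0 : 0 < ‖x‖ := lt_of_lt_of_le (by positivity) hlow
  have hxR : ‖x‖ ≤ β * R := by
    refine le_of_sq_le_sq (h4.trans ?_) (by positivity)
    rw [mul_pow]
    calc (1 - δ / 2) * (β ^ 2 * ‖u‖ ^ 2) ≤ 1 * (β ^ 2 * R ^ 2) := by
          gcongr; linarith
      _ = _ := one_mul _
  have hy : y = (2 : ℝ) • x - u := by rw [hu]; abel
  refine ⟨⟨norm_pos_iff.1 hx0, norm_pos_iff.1 hu0⟩, ⟨hlow, by nlinarith, ?_⟩, ?_⟩
  · rw [hy]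
    refine (norm_sub_le _ _).trans ?_
    rw [norm_smul, Real.norm_of_nonneg (by norm_num)]
    nlinarith
  · have e1 : ‖u‖ ^ 2 = 4 * ‖x‖ ^ 2 - 4 * inner ℝ x y + ‖y‖ ^ 2 := by
      rw [hu, norm_sub_sq_real, norm_smul, inner_smul_left, mul_pow]
      simp only [RCLike.conj_to_real, Real.norm_ofNat]
      ring
    have e2 : ‖x‖ ^ 2 * (1 + δ / 2) ≤ β ^ 2 * ‖u‖ ^ 2 := by
      have h5 : ‖x‖ ^ 2 * (1 + δ / 2) ≤ (1 - δ / 2) * (β ^ 2 * ‖u‖ ^ 2) * (1 + δ / 2) := by gcongr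
      have h6 : 0 ≤ β ^ 2 * ‖u‖ ^ 2 := by positivity
      nlinarith [mul_nonneg h6 (sq_nonneg δ)]
    have e3 : ‖x‖ ^ 2 * (β⁻¹ ^ 2 * (1 + δ / 2)) ≤ ‖u‖ ^ 2 := by
      calc _ = β⁻¹ ^ 2 * (‖x‖ ^ 2 * (1 + δ / 2)) := by ring
        _ ≤ β⁻¹ ^ 2 * (β ^ 2 * ‖u‖ ^ 2) := by gcongr
        _ = _ := by rw [← mul_assoc, ← mul_pow, inv_mul_cancel₀ hβ0.ne', one_pow, one_mul]
    have e4 : β⁻¹ ≤ 1 := inv_le_one_of_one_le₀ hβ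
    have e5 : δ * ρ ^ 2 / 2 ≤ ‖x‖ ^ 2 * β⁻¹ ^ 2 := by
      calc δ * ρ ^ 2 / 2 ≤ δ / 2 * ‖u‖ ^ 2 := by
            have : ρ ^ 2 ≤ ‖u‖ ^ 2 := by gcongr
            nlinarith
        _ = (δ / 2 * (β ^ 2 * ‖u‖ ^ 2)) * β⁻¹ ^ 2 := by field_simp
        _ ≤ _ := by gcongr
    have e6 : 1 ≤ (2 - β⁻¹) ^ 2 := by nlinarith
    have e7 := mul_le_mul_of_nonneg_left e6 (sq_nonneg ‖x‖)
    unfold kap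
    nlinarith

end CollisionAmplitude

/-! ### Construction of the amplitude -/

section ExistsAmplitude

variable {N : ℕ}

/-- A smooth cut-off equal to `1` at `0` and supported in `[-ε, ε]`. -/
lemma exists_cutOff_real {ε : ℝ} (hε : 0 < ε) :
    ∃ χ : ℝ → ℝ, ContDiff ℝ ∞ χ ∧ χ 0 = 1 ∧ ∀ t, χ t ≠ 0 → |t| ≤ ε := by
  let B : ContDiffBump (0 : ℝ) := ⟨ε / 2, ε, by positivity, by linarith⟩
  refine ⟨B, B.contDiff, B.one_of_mem_closedBall (Metric.mem_closedBall_self B.rIn_pos.le),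
    fun t ht => ?_⟩
  by_contra h
  exact ht (B.zero_of_le_dist (by rw [Real.dist_eq, sub_zero]; exact (not_le.1 h).le))

lemma contDiff_relP : ContDiff ℝ ∞ fun z : VelPair N => (2 : ℝ) • fstP N z - sndP N z :=
  ((2 : ℝ) • fstP N - sndP N).contDiff

lemma contDiffAt_carlJac {β : ℝ} (hβ : 0 < β) {z : VelPair N} (hx : fstP N z ≠ 0)
    (hu : (2 : ℝ) • fstP N z - sndP N z ≠ 0) :
    ContDiffAt ℝ ∞ (fun z : VelPair N => carlJac β (fstP N z) (sndP N z)) z := by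
  have h1 : ContDiffAt ℝ ∞ (fun z : VelPair N => ‖fstP N z‖) z :=
    (fstP N).contDiff.contDiffAt.norm ℝ hx
  have h2 : ContDiffAt ℝ ∞ (fun z : VelPair N => ‖(2 : ℝ) • fstP N z - sndP N z‖) z :=
    contDiff_relP.contDiffAt.norm ℝ hu
  have h3 : ContDiffAt ℝ ∞ (fun z : VelPair N => (‖fstP N z‖ ^ (N - 1))⁻¹) z :=
    (h1.pow _).inv (pow_ne_zero _ (norm_ne_zero_iff.2 hx))
  have h4 : ContDiffAt ℝ ∞ (fun z : VelPair N => β * ‖(2 : ℝ) • fstP N z - sndP N z‖) z :=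
    contDiffAt_const.mul h2
  have h5 : ContDiffAt ℝ ∞ (fun z : VelPair N => ‖fstP N z‖ /
      (β * ‖(2 : ℝ) • fstP N z - sndP N z‖)) z :=
    h1.div h4 (mul_ne_zero hβ.ne' (norm_ne_zero_iff.2 hu))
  exact (contDiffAt_const.mul h3).mul (h5.pow _)

lemma contDiffAt_kernelXY {β : ℝ} (hβ : 0 < β) {Φ : Vel N → ℝ} (hΦ : ContDiff ℝ ∞ Φ) {b : ℝ → ℝ}
    (hb : ContDiff ℝ ∞ b) {z : VelPair N} (hu : (2 : ℝ) • fstP N z - sndP N z ≠ 0) :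
    ContDiffAt ℝ ∞ (fun z : VelPair N => kernelXY β Φ b (fstP N z) (sndP N z)) z := by
  have h2 := contDiff_relP (N := N)
  have h3 : ContDiffAt ℝ ∞ (fun z : VelPair N => ‖(2 : ℝ) • fstP N z - sndP N z‖ ^ 2) z :=
    (h2.norm_sq ℝ).contDiffAt
  have h4 : ContDiffAt ℝ ∞ (fun z : VelPair N => ‖fstP N z‖ ^ 2) z :=
    ((fstP N).contDiff.norm_sq ℝ).contDiffAt
  unfold kernelXY
  refine (hΦ.comp h2).contDiffAt.mul (hb.contDiffAt.comp z (contDiffAt_const.sub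
    ((contDiffAt_const.mul h4).div (contDiffAt_const.mul h3) ?_)))
  have := norm_pos_iff.2 hu
  positivity

lemma inner_carlY (β : ℝ) {x : Vel N} (hx : x ≠ 0) (p : Vel N) :
    inner ℝ x (carlY β x p) = kap β * ‖x‖ ^ 2 := by
  unfold carlY
  rw [inner_add_right, inner_smul_right, inner_perpProj hx, real_inner_self_eq_norm_sq, add_zero]

/-- The amplitude of the Carleman representation of the gain operator: it is smooth, compactly
supported, and the weight exponent is negative on its support, uniformly in `w`. -/
theorem exists_amplitude {β : ℝ} (hβ : 1 ≤ β) {Φ : Vel N → ℝ} (hΦ : ContDiff ℝ ∞ Φ)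
    (hΦc : HasCompactSupport Φ) (hΦ0 : (0 : Vel N) ∉ tsupport Φ) {b : ℝ → ℝ}
    (hb : ContDiff ℝ ∞ b) (hbs : tsupport b ⊆ Set.Ioo (-1) 1) (k : ℝ) :
    ∃ (Θ : VelPair N → ℂ) (c₀ : Vel N → ℂ) (c : ℝ), ContDiff ℝ ∞ Θ ∧ HasCompactSupport Θ ∧
      CutOff c₀ ∧ 0 < c ∧ (∀ z ∈ tsupport Θ, ∀ w, logRatio (fstP N) (sndP N) w z ≤ -c) ∧
      ∀ x p, x ≠ 0 → Θ (mkP x (carlY β x p)) * c₀ x =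
        ((k * kernelXY β Φ b x (carlY β x p) * carlJac β x (carlY β x p) *
          Real.exp (Real.pi * ‖carlY β x p‖ ^ 2) : ℝ) : ℂ) := by
  have hβ0 : 0 < β := by linarith
  obtain ⟨ρ, R, hρ, hR1, hΦb⟩ := exists_norm_bounds hΦc hΦ0
  obtain ⟨δ, hδ, hδ1, hbb⟩ := exists_support_bound hbs
  set R' := 3 * β * R with hR'
  have hR'0 : 0 < R' := by positivity
  -- The gap in `collSet_bounds` is `2D`. The choice `ε ≤ D/4` leaves `|y|² - |x|² ≥ D` on the
  -- support, `h` is the radius allowed by `logBracket_le_of_near`, and `ε ≤ l/4` leaves the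
  -- exponent at most `-l/4` for `|w| ≥ h`.
  set D := δ ^ 2 * ρ ^ 2 / 8 with hD
  have hD0 : 0 < D := by positivity
  set h := D / (8 * R') with hh
  have hh0 : 0 < h := by positivity
  set l := Real.log (1 + h ^ 2) with hl
  have hl0 : 0 < l := Real.log_pos (by have : 0 < h ^ 2 := by positivity
                                       linarith)
  set ε := min (D / 4) (l / 4) with hε
  have hε0 : 0 < ε := by positivity
  obtain ⟨χ, hχ, hχ1, hχs⟩ := exists_cutOff_real hε0
  obtain ⟨c₀, hc₀, hc₀1⟩ := exists_cutOff (N := N) (a := √(δ / 2) * ρ) (R := R') (by positivity) hR'0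
  set K := fun z : VelPair N => kernelXY β Φ b (fstP N z) (sndP N z) with hK
  -- The factor `χ` equals `1` on the surface `x·y = κ|x|²` where the amplitude is evaluated, and
  -- confines its support to a thin neighbourhood where the exponent is still negative. The factor
  -- `exp(π|y|²)` compensates the Gaussian of the model pairing.
  set rest := fun z : VelPair N => k * (carlJac β (fstP N z) (sndP N z) *
    (Real.exp (Real.pi * ‖sndP N z‖ ^ 2) *
      χ (inner ℝ (fstP N z) (sndP N z) - kap β * ‖fstP N z‖ ^ 2))) with hrest
  have hKs := tsupport_kernelXY_subset hβ0 hρ hΦb hbb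
  have hsub : tsupport (fun z => ((K z * rest z : ℝ) : ℂ)) ⊆ collSet N β ρ R δ ∩
      {z | |inner ℝ (fstP N z) (sndP N z) - kap β * ‖fstP N z‖ ^ 2| ≤ ε} := by
    have hcl : IsClosed {z : VelPair N |
        |inner ℝ (fstP N z) (sndP N z) - kap β * ‖fstP N z‖ ^ 2| ≤ ε} := by
      refine isClosed_le (Continuous.abs ?_) continuous_const
      exact ((fstP N).continuous.inner (sndP N).continuous).sub
        (continuous_const.mul ((fstP N).continuous.norm.pow 2))
    refine closure_minimal (fun z hz => ?_) ((isClosed_collSet β ρ R δ).inter hcl)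
    have hz' : K z * rest z ≠ 0 := fun h0 => hz (by simp only [h0, Complex.ofReal_zero])
    refine ⟨hKs (subset_tsupport _ (left_ne_zero_of_mul hz')), hχs _ ?_⟩
    exact right_ne_zero_of_mul (right_ne_zero_of_mul (right_ne_zero_of_mul
      (right_ne_zero_of_mul hz')))
  refine ⟨fun z => ((K z * rest z : ℝ) : ℂ), c₀,
    min (D / 2 / (4 * (1 + (h + R') ^ 2))) (l / 4), ?_, ?_, hc₀, by positivity, ?_, ?_⟩
  · rw [contDiff_iff_contDiffAt]
    intro z
    by_cases hz : z ∈ tsupport fun z => ((K z * rest z : ℝ) : ℂ)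
    · obtain ⟨⟨hx, hu⟩, -, -⟩ := collSet_bounds hβ hρ hδ hδ1 (hsub hz).1
      refine Complex.ofRealCLM.contDiff.contDiffAt.comp z ((contDiffAt_kernelXY hβ0 hΦ hb hu).mul
        (contDiffAt_const.mul ((contDiffAt_carlJac hβ0 hx hu).mul (ContDiff.contDiffAt ?_))))
      refine (Real.contDiff_exp.comp (contDiff_const.mul ((sndP N).contDiff.norm_sq ℝ))).mul
        (hχ.comp (((fstP N).contDiff.inner ℝ (sndP N).contDiff).sub
          (contDiff_const.mul ((fstP N).contDiff.norm_sq ℝ))))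
    · exact contDiffAt_const.congr_of_eventuallyEq (notMem_tsupport_iff_eventuallyEq.1 hz)
  · refine (isCompact_closedBall (0 : VelPair N) (2 * R')).of_isClosed_subset (isClosed_tsupport _)
      fun z hz => ?_
    obtain ⟨-, ⟨-, h1, h2⟩, -⟩ := collSet_bounds hβ hρ hδ hδ1 (hsub hz).1
    rw [mem_closedBall_zero_iff]
    refine le_of_sq_le_sq ?_ (by positivity)
    rw [norm_sq_pair]
    nlinarith [norm_nonneg (fstP N z), norm_nonneg (sndP N z)]
  · intro z hz w
    obtain ⟨hz1, hz2⟩ := hsub hz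
    obtain ⟨-, ⟨-, h1, h2⟩, h3⟩ := collSet_bounds hβ hρ hδ hδ1 hz1
    rw [Set.mem_ofPred_eq] at hz2
    have hτ := abs_le.1 hz2
    have hk : 1 ≤ kap β := by
      unfold kap; have := inv_le_one_of_one_le₀ hβ; linarith
    have hεD : ε ≤ D / 4 := min_le_left _ _
    have hεl : ε ≤ l / 4 := min_le_right _ _
    unfold logRatio
    rcases le_total ‖w‖ h with hw | hw
    · refine (logBracket_le_of_near hD0 hR'0 hh0.le ?_ h1 h2 ?_ hw).trans ?_
      · rw [hh]; field_simp; exact le_refl _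
      · have : δ ^ 2 * ρ ^ 2 / 4 = 2 * D := by rw [hD]; ring
        linarith [hτ.1]
      · refine neg_le_neg ((min_le_left _ _).trans ?_)
        gcongr
        linarith
    · refine (logBracket_le_of_far hk hε0.le hh0.le hz2 hw).trans ?_
      have := min_le_right (D / 2 / (4 * (1 + (h + R') ^ 2))) (l / 4)
      rw [← hl]
      linarith
  · intro x p hx
    have e1 : fstP N (mkP x (carlY β x p)) = x := rfl
    have e2 : sndP N (mkP x (carlY β x p)) = carlY β x p := rfl
    by_cases hK0 : kernelXY β Φ b x (carlY β x p) = 0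
    · simp only [hK, e1, e2, hK0, zero_mul, mul_zero, Complex.ofReal_zero]
    · have hz : mkP x (carlY β x p) ∈ collSet N β ρ R δ :=
        hKs (subset_tsupport _ (by rw [Function.mem_support, e1, e2]; exact hK0))
      obtain ⟨-, ⟨h0, h1, -⟩, -⟩ := collSet_bounds hβ hρ hδ hδ1 hz
      rw [e1] at h0 h1
      rw [hc₀1 x h0 h1, mul_one]
      simp only [hK, hrest, e1, e2, inner_carlY β hx, sub_self, hχ1]
      congr 1
      ring

end ExistsAmplitude

/-! ### Carleman coordinates as an identity of measures -/

section CollisionMeasure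

variable {N : ℕ}

/-- The measure `du dσ`. -/
noncomputable abbrev collMeasure (N : ℕ) : Measure (Vel N × Sph N) :=
  (volume : Measure (Vel N)).prod (volume : Measure (Vel N)).toSphere

/-- The map `(u, σ) ↦ (x, y)`. -/
noncomputable def collPair (β : ℝ) (q : Vel N × Sph N) : Vel N × Vel N :=
  (collX β q.1 q.2, (2 : ℝ) • collX β q.1 q.2 - q.1)

/-- The density of the Carleman representation. -/
noncomputable def carlDensity (β : ℝ) (z : Vel N × Vel N) : ℝ :=
  carlJac β z.1 (carlY β z.1 z.2) * dirGauss z.1 z.2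

/-- The map `(x, p) ↦ (x, y)`. -/
noncomputable def carlPair (β : ℝ) (z : Vel N × Vel N) : Vel N × Vel N := (z.1, carlY β z.1 z.2)

lemma continuous_collX (β : ℝ) : Continuous fun q : Vel N × Sph N => collX β q.1 q.2 := by
  unfold collX; fun_prop

lemma measurable_collPair (β : ℝ) : Measurable (collPair (N := N) β) := by
  have := continuous_collX (N := N) β
  have h : Continuous (collPair (N := N) β) := by unfold collPair; fun_prop
  exact h.measurable

lemma measurable_carlPair (β : ℝ) : Measurable (carlPair (N := N) β) :=
  measurable_fst.prodMk (measurable_carlY β)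

lemma measurable_carlDensity (β : ℝ) : Measurable (carlDensity (N := N) β) := by
  have h := measurable_carlY (N := N) β
  unfold carlDensity carlJac dirGauss
  fun_prop

lemma carlDensity_nonneg {β : ℝ} (hβ : 0 < β) (z : Vel N × Vel N) : 0 ≤ carlDensity β z := by
  unfold carlDensity carlJac dirGauss
  positivity

lemma lintegral_collPair (hN : 2 ≤ N) {β : ℝ} (hβ : 0 < β) {H : Vel N × Vel N → ℝ≥0∞}
    (hH : Measurable H) : ∫⁻ q, H (collPair β q) ∂(collMeasure N) =
      ∫⁻ z, ENNReal.ofReal (carlDensity β z) * H (carlPair β z) ∂(volume.prod volume) := by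
  have h := lintegral_carleman (N := N) hN hβ (Ψ := fun x y => H (x, y)) hH
  have m1 : Measurable fun q => H (collPair (N := N) β q) := hH.comp (measurable_collPair β)
  have m2 : Measurable fun z => ENNReal.ofReal (carlDensity β z) * H (carlPair β z) :=
    (measurable_carlDensity β).ennreal_ofReal.mul (hH.comp (measurable_carlPair β))
  rw [lintegral_prod _ m1.aemeasurable, lintegral_prod _ m2.aemeasurable]
  exact h

/-- Stated for image measures so that the formula passes from nonnegative to complex integrands
without an integrability condition. -/
lemma map_collPair (hN : 2 ≤ N) {β : ℝ} (hβ : 0 < β) : (collMeasure N).map (collPair β) =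
    (((volume : Measure (Vel N)).prod volume).withDensity
      fun z => ENNReal.ofReal (carlDensity β z)).map (carlPair β) := by
  refine Measure.ext_of_lintegral _ fun H hH => ?_
  have m1 : Measurable fun z => H (carlPair (N := N) β z) := hH.comp (measurable_carlPair β)
  rw [lintegral_map hH (measurable_collPair β), lintegral_map hH (measurable_carlPair β),
    lintegral_collPair hN hβ hH, lintegral_withDensity_eq_lintegral_mul _
      (measurable_carlDensity β).ennreal_ofReal m1]
  rfl

lemma integral_collPair (hN : 2 ≤ N) {β : ℝ} (hβ : 0 < β) {Ψ : Vel N × Vel N → ℂ}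
    (hΨ : Measurable Ψ) : ∫ q, Ψ (collPair β q) ∂(collMeasure N) =
      ∫ z, (carlDensity β z : ℂ) * Ψ (carlPair β z) ∂(volume.prod volume) := by
  rw [← integral_map (measurable_collPair β).aemeasurable hΨ.aestronglyMeasurable,
    map_collPair hN hβ, integral_map (measurable_carlPair β).aemeasurable hΨ.aestronglyMeasurable,
    integral_withDensity_eq_integral_toReal_smul (measurable_carlDensity β).ennreal_ofReal
      (Filter.Eventually.of_forall fun _ => ENNReal.ofReal_lt_top)]
  refine integral_congr_ae (Filter.Eventually.of_forall fun z => ?_)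
  simp only [ENNReal.toReal_ofReal (carlDensity_nonneg hβ z), Complex.real_smul]

lemma ae_fst_ne_zero (hN : 2 ≤ N) :
    ∀ᵐ z : Vel N × Vel N ∂((volume : Measure (Vel N)).prod volume), z.1 ≠ 0 := by
  have : Nonempty (Fin N) := ⟨⟨0, by omega⟩⟩
  have h : ∀ᵐ x : Vel N, x ≠ 0 := by
    rw [ae_iff]; simp
  exact Measure.quasiMeasurePreserving_fst.ae h

lemma lintegral_gauss_norm : ∫⁻ p : Vel N, ENNReal.ofReal (Real.exp (-Real.pi * ‖p‖ ^ 2)) = 1 := by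
  rw [lintegral_exp_neg_mul_sq_norm Real.pi_pos, div_self Real.pi_ne_zero, Real.one_rpow,
    ENNReal.ofReal_one]

lemma lintegral_gauss_fst_le {c : Vel N → ℂ} {M : ℝ≥0} (hM : ∀ x, ‖c x‖ₑ ≤ M)
    (β : ℝ) {H : Vel N → ℝ≥0∞} (hH : Measurable H) :
    ∫⁻ z : Vel N × Vel N, ‖c z.1‖ₑ * ENNReal.ofReal (gaussW β z.1 z.2) * H z.1
      ∂(volume.prod volume) ≤ M * ∫⁻ x, H x := by
  have hm : Measurable fun p : Vel N => ENNReal.ofReal (Real.exp (-Real.pi * ‖p‖ ^ 2)) := by fun_prop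
  calc _ ≤ ∫⁻ z : Vel N × Vel N, (M * H z.1) * ENNReal.ofReal (Real.exp (-Real.pi * ‖z.2‖ ^ 2))
        ∂(volume.prod volume) := by
        refine lintegral_mono fun z => ?_
        calc _ ≤ M * ENNReal.ofReal (Real.exp (-Real.pi * ‖z.2‖ ^ 2)) * H z.1 := by
              gcongr
              · exact hM _
              · exact gaussW_le β _ _
          _ = _ := by ring
    _ = M * ∫⁻ x, H x := by
        rw [lintegral_prod_mul (hH.const_mul _).aemeasurable hm.aemeasurable, lintegral_gauss_norm,
          mul_one, lintegral_const_mul _ hH]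

/-- The distribution of `y` has bounded density. On a ray `x = rϑ` one has `y = κrϑ + P_ϑ p`, and
`lintegral_planeSwap` identifies `(κr, p)` with `y` and an idle Gaussian scalar; the radial weight
is bounded on the support of `c`. -/
lemma lintegral_gauss_carlY_le (hN : 2 ≤ N) {c : Vel N → ℂ} (hc : CutOff c) {β : ℝ}
    (hβ : 0 < kap β) : ∃ C : ℝ≥0, ∀ H : Vel N → ℝ≥0∞, Measurable H →
    ∫⁻ z : Vel N × Vel N, ‖c z.1‖ₑ * ENNReal.ofReal (gaussW β z.1 z.2) * H (carlY β z.1 z.2)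
      ∂(volume.prod volume) ≤ C * ∫⁻ x, H x := by
  have : Nontrivial (Vel N) := by
    have : Nonempty (Fin N) := ⟨⟨0, by omega⟩⟩
    infer_instance
  obtain ⟨M, hM0, hM⟩ := hc.exists_bound
  obtain ⟨R, hR0, hR⟩ := hc.exists_radius
  set κ := kap β with hκ
  set S : ℝ≥0∞ := (volume : Measure (Vel N)).toSphere Set.univ with hS
  have hStop : S ≠ ⊤ := measure_ne_top _ _
  set C : ℝ≥0∞ := ENNReal.ofReal (R ^ (Module.finrank ℝ (Vel N) - 1)) * ENNReal.ofReal M *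
    ENNReal.ofReal κ⁻¹ * S with hC
  have hCtop : C ≠ ⊤ := by finiteness
  refine ⟨C.toNNReal, fun H hH => ?_⟩
  rw [ENNReal.coe_toNNReal hCtop]
  have hY := measurable_carlY (N := N) β
  have hm : Measurable fun z : Vel N × Vel N => ‖c z.1‖ₑ * ENNReal.ofReal (gaussW β z.1 z.2) *
      H (carlY β z.1 z.2) :=
    ((hc.smooth.continuous.measurable.comp measurable_fst).enorm.mul
      (continuous_gaussW β).measurable.ennreal_ofReal).mul (hH.comp hY)
  rw [lintegral_prod _ hm.aemeasurable, lintegral_polar hm.lintegral_prod_right']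
  set F : Vel N → ℝ → ℝ≥0∞ := fun u s => H u * ENNReal.ofReal (Real.exp (-Real.pi * s ^ 2)) with hF
  have hFm : Measurable (Function.uncurry F) := by
    simp only [hF, Function.uncurry_def]
    exact (hH.comp measurable_fst).mul (by fun_prop)
  have hFint : ∫⁻ u, ∫⁻ s, F u s = ∫⁻ x, H x := by
    refine lintegral_congr fun u => ?_
    simp only [hF]
    rw [lintegral_const_mul _ (by fun_prop), lintegral_gauss, mul_one]
  have hray (ϑ : Sph N) : ∫⁻ r in Set.Ioi (0 : ℝ), ENNReal.ofReal
      (r ^ (Module.finrank ℝ (Vel N) - 1)) * ∫⁻ p : Vel N, ‖c (r • (ϑ : Vel N))‖ₑ *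
        ENNReal.ofReal (gaussW β (r • (ϑ : Vel N)) p) * H (carlY β (r • (ϑ : Vel N)) p) ≤
      ENNReal.ofReal (R ^ (Module.finrank ℝ (Vel N) - 1)) * ENNReal.ofReal M *
        ENNReal.ofReal κ⁻¹ * ∫⁻ x, H x := by
    have hϑ : ‖(ϑ : Vel N)‖ = 1 := by simp
    set L : ℝ → ℝ≥0∞ := fun t => ∫⁻ p : Vel N, F (t • (ϑ : Vel N) + perpProj (ϑ : Vel N) p)
      (inner ℝ (ϑ : Vel N) p) with hL
    have hG : Measurable fun z : ℝ × Vel N => F (z.1 • (ϑ : Vel N) + perpProj (ϑ : Vel N) z.2)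
        (inner ℝ (ϑ : Vel N) z.2) := by
      have h1 : Measurable fun p : Vel N => perpProj (ϑ : Vel N) p :=
        measurable_perpProj.comp (f := fun p => ((ϑ : Vel N), p)) (by fun_prop)
      exact hFm.comp (f := fun z : ℝ × Vel N => (z.1 • (ϑ : Vel N) + perpProj (ϑ : Vel N) z.2,
        inner ℝ (ϑ : Vel N) z.2)) (by fun_prop)
    have hLm : Measurable L := hG.lintegral_prod_right'
    calc _ ≤ ∫⁻ r in Set.Ioi (0 : ℝ), (ENNReal.ofReal (R ^ (Module.finrank ℝ (Vel N) - 1)) *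
          ENNReal.ofReal M) * L (κ * r) := by
          refine setLIntegral_mono' measurableSet_Ioi fun r hr => ?_
          have hr : 0 < r := hr
          by_cases hrR : r ≤ R
          · rw [mul_assoc, hL]
            refine mul_le_mul' (ENNReal.ofReal_le_ofReal (pow_le_pow_left₀ hr.le hrR _)) ?_
            rw [← lintegral_const_mul' _ _ ENNReal.ofReal_ne_top]
            refine lintegral_mono fun p => ?_
            have e1 : carlY β (r • (ϑ : Vel N)) p =
                (κ * r) • (ϑ : Vel N) + perpProj (ϑ : Vel N) p := by
              unfold carlY; rw [perpProj_smul hr.ne', smul_smul]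
            have e2 : gaussW β (r • (ϑ : Vel N)) p ≤
                Real.exp (-Real.pi * (inner ℝ (ϑ : Vel N) p) ^ 2) := by
              refine (gaussW_le β _ p).trans (Real.exp_le_exp.2 ?_)
              have h1 : (inner ℝ (ϑ : Vel N) p) ^ 2 ≤ ‖p‖ ^ 2 := by
                rw [← sq_abs]
                have := abs_real_inner_le_norm (ϑ : Vel N) p
                rw [hϑ, one_mul] at this
                gcongr
              nlinarith [Real.pi_pos]
            have e3 : ‖c (r • (ϑ : Vel N))‖ₑ ≤ ENNReal.ofReal M := by
              rw [← ofReal_norm]; exact ENNReal.ofReal_le_ofReal (hM _)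
            rw [e1, mul_assoc]
            refine mul_le_mul' e3 ?_
            simp only [hF]
            rw [mul_comm]
            exact mul_le_mul' le_rfl (ENNReal.ofReal_le_ofReal e2)
          · have h0 : c (r • (ϑ : Vel N)) = 0 := hR _ (by
              rw [norm_smul, hϑ, mul_one, Real.norm_of_nonneg hr.le]; exact not_le.1 hrR)
            simp [h0]
      _ = (ENNReal.ofReal (R ^ (Module.finrank ℝ (Vel N) - 1)) * ENNReal.ofReal M) *
          (ENNReal.ofReal κ⁻¹ * ∫⁻ t in Set.Ioi (0 : ℝ), L t) := by
          rw [lintegral_const_mul _ (by fun_prop), lintegral_Ioi_mul hβ hLm]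
      _ ≤ (ENNReal.ofReal (R ^ (Module.finrank ℝ (Vel N) - 1)) * ENNReal.ofReal M) *
          (ENNReal.ofReal κ⁻¹ * ∫⁻ t, L t) := by
          gcongr
          exact Measure.restrict_le_self
      _ = _ := by
          rw [hL, lintegral_lintegral_swap (f := fun (t : ℝ) (p : Vel N) =>
            F (t • (ϑ : Vel N) + perpProj (ϑ : Vel N) p) (inner ℝ (ϑ : Vel N) p)) hG.aemeasurable,
            lintegral_planeSwap hϑ hFm, hFint]
          ring
  refine (lintegral_mono hray).trans (le_of_eq ?_)
  rw [lintegral_const, hC]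
  ring

end CollisionMeasure

/-! ### The pairing at fixed pre-collisional velocity -/

section FixedVelocity

open scoped SchwartzMap

section Density

variable {E : Type*} [NormedAddCommGroup E] [InnerProductSpace ℝ E] [FiniteDimensional ℝ E]
  [MeasurableSpace E] [BorelSpace E]

lemma exists_schwartz_eLpNorm_sub_le {u : E → ℂ} (hu : MemLp u 2 (volume : Measure E)) {ε : ℝ}
    (hε : 0 < ε) : ∃ ψ : 𝓢(E, ℂ), eLpNorm (u - ⇑ψ) 2 volume ≤ ENNReal.ofReal ε := by
  have hdense : DenseRange (SchwartzMap.toLpCLM ℂ (E := E) ℂ 2 volume) :=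
    SchwartzMap.denseRange_toLpCLM ENNReal.ofNat_ne_top
  obtain ⟨ψ, hψ⟩ := hdense.exists_dist_lt (hu.toLp u) hε
  refine ⟨ψ, ?_⟩
  have h1 : edist (hu.toLp u) (SchwartzMap.toLpCLM ℂ (E := E) ℂ 2 volume ψ) ≤ ENNReal.ofReal ε := by
    rw [edist_dist]; exact ENNReal.ofReal_le_ofReal hψ.le
  rw [Lp.edist_def] at h1
  refine le_of_eq_of_le (eLpNorm_congr_ae ?_) h1
  have h2 : ⇑(SchwartzMap.toLpCLM ℂ (E := E) ℂ 2 volume ψ) =ᵐ[volume] ψ :=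
    SchwartzMap.coeFn_toLp _ _ _
  filter_upwards [hu.coeFn_toLp, h2] with x h3 h4
  rw [Pi.sub_apply, Pi.sub_apply, h3, h4]

lemma MemLp.l2_sub_schwartz {u : E → ℂ} (hu : MemLp u 2 (volume : Measure E)) (ψ : 𝓢(E, ℂ)) :
    MemLp (u - ⇑ψ) 2 (volume : Measure E) := MeasureTheory.MemLp.sub hu (ψ.memLp 2)

lemma exists_schwartz_hnorm_sub_le {s : ℝ} {u : E → ℂ} (hu : MemLp u 2 (volume : Measure E))
    (hs : hnorm s u < ⊤) {ε : ℝ} (hε : 0 < ε) :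
    ∃ ψ : 𝓢(E, ℂ), hnorm s (u - ⇑ψ) ≤ ENNReal.ofReal ε := by
  have hm : MemLp (fun ξ : E => (jb ξ ^ (s / 2) : ℝ) • l2hat u ξ) 2 volume :=
    ⟨(continuous_jb_rpow _).aestronglyMeasurable.smul (l2hat_memLp u).1, hs⟩
  obtain ⟨χ, hχ⟩ := exists_schwartz_eLpNorm_sub_le hm hε
  refine ⟨𝓕⁻ (jbMul (-(s / 2)) χ), le_of_eq_of_le (eLpNorm_congr_ae ?_) hχ⟩
  set ψ : 𝓢(E, ℂ) := 𝓕⁻ (jbMul (-(s / 2)) χ) with hψ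
  have h1 : l2hat (u + (-1 : ℂ) • ⇑ψ) =ᵐ[volume] l2hat u + l2hat ((-1 : ℂ) • ⇑ψ) :=
    l2hat_add hu ((ψ.memLp 2).const_smul _)
  have h2 := l2hat_const_smul (ψ.memLp 2 : MemLp (⇑ψ) 2 (volume : Measure E)) (-1)
  have e : u - ⇑ψ = u + (-1 : ℂ) • ⇑ψ := by rw [neg_one_smul, sub_eq_add_neg]
  rw [e]
  filter_upwards [h1, h2, l2hat_schwartz ψ] with ξ h3 h4 h5
  rw [h3, Pi.add_apply, h4, Pi.smul_apply, h5, hψ, FourierTransform.fourier_fourierInv_eq,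
    jbMul_apply, Pi.sub_apply, smul_add, neg_one_smul, smul_neg, smul_smul,
    ← Real.rpow_add (jb_pos ξ), add_neg_cancel, Real.rpow_zero, one_smul, sub_eq_add_neg]

/-- Passage from Schwartz functions to `H^s`. The crude L² bound with constant `B` controls the
remainder `I (G - ψ)`, which tends to zero, so `B` does not enter the final constant; in the
application `B` depends on the test function. -/
lemma enorm_le_of_schwartz_dense {s : ℝ} (hs : 0 ≤ s) {I : (E → ℂ) → ℂ} {A B : ℝ≥0∞} (hA : A ≠ ⊤)
    (hB : B ≠ ⊤) (hI : ∀ ψ : 𝓢(E, ℂ), ‖I ψ‖ₑ ≤ A * hnorm s ψ) {G : E → ℂ}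
    (hG : MemLp G 2 (volume : Measure E)) (hGs : hnorm s G < ⊤)
    (hadd : ∀ ψ : 𝓢(E, ℂ), I G = I ψ + I (G - ⇑ψ))
    (hIB : ∀ ψ : 𝓢(E, ℂ), ‖I (G - ⇑ψ)‖ₑ ≤ B * eLpNorm (G - ⇑ψ) 2 volume) :
    ‖I G‖ₑ ≤ A * hnorm s G := by
  have key : ∀ ε : ℝ, 0 < ε → ‖I G‖ₑ ≤ A * hnorm s G + (A + B) * ENNReal.ofReal ε := by
    intro ε hε
    obtain ⟨ψ, hψ⟩ := exists_schwartz_hnorm_sub_le hG hGs hε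
    have hd : MemLp (G - ⇑ψ) 2 volume := MemLp.l2_sub_schwartz hG ψ
    have e2 : hnorm s ψ ≤ hnorm s G + ENNReal.ofReal ε := by
      have h3 : (⇑ψ : E → ℂ) = G + (-1 : ℂ) • (G - ⇑ψ) := by
        rw [neg_one_smul]; abel
      rw [h3]
      refine (hnorm_add_le s hG (hd.const_smul _)).trans ?_
      rw [hnorm_const_smul s hd, enorm_neg, enorm_one, one_mul]
      gcongr
    have e3 : eLpNorm (G - ⇑ψ) 2 volume ≤ ENNReal.ofReal ε := by
      rw [← hnorm_zero hd]
      exact (hnorm_mono hs _).trans hψ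
    rw [hadd ψ]
    calc _ ≤ A * hnorm s ψ + B * eLpNorm (G - ⇑ψ) 2 volume :=
          (enorm_add_le _ _).trans (add_le_add (hI ψ) (hIB ψ))
      _ ≤ A * (hnorm s G + ENNReal.ofReal ε) + B * ENNReal.ofReal ε := by gcongr
      _ = _ := by ring
  have hABtop : A + B ≠ ⊤ := ENNReal.add_ne_top.2 ⟨hA, hB⟩
  refine ENNReal.le_of_forall_pos_le_add fun ε hε _ => ?_
  have hB1 : 0 < (A + B).toReal + 1 := by positivity
  refine (key (ε / ((A + B).toReal + 1)) (by positivity)).trans (add_le_add le_rfl ?_)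
  rw [← ENNReal.ofReal_toReal hABtop, ← ENNReal.ofReal_mul ENNReal.toReal_nonneg,
    ← ENNReal.ofReal_coe_nnreal]
  refine ENNReal.ofReal_le_ofReal ?_
  rw [ENNReal.toReal_ofReal ENNReal.toReal_nonneg, mul_div_assoc', div_le_iff₀ hB1]
  nlinarith [ENNReal.toReal_nonneg (a := A + B), ε.coe_nonneg]

end Density

/-- The Cauchy-Schwarz inequality with a weight. -/
lemma lintegral_mul_sq_le {α : Type*} [MeasurableSpace α] {μ : Measure α} {W F G : α → ℝ≥0∞}
    (hW : Measurable W) (hF : Measurable F) (hG : Measurable G) :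
    (∫⁻ x, W x * (F x * G x) ∂μ) ^ 2 ≤ (∫⁻ x, W x * F x ^ 2 ∂μ) * ∫⁻ x, W x * G x ^ 2 ∂μ := by
  have h := ENNReal.lintegral_mul_le_Lp_mul_Lq (μ.withDensity W) (p := 2) (q := 2)
    (Real.holderConjugate_iff.2 ⟨by norm_num, by norm_num⟩) hF.aemeasurable hG.aemeasurable
  simp only [ENNReal.rpow_two] at h
  rw [lintegral_withDensity_eq_lintegral_mul _ hW (hF.mul hG),
    lintegral_withDensity_eq_lintegral_mul _ hW (hF.pow_const 2),
    lintegral_withDensity_eq_lintegral_mul _ hW (hG.pow_const 2)] at h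
  simp only [Pi.mul_apply] at h
  refine (pow_le_pow_left' h 2).trans (le_of_eq ?_)
  rw [mul_pow, ← ENNReal.rpow_natCast, ← ENNReal.rpow_natCast, ← ENNReal.rpow_mul,
    ← ENNReal.rpow_mul]
  norm_num

variable {N : ℕ}

/-- The data of the Carleman representation of the gain operator. -/
structure IsCollAmp (β k : ℝ) (Φ : Vel N → ℝ) (b : ℝ → ℝ) (Θ : VelPair N → ℂ) (c₀ : Vel N → ℂ)
    (c : ℝ) : Prop where
  smooth : ContDiff ℝ ∞ Θ
  compact : HasCompactSupport Θ
  cutOff : CutOff c₀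
  pos : 0 < c
  neg : ∀ z ∈ tsupport Θ, ∀ w, logRatio (fstP N) (sndP N) w z ≤ -c
  eq : ∀ x p, x ≠ 0 → Θ (mkP x (carlY β x p)) * c₀ x =
    ((k * kernelXY β Φ b x (carlY β x p) * carlJac β x (carlY β x p) *
      Real.exp (Real.pi * ‖carlY β x p‖ ^ 2) : ℝ) : ℂ)

/-- The weighted collision kernel in the variables `(x, y)`. -/
noncomputable def collWeight (β k : ℝ) (Φ : Vel N → ℝ) (b : ℝ → ℝ) (η : ℝ) (w : Vel N)
    (z : Vel N × Vel N) : ℝ :=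
  k * kernelXY β Φ b z.1 z.2 *
    Real.exp (η * (logBracket (w + z.1) - logBracket (w + z.2) - 2 * logBracket w))

lemma measurable_collWeight (β k : ℝ) {Φ : Vel N → ℝ} (hΦ : Continuous Φ) {b : ℝ → ℝ}
    (hb : Continuous b) (η : ℝ) : Measurable fun q : Vel N × (Vel N × Vel N) =>
      collWeight β k Φ b η q.1 q.2 := by
  have h1 : Continuous (logBracket : Vel N → ℝ) := contDiff_logBracket.continuous
  have h2 := hΦ.measurable
  have h3 := hb.measurable
  have h4 := h1.measurable
  unfold collWeight kernelXY
  fun_prop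

variable {β k : ℝ} {Φ : Vel N → ℝ} {b : ℝ → ℝ} {Θ : VelPair N → ℂ} {c₀ : Vel N → ℂ} {c : ℝ}

/-- Identifies collision kernel, Jacobian and weight ratio with the smooth amplitude times the
Gaussian of the model pairing; the factors `exp(±π|y|²)` cancel. -/
lemma IsCollAmp.density_mul (H : IsCollAmp β k Φ b Θ c₀ c) (η : ℝ) (w : Vel N)
    {z : Vel N × Vel N} (hz : z.1 ≠ 0) :
    (carlDensity β z : ℂ) * (collWeight β k Φ b η w (carlPair β z) : ℂ) =
      weightAmp (fstP N) (sndP N) Θ η w (mkP z.1 (carlY β z.1 z.2)) *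
        (c₀ z.1 * gaussW β z.1 z.2) := by
  have h1 := H.eq z.1 z.2 hz
  have e1 : logRatio (fstP N) (sndP N) w (mkP z.1 (carlY β z.1 z.2)) =
    logBracket (w + z.1) - logBracket (w + carlY β z.1 z.2) - 2 * logBracket w := rfl
  unfold weightAmp
  rw [e1, Complex.real_smul, mul_assoc, ← mul_assoc (Θ _), h1, ← exp_mul_dirGauss β hz]
  unfold collWeight carlDensity carlPair
  have e2 : Real.exp (Real.pi * ‖carlY β z.1 z.2‖ ^ 2) *
      Real.exp (-Real.pi * ‖carlY β z.1 z.2‖ ^ 2) = 1 := by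
    rw [← Real.exp_add]; simp
  simp only [← Complex.ofReal_mul]
  congr 1
  linear_combination -(k * kernelXY β Φ b z.1 (carlY β z.1 z.2) *
    carlJac β z.1 (carlY β z.1 z.2) * dirGauss z.1 z.2 *
    Real.exp (η * (logBracket (w + z.1) - logBracket (w + carlY β z.1 z.2) -
      2 * logBracket w))) * e2

lemma IsCollAmp.exists_bound (H : IsCollAmp β k Φ b Θ c₀ c) : ∃ M : ℝ≥0, ∀ η, 0 ≤ η →
    ∀ w z, ‖weightAmp (fstP N) (sndP N) Θ η w z‖ₑ ≤ M := by
  obtain ⟨M, hM⟩ := H.compact.exists_bound_of_continuous H.smooth.continuous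
  have hM0 : 0 ≤ M := (norm_nonneg _).trans (hM 0)
  refine ⟨M.toNNReal, fun η hη w z => ?_⟩
  rw [← ofReal_norm]
  refine ENNReal.ofReal_le_ofReal ?_
  unfold weightAmp
  by_cases hz : z ∈ tsupport Θ
  · rw [norm_smul, Real.norm_of_nonneg (Real.exp_pos _).le]
    refine (mul_le_of_le_one_left (norm_nonneg _) (Real.exp_le_one_iff.2 ?_)).trans (hM z)
    nlinarith [H.neg z hz w, H.pos]
  · rw [image_eq_zero_of_notMem_tsupport hz, smul_zero, norm_zero]; exact hM0

/-- Schur-type bounds: under the weighted collision kernel both `v = w + x` and `'v_* = w + y` have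
bounded density, uniformly in `w` and `η` because the weight exponent is negative. -/
lemma IsCollAmp.exists_lintegral_le (H : IsCollAmp β k Φ b Θ c₀ c) (hN : 2 ≤ N) (hβ : 1 ≤ β)
    (hΦ : Continuous Φ) (hb : Continuous b) : ∃ C : ℝ≥0, ∀ η, 0 ≤ η → ∀ w,
      ∀ F : Vel N → ℝ≥0∞, Measurable F →
      (∫⁻ q, ‖collWeight β k Φ b η w (collPair β q)‖ₑ * F (w + (collPair β q).1) ∂(collMeasure N) ≤
        C * ∫⁻ x, F x) ∧
      (∫⁻ q, ‖collWeight β k Φ b η w (collPair β q)‖ₑ * F (w + (collPair β q).2) ∂(collMeasure N) ≤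
        C * ∫⁻ x, F x) := by
  have hβ0 : 0 < β := by linarith
  have hκ : 0 < kap β := by unfold kap; have := inv_le_one_of_one_le₀ hβ; linarith
  obtain ⟨M, hM⟩ := H.exists_bound
  obtain ⟨M₀, hM₀0, hM₀⟩ := H.cutOff.exists_bound
  obtain ⟨C, hC⟩ := lintegral_gauss_carlY_le hN H.cutOff hκ
  refine ⟨M * (M₀.toNNReal + C), fun η hη w F hF => ?_⟩
  have hred : ∀ G : Vel N × Vel N → ℝ≥0∞, Measurable G →
      ∫⁻ q, ‖collWeight β k Φ b η w (collPair β q)‖ₑ * G (collPair β q) ∂(collMeasure N) ≤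
        M * ∫⁻ z : Vel N × Vel N, ‖c₀ z.1‖ₑ * ENNReal.ofReal (gaussW β z.1 z.2) *
          G (carlPair β z) ∂(volume.prod volume) := by
    intro G hG
    have hWm : Measurable fun z => collWeight β k Φ b η w z :=
      (measurable_collWeight β k hΦ hb η).comp (f := fun z => (w, z)) (by fun_prop)
    rw [lintegral_collPair hN hβ0 (H := fun z => ‖collWeight β k Φ b η w z‖ₑ * G z)
      (hWm.enorm.mul hG), ← lintegral_const_mul' _ _ ENNReal.coe_ne_top]
    refine lintegral_mono_ae ?_
    filter_upwards [ae_fst_ne_zero hN] with z hz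
    have h1 := congrArg (‖·‖ₑ) (H.density_mul η w hz)
    simp only [enorm_mul] at h1
    have e1 : ‖(carlDensity β z : ℂ)‖ₑ = ENNReal.ofReal (carlDensity β z) := by
      rw [← ofReal_norm, Complex.norm_real, Real.norm_of_nonneg (carlDensity_nonneg hβ0 z)]
    have e2 : ‖(collWeight β k Φ b η w (carlPair β z) : ℂ)‖ₑ =
        ‖collWeight β k Φ b η w (carlPair β z)‖ₑ := by
      rw [← ofReal_norm, Complex.norm_real, ofReal_norm]
    have e3 : ‖(gaussW β z.1 z.2 : ℂ)‖ₑ = ENNReal.ofReal (gaussW β z.1 z.2) := by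
      rw [← ofReal_norm, Complex.norm_real, Real.norm_of_nonneg (gaussW_pos β _ _).le]
    rw [e1, e2, e3] at h1
    rw [← mul_assoc, h1, mul_assoc]
    exact mul_le_mul' (hM η hη w _) le_rfl
  have htr : ∫⁻ x, F (w + x) = ∫⁻ x, F x := lintegral_add_left_eq_self F w
  have hFw : Measurable fun x => F (w + x) := hF.comp (measurable_const_add w)
  have hM₀' : ∀ x, ‖c₀ x‖ₑ ≤ M₀.toNNReal := fun x => by
    rw [← ofReal_norm]; exact ENNReal.ofReal_le_ofReal (hM₀ x)
  constructor
  · refine (hred (fun z => F (w + z.1)) (hFw.comp measurable_fst)).trans ?_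
    refine (mul_le_mul' le_rfl (lintegral_gauss_fst_le hM₀' β hFw)).trans ?_
    rw [htr, ← mul_assoc]
    refine mul_le_mul' ?_ le_rfl
    push_cast
    gcongr
    exact le_self_add
  · refine (hred (fun z => F (w + z.2)) (hFw.comp measurable_snd)).trans ?_
    refine (mul_le_mul' le_rfl (hC _ hFw)).trans ?_
    rw [htr, ← mul_assoc]
    refine mul_le_mul' ?_ le_rfl
    push_cast
    gcongr
    exact le_add_self

/-- The integrand of the pairing of the gain operator with `φ`, for a given velocity `w`. -/
noncomputable def pairIntegrand (β k : ℝ) (Φ : Vel N → ℝ) (b : ℝ → ℝ) (η : ℝ) (w : Vel N)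
    (G φ : Vel N → ℂ) (z : Vel N × Vel N) : ℂ :=
  (collWeight β k Φ b η w z : ℂ) * (G (w + z.2) * φ (w + z.1))

lemma measurable_pairIntegrand (hΦ : Continuous Φ) (hb : Continuous b) (η : ℝ)
    {G φ : Vel N → ℂ} (hG : Measurable G) (hφ : Measurable φ) :
    Measurable fun q : Vel N × (Vel N × Vel N) => pairIntegrand β k Φ b η q.1 G φ q.2 := by
  have h1 := measurable_collWeight β k hΦ hb η
  unfold pairIntegrand
  fun_prop

/-- Cauchy–Schwarz for the two Schur-type bounds. This estimate without smoothing supplies absolute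
convergence and the continuity needed for density arguments. -/
lemma IsCollAmp.exists_lintegral_pair_le (H : IsCollAmp β k Φ b Θ c₀ c) (hN : 2 ≤ N) (hβ : 1 ≤ β)
    (hΦ : Continuous Φ) (hb : Continuous b) : ∃ C : ℝ≥0, ∀ η, 0 ≤ η → ∀ w,
      ∀ G φ : Vel N → ℂ, Measurable G → Measurable φ →
      ∫⁻ q, ‖pairIntegrand β k Φ b η w G φ (collPair β q)‖ₑ ∂(collMeasure N) ≤
        C * eLpNorm G 2 volume * eLpNorm φ 2 volume := by
  obtain ⟨C, hC⟩ := H.exists_lintegral_le hN hβ hΦ hb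
  refine ⟨C, fun η hη w G φ hG hφ => ?_⟩
  have hW : Measurable fun q => ‖collWeight β k Φ b η w (collPair (N := N) β q)‖ₑ :=
    ((measurable_collWeight β k hΦ hb η).comp (f := fun q => (w, collPair (N := N) β q))
      (measurable_const.prodMk (measurable_collPair β))).enorm
  have hT := measurable_collPair (N := N) β
  have h1 := lintegral_mul_sq_le (μ := collMeasure N) hW
    (F := fun q => ‖G (w + (collPair β q).2)‖ₑ) (G := fun q => ‖φ (w + (collPair β q).1)‖ₑ)
    (hG.comp (measurable_const.add (measurable_snd.comp hT))).enorm
    (hφ.comp (measurable_const.add (measurable_fst.comp hT))).enorm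
  have h2 := (hC η hη w (fun x => ‖G x‖ₑ ^ 2) (by fun_prop)).2
  have h3 := (hC η hη w (fun x => ‖φ x‖ₑ ^ 2) (by fun_prop)).1
  rw [← eLpNorm_two_sq] at h2 h3
  refine (ENNReal.pow_le_pow_left_iff (n := 2) (by norm_num)).1 ?_
  have e : ∀ q, ‖pairIntegrand β k Φ b η w G φ (collPair β q)‖ₑ =
      ‖collWeight β k Φ b η w (collPair β q)‖ₑ *
        (‖G (w + (collPair β q).2)‖ₑ * ‖φ (w + (collPair β q).1)‖ₑ) := fun q => by
    unfold pairIntegrand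
    rw [enorm_mul, enorm_mul, ← ofReal_norm (Complex.ofReal _), Complex.norm_real, ofReal_norm]
  simp only [e]
  refine h1.trans ((mul_le_mul' h2 h3).trans (le_of_eq ?_))
  ring

lemma IsCollAmp.integrable_pair (H : IsCollAmp β k Φ b Θ c₀ c) (hN : 2 ≤ N) (hβ : 1 ≤ β)
    (hΦ : Continuous Φ) (hb : Continuous b) {η : ℝ} (hη : 0 ≤ η) (w : Vel N)
    {G φ : Vel N → ℂ} (hG : Measurable G) (hφ : Measurable φ) (hG2 : eLpNorm G 2 volume < ⊤)
    (hφ2 : eLpNorm φ 2 volume < ⊤) :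
    Integrable (fun q => pairIntegrand β k Φ b η w G φ (collPair β q)) (collMeasure N) := by
  obtain ⟨C, hC⟩ := H.exists_lintegral_pair_le hN hβ hΦ hb
  refine ⟨((measurable_pairIntegrand hΦ hb η hG hφ).comp (f := fun q => (w, collPair (N := N) β q))
      (measurable_const.prodMk (measurable_collPair β))).aestronglyMeasurable, ?_⟩
  exact (hC η hη w G φ hG hφ).trans_lt (by finiteness)

/-- In Carleman coordinates the pairing is that of `enorm_integral_amp_translate_le` with amplitude
`weightAmp`, whose Fourier transform decays with the factor `(1+η)^{-J}`. -/
lemma IsCollAmp.exists_enorm_integral_schwartz_le (H : IsCollAmp β k Φ b Θ c₀ c) (hN : 2 ≤ N)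
    (hβ : 1 ≤ β) (hΦ : Continuous Φ) (hb : Continuous b) {s : ℝ} (hs : 0 ≤ s) (J : ℕ) :
    ∃ C : ℝ≥0, ∀ η, 0 ≤ η → ∀ w, ∀ G φ : 𝓢(Vel N, ℂ),
      ‖∫ q, pairIntegrand β k Φ b η w G φ (collPair β q) ∂(collMeasure N)‖ₑ ≤
        C * ENNReal.ofReal ((1 + η) ^ J)⁻¹ * hnorm s G * dualNorm (s + ((N : ℝ) - 1) / 2) φ := by
  have hβ0 : 0 < β := by linarith
  have hκ : 0 < kap β := by unfold kap; have := inv_le_one_of_one_le₀ hβ; linarith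
  obtain ⟨m, C, hC⟩ := enorm_integral_amp_translate_le hN hκ H.cutOff hs
  obtain ⟨D, hD0, hD⟩ := exists_norm_fourier_weightAmp_le (fstP N) (sndP N) H.smooth H.compact
    H.pos H.neg J m
  refine ⟨C * D.toNNReal, fun η hη w G φ => ?_⟩
  have h1 := hC (weightAmp (fstP N) (sndP N) Θ η w) (contDiff_weightAmp _ _ H.smooth η w)
    (H.compact.of_isClosed_subset (isClosed_tsupport _) (tsupport_weightAmp_subset _ _ _ _ _))
    (D * ((1 + η) ^ J)⁻¹) (by positivity) (hD η hη w) G φ w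
  have hm : Measurable fun z => pairIntegrand β k Φ b η w G φ z :=
    (measurable_pairIntegrand hΦ hb η G.continuous.measurable φ.continuous.measurable).comp
      (f := fun z => (w, z)) (by fun_prop)
  rw [integral_collPair hN hβ0 hm]
  have e : ∫ z, (carlDensity β z : ℂ) * pairIntegrand β k Φ b η w G φ (carlPair β z)
      ∂(volume.prod volume) = ∫ z, weightAmp (fstP N) (sndP N) Θ η w (mkP z.1 (carlY β z.1 z.2)) *
        pairKernel β c₀ (fun y => G (w + y)) (fun x => φ (w + x)) z ∂(volume.prod volume) := by
    refine integral_congr_ae ?_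
    filter_upwards [ae_fst_ne_zero hN] with z hz
    unfold pairIntegrand pairKernel
    rw [← mul_assoc, H.density_mul η w hz]
    simp only [carlPair]
    ring
  rw [e]
  refine h1.trans (le_of_eq ?_)
  rw [ENNReal.ofReal_mul hD0, ENNReal.coe_mul,
    show ((D.toNNReal : ℝ≥0) : ℝ≥0∞) = ENNReal.ofReal D from rfl]
  ring

lemma dualNorm_lt_top (r : ℝ) (φ : 𝓢(Vel N, ℂ)) : dualNorm r φ < ⊤ :=
  (rapid_schwartz (𝓕⁻ φ : 𝓢(Vel N, ℂ))).eLpNorm_jb_lt_top (-r / 2)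

end FixedVelocity

/-! ### Extension of the fixed-velocity estimate to `H^s` -/

section Pairing

open scoped SchwartzMap

variable {N : ℕ} {β k : ℝ} {Φ : Vel N → ℝ} {b : ℝ → ℝ} {Θ : VelPair N → ℂ} {c₀ : Vel N → ℂ} {c : ℝ}

/-- The pairing of the gain operator with `φ`, for a given velocity `w`. -/
noncomputable def pairing (β k : ℝ) (Φ : Vel N → ℝ) (b : ℝ → ℝ) (η : ℝ) (w : Vel N)
    (φ G : Vel N → ℂ) : ℂ :=
  ∫ q, pairIntegrand β k Φ b η w G φ (collPair β q) ∂(collMeasure N)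

lemma IsCollAmp.pairing_sub (H : IsCollAmp β k Φ b Θ c₀ c) (hN : 2 ≤ N) (hβ : 1 ≤ β)
    (hΦ : Continuous Φ) (hb : Continuous b) {η : ℝ} (hη : 0 ≤ η) (w : Vel N) {φ G ψ : Vel N → ℂ}
    (hφm : Measurable φ) (hGm : Measurable G) (hψm : Measurable ψ)
    (hφ : MemLp φ 2 volume) (hG : MemLp G 2 volume) (hψ : MemLp ψ 2 volume) :
    pairing β k Φ b η w φ G = pairing β k Φ b η w φ ψ + pairing β k Φ b η w φ (G - ψ) := by
  unfold pairing
  rw [← integral_add (H.integrable_pair hN hβ hΦ hb hη w hψm hφm hψ.2 hφ.2)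
    (H.integrable_pair hN hβ hΦ hb hη w (hGm.sub hψm) hφm (MeasureTheory.MemLp.sub hG hψ).2 hφ.2)]
  refine integral_congr_ae (Filter.Eventually.of_forall fun q => ?_)
  simp only [pairIntegrand, Pi.sub_apply]
  ring

theorem IsCollAmp.exists_enorm_pairing_le (H : IsCollAmp β k Φ b Θ c₀ c) (hN : 2 ≤ N)
    (hβ : 1 ≤ β) (hΦ : Continuous Φ) (hb : Continuous b) {s : ℝ} (hs : 0 ≤ s) (J : ℕ) :
    ∃ C : ℝ≥0, ∀ η, 0 ≤ η → ∀ w, ∀ (G : Vel N → ℂ) (φ : 𝓢(Vel N, ℂ)), Measurable G →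
      MemLp G 2 volume → hnorm s G < ⊤ →
      ‖pairing β k Φ b η w φ G‖ₑ ≤
        C * ENNReal.ofReal ((1 + η) ^ J)⁻¹ * hnorm s G * dualNorm (s + ((N : ℝ) - 1) / 2) φ := by
  obtain ⟨C, hC⟩ := H.exists_enorm_integral_schwartz_le hN hβ hΦ hb hs J
  obtain ⟨D, hD⟩ := H.exists_lintegral_pair_le hN hβ hΦ hb
  refine ⟨C, fun η hη w G φ hGm hG hGs => ?_⟩
  have hPtop : dualNorm (s + ((N : ℝ) - 1) / 2) φ ≠ ⊤ := (dualNorm_lt_top _ φ).ne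
  have hφ : MemLp (⇑φ) 2 (volume : Measure (Vel N)) := φ.memLp 2
  have hφm : Measurable φ := φ.continuous.measurable
  have hA : (C : ℝ≥0∞) * ENNReal.ofReal ((1 + η) ^ J)⁻¹ *
      dualNorm (s + ((N : ℝ) - 1) / 2) φ ≠ ⊤ :=
    ENNReal.mul_ne_top (ENNReal.mul_ne_top ENNReal.coe_ne_top ENNReal.ofReal_ne_top) hPtop
  have hB : (D : ℝ≥0∞) * eLpNorm (⇑φ) 2 volume ≠ ⊤ :=
    ENNReal.mul_ne_top ENNReal.coe_ne_top hφ.2.ne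
  have h1 : ∀ ψ : 𝓢(Vel N, ℂ), ‖pairing β k Φ b η w φ ψ‖ₑ ≤ (C : ℝ≥0∞) *
      ENNReal.ofReal ((1 + η) ^ J)⁻¹ * dualNorm (s + ((N : ℝ) - 1) / 2) φ * hnorm s ψ := fun ψ => by
    rw [mul_right_comm]
    exact hC η hη w ψ φ
  have h2 : ∀ ψ : 𝓢(Vel N, ℂ), pairing β k Φ b η w φ G =
      pairing β k Φ b η w φ ψ + pairing β k Φ b η w φ (G - ⇑ψ) := fun ψ =>
    H.pairing_sub hN hβ hΦ hb hη w hφm hGm ψ.continuous.measurable hφ hG (ψ.memLp 2)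
  have h3 : ∀ ψ : 𝓢(Vel N, ℂ), ‖pairing β k Φ b η w φ (G - ⇑ψ)‖ₑ ≤
      D * eLpNorm (⇑φ) 2 volume * eLpNorm (G - ⇑ψ) 2 volume := fun ψ => by
    rw [mul_right_comm]
    exact (enorm_integral_le_lintegral_enorm _).trans
      (hD η hη w _ _ (hGm.sub ψ.continuous.measurable) hφm)
  rw [mul_right_comm]
  exact enorm_le_of_schwartz_dense hs hA hB h1 hG hGs h2 h3

end Pairing

/-! ### Pre-collisional variables and distribution of the weights -/

section ChangeOfVariables

variable {N : ℕ}

instance sFinite_collMeasure : SFinite (collMeasure N) := by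
  have : IsFiniteMeasure ((volume : Measure (Vel N)).toSphere) := inferInstance
  exact Measure.prod.instSFinite

lemma measurePreserving_shear {α : Type*} [MeasurableSpace α] (μ : Measure α) [SFinite μ]
    {X : α → Vel N} (hX : Measurable X) :
    MeasurePreserving (fun p : Vel N × α => (p.1 + X p.2, p.2))
      ((volume : Measure (Vel N)).prod μ) ((volume : Measure (Vel N)).prod μ) := by
  have h : MeasurePreserving (fun p : α × Vel N => (p.1, p.2 + X p.1))
      (μ.prod (volume : Measure (Vel N))) (μ.prod (volume : Measure (Vel N))) :=
    (MeasurePreserving.id μ).skew_product (g := fun a x => x + X a)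
      (measurable_snd.add (hX.comp measurable_fst))
      (Filter.Eventually.of_forall fun a => (measurePreserving_add_right volume (X a)).map_eq)
  exact (Measure.measurePreserving_swap.comp h).comp Measure.measurePreserving_swap

/-- The change of variables `(v, (v_*, σ)) ↦ ('v, (v - v_*, σ))`. -/
noncomputable def preCollision (β : ℝ) (p : Vel N × (Vel N × Sph N)) : Vel N × (Vel N × Sph N) :=
  (p.1 - collX β (p.1 - p.2.1) p.2.2, (p.1 - p.2.1, p.2.2))

/-- A composition of `v_* ↦ v - v_*` at fixed `v` with the shear `v ↦ v - x(u, σ)` at fixed `(u,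
σ)`. -/
lemma measurePreserving_preCollision (β : ℝ) : MeasurePreserving (preCollision (N := N) β)
    ((volume : Measure (Vel N)).prod (collMeasure N))
    ((volume : Measure (Vel N)).prod (collMeasure N)) := by
  have hX : Measurable fun q : Vel N × Sph N => -collX β q.1 q.2 :=
    (continuous_collX β).measurable.neg
  have h1 := measurePreserving_shear (collMeasure N) hX
  have h2 : MeasurePreserving (fun p : Vel N × (Vel N × Sph N) => (p.1, (p.1 - p.2.1, p.2.2)))
      ((volume : Measure (Vel N)).prod (collMeasure N))
      ((volume : Measure (Vel N)).prod (collMeasure N)) := by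
    refine (MeasurePreserving.id volume).skew_product
      (g := fun v (q : Vel N × Sph N) => (v - q.1, q.2)) ?_
      (Filter.Eventually.of_forall fun v => ?_)
    · unfold Function.uncurry
      fun_prop
    · exact ((Measure.measurePreserving_sub_left volume v).prod (MeasurePreserving.id _)).map_eq
  have e : preCollision (N := N) β = (fun p : Vel N × (Vel N × Sph N) =>
      (p.1 + -collX β p.2.1 p.2.2, p.2)) ∘ fun p => (p.1, (p.1 - p.2.1, p.2.2)) := by
    funext p
    simp [preCollision, sub_eq_add_neg]
  rw [e]
  exact h1.comp h2

lemma preVel_eq (e : ℝ) (v vs : Vel N) (σ : Sph N) :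
    preVel e v vs σ = (preCollision (betaCoeff e) (v, (vs, σ))).1 := by
  unfold preVel preRel preCollision collX
  module

lemma preVelStar_eq (e : ℝ) (v vs : Vel N) (σ : Sph N) :
    preVelStar e v vs σ = (preCollision (betaCoeff e) (v, (vs, σ))).1 +
      (collPair (betaCoeff e) (preCollision (betaCoeff e) (v, (vs, σ))).2).2 := by
  unfold preVelStar preRel preCollision collPair collX
  module

lemma quasiMeasurePreserving_preVel (e : ℝ) : Measure.QuasiMeasurePreserving
    (fun p : Vel N × (Vel N × Sph N) => preVel e p.1 p.2.1 p.2.2)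
    ((volume : Measure (Vel N)).prod (collMeasure N)) volume := by
  have h := Measure.quasiMeasurePreserving_fst.comp
    (measurePreserving_preCollision (N := N) (betaCoeff e)).quasiMeasurePreserving
  simp only [preVel_eq]
  exact h

lemma quasiMeasurePreserving_preVelStar (e : ℝ) : Measure.QuasiMeasurePreserving
    (fun p : Vel N × (Vel N × Sph N) => preVelStar e p.1 p.2.1 p.2.2)
    ((volume : Measure (Vel N)).prod (collMeasure N)) volume := by
  have h := Measure.quasiMeasurePreserving_fst.comp
    ((measurePreserving_shear (collMeasure N)
      (measurable_snd.comp (measurable_collPair (N := N) (betaCoeff e)))).comp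
      (measurePreserving_preCollision (N := N) (betaCoeff e))).quasiMeasurePreserving
  simp only [preVelStar_eq]
  exact h

/-- Modifying `f` or `g` on a null set is harmless because `'v` and `'v_*` pull null sets back to
null sets: each is a projection after measure-preserving shears. Measurable representatives may
therefore be used. -/
lemma gainIntegrand_congr_ae {f f' g g' : Vel N → ℝ} (hf : f =ᵐ[volume] f') (hg : g =ᵐ[volume] g')
    (e : ℝ) (Φ : Vel N → ℝ) (b : ℝ → ℝ) : ∀ᵐ v : Vel N,
      gainIntegrand e Φ b g f v =ᵐ[collMeasure N] gainIntegrand e Φ b g' f' v := by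
  refine Measure.ae_ae_of_ae_prod (μ := (volume : Measure (Vel N))) (ν := collMeasure N)
    (p := fun p => gainIntegrand e Φ b g f p.1 p.2 = gainIntegrand e Φ b g' f' p.1 p.2) ?_
  filter_upwards [(quasiMeasurePreserving_preVel e).ae hf,
    (quasiMeasurePreserving_preVelStar e).ae hg] with p h1 h2
  simp only [gainIntegrand, h1, h2]

lemma gain_congr_ae {f f' g g' : Vel N → ℝ} (hf : f =ᵐ[volume] f') (hg : g =ᵐ[volume] g')
    (e : ℝ) (Φ : Vel N → ℝ) (b : ℝ → ℝ) : gain e Φ b g f =ᵐ[volume] gain e Φ b g' f' := by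
  filter_upwards [gainIntegrand_congr_ae hf hg e Φ b] with v hv
  exact integral_congr_ae hv

/-- The weight `⟨v⟩^η` is written as `⟨'v⟩^{2η} ⟨'v_*⟩^η exp(η ψ_w)` with `w = 'v`; the first two
factors are given to `f` and `g`. -/
lemma weighted_gainIntegrand {e : ℝ} (he : 0 < e) {Φ : Vel N → ℝ}
    (hΦ0 : (0 : Vel N) ∉ tsupport Φ) (b : ℝ → ℝ) (η : ℝ) (g f : Vel N → ℝ) (φ : Vel N → ℂ)
    (v : Vel N) (p : Vel N × Sph N) :
    ((bracket v ^ η * gainIntegrand e Φ b g f v p : ℝ) : ℂ) * φ v =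
      cweighted (2 * η) f (preCollision (betaCoeff e) (v, p)).1 *
        pairIntegrand (betaCoeff e) (e ^ 2)⁻¹ Φ b η (preCollision (betaCoeff e) (v, p)).1
          (cweighted η g) φ (collPair (betaCoeff e) (preCollision (betaCoeff e) (v, p)).2) := by
  have hβ : 0 < betaCoeff e := by unfold betaCoeff; positivity
  obtain ⟨vs, σ⟩ := p
  unfold gainIntegrand pairIntegrand
  rw [preVel_eq, preVelStar_eq, collisionKernel_eq_kernelXY hβ hΦ0]
  set w := (preCollision (betaCoeff e) (v, (vs, σ))).1 with hw
  have hq : (preCollision (betaCoeff e) (v, (vs, σ))).2 = (v - vs, σ) := rfl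
  rw [hq]
  have hv : w + (collPair (betaCoeff e) (v - vs, σ)).1 = v := by
    rw [hw]; simp [preCollision, collPair]
  have hk : kernelXY (betaCoeff e) Φ b (collX (betaCoeff e) (v - vs) σ)
      ((2 : ℝ) • collX (betaCoeff e) (v - vs) σ - (v - vs)) =
      kernelXY (betaCoeff e) Φ b (collPair (betaCoeff e) (v - vs, σ)).1
        (collPair (betaCoeff e) (v - vs, σ)).2 := rfl
  rw [hk]
  unfold collWeight cweighted weighted
  rw [hv]
  set z := collPair (betaCoeff e) (v - vs, σ)
  simp only [bracket_rpow]
  have hE : Real.exp (2 * η * logBracket w) * Real.exp (η * logBracket (w + z.2)) *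
      Real.exp (η * (logBracket v - logBracket (w + z.2) - 2 * logBracket w)) =
      Real.exp (η * logBracket v) := by
    rw [← Real.exp_add, ← Real.exp_add]; congr 1; ring
  rw [← hE]
  push_cast
  ring

end ChangeOfVariables

/-! ### L² norms of nonnegative functions by duality -/

section L2Duality

/-- Testing with the truncations `φ n` of `A` gives `T² ≤ K² T` for `T = ∫ φ n²`, and `T` is finite
so it can be cancelled. Fatou's lemma removes the truncation; no finiteness of `A` is assumed. -/
lemma lintegral_sq_le_of_dual {α : Type*} [MeasurableSpace α] {μ : Measure α} [SigmaFinite μ]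
    {A : α → ℝ≥0∞} (hA : Measurable A) {K : ℝ≥0∞}
    (h : ∀ φ : α → ℝ≥0∞, Measurable φ → (∀ x, φ x ≠ ⊤) →
      (∫⁻ x, φ x * A x ∂μ) ^ 2 ≤ K ^ 2 * ∫⁻ x, φ x ^ 2 ∂μ) :
    ∫⁻ x, A x ^ 2 ∂μ ≤ K ^ 2 := by
  set φ : ℕ → α → ℝ≥0∞ := fun n => (spanningSets μ n).indicator fun x => min (A x) n with hφ
  have hφm : ∀ n, Measurable (φ n) := fun n =>
    (hA.min measurable_const).indicator (measurableSet_spanningSets μ n)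
  have hφn : ∀ n x, φ n x ≤ n := fun n x => by
    refine Set.indicator_apply_le' (fun _ => min_le_right _ _) fun _ => bot_le
  have hφA : ∀ n x, φ n x ≤ A x := fun n x => by
    refine Set.indicator_apply_le' (fun _ => min_le_left _ _) fun _ => bot_le
  have hle : ∀ n, ∫⁻ x, φ n x ^ 2 ∂μ ≤ K ^ 2 := fun n => by
    set T := ∫⁻ x, φ n x ^ 2 ∂μ with hT
    have hTtop : T ≠ ⊤ := by
      refine ((lintegral_mono (g := (spanningSets μ n).indicator fun _ => (n : ℝ≥0∞) ^ 2)
        fun x => ?_).trans_lt ?_).ne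
      · by_cases hx : x ∈ spanningSets μ n
        · rw [Set.indicator_of_mem hx]
          exact pow_le_pow_left' (hφn n x) 2
        · simp [hφ, hx]
      · rw [lintegral_indicator_const (measurableSet_spanningSets μ n)]
        exact ENNReal.mul_lt_top (by simp) (measure_spanningSets_lt_top μ n)
    have h1 : T ≤ ∫⁻ x, φ n x * A x ∂μ := lintegral_mono fun x => by
      rw [sq]; exact mul_le_mul_right (hφA n x) _
    have h2 := (pow_le_pow_left' h1 2).trans
      (h (φ n) (hφm n) fun x => ((hφn n x).trans_lt (ENNReal.natCast_lt_top n)).ne)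
    rcases eq_or_ne T 0 with h0 | h0
    · rw [h0]; exact bot_le
    · rw [sq] at h2
      exact (ENNReal.mul_le_mul_iff_left h0 hTtop).1 h2
  have hlim : ∀ x, Filter.Tendsto (fun n => φ n x ^ 2) Filter.atTop (nhds (A x ^ 2)) := fun x => by
    refine (ENNReal.continuous_pow 2).continuousAt.tendsto.comp ?_
    have h1 : Filter.Tendsto (fun n : ℕ => min (A x) (n : ℝ≥0∞)) Filter.atTop
        (nhds (min (A x) ⊤)) :=
      tendsto_const_nhds.min ENNReal.tendsto_nat_nhds_top
    rw [min_top_right] at h1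
    refine h1.congr' ?_
    filter_upwards [Filter.eventually_ge_atTop (spanningSetsIndex μ x)] with n hn
    have : x ∈ spanningSets μ n := monotone_spanningSets μ hn (mem_spanningSetsIndex μ x)
    simp only [hφ, Set.indicator_of_mem this]
  calc ∫⁻ x, A x ^ 2 ∂μ = ∫⁻ x, Filter.liminf (fun n => φ n x ^ 2) Filter.atTop ∂μ :=
        lintegral_congr fun x => ((hlim x).liminf_eq).symm
    _ ≤ Filter.liminf (fun n => ∫⁻ x, φ n x ^ 2 ∂μ) Filter.atTop :=
        lintegral_liminf_le fun n => (hφm n).pow_const 2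
    _ ≤ K ^ 2 := Filter.liminf_le_of_frequently_le' (Filter.Frequently.of_forall hle)

end L2Duality

/-! ### Pairing of the gain operator with test functions -/

section GainPairing

open scoped SchwartzMap

variable {N : ℕ} {e : ℝ} {Φ : Vel N → ℝ} {b : ℝ → ℝ} {Θ : VelPair N → ℂ} {c₀ : Vel N → ℂ} {c : ℝ}

lemma measurable_gainIntegrand (hΦ : Continuous Φ) (hb : Continuous b) {g f : Vel N → ℝ}
    (hg : Measurable g) (hf : Measurable f) (e : ℝ) :
    Measurable fun p : Vel N × (Vel N × Sph N) => gainIntegrand e Φ b g f p.1 p.2 := by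
  have h1 := hf.comp (quasiMeasurePreserving_preVel (N := N) e).measurable
  have h2 := hg.comp (quasiMeasurePreserving_preVelStar (N := N) e).measurable
  have h3 := hΦ.measurable
  have h4 := hb.measurable
  have h5 : Measurable fun p : Vel N × (Vel N × Sph N) => (p.2.2 : Vel N) := by fun_prop
  have h6 : Measurable fun p : Vel N × (Vel N × Sph N) => inner ℝ (‖p.1 - p.2.1‖⁻¹ • (p.1 - p.2.1))
      (p.2.2 : Vel N) := Measurable.inner (by fun_prop) h5
  unfold gainIntegrand collisionKernel
  exact ((h1.mul h2).div_const _).mul ((h3.comp (by fun_prop)).mul (h4.comp h6))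

/-- The pairing of the gain operator with `φ`, as an integrand in the variables `(w, (u, σ))`. -/
noncomputable def gainPairIntegrand (e : ℝ) (Φ : Vel N → ℝ) (b : ℝ → ℝ) (η : ℝ)
    (g f : Vel N → ℝ) (φ : Vel N → ℂ) (q : Vel N × (Vel N × Sph N)) : ℂ :=
  cweighted (2 * η) f q.1 * pairIntegrand (betaCoeff e) (e ^ 2)⁻¹ Φ b η q.1 (cweighted η g) φ
    (collPair (betaCoeff e) q.2)

lemma measurable_cweighted (η : ℝ) {g : Vel N → ℝ} (hg : Measurable g) :
    Measurable (cweighted η g) := by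
  have := (continuous_bracket_rpow (N := N) η).measurable
  unfold cweighted weighted
  fun_prop

lemma measurable_gainPairIntegrand (hΦ : Continuous Φ) (hb : Continuous b) {g f : Vel N → ℝ}
    (hg : Measurable g) (hf : Measurable f) {φ : Vel N → ℂ} (hφ : Measurable φ) (e η : ℝ) :
    Measurable (gainPairIntegrand e Φ b η g f φ) := by
  have h1 := (measurable_pairIntegrand (β := betaCoeff e) (k := (e ^ 2)⁻¹) hΦ hb η
    (measurable_cweighted η hg) hφ).comp
    (f := fun q : Vel N × (Vel N × Sph N) => (q.1, collPair (betaCoeff e) q.2))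
    (measurable_fst.prodMk ((measurable_collPair _).comp measurable_snd))
  exact ((measurable_cweighted (2 * η) hf).comp measurable_fst).mul h1

/-- The fixed-velocity bound is uniform in `w`, so integration in `w` only costs the weighted L¹
norm of `f`. -/
lemma IsCollAmp.exists_lintegral_gainPair_le
    (H : IsCollAmp (betaCoeff e) (e ^ 2)⁻¹ Φ b Θ c₀ c) (hN : 2 ≤ N) (hβ : 1 ≤ betaCoeff e)
    (hΦ : Continuous Φ) (hb : Continuous b) : ∃ C : ℝ≥0, ∀ η, 0 ≤ η → ∀ g f : Vel N → ℝ,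
      Measurable g → Measurable f → ∀ φ : Vel N → ℂ, Measurable φ →
      ∫⁻ q, ‖gainPairIntegrand e Φ b η g f φ q‖ₑ
        ∂((volume : Measure (Vel N)).prod (collMeasure N)) ≤
        C * eLpNorm (cweighted η g) 2 volume * eLpNorm φ 2 volume * l1Norm (2 * η) f := by
  obtain ⟨C, hC⟩ := H.exists_lintegral_pair_le hN hβ hΦ hb
  refine ⟨C, fun η hη g f hg hf φ hφ => ?_⟩
  rw [lintegral_prod _ (measurable_gainPairIntegrand hΦ hb hg hf hφ e η).enorm.aemeasurable]
  have hf1 : l1Norm (2 * η) f = ∫⁻ w, ‖cweighted (2 * η) f w‖ₑ := by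
    unfold l1Norm
    rw [eLpNorm_one_eq_lintegral_enorm]
    refine lintegral_congr fun w => ?_
    rw [cweighted, ← ofReal_norm (Complex.ofReal _), Complex.norm_real, ofReal_norm]
  rw [hf1, ← lintegral_const_mul _ (measurable_cweighted (2 * η) hf).enorm]
  refine lintegral_mono fun w => ?_
  simp only [gainPairIntegrand, enorm_mul]
  rw [lintegral_const_mul', mul_comm]
  · exact mul_le_mul_left (hC η hη w _ _ (measurable_cweighted η hg) hφ) _
  · exact enorm_ne_top

/-- `∫ ⟨v⟩^η |e⁻² f('v) g('v_*) B| dσ dv_*`. -/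
noncomputable def absGain (e : ℝ) (Φ : Vel N → ℝ) (b : ℝ → ℝ) (η : ℝ) (g f : Vel N → ℝ)
    (v : Vel N) : ℝ≥0∞ :=
  ∫⁻ p, ‖bracket v ^ η * gainIntegrand e Φ b g f v p‖ₑ ∂(collMeasure N)

lemma measurable_weighted_gainIntegrand (hΦ : Continuous Φ) (hb : Continuous b) {g f : Vel N → ℝ}
    (hg : Measurable g) (hf : Measurable f) (e η : ℝ) :
    Measurable fun p : Vel N × (Vel N × Sph N) =>
      bracket p.1 ^ η * gainIntegrand e Φ b g f p.1 p.2 :=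
  (((continuous_bracket_rpow (N := N) η).measurable).comp measurable_fst).mul
    (measurable_gainIntegrand hΦ hb hg hf e)

lemma measurable_absGain (hΦ : Continuous Φ) (hb : Continuous b) {g f : Vel N → ℝ}
    (hg : Measurable g) (hf : Measurable f) (e η : ℝ) : Measurable (absGain e Φ b η g f) :=
  (measurable_weighted_gainIntegrand hΦ hb hg hf e η).enorm.lintegral_prod_right'

lemma enorm_ofReal' (x : ℝ) : ‖(x : ℂ)‖ₑ = ‖x‖ₑ := by
  rw [← ofReal_norm, Complex.norm_real, ofReal_norm]

lemma lintegral_mul_absGain (he : 0 < e) (hΦ : Continuous Φ) (hΦ0 : (0 : Vel N) ∉ tsupport Φ)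
    (hb : Continuous b) {g f : Vel N → ℝ} (hg : Measurable g) (hf : Measurable f)
    {φ : Vel N → ℂ} (hφ : Measurable φ) (η : ℝ) :
    ∫⁻ v, ‖φ v‖ₑ * absGain e Φ b η g f v =
      ∫⁻ q, ‖gainPairIntegrand e Φ b η g f φ q‖ₑ
        ∂((volume : Measure (Vel N)).prod (collMeasure N)) := by
  have hm := measurable_gainPairIntegrand hΦ hb hg hf hφ e η
  have hP := measurePreserving_preCollision (N := N) (betaCoeff e)
  have h1 : Measurable fun p : Vel N × (Vel N × Sph N) =>
      ‖gainPairIntegrand e Φ b η g f φ (preCollision (betaCoeff e) p)‖ₑ :=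
    (hm.comp hP.measurable).enorm
  rw [← hP.lintegral_comp hm.enorm, lintegral_prod _ h1.aemeasurable]
  refine lintegral_congr fun v => ?_
  unfold absGain
  rw [← lintegral_const_mul' _ _ enorm_ne_top]
  refine lintegral_congr fun p => ?_
  have := weighted_gainIntegrand he hΦ0 b η g f φ v p
  rw [gainPairIntegrand, ← this, mul_comm, ← enorm_ofReal']
  exact (enorm_mul _ _).symm

/-- The bound holds for the integral of absolute values, hence it yields both the absolute
convergence of the gain integral almost everywhere and its membership in weighted L². -/
lemma IsCollAmp.exists_lintegral_absGain_le
    (H : IsCollAmp (betaCoeff e) (e ^ 2)⁻¹ Φ b Θ c₀ c) (hN : 2 ≤ N) (he : 0 < e)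
    (hβ : 1 ≤ betaCoeff e) (hΦ : Continuous Φ) (hΦ0 : (0 : Vel N) ∉ tsupport Φ)
    (hb : Continuous b) : ∃ C : ℝ≥0, ∀ η, 0 ≤ η → ∀ g f : Vel N → ℝ,
      Measurable g → Measurable f → ∫⁻ v, absGain e Φ b η g f v ^ 2 ≤
        (C * eLpNorm (cweighted η g) 2 volume * l1Norm (2 * η) f) ^ 2 := by
  obtain ⟨C, hC⟩ := H.exists_lintegral_gainPair_le hN hβ hΦ hb
  refine ⟨C, fun η hη g f hg hf => ?_⟩
  refine lintegral_sq_le_of_dual (measurable_absGain hΦ hb hg hf e η) fun φ hφ hφt => ?_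
  have hφm : Measurable fun v => (((φ v).toReal : ℝ) : ℂ) :=
    Complex.measurable_ofReal.comp hφ.ennreal_toReal
  have h0 : ∀ v, ‖(((φ v).toReal : ℝ) : ℂ)‖ₑ = φ v := fun v => by
    rw [enorm_ofReal', Real.enorm_of_nonneg ENNReal.toReal_nonneg, ENNReal.ofReal_toReal (hφt v)]
  have h1 := lintegral_mul_absGain he hΦ hΦ0 hb hg hf hφm η
  have h2 := hC η hη g f hg hf _ hφm
  rw [← h1] at h2
  have h3 := eLpNorm_two_sq (μ := volume) fun v => (((φ v).toReal : ℝ) : ℂ)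
  simp only [h0] at h2 h3
  rw [← h3]
  refine (pow_le_pow_left' h2 2).trans (le_of_eq ?_)
  ring

lemma ae_integrable_gainIntegrand (hΦ : Continuous Φ) (hb : Continuous b) {g f : Vel N → ℝ}
    (hg : Measurable g) (hf : Measurable f) (e η : ℝ)
    (h : ∫⁻ v, absGain e Φ b η g f v ^ 2 < ⊤) :
    ∀ᵐ v, Integrable (gainIntegrand e Φ b g f v) (collMeasure N) := by
  have hm := measurable_gainIntegrand hΦ hb hg hf e
  filter_upwards [ae_lt_top ((measurable_absGain hΦ hb hg hf e η).pow_const 2) h.ne] with v hv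
  have h1 : absGain e Φ b η g f v < ⊤ := by
    by_contra h2
    rw [not_lt_top_iff] at h2
    simp [h2] at hv
  have h3 : Integrable (fun p => bracket v ^ η * gainIntegrand e Φ b g f v p) (collMeasure N) :=
    ⟨((hm.comp (f := fun p => (v, p)) (by fun_prop)).const_mul _).aestronglyMeasurable, h1⟩
  refine (h3.const_mul (bracket v ^ η)⁻¹).congr (Filter.Eventually.of_forall fun p => ?_)
  have := (bracket_rpow_pos η v).ne'
  simp only
  field_simp

lemma cweighted_gain_eq (e η : ℝ) (g f : Vel N → ℝ) (v : Vel N) :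
    cweighted η (gain e Φ b g f) v =
      ∫ p, ((bracket v ^ η * gainIntegrand e Φ b g f v p : ℝ) : ℂ) ∂(collMeasure N) := by
  rw [integral_complex_ofReal, integral_const_mul]
  rfl

lemma memLp_cweighted_gain (hΦ : Continuous Φ) (hb : Continuous b) {g f : Vel N → ℝ}
    (hg : Measurable g) (hf : Measurable f) (e η : ℝ)
    (h : ∫⁻ v, absGain e Φ b η g f v ^ 2 < ⊤) :
    MemLp (cweighted η (gain e Φ b g f)) 2 volume := by
  have hm := measurable_weighted_gainIntegrand hΦ hb hg hf e η
  have e1 : cweighted η (gain e Φ b g f) = fun v =>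
      ∫ p, ((bracket v ^ η * gainIntegrand e Φ b g f v p : ℝ) : ℂ) ∂(collMeasure N) :=
    funext fun v => cweighted_gain_eq e η g f v
  refine ⟨?_, ?_⟩
  · rw [e1]
    exact ((Complex.measurable_ofReal.comp hm).stronglyMeasurable.integral_prod_right'
      (ν := collMeasure N)).aestronglyMeasurable
  · have h2 : eLpNorm (cweighted η (gain e Φ b g f)) 2 volume ^ 2 < ⊤ := by
      rw [eLpNorm_two_sq]
      refine (lintegral_mono fun v => ?_).trans_lt h
      rw [cweighted_gain_eq]
      refine pow_le_pow_left' ((enorm_integral_le_lintegral_enorm _).trans (le_of_eq ?_)) 2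
      simp only [enorm_ofReal']
      rfl
    by_contra h3
    rw [not_lt_top_iff] at h3
    simp [h3] at h2

lemma integral_cweighted_gain_mul (he : 0 < e) (hΦ : Continuous Φ)
    (hΦ0 : (0 : Vel N) ∉ tsupport Φ) (hb : Continuous b) {g f : Vel N → ℝ} (hg : Measurable g)
    (hf : Measurable f) {φ : Vel N → ℂ} (hφ : Measurable φ) (η : ℝ)
    (hI : ∫⁻ q, ‖gainPairIntegrand e Φ b η g f φ q‖ₑ
        ∂((volume : Measure (Vel N)).prod (collMeasure N)) < ⊤) :
    ∫ v, cweighted η (gain e Φ b g f) v * φ v =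
      ∫ w, cweighted (2 * η) f w *
        pairing (betaCoeff e) (e ^ 2)⁻¹ Φ b η w φ (cweighted η g) := by
  have hm := measurable_gainPairIntegrand hΦ hb hg hf hφ e η
  have hP := measurePreserving_preCollision (N := N) (betaCoeff e)
  have hint : Integrable (gainPairIntegrand e Φ b η g f φ)
      ((volume : Measure (Vel N)).prod (collMeasure N)) := ⟨hm.aestronglyMeasurable, hI⟩
  have hint2 : Integrable (fun p => gainPairIntegrand e Φ b η g f φ (preCollision (betaCoeff e) p))
      ((volume : Measure (Vel N)).prod (collMeasure N)) := hP.integrable_comp_of_integrable hint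
  have h1 : ∫ q, gainPairIntegrand e Φ b η g f φ q
      ∂((volume : Measure (Vel N)).prod (collMeasure N)) =
      ∫ p, gainPairIntegrand e Φ b η g f φ (preCollision (betaCoeff e) p)
        ∂((volume : Measure (Vel N)).prod (collMeasure N)) := by
    conv_lhs => rw [← hP.map_eq]
    exact integral_map hP.measurable.aemeasurable hm.aestronglyMeasurable
  rw [integral_prod _ hint, integral_prod _ hint2] at h1
  refine Eq.trans (integral_congr_ae (Filter.Eventually.of_forall fun v => ?_))
    (h1.symm.trans (integral_congr_ae (Filter.Eventually.of_forall fun w => ?_)))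
  · simp only
    rw [cweighted_gain_eq, ← integral_mul_const]
    refine integral_congr_ae (Filter.Eventually.of_forall fun p => ?_)
    exact weighted_gainIntegrand he hΦ0 b η g f φ v p
  · simp only [gainPairIntegrand, pairing]
    rw [integral_const_mul]

end GainPairing

/-! ### The gain estimate in Fourier norms -/

section GainEstimate

variable {N : ℕ} {e : ℝ} {Φ : Vel N → ℝ} {b : ℝ → ℝ} {Θ : VelPair N → ℂ} {c₀ : Vel N → ℂ} {c : ℝ}

lemma l1Norm_eq_lintegral (q : ℝ) (f : Vel N → ℝ) : l1Norm q f = ∫⁻ w, ‖cweighted q f w‖ₑ := by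
  unfold l1Norm
  rw [eLpNorm_one_eq_lintegral_enorm]
  exact lintegral_congr fun w => (enorm_ofReal' _).symm

theorem IsCollAmp.exists_gain_bound
    (H : IsCollAmp (betaCoeff e) (e ^ 2)⁻¹ Φ b Θ c₀ c) (hN : 2 ≤ N) (he : 0 < e)
    (hβ : 1 ≤ betaCoeff e) (hΦ : Continuous Φ) (hΦ0 : (0 : Vel N) ∉ tsupport Φ)
    (hb : Continuous b) {s : ℝ} (hs : 0 ≤ s) (J : ℕ) : ∃ C : ℝ≥0, ∀ η, 0 ≤ η →
      ∀ g f : Vel N → ℝ, Measurable g → Measurable f → MemLp (cweighted η g) 2 volume →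
      hnorm s (cweighted η g) < ⊤ → l1Norm (2 * η) f < ⊤ →
      (∀ᵐ v, Integrable (gainIntegrand e Φ b g f v) (collMeasure N)) ∧
      MemLp (cweighted η (gain e Φ b g f)) 2 volume ∧
      hnorm (s + ((N : ℝ) - 1) / 2) (cweighted η (gain e Φ b g f)) ≤
        C * ENNReal.ofReal ((1 + η) ^ J)⁻¹ * hnorm s (cweighted η g) * l1Norm (2 * η) f := by
  obtain ⟨A, hA⟩ := H.exists_lintegral_absGain_le hN he hβ hΦ hΦ0 hb
  obtain ⟨D, hD⟩ := H.exists_lintegral_gainPair_le hN hβ hΦ hb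
  obtain ⟨C, hC⟩ := H.exists_enorm_pairing_le hN hβ hΦ hb hs J
  refine ⟨C, fun η hη g f hg hf hG hGs hf1 => ?_⟩
  have hGm := measurable_cweighted η hg
  have h1 : ∫⁻ v, absGain e Φ b η g f v ^ 2 < ⊤ :=
    (hA η hη g f hg hf).trans_lt (ENNReal.pow_lt_top
      (ENNReal.mul_lt_top (ENNReal.mul_lt_top ENNReal.coe_lt_top hG.2) hf1))
  have hu := memLp_cweighted_gain hΦ hb hg hf e η h1
  refine ⟨ae_integrable_gainIntegrand hΦ hb hg hf e η h1, hu, ?_⟩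
  -- With L² membership known, the smoothing is tested against Schwartz functions, where the pairing
  -- at each `w` satisfies the uniform estimate.
  refine hnorm_le_of_dual hu (ENNReal.mul_ne_top (ENNReal.mul_ne_top (ENNReal.mul_ne_top
    ENNReal.coe_ne_top ENNReal.ofReal_ne_top) hGs.ne) hf1.ne) fun φ => ?_
  have hφm : Measurable φ := φ.continuous.measurable
  have hφ : MemLp (⇑φ) 2 (volume : Measure (Vel N)) := φ.memLp 2
  rw [integral_cweighted_gain_mul he hΦ hΦ0 hb hg hf hφm η ((hD η hη g f hg hf _ hφm).trans_lt
    (ENNReal.mul_lt_top (ENNReal.mul_lt_top (ENNReal.mul_lt_top ENNReal.coe_lt_top hG.2) hφ.2) hf1))]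
  refine (enorm_integral_le_lintegral_enorm _).trans ?_
  calc ∫⁻ w, ‖cweighted (2 * η) f w * pairing (betaCoeff e) (e ^ 2)⁻¹ Φ b η w φ (cweighted η g)‖ₑ
      ≤ ∫⁻ w, ‖cweighted (2 * η) f w‖ₑ * (C * ENNReal.ofReal ((1 + η) ^ J)⁻¹ *
          hnorm s (cweighted η g) * dualNorm (s + ((N : ℝ) - 1) / 2) φ) := by
        refine lintegral_mono fun w => ?_
        rw [enorm_mul]
        exact mul_le_mul_right (hC η hη w _ φ hGm hG hGs) _
    _ = _ := by
        rw [lintegral_mul_const _ (measurable_cweighted (2 * η) hf).enorm, ← l1Norm_eq_lintegral]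
        ring

lemma aemeasurable_of_weighted {q : ℝ} {f : Vel N → ℝ}
    (h : AEStronglyMeasurable (weighted q f) volume) : AEMeasurable f volume := by
  have h1 : f = fun v => bracket v ^ (-q) * weighted q f v := by
    funext v
    rw [weighted, ← mul_assoc, bracket_rpow, bracket_rpow, ← Real.exp_add]
    simp
  rw [h1]
  exact (continuous_bracket_rpow (-q)).measurable.aemeasurable.mul h.aemeasurable

lemma isCollAmp_of_support (hΦ : ContDiff ℝ ∞ Φ) (hΦc : HasCompactSupport Φ)
    (hΦ0 : (0 : Vel N) ∉ tsupport Φ) (hb : ContDiff ℝ ∞ b) (hbs : tsupport b ⊆ Set.Ioo (-1) 1)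
    {β : ℝ} (hβ : 1 ≤ β) (k : ℝ) : ∃ Θ c₀ c, IsCollAmp β k Φ b Θ c₀ c := by
  obtain ⟨Θ, c₀, c, h1, h2, h3, h4, h5, h6⟩ := exists_amplitude hβ hΦ hΦc hΦ0 hb hbs k
  exact ⟨Θ, c₀, c, ⟨h1, h2, h3, h4, h5, h6⟩⟩

lemma one_le_betaCoeff (he0 : 0 < e) (he1 : e ≤ 1) : 1 ≤ betaCoeff e := by
  unfold betaCoeff
  rw [le_div_iff₀ (by linarith)]
  linarith

end GainEstimate

end InelasticBoltzmann

/-! ### The theorem -/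

theorem theorem2p2 (N : ℕ) (hN : 2 ≤ N)
    (Φ : InelasticBoltzmann.Vel N → ℝ) (hΦ : ContDiff ℝ ∞ Φ) (hΦc : HasCompactSupport Φ)
    (hΦ0 : (0 : InelasticBoltzmann.Vel N) ∉ tsupport Φ)
    (b : ℝ → ℝ) (hb : ContDiff ℝ ∞ b) (hbs : tsupport b ⊆ Set.Ioo (-1) 1)
    (e : ℝ) (he0 : 0 < e) (he1 : e ≤ 1) (s : ℝ) (hs : 0 ≤ s) :
    ∃ C : ℝ≥0, 0 < C ∧ ∀ η : ℝ, 0 ≤ η → ∀ g f : InelasticBoltzmann.Vel N → ℝ,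
      InelasticBoltzmann.MemSobolevSpace s η g → InelasticBoltzmann.MemL1 (2 * η) f →
        (∀ᵐ v : InelasticBoltzmann.Vel N,
          Integrable (InelasticBoltzmann.gainIntegrand e Φ b g f v)
            ((volume : Measure (InelasticBoltzmann.Vel N)).prod
              (volume : Measure (InelasticBoltzmann.Vel N)).toSphere)) ∧
        InelasticBoltzmann.MemSobolevSpace (s + ((N : ℝ) - 1) / 2) η
          (InelasticBoltzmann.gain e Φ b g f) ∧
        InelasticBoltzmann.sobolevNorm (s + ((N : ℝ) - 1) / 2) η
            (InelasticBoltzmann.gain e Φ b g f) ≤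
          C * InelasticBoltzmann.sobolevNorm s η g * InelasticBoltzmann.l1Norm (2 * η) f := by
  have he1' := InelasticBoltzmann.one_le_betaCoeff he0 he1
  obtain ⟨Θ, c₀, c, H⟩ := InelasticBoltzmann.isCollAmp_of_support hΦ hΦc hΦ0 hb hbs he1'
    (e ^ 2)⁻¹
  set r : ℝ := s + ((N : ℝ) - 1) / 2 with hr
  have hr0 : 0 ≤ r := by
    have : (2 : ℝ) ≤ N := by exact_mod_cast hN
    rw [hr]; linarith
  -- The exponent `J = ⌊s⌋ + ⌊r⌋` is exactly what the two norm comparisons lose in powers of `1+η`: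
  -- `⌊s⌋` for `g` and `⌊r⌋` for the gain term.
  obtain ⟨C, hC⟩ := H.exists_gain_bound hN he0 he1' hΦ.continuous hΦ0 hb.continuous hs
    (⌊s⌋₊ + ⌊r⌋₊)
  obtain ⟨C₁, hC₁⟩ := InelasticBoltzmann.hnorm_cweighted_le_sobolevNorm (N := N) hs
  obtain ⟨C₂, hC₂⟩ := InelasticBoltzmann.sobolevNorm_le_hnorm_cweighted (N := N) hr0
  -- The added `1` only serves to make the constant positive.
  refine ⟨C₂ * C * C₁ + 1, by positivity, fun η hη g f hg hf => ?_⟩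
  obtain ⟨hG, hGs⟩ := hC₁ η hη g hg
  have hGtop : InelasticBoltzmann.hnorm s (InelasticBoltzmann.cweighted η g) < ⊤ :=
    hGs.trans_lt (ENNReal.mul_lt_top (ENNReal.mul_lt_top ENNReal.coe_lt_top
      (ENNReal.pow_lt_top ENNReal.ofReal_lt_top)) hg)
  have hgm : AEMeasurable g volume :=
    (InelasticBoltzmann.locallyIntegrable_of_cweighted hG).aestronglyMeasurable.aemeasurable
  have hfm : AEMeasurable f volume := InelasticBoltzmann.aemeasurable_of_weighted hf.1
  -- The estimates above are for Borel representatives; the gain operator does not see the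
  -- difference almost everywhere.
  obtain ⟨g', hg'm, hgg'⟩ := hgm
  obtain ⟨f', hf'm, hff'⟩ := hfm
  have hcg := InelasticBoltzmann.cweighted_congr (q := η) hgg'
  have hl : InelasticBoltzmann.l1Norm (2 * η) f' = InelasticBoltzmann.l1Norm (2 * η) f := by
    rw [InelasticBoltzmann.l1Norm_eq_lintegral, InelasticBoltzmann.l1Norm_eq_lintegral]
    refine lintegral_congr_ae ?_
    filter_upwards [InelasticBoltzmann.cweighted_congr (q := 2 * η) hff'] with v hv
    rw [hv]
  have hh := InelasticBoltzmann.hnorm_congr (r := s) hcg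
  obtain ⟨h1, h2, h3⟩ := hC η hη g' f' hg'm hf'm (hG.ae_eq hcg) (hh ▸ hGtop)
    (lt_of_eq_of_lt hl hf.2)
  have hgain := InelasticBoltzmann.gain_congr_ae hff' hgg' e Φ b
  have hcgain := InelasticBoltzmann.cweighted_congr (q := η) hgain
  have hu := h2.ae_eq hcgain.symm
  rw [← InelasticBoltzmann.hnorm_congr (r := r) hcgain, ← hh, hl] at h3
  have hutop := h3.trans_lt (ENNReal.mul_lt_top (ENNReal.mul_lt_top (ENNReal.mul_lt_top
    ENNReal.coe_lt_top ENNReal.ofReal_lt_top) hGtop) hf.2)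
  have key : InelasticBoltzmann.sobolevNorm r η (InelasticBoltzmann.gain e Φ b g f) ≤
      ((C₂ * C * C₁ + 1 : ℝ≥0) : ℝ≥0∞) * InelasticBoltzmann.sobolevNorm s η g *
        InelasticBoltzmann.l1Norm (2 * η) f := by
    -- All powers of `1+η` cancel, so the constant is independent of the weight.
    have hone : ENNReal.ofReal (1 + η) ^ ⌊r⌋₊ * ENNReal.ofReal ((1 + η) ^ (⌊s⌋₊ + ⌊r⌋₊))⁻¹ *
        ENNReal.ofReal (1 + η) ^ ⌊s⌋₊ = 1 := by
      have h0 : (0 : ℝ) < 1 + η := by linarith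
      rw [← ENNReal.ofReal_pow h0.le, ← ENNReal.ofReal_pow h0.le,
        ← ENNReal.ofReal_mul (by positivity), ← ENNReal.ofReal_mul (by positivity),
        ← ENNReal.ofReal_one]
      congr 1
      rw [pow_add]
      field_simp
    calc InelasticBoltzmann.sobolevNorm r η (InelasticBoltzmann.gain e Φ b g f)
        ≤ C₂ * ENNReal.ofReal (1 + η) ^ ⌊r⌋₊ * (C * ENNReal.ofReal ((1 + η) ^ (⌊s⌋₊ + ⌊r⌋₊))⁻¹ *
            (C₁ * ENNReal.ofReal (1 + η) ^ ⌊s⌋₊ * InelasticBoltzmann.sobolevNorm s η g) *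
            InelasticBoltzmann.l1Norm (2 * η) f) := by
          refine (hC₂ η hη _ hu hutop).trans (mul_le_mul_right (h3.trans ?_) _)
          exact mul_le_mul_left (mul_le_mul_right hGs _) _
      _ = (ENNReal.ofReal (1 + η) ^ ⌊r⌋₊ * ENNReal.ofReal ((1 + η) ^ (⌊s⌋₊ + ⌊r⌋₊))⁻¹ *
            ENNReal.ofReal (1 + η) ^ ⌊s⌋₊) * ((C₂ * C * C₁ : ℝ≥0) : ℝ≥0∞) *
            InelasticBoltzmann.sobolevNorm s η g * InelasticBoltzmann.l1Norm (2 * η) f := by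
          push_cast
          ring
      _ ≤ _ := by
          rw [hone, one_mul]
          refine mul_le_mul_left (mul_le_mul_left ?_ _) _
          exact ENNReal.coe_le_coe.2 le_self_add
  refine ⟨?_, key.trans_lt (ENNReal.mul_lt_top (ENNReal.mul_lt_top ENNReal.coe_lt_top hg) hf.2),
    key⟩
  filter_upwards [h1, InelasticBoltzmann.gainIntegrand_congr_ae hff' hgg' e Φ b] with v hv1 hv2
  exact hv1.congr hv2.symm
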